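/- Let $k$ be a commutative ring in which $2$ and $3$ are units. **Conventions.** Operads are symmetric operads in $\mathbb Z$-graded $k$-modules with right actions $\mu\mapsto\mu^\sigma$, $\mu^{\sigma\tau}=(\mu^\sigma)^\tau$ (permutations compose as maps), with $\mu^\sigma\circ_i\nu^\tau=(\mu\circ_{\sigma(i)}\nu)^{\sigma\circ_i\tau}$; differentials have degree $-1$. Cooperads are given by their coaugmentation coideals $C$ with internal differential $d$ and infinitesimal decomposition map $\Delta_{(1)}\colon C\to C\circ_{(1)}C$, whose target is spanned by elements $(\mu\otimes_i\nu)^\sigma$. The cobar construction $\Omega C$ is the free operad on $s^{-1}C$ with the derivation $d$ determined by $$d(s^{-1}x)=-s^{-1}dx-\sum(-1)^{|\mu|}(s^{-1}\mu\circ_i s^{-1}\nu)^\sigma\quad\text{if }\Delta_{(1)}(x)=\sum(\mu\otimes_i\nu)^\sigma ,$$ and an equivariant map $f\colon C\to C'$ induces the operad morphism $\Omega f$, $s^{-1}x\mapsto s^{-1}f(x)$. **The cooperads.** $\mathrm{Lie}^{¡}$ has one basis element $\ell_n$ of degree $n-1$ in each arity $n\ge 2$ (besides the unit), $\ell_n^\sigma=(-1)^{|\sigma|}\ell_n$,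 zero differential, and $$\Delta_{(1)}(\ell_n)=\sum_{i+j=n+1,\ i,j\ge 2}(-1)^{(j-1)(i-1)}\sum_{\sigma\in \mathrm{Sh}^{-1}(i,j-1)}(-1)^{|\sigma|}(\ell_j\otimes_1\ell_i)^\sigma .$$ $\mathrm{Lie}^{¡}_3\subset\mathrm{Lie}^{¡}$ is the subcooperad spanned by $\ell_2,\ell_3,\ell_4$. $\mathcal R$ (the resolution) is the graded $\mathbb S$-module that is free on generators $\ell_2,\ell_{2;1},\ell_{2;1,1},\ell_{2;1,1,1}$ (arity 2, degrees 1, 2, 3, 4), $\ell_3$ (degree 2), $\ell_{3;1},\ell_{3;2}$ (degree 3), $\ell_{3;1,1},\ell_{3;1,2},\ell_{3;2,2}$ (degree 4) in arity 3, $\ell_4$ (degree 3), $\ell_{4;1},\ell_{4;2},\ell_{4;3}$ (degree 4) in arity 4, and $\ell_5$ (arity 5, degree 4). Its differential is $d\ell_n=0$, $d\ell_{n;i}=-\ell_n-\ell_n^{(i\,i+1)}$, $d\ell_{2;1,1}=-\ell_{2;1}+\ell_{2;1}^{(12)}$, $d\ell_{2;1,1,1}=-\ell_{2;1,1}-\ell_{2;1,1}^{(12)}$,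 $d\ell_{3;1,1}=-\ell_{3;1}+\ell_{3;1}^{(12)}$, $d\ell_{3;2,2}=-\ell_{3;2}+\ell_{3;2}^{(23)}$, $d\ell_{3;1,2}=\ell_{3;1}+\ell_{3;1}^{(23)}+\ell_{3;1}^{(132)}-\ell_{3;2}-\ell_{3;2}^{(12)}-\ell_{3;2}^{(123)}$. Its infinitesimal decomposition vanishes in arity $2$ and is otherwise: - $\ell_3\mapsto-\ell_2\otimes_1\ell_2+\ell_2\otimes_2\ell_2-(\ell_2\otimes_2\ell_2)^{(12)}$; - $\ell_{3;1}\mapsto\ell_2\otimes_1\ell_{2;1}$; - $\ell_{3;2}\mapsto-\ell_{2;1}\otimes_1\ell_2-\ell_2\otimes_2\ell_{2;1}-(\ell_{2;1}\otimes_2\ell_2)^{(12)}$; - $\ell_{3;1,1}\mapsto-\ell_2\otimes_1\ell_{2;1,1}$; - $\ell_{3;1,2}\mapsto-\ell_{2;1}\otimes_1\ell_{2;1}-\ell_{2;1}\otimes_2\ell_{2;1}-(\ell_{2;1}\otimes_2\ell_{2;1})^{(12)}+(\ell_{2;1,1}\otimes_2\ell_2)^{(132)}$; - $\ell_{3;2,2}\mapsto-\ell_{2;1,1}\otimes_1\ell_2+\ell_2\otimes_2\ell_{2;1,1}-(\ell_{2;1,1}\otimes_2\ell_2)^{(12)}$;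 - $\ell_4\mapsto\ell_2\otimes_1\ell_3+\sum_{\tau\in\{1,(12),(123)\}}(-1)^{|\tau|}(\ell_2\otimes_2\ell_3)^\tau+\ell_3\otimes_1\ell_2-\sum_{\tau\in\{1,(12)\}}(-1)^{|\tau|}(\ell_3\otimes_2\ell_2)^\tau+\sum_{\tau\in\{1,(23),(132)\}}(-1)^{|\tau|}(\ell_3\otimes_3\ell_2)^\tau$; - $\ell_{4;1}\mapsto-\ell_2\otimes_1\ell_{3;1}-(\ell_2\otimes_2\ell_{3;1})^{(123)}+\ell_3\otimes_1\ell_{2;1}+\ell_{3;1}\otimes_3\ell_2$; - $\ell_{4;2}\mapsto-\ell_2\otimes_1\ell_{3;2}-\ell_2\otimes_2\ell_{3;1}+\ell_{3;1}\otimes_1\ell_2+(\ell_{3;1}\otimes_2\ell_2)^{(12)}-\ell_3\otimes_2\ell_{2;1}+(\ell_{3;1}\otimes_3\ell_2)^{(132)}$; - $\ell_{4;3}\mapsto(\ell_{2;1}\otimes_2\ell_3)^{(123)}-\ell_2\otimes_2\ell_{3;2}+(\ell_2\otimes_2\ell_{3;2})^{(12)}+\ell_{2;1}\otimes_1\ell_3+\ell_{3;2}\otimes_1\ell_2-(\ell_{3;2}\otimes_3\ell_2)^{(23)}+(\ell_{3;2}\otimes_3\ell_2)^{(132)}+\ell_3\otimes_3\ell_{2;1}-\ell_{3;2}\otimes_2\ell_2+(\ell_{3;2}\otimes_2\ell_2)^{(12)}$;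 - $\ell_5\mapsto-\ell_2\otimes_1\ell_4+\sum_{\tau\in\{1,(12),(123),(1234)\}}(-1)^{|\tau|}(\ell_2\otimes_2\ell_4)^\tau+\ell_3\otimes_1\ell_3+\sum_{\tau\in\{1,(12),(123)\}}(-1)^{|\tau|}(\ell_3\otimes_2\ell_3)^\tau+\sum_{\tau\in\{1,(23),(234),(132),(1342),(13)(24)\}}(-1)^{|\tau|}(\ell_3\otimes_3\ell_3)^\tau-\ell_4\otimes_1\ell_2+\sum_{\tau\in\{1,(12)\}}(-1)^{|\tau|}(\ell_4\otimes_2\ell_2)^\tau-\sum_{\tau\in\{1,(23),(132)\}}(-1)^{|\tau|}(\ell_4\otimes_3\ell_2)^\tau+\sum_{\tau\in\{1,(34),(243),(1432)\}}(-1)^{|\tau|}(\ell_4\otimes_4\ell_2)^\tau$. Let $\psi\colon\mathcal R\to\mathrm{Lie}^{¡}$ be the equivariant map with $\ell_n\mapsto\ell_n$ and with all other generators sent to $0$, and let $\psi_3\colon\mathcal R\to\mathrm{Lie}^{¡}_3$ be its composite with the projection that sends $\ell_n$ to $0$ for $n\ge 5$. Let $\iota\colon\mathrm{Lie}^{¡}_3\to\mathrm{Lie}^{¡}$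 be the inclusion. **Theorem.** $\Omega\mathcal R$ and $\Omega\mathrm{Lie}^{¡}_3$ are dg operads and $\Omega\psi\colon\Omega\mathcal R\to\Omega\mathrm{Lie}^{¡}$ commutes with the differentials. There is a morphism of dg operads $\Phi\colon\Omega\mathrm{Lie}^{¡}_3\to\Omega\mathcal R$ with $\Omega\psi_3\circ\Phi=\mathrm{id}$ and $\Omega\psi\circ\Phi=\Omega\iota$, given on generators by $$\Phi(s^{-1}\ell_2)=\tfrac12\sum_{\sigma\in S_2}(-1)^{|\sigma|}(s^{-1}\ell_2)^\sigma,$$ $$\Phi(s^{-1}\ell_3)=\tfrac16\sum_{\sigma\in S_3}(-1)^{|\sigma|}(s^{-1}\ell_3)^\sigma-\tfrac1{24}\sum_{\sigma\in S_3}(-1)^{|\sigma|}\bigl(s^{-1}\ell_{2;1}\circ_1s^{-1}\ell_2+s^{-1}\ell_{2;1}\circ_2s^{-1}\ell_2\bigr)^\sigma,$$ $$\Phi(s^{-1}\ell_4)=\tfrac1{24}\sum_{\sigma\in S_4}(-1)^{|\sigma|}(s^{-1}\ell_4)^\sigma+\tfrac1{48}\sum_{\sigma\in S_4}(-1)^{|\sigma|}\bigl(s^{-1}\ell_{2;1}\circ_1s^{-1}\ell_3-s^{-1}\ell_{3;1}\circ_1s^{-1}\ell_2+s^{-1}\ell_{3;2}\circ_2s^{-1}\ell_2-s^{-1}\ell_{2;1}\circ_2s^{-1}\ell_3-s^{-1}\ell_{3;1}\circ_2s^{-1}\ell_2+s^{-1}\ell_{3;2}\circ_3s^{-1}\ell_2\bigr)^\sigma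 .$$ Moreover, let $L$ be a chain complex of $k$-modules concentrated in degrees $0,1,2$, with endomorphism operad $\mathrm{End}_L$, and let $g\colon\Omega\mathcal R\to\mathrm{End}_L$ be a morphism of dg operads (a weak Lie 3-algebra structure on $L$), with structure maps $\lambda_*=g(s^{-1}\ell_*)$. Then there is exactly one morphism of dg operads $h\colon\Omega\mathrm{Lie}^{¡}\to\mathrm{End}_L$ (a semi-strict Lie 3-algebra structure, that is a 3-term $L_\infty$-algebra structure, on $L$) such that $h\circ\Omega\iota=g\circ\Phi$ and such that the structure maps $l_n=h(s^{-1}\ell_n)$ are $$l_2=\tfrac12\sum_{\sigma\in S_2}(-1)^{|\sigma|}\lambda_2^\sigma,\qquad l_3=\tfrac16\sum_{\sigma\in S_3}(-1)^{|\sigma|}\lambda_3^\sigma-\tfrac1{24}\sum_{\sigma\in S_3}(-1)^{|\sigma|}(\lambda_{2;1}\circ_1\lambda_2+\lambda_{2;1}\circ_2\lambda_2)^\sigma,$$ $$l_4=\tfrac1{24}\sum_{\sigma\in S_4}(-1)^{|\sigma|}\lambda_4^\sigma+\tfrac1{48}\sum_{\sigma\in S_4}(-1)^{|\sigma|}(\lambda_{2;1}\circ_1\lambda_3-\lambda_{3;1}\circ_1\lambda_2+\lambda_{3;2}\circ_2\lambda_2-\lambda_{2;1}\circ_2\lambda_3-\lambda_{3;1}\circ_2\lambda_2+\lambda_{3;2}\circ_3\lambda_2)^\sigma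 .$$ -/

import Mathlib

universe u v w

noncomputable section

namespace WeakLie

open Equiv

/-! ### Signs and partial composition of permutations -/

/-- The sign `(-1)^n` as an element of the ground ring. -/
def ksign (k : Type u) [CommRing k] (n : ℤ) : k := ((n.negOnePow : ℤˣ) : ℤ)

/-- The sign `(-1)^{|σ|}` of a permutation as an element of the ground ring. -/
def psign (k : Type u) [CommRing k] {n : ℕ} (σ : Perm (Fin n)) : k := ((Perm.sign σ : ℤˣ) : ℤ)

/-- When an operation with `n` inputs is grafted at the input `i` of an operation with `m` inputs,
its input `j` becomes the input `i + j` of the composite (inputs are numbered from `0`). -/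
def innerInput {m n r : ℕ} (h : m + n = r + 1) (i : Fin m) (j : Fin n) : Fin r :=
  ⟨i + j, by omega⟩

/-- In the same situation, this is the position in the composite of an input `x ≠ i` of the outer
operation. -/
def outerInput {m n r : ℕ} (h : m + n = r + 1) (i x : Fin m) (hx : x ≠ i) : Fin r :=
  if hlt : x < i then ⟨x, by have := i.2; have : (x : ℕ) < i := hlt; omega⟩
  else ⟨x + n - 1, by
    have h1 : ¬ (x : ℕ) < i := hlt
    have h2 : (x : ℕ) ≠ i := fun e => hx (Fin.ext e)
    have := x.2
    omega⟩

/-- `ρ` is the permutation `σ ∘_i τ`, that is the one for which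
`μ^σ ∘_i ν^τ = (μ ∘_{σ(i)} ν)^ρ`. -/
def IsBlockPerm {m n r : ℕ} (h : m + n = r + 1) (i : Fin m) (σ : Perm (Fin m)) (τ : Perm (Fin n))
    (ρ : Perm (Fin r)) : Prop :=
  (∀ j, ρ (innerInput h i j) = innerInput h (σ i) (τ j)) ∧
  ∀ x (hx : x ≠ i), ρ (outerInput h i x hx) = outerInput h (σ i) (σ x) (σ.injective.ne hx)

/-! ### Differential graded operads -/

/-- A graded collection with an action of the symmetric groups, partial compositions, a unit and an
operator of degree `-1`. The laws are in `IsOperad` and `IsDGOperad`. Arities and degrees of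
composites are given up to a proof of equality, so that no transport is ever needed. -/
structure PreDGOperad (k : Type u) [CommRing k] where
  carrier : ℕ → ℤ → Type v
  [acg : ∀ n p, AddCommGroup (carrier n p)]
  [mod : ∀ n p, Module k (carrier n p)]
  act : ∀ {n : ℕ} {p : ℤ}, Perm (Fin n) → carrier n p →ₗ[k] carrier n p
  one : carrier 1 0
  comp : ∀ {m n r : ℕ} {p q s : ℤ}, m + n = r + 1 → p + q = s → Fin m →
    carrier m p →ₗ[k] carrier n q →ₗ[k] carrier r s
  d : ∀ {n : ℕ} {p q : ℤ}, q + 1 = p → carrier n p →ₗ[k] carrier n q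

attribute [instance] PreDGOperad.acg PreDGOperad.mod

/-- The laws of a symmetric operad in graded modules, in terms of partial compositions and of the
right actions `μ ↦ μ^σ`, with Koszul signs. -/
structure IsOperad {k : Type u} [CommRing k] (P : PreDGOperad.{u, v} k) : Prop where
  act_one : ∀ {n p} (x : P.carrier n p), P.act 1 x = x
  act_mul : ∀ {n p} (σ τ : Perm (Fin n)) (x : P.carrier n p),
    P.act (σ * τ) x = P.act τ (P.act σ x)
  one_comp : ∀ {n : ℕ} {p : ℤ} (h : 1 + n = n + 1) (h' : 0 + p = p) (i : Fin 1)
    (x : P.carrier n p), P.comp h h' i P.one x = x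
  comp_one : ∀ {n : ℕ} {p : ℤ} (h : n + 1 = n + 1) (h' : p + 0 = p) (i : Fin n)
    (x : P.carrier n p), P.comp h h' i x P.one = x
  assoc_seq : ∀ {m n l a b c : ℕ} {p q r s t z : ℤ}
    (h₁ : m + n = a + 1) (h₂ : a + l = c + 1) (h₃ : n + l = b + 1) (h₄ : m + b = c + 1)
    (e₁ : p + q = s) (e₂ : s + r = z) (e₃ : q + r = t) (e₄ : p + t = z)
    (i : Fin m) (j : Fin n) (y : Fin a) (_ : (y : ℕ) = i + j)
    (μ : P.carrier m p) (ν : P.carrier n q) (ξ : P.carrier l r),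
    P.comp h₂ e₂ y (P.comp h₁ e₁ i μ ν) ξ = P.comp h₄ e₄ i μ (P.comp h₃ e₃ j ν ξ)
  assoc_par : ∀ {m n l a b c : ℕ} {p q r s t z : ℤ}
    (h₁ : m + n = a + 1) (h₂ : a + l = c + 1) (h₃ : m + l = b + 1) (h₄ : b + n = c + 1)
    (e₁ : p + q = s) (e₂ : s + r = z) (e₃ : p + r = t) (e₄ : t + q = z)
    (i j : Fin m) (_ : i < j) (y : Fin a) (_ : (y : ℕ) + 1 = j + n) (x : Fin b)
    (_ : (x : ℕ) = i)
    (μ : P.carrier m p) (ν : P.carrier n q) (ξ : P.carrier l r),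
    P.comp h₂ e₂ y (P.comp h₁ e₁ i μ ν) ξ =
      ksign k (q * r) • P.comp h₄ e₄ x (P.comp h₃ e₃ j μ ξ) ν
  equivariant : ∀ {m n r : ℕ} {p q s : ℤ} (h : m + n = r + 1) (e : p + q = s) (i : Fin m)
    (σ : Perm (Fin m)) (τ : Perm (Fin n)) (ρ : Perm (Fin r)) (_ : IsBlockPerm h i σ τ ρ)
    (μ : P.carrier m p) (ν : P.carrier n q),
    P.comp h e i (P.act σ μ) (P.act τ ν) = P.act ρ (P.comp h e (σ i) μ ν)

/-- The laws of a dg operad. -/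
structure IsDGOperad {k : Type u} [CommRing k] (P : PreDGOperad.{u, v} k) : Prop
    extends IsOperad P where
  d_act : ∀ {n : ℕ} {p q : ℤ} (h : q + 1 = p) (σ : Perm (Fin n)) (x : P.carrier n p),
    P.d h (P.act σ x) = P.act σ (P.d h x)
  d_one : ∀ {q : ℤ} (h : q + 1 = 0), P.d h P.one = 0
  d_comp : ∀ {m n r : ℕ} {p q s p' q' s' : ℤ} (h : m + n = r + 1) (e : p + q = s)
    (ep : p' + 1 = p) (eq : q' + 1 = q) (es : s' + 1 = s) (e₁ : p' + q = s') (e₂ : p + q' = s')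
    (i : Fin m) (μ : P.carrier m p) (ν : P.carrier n q),
    P.d es (P.comp h e i μ ν) =
      P.comp h e₁ i (P.d ep μ) ν + ksign k p • P.comp h e₂ i μ (P.d eq ν)
  d_d : ∀ {n : ℕ} {p q r : ℤ} (h : q + 1 = p) (h' : r + 1 = q) (x : P.carrier n p),
    P.d h' (P.d h x) = 0

/-- A morphism of graded operads. -/
structure OperadHom {k : Type u} [CommRing k] (P : PreDGOperad.{u, v} k)
    (Q : PreDGOperad.{u, w} k) where
  toFun : ∀ {n : ℕ} {p : ℤ}, P.carrier n p →ₗ[k] Q.carrier n p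
  map_act : ∀ {n : ℕ} {p : ℤ} (σ : Perm (Fin n)) (x : P.carrier n p),
    toFun (P.act σ x) = Q.act σ (toFun x)
  map_one : toFun P.one = Q.one
  map_comp : ∀ {m n r : ℕ} {p q s : ℤ} (h : m + n = r + 1) (e : p + q = s) (i : Fin m)
    (μ : P.carrier m p) (ν : P.carrier n q),
    toFun (P.comp h e i μ ν) = Q.comp h e i (toFun μ) (toFun ν)

/-- A morphism of operads that commutes with the differentials. -/
def OperadHom.IsDG {k : Type u} [CommRing k] {P : PreDGOperad.{u, v} k}
    {Q : PreDGOperad.{u, w} k} (f : OperadHom P Q) : Prop :=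
  ∀ {n : ℕ} {p q : ℤ} (h : q + 1 = p) (x : P.carrier n p), f.toFun (P.d h x) = Q.d h (f.toFun x)

/-- A morphism of dg operads. -/
structure DGOperadHom {k : Type u} [CommRing k] (P : PreDGOperad.{u, v} k)
    (Q : PreDGOperad.{u, w} k) extends OperadHom P Q where
  isDG : toOperadHom.IsDG

/-- `∑_σ (-1)^{|σ|} x^σ`, the sum over all permutations of the inputs. -/
def PreDGOperad.alt {k : Type u} [CommRing k] (P : PreDGOperad.{u, v} k) {n : ℕ} {p : ℤ}
    (x : P.carrier n p) : P.carrier n p :=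
  ∑ σ : Perm (Fin n), psign k σ • P.act σ x

/-! ### Graded `𝕊`-modules, infinitesimal composites and infinitesimal decompositions -/

/-- A graded `𝕊`-module: right actions of the symmetric groups on graded modules. -/
structure SMod (k : Type u) [CommRing k] where
  carrier : ℕ → ℤ → Type v
  [acg : ∀ n p, AddCommGroup (carrier n p)]
  [mod : ∀ n p, Module k (carrier n p)]
  act : ∀ {n : ℕ} {p : ℤ}, Perm (Fin n) → carrier n p →ₗ[k] carrier n p
  act_one : ∀ {n : ℕ} {p : ℤ} (x : carrier n p), act 1 x = x
  act_mul : ∀ {n : ℕ} {p : ℤ} (σ τ : Perm (Fin n)) (x : carrier n p),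
    act (σ * τ) x = act τ (act σ x)

attribute [instance] SMod.acg SMod.mod

/-- A morphism of graded `𝕊`-modules (of degree `0`). -/
structure SHom {k : Type u} [CommRing k] (M : SMod.{u, v} k) (N : SMod.{u, w} k) where
  toFun : ∀ {n : ℕ} {p : ℤ}, M.carrier n p →ₗ[k] N.carrier n p
  map_act : ∀ {n : ℕ} {p : ℤ} (σ : Perm (Fin n)) (x : M.carrier n p),
    toFun (M.act σ x) = N.act σ (toFun x)

/-- A symbol `(μ ⊗_i ν)^σ`. -/
structure InfSymbol {k : Type u} [CommRing k] (M : SMod.{u, v} k) (r : ℕ) (s : ℤ) where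
  m : ℕ
  n : ℕ
  p : ℤ
  q : ℤ
  hm : m + n = r + 1
  hp : p + q = s
  i : Fin m
  μ : M.carrier m p
  ν : M.carrier n q
  σ : Perm (Fin r)

/-- The relations between the symbols `(μ ⊗_i ν)^σ`: bilinearity and
`(μ^α ⊗_i ν^β)^σ = (μ ⊗_{α(i)} ν)^{(α ∘_i β) σ}`. -/
inductive InfRel {k : Type u} [CommRing k] (M : SMod.{u, v} k) (r : ℕ) (s : ℤ) :
    (InfSymbol M r s →₀ k) → Prop
  | add_left {m n p q} (hm : m + n = r + 1) (hp : p + q = s) (i : Fin m)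
      (μ μ' : M.carrier m p) (ν : M.carrier n q) (σ : Perm (Fin r)) :
      InfRel M r s (Finsupp.single ⟨m, n, p, q, hm, hp, i, μ + μ', ν, σ⟩ 1
        - Finsupp.single ⟨m, n, p, q, hm, hp, i, μ, ν, σ⟩ 1
        - Finsupp.single ⟨m, n, p, q, hm, hp, i, μ', ν, σ⟩ 1)
  | smul_left {m n p q} (hm : m + n = r + 1) (hp : p + q = s) (i : Fin m) (c : k)
      (μ : M.carrier m p) (ν : M.carrier n q) (σ : Perm (Fin r)) :
      InfRel M r s (Finsupp.single ⟨m, n, p, q, hm, hp, i, c • μ, ν, σ⟩ 1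
        - Finsupp.single ⟨m, n, p, q, hm, hp, i, μ, ν, σ⟩ c)
  | add_right {m n p q} (hm : m + n = r + 1) (hp : p + q = s) (i : Fin m)
      (μ : M.carrier m p) (ν ν' : M.carrier n q) (σ : Perm (Fin r)) :
      InfRel M r s (Finsupp.single ⟨m, n, p, q, hm, hp, i, μ, ν + ν', σ⟩ 1
        - Finsupp.single ⟨m, n, p, q, hm, hp, i, μ, ν, σ⟩ 1
        - Finsupp.single ⟨m, n, p, q, hm, hp, i, μ, ν', σ⟩ 1)
  | smul_right {m n p q} (hm : m + n = r + 1) (hp : p + q = s) (i : Fin m) (c : k)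
      (μ : M.carrier m p) (ν : M.carrier n q) (σ : Perm (Fin r)) :
      InfRel M r s (Finsupp.single ⟨m, n, p, q, hm, hp, i, μ, c • ν, σ⟩ 1
        - Finsupp.single ⟨m, n, p, q, hm, hp, i, μ, ν, σ⟩ c)
  | equivariant {m n p q} (hm : m + n = r + 1) (hp : p + q = s) (i : Fin m)
      (α : Perm (Fin m)) (β : Perm (Fin n)) (ρ : Perm (Fin r)) (_ : IsBlockPerm hm i α β ρ)
      (μ : M.carrier m p) (ν : M.carrier n q) (σ : Perm (Fin r)) :
      InfRel M r s (Finsupp.single ⟨m, n, p, q, hm, hp, i, M.act α μ, M.act β ν, σ⟩ 1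
        - Finsupp.single ⟨m, n, p, q, hm, hp, α i, μ, ν, ρ * σ⟩ 1)

/-- The component of arity `r` and degree `s` of the infinitesimal composite `M ∘_{(1)} M`. -/
abbrev InfComp {k : Type u} [CommRing k] (M : SMod.{u, v} k) (r : ℕ) (s : ℤ) : Type (max u v) :=
  (InfSymbol M r s →₀ k) ⧸ Submodule.span k {x | InfRel M r s x}

namespace InfComp

variable {k : Type u} [CommRing k] {M : SMod.{u, v} k} {r : ℕ} {s : ℤ}

/-- The element `(μ ⊗_i ν)^σ` of `M ∘_{(1)} M`. -/
def mk {m n : ℕ} {p q : ℤ} (hm : m + n = r + 1) (hp : p + q = s) (i : Fin m)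
    (μ : M.carrier m p) (ν : M.carrier n q) (σ : Perm (Fin r)) : InfComp M r s :=
  Submodule.Quotient.mk (Finsupp.single ⟨m, n, p, q, hm, hp, i, μ, ν, σ⟩ 1)

theorem mk_equivariant {m n : ℕ} {p q : ℤ} (hm : m + n = r + 1) (hp : p + q = s) (i : Fin m)
    (α : Perm (Fin m)) (β : Perm (Fin n)) (ρ : Perm (Fin r)) (hρ : IsBlockPerm hm i α β ρ)
    (μ : M.carrier m p) (ν : M.carrier n q) (σ : Perm (Fin r)) :
    mk hm hp i (M.act α μ) (M.act β ν) σ = mk hm hp (α i) μ ν (ρ * σ) := by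
  unfold mk
  rw [Submodule.Quotient.eq]
  exact Submodule.subset_span (InfRel.equivariant hm hp i α β ρ hρ μ ν σ)

theorem mk_smul_left {m n : ℕ} {p q : ℤ} (hm : m + n = r + 1) (hp : p + q = s) (i : Fin m)
    (c : k) (μ : M.carrier m p) (ν : M.carrier n q) (σ : Perm (Fin r)) :
    mk hm hp i (c • μ) ν σ = c • mk hm hp i μ ν σ := by
  unfold mk
  rw [← Submodule.Quotient.mk_smul, Submodule.Quotient.eq, Finsupp.smul_single, smul_eq_mul,
    mul_one]
  exact Submodule.subset_span (InfRel.smul_left hm hp i c μ ν σ)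

theorem mk_smul_right {m n : ℕ} {p q : ℤ} (hm : m + n = r + 1) (hp : p + q = s) (i : Fin m)
    (c : k) (μ : M.carrier m p) (ν : M.carrier n q) (σ : Perm (Fin r)) :
    mk hm hp i μ (c • ν) σ = c • mk hm hp i μ ν σ := by
  unfold mk
  rw [← Submodule.Quotient.mk_smul, Submodule.Quotient.eq, Finsupp.smul_single, smul_eq_mul,
    mul_one]
  exact Submodule.subset_span (InfRel.smul_right hm hp i c μ ν σ)

/-- `(μ ⊗_i ν)^σ ↦ (μ ⊗_i ν)^{σ τ}`. -/
def symbolAct (τ : Perm (Fin r)) (x : InfSymbol M r s) : InfSymbol M r s :=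
  { x with σ := x.σ * τ }

/-- The right action of the symmetric group on `M ∘_{(1)} M`. -/
def act (τ : Perm (Fin r)) : InfComp M r s →ₗ[k] InfComp M r s :=
  Submodule.mapQ _ _ (Finsupp.lmapDomain k k (symbolAct τ)) (by
    rw [Submodule.span_le]
    rintro x hx
    simp only [Submodule.comap_coe, Set.mem_preimage, SetLike.mem_coe]
    have key : ∀ y, InfRel M r s y → y ∈ Submodule.span k {x | InfRel M r s x} :=
      fun y hy => Submodule.subset_span hy
    cases hx with
    | add_left hm hp i μ μ' ν σ =>
      simp only [map_sub, Finsupp.lmapDomain_apply, Finsupp.mapDomain_single]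
      exact key _ (InfRel.add_left hm hp i μ μ' ν (σ * τ))
    | smul_left hm hp i c μ ν σ =>
      simp only [map_sub, Finsupp.lmapDomain_apply, Finsupp.mapDomain_single]
      exact key _ (InfRel.smul_left hm hp i c μ ν (σ * τ))
    | add_right hm hp i μ ν ν' σ =>
      simp only [map_sub, Finsupp.lmapDomain_apply, Finsupp.mapDomain_single]
      exact key _ (InfRel.add_right hm hp i μ ν ν' (σ * τ))
    | smul_right hm hp i c μ ν σ =>
      simp only [map_sub, Finsupp.lmapDomain_apply, Finsupp.mapDomain_single]
      exact key _ (InfRel.smul_right hm hp i c μ ν (σ * τ))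
    | equivariant hm hp i α β ρ hρ μ ν σ =>
      simp only [map_sub, Finsupp.lmapDomain_apply, Finsupp.mapDomain_single, symbolAct, mul_assoc]
      exact key _ (InfRel.equivariant hm hp i α β ρ hρ μ ν (σ * τ)))

theorem act_mk {m n : ℕ} {p q : ℤ} (hm : m + n = r + 1) (hp : p + q = s) (i : Fin m)
    (μ : M.carrier m p) (ν : M.carrier n q) (σ τ : Perm (Fin r)) :
    act τ (mk hm hp i μ ν σ) = mk hm hp i μ ν (σ * τ) := by
  simp [act, mk, symbolAct, Finsupp.mapDomain_single]

theorem act_mul (σ τ : Perm (Fin r)) (x : InfComp M r s) :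
    act (σ * τ) x = act τ (act σ x) := by
  induction x using Submodule.Quotient.induction_on with
  | H x =>
    induction x using Finsupp.induction_linear with
    | zero => simp
    | add f g hf hg => simp only [Submodule.Quotient.mk_add, map_add, hf, hg]
    | single a c => simp [act, symbolAct, Finsupp.mapDomain_single, mul_assoc]

end InfComp

/-- The part of the structure of a coaugmented dg cooperad from which the cobar construction is
formed: the coaugmentation coideal with its internal differential `d` and its infinitesimal
decomposition map `Δ_{(1)}`. For such data, the cooperad laws (`d² = 0`, compatibility of `d` and
`Δ_{(1)}`, coassociativity) say precisely that the derivation `d₁ - d₂` of the cobar construction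
below squares to zero. -/
structure PreDGCooperad (k : Type u) [CommRing k] extends SMod.{u, v} k where
  d : ∀ {n : ℕ} {p q : ℤ}, q + 1 = p → carrier n p →ₗ[k] carrier n q
  d_act : ∀ {n : ℕ} {p q : ℤ} (h : q + 1 = p) (σ : Perm (Fin n)) (x : carrier n p),
    d h (act σ x) = act σ (d h x)
  decomp : ∀ {n : ℕ} {p : ℤ}, carrier n p →ₗ[k] InfComp toSMod n p
  decomp_act : ∀ {n : ℕ} {p : ℤ} (σ : Perm (Fin n)) (x : carrier n p),
    decomp (act σ x) = InfComp.act σ (decomp x)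

/-! ### The free operad on the desuspension of an `𝕊`-module -/

/-- Formal operadic expressions in generators `s⁻¹x`, where `x` is an element of `M`. -/
inductive Term {k : Type u} [CommRing k] (M : SMod.{u, v} k) : ℕ → ℤ → Type (max u v)
  | gen {n : ℕ} {p q : ℤ} (h : q + 1 = p) (x : M.carrier n p) : Term M n q
  | one : Term M 1 0
  | act {n : ℕ} {p : ℤ} (σ : Perm (Fin n)) (x : Term M n p) : Term M n p
  | comp {m n r : ℕ} {p q s : ℤ} (h : m + n = r + 1) (e : p + q = s) (i : Fin m)
      (x : Term M m p) (y : Term M n q) : Term M r s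
  | zero {n : ℕ} {p : ℤ} : Term M n p
  | add {n : ℕ} {p : ℤ} (x y : Term M n p) : Term M n p
  | smul {n : ℕ} {p : ℤ} (c : k) (x : Term M n p) : Term M n p

/-- The relations of the free operad: the module axioms, the linearity of all operations, the
axioms of an operad, and the relations saying that `s⁻¹ : M → T(s⁻¹M)` is linear and
equivariant. -/
inductive Rel {k : Type u} [CommRing k] (M : SMod.{u, v} k) :
    ∀ {n : ℕ} {p : ℤ}, Term M n p → Term M n p → Prop
  -- compatibility with the operations
  | congr_act {n p} (σ : Perm (Fin n)) {x y : Term M n p} : Rel M x y →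
      Rel M (.act σ x) (.act σ y)
  | congr_comp_left {m n r : ℕ} {p q s : ℤ} (h : m + n = r + 1) (e : p + q = s) (i : Fin m)
      {x x' : Term M m p} (y : Term M n q) : Rel M x x' → Rel M (.comp h e i x y) (.comp h e i x' y)
  | congr_comp_right {m n r : ℕ} {p q s : ℤ} (h : m + n = r + 1) (e : p + q = s) (i : Fin m)
      (x : Term M m p) {y y' : Term M n q} : Rel M y y' → Rel M (.comp h e i x y) (.comp h e i x y')
  | congr_add_left {n p} {x x' : Term M n p} (y : Term M n p) : Rel M x x' →
      Rel M (.add x y) (.add x' y)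
  | congr_add_right {n p} (x : Term M n p) {y y' : Term M n p} : Rel M y y' →
      Rel M (.add x y) (.add x y')
  | congr_smul {n p} (c : k) {x x' : Term M n p} : Rel M x x' → Rel M (.smul c x) (.smul c x')
  -- module axioms
  | add_assoc {n p} (x y z : Term M n p) : Rel M (.add (.add x y) z) (.add x (.add y z))
  | add_comm {n p} (x y : Term M n p) : Rel M (.add x y) (.add y x)
  | zero_add {n p} (x : Term M n p) : Rel M (.add .zero x) x
  | neg_add {n p} (x : Term M n p) : Rel M (.add (.smul (-1) x) x) .zero
  | smul_add {n p} (c : k) (x y : Term M n p) :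
      Rel M (.smul c (.add x y)) (.add (.smul c x) (.smul c y))
  | add_smul {n p} (c c' : k) (x : Term M n p) :
      Rel M (.smul (c + c') x) (.add (.smul c x) (.smul c' x))
  | mul_smul {n p} (c c' : k) (x : Term M n p) : Rel M (.smul (c * c') x) (.smul c (.smul c' x))
  | one_smul {n p} (x : Term M n p) : Rel M (.smul 1 x) x
  -- linearity of the operations
  | act_add {n p} (σ : Perm (Fin n)) (x y : Term M n p) :
      Rel M (.act σ (.add x y)) (.add (.act σ x) (.act σ y))
  | act_smul {n p} (σ : Perm (Fin n)) (c : k) (x : Term M n p) :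
      Rel M (.act σ (.smul c x)) (.smul c (.act σ x))
  | comp_add_left {m n r : ℕ} {p q s : ℤ} (h : m + n = r + 1) (e : p + q = s) (i : Fin m)
      (x x' : Term M m p) (y : Term M n q) :
      Rel M (.comp h e i (.add x x') y) (.add (.comp h e i x y) (.comp h e i x' y))
  | comp_smul_left {m n r : ℕ} {p q s : ℤ} (h : m + n = r + 1) (e : p + q = s) (i : Fin m)
      (c : k) (x : Term M m p) (y : Term M n q) :
      Rel M (.comp h e i (.smul c x) y) (.smul c (.comp h e i x y))
  | comp_add_right {m n r : ℕ} {p q s : ℤ} (h : m + n = r + 1) (e : p + q = s) (i : Fin m)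
      (x : Term M m p) (y y' : Term M n q) :
      Rel M (.comp h e i x (.add y y')) (.add (.comp h e i x y) (.comp h e i x y'))
  | comp_smul_right {m n r : ℕ} {p q s : ℤ} (h : m + n = r + 1) (e : p + q = s) (i : Fin m)
      (c : k) (x : Term M m p) (y : Term M n q) :
      Rel M (.comp h e i x (.smul c y)) (.smul c (.comp h e i x y))
  -- operad axioms
  | act_one {n p} (x : Term M n p) : Rel M (.act 1 x) x
  | act_mul {n p} (σ τ : Perm (Fin n)) (x : Term M n p) :
      Rel M (.act (σ * τ) x) (.act τ (.act σ x))
  | one_comp {n p} (h : 1 + n = n + 1) (e : 0 + p = p) (i : Fin 1) (x : Term M n p) :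
      Rel M (.comp h e i .one x) x
  | comp_one {n p} (h : n + 1 = n + 1) (e : p + 0 = p) (i : Fin n) (x : Term M n p) :
      Rel M (.comp h e i x .one) x
  | assoc_seq {m n l a b c : ℕ} {p q r s t z : ℤ}
      (h₁ : m + n = a + 1) (h₂ : a + l = c + 1) (h₃ : n + l = b + 1) (h₄ : m + b = c + 1)
      (e₁ : p + q = s) (e₂ : s + r = z) (e₃ : q + r = t) (e₄ : p + t = z)
      (i : Fin m) (j : Fin n) (y : Fin a) (_ : (y : ℕ) = i + j)
      (μ : Term M m p) (ν : Term M n q) (ξ : Term M l r) :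
      Rel M (.comp h₂ e₂ y (.comp h₁ e₁ i μ ν) ξ) (.comp h₄ e₄ i μ (.comp h₃ e₃ j ν ξ))
  | assoc_par {m n l a b c : ℕ} {p q r s t z : ℤ}
      (h₁ : m + n = a + 1) (h₂ : a + l = c + 1) (h₃ : m + l = b + 1) (h₄ : b + n = c + 1)
      (e₁ : p + q = s) (e₂ : s + r = z) (e₃ : p + r = t) (e₄ : t + q = z)
      (i j : Fin m) (_ : i < j) (y : Fin a) (_ : (y : ℕ) + 1 = j + n) (x : Fin b)
      (_ : (x : ℕ) = i)
      (μ : Term M m p) (ν : Term M n q) (ξ : Term M l r) :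
      Rel M (.comp h₂ e₂ y (.comp h₁ e₁ i μ ν) ξ)
        (.smul (ksign k (q * r)) (.comp h₄ e₄ x (.comp h₃ e₃ j μ ξ) ν))
  | equivariant {m n r : ℕ} {p q s : ℤ} (h : m + n = r + 1) (e : p + q = s) (i : Fin m)
      (σ : Perm (Fin m)) (τ : Perm (Fin n)) (ρ : Perm (Fin r)) (_ : IsBlockPerm h i σ τ ρ)
      (μ : Term M m p) (ν : Term M n q) :
      Rel M (.comp h e i (.act σ μ) (.act τ ν)) (.act ρ (.comp h e (σ i) μ ν))
  -- generators
  | gen_add {n p q} (h : q + 1 = p) (x y : M.carrier n p) :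
      Rel M (.gen h (x + y)) (.add (.gen h x) (.gen h y))
  | gen_smul {n p q} (h : q + 1 = p) (c : k) (x : M.carrier n p) :
      Rel M (.gen h (c • x)) (.smul c (.gen h x))
  | gen_act {n p q} (h : q + 1 = p) (σ : Perm (Fin n)) (x : M.carrier n p) :
      Rel M (.gen h (M.act σ x)) (.act σ (.gen h x))

/-- The component of arity `n` and degree `p` of the free operad `T(s⁻¹M)`. -/
def FreeOp {k : Type u} [CommRing k] (M : SMod.{u, v} k) (n : ℕ) (p : ℤ) : Type (max u v) :=
  Quot (Rel M (n := n) (p := p))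

namespace FreeOp

variable {k : Type u} [CommRing k] {M : SMod.{u, v} k}

/-- The element of the free operad given by an expression. -/
def mk {n : ℕ} {p : ℤ} (x : Term M n p) : FreeOp M n p := Quot.mk _ x

theorem mk_surjective {n : ℕ} {p : ℤ} : Function.Surjective (mk (M := M) (n := n) (p := p)) :=
  Quot.exists_rep

theorem sound {n : ℕ} {p : ℤ} {x y : Term M n p} (h : Rel M x y) : mk x = mk y := Quot.sound h

instance {n : ℕ} {p : ℤ} : Zero (FreeOp M n p) := ⟨mk .zero⟩

instance {n : ℕ} {p : ℤ} : Add (FreeOp M n p) :=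
  ⟨Quot.map₂ Term.add (fun x _ _ h => Rel.congr_add_right x h) (fun _ _ y h =>
    Rel.congr_add_left y h)⟩

instance {n : ℕ} {p : ℤ} : SMul k (FreeOp M n p) :=
  ⟨fun c => Quot.map (Term.smul c) (fun _ _ h => Rel.congr_smul c h)⟩

instance {n : ℕ} {p : ℤ} : Neg (FreeOp M n p) := ⟨fun x => (-1 : k) • x⟩

theorem mk_zero {n : ℕ} {p : ℤ} : mk (.zero : Term M n p) = 0 := rfl
theorem mk_add {n : ℕ} {p : ℤ} (x y : Term M n p) : mk (.add x y) = mk x + mk y := rfl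
theorem mk_smul {n : ℕ} {p : ℤ} (c : k) (x : Term M n p) : mk (.smul c x) = c • mk x := rfl

instance {n : ℕ} {p : ℤ} : AddCommGroup (FreeOp M n p) where
  add_assoc := by rintro ⟨x⟩ ⟨y⟩ ⟨z⟩; exact sound (.add_assoc x y z)
  zero_add := by rintro ⟨x⟩; exact sound (.zero_add x)
  add_zero := by rintro ⟨x⟩; exact (sound (.add_comm x .zero)).trans (sound (.zero_add x))
  add_comm := by rintro ⟨x⟩ ⟨y⟩; exact sound (.add_comm x y)
  neg_add_cancel := by rintro ⟨x⟩; exact sound (.neg_add x)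
  nsmul := nsmulRec
  zsmul := zsmulRec

instance {n : ℕ} {p : ℤ} : Module k (FreeOp M n p) :=
  Module.ofMinimalAxioms
    (by rintro c ⟨x⟩ ⟨y⟩; exact sound (.smul_add c x y))
    (by rintro c c' ⟨x⟩; exact sound (.add_smul c c' x))
    (by rintro c c' ⟨x⟩; exact sound (.mul_smul c c' x))
    (by rintro ⟨x⟩; exact sound (.one_smul x))

/-- The right action of the symmetric group. -/
def act {n : ℕ} {p : ℤ} (σ : Perm (Fin n)) : FreeOp M n p →ₗ[k] FreeOp M n p where
  toFun := Quot.map (Term.act σ) (fun _ _ h => Rel.congr_act σ h)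
  map_add' := by rintro ⟨x⟩ ⟨y⟩; exact sound (.act_add σ x y)
  map_smul' := by rintro c ⟨x⟩; exact sound (.act_smul σ c x)

/-- Partial composition. -/
def comp {m n r : ℕ} {p q s : ℤ} (h : m + n = r + 1) (e : p + q = s) (i : Fin m) :
    FreeOp M m p →ₗ[k] FreeOp M n q →ₗ[k] FreeOp M r s :=
  LinearMap.mk₂ k
    (Quot.map₂ (Term.comp h e i) (fun x _ _ hr => Rel.congr_comp_right h e i x hr)
      (fun _ _ y hr => Rel.congr_comp_left h e i y hr))
    (by rintro ⟨x⟩ ⟨x'⟩ ⟨y⟩; exact sound (.comp_add_left h e i x x' y))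
    (by rintro c ⟨x⟩ ⟨y⟩; exact sound (.comp_smul_left h e i c x y))
    (by rintro ⟨x⟩ ⟨y⟩ ⟨y'⟩; exact sound (.comp_add_right h e i x y y'))
    (by rintro c ⟨x⟩ ⟨y⟩; exact sound (.comp_smul_right h e i c x y))

/-- The unit of the free operad. -/
def one : FreeOp M 1 0 := mk .one

/-- The generator `s⁻¹x`. -/
def gen {n : ℕ} {p q : ℤ} (h : q + 1 = p) : M.carrier n p →ₗ[k] FreeOp M n q where
  toFun x := mk (.gen h x)
  map_add' x y := sound (.gen_add h x y)
  map_smul' c x := sound (.gen_smul h c x)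

theorem mk_act {n : ℕ} {p : ℤ} (σ : Perm (Fin n)) (x : Term M n p) :
    mk (.act σ x) = act σ (mk x) := rfl
theorem mk_comp {m n r : ℕ} {p q s : ℤ} (h : m + n = r + 1) (e : p + q = s) (i : Fin m)
    (x : Term M m p) (y : Term M n q) : mk (.comp h e i x y) = comp h e i (mk x) (mk y) := rfl
theorem mk_gen {n : ℕ} {p q : ℤ} (h : q + 1 = p) (x : M.carrier n p) :
    mk (.gen h x) = gen h x := rfl

theorem gen_act {n : ℕ} {p q : ℤ} (h : q + 1 = p) (σ : Perm (Fin n)) (x : M.carrier n p) :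
    gen h (M.act σ x) = act σ (gen h x) := sound (.gen_act h σ x)

theorem act_one {n : ℕ} {p : ℤ} (x : FreeOp M n p) : act 1 x = x := by
  obtain ⟨x, rfl⟩ := mk_surjective x
  exact sound (.act_one x)

theorem act_mul {n : ℕ} {p : ℤ} (σ τ : Perm (Fin n)) (x : FreeOp M n p) :
    act (σ * τ) x = act τ (act σ x) := by
  obtain ⟨x, rfl⟩ := mk_surjective x
  exact sound (.act_mul σ τ x)

theorem one_comp {n : ℕ} {p : ℤ} (h : 1 + n = n + 1) (e : 0 + p = p) (i : Fin 1)
    (x : FreeOp M n p) : comp h e i one x = x := by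
  obtain ⟨x, rfl⟩ := mk_surjective x
  exact sound (.one_comp h e i x)

theorem comp_one {n : ℕ} {p : ℤ} (h : n + 1 = n + 1) (e : p + 0 = p) (i : Fin n)
    (x : FreeOp M n p) : comp h e i x one = x := by
  obtain ⟨x, rfl⟩ := mk_surjective x
  exact sound (.comp_one h e i x)

theorem assoc_seq {m n l a b c : ℕ} {p q r s t z : ℤ}
    (h₁ : m + n = a + 1) (h₂ : a + l = c + 1) (h₃ : n + l = b + 1) (h₄ : m + b = c + 1)
    (e₁ : p + q = s) (e₂ : s + r = z) (e₃ : q + r = t) (e₄ : p + t = z)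
    (i : Fin m) (j : Fin n) (y : Fin a) (hy : (y : ℕ) = i + j)
    (μ : FreeOp M m p) (ν : FreeOp M n q) (ξ : FreeOp M l r) :
    comp h₂ e₂ y (comp h₁ e₁ i μ ν) ξ = comp h₄ e₄ i μ (comp h₃ e₃ j ν ξ) := by
  obtain ⟨μ, rfl⟩ := mk_surjective μ
  obtain ⟨ν, rfl⟩ := mk_surjective ν
  obtain ⟨ξ, rfl⟩ := mk_surjective ξ
  exact sound (.assoc_seq h₁ h₂ h₃ h₄ e₁ e₂ e₃ e₄ i j y hy μ ν ξ)

theorem assoc_par {m n l a b c : ℕ} {p q r s t z : ℤ}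
    (h₁ : m + n = a + 1) (h₂ : a + l = c + 1) (h₃ : m + l = b + 1) (h₄ : b + n = c + 1)
    (e₁ : p + q = s) (e₂ : s + r = z) (e₃ : p + r = t) (e₄ : t + q = z)
    (i j : Fin m) (hij : i < j) (y : Fin a) (hy : (y : ℕ) + 1 = j + n) (x : Fin b)
    (hx : (x : ℕ) = i)
    (μ : FreeOp M m p) (ν : FreeOp M n q) (ξ : FreeOp M l r) :
    comp h₂ e₂ y (comp h₁ e₁ i μ ν) ξ =
      ksign k (q * r) • comp h₄ e₄ x (comp h₃ e₃ j μ ξ) ν := by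
  obtain ⟨μ, rfl⟩ := mk_surjective μ
  obtain ⟨ν, rfl⟩ := mk_surjective ν
  obtain ⟨ξ, rfl⟩ := mk_surjective ξ
  exact sound (.assoc_par h₁ h₂ h₃ h₄ e₁ e₂ e₃ e₄ i j hij y hy x hx μ ν ξ)

theorem equivariant {m n r : ℕ} {p q s : ℤ} (h : m + n = r + 1) (e : p + q = s) (i : Fin m)
    (σ : Perm (Fin m)) (τ : Perm (Fin n)) (ρ : Perm (Fin r)) (hρ : IsBlockPerm h i σ τ ρ)
    (μ : FreeOp M m p) (ν : FreeOp M n q) :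
    comp h e i (act σ μ) (act τ ν) = act ρ (comp h e (σ i) μ ν) := by
  obtain ⟨μ, rfl⟩ := mk_surjective μ
  obtain ⟨ν, rfl⟩ := mk_surjective ν
  exact sound (.equivariant h e i σ τ ρ hρ μ ν)

end FreeOp

/-- The free operad with a given operator of degree `-1`. -/
def freePreDG {k : Type u} [CommRing k] (M : SMod.{u, v} k)
    (d : ∀ {n : ℕ} {p q : ℤ}, q + 1 = p → FreeOp M n p →ₗ[k] FreeOp M n q) :
    PreDGOperad.{u, max u v} k where
  carrier := FreeOp M
  act := FreeOp.act
  one := FreeOp.one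
  comp := FreeOp.comp
  d := d

theorem freePreDG_isOperad {k : Type u} [CommRing k] (M : SMod.{u, v} k)
    (d : ∀ {n : ℕ} {p q : ℤ}, q + 1 = p → FreeOp M n p →ₗ[k] FreeOp M n q) :
    IsOperad (freePreDG M d) where
  act_one := FreeOp.act_one
  act_mul := FreeOp.act_mul
  one_comp := FreeOp.one_comp
  comp_one := FreeOp.comp_one
  assoc_seq := FreeOp.assoc_seq
  assoc_par := FreeOp.assoc_par
  equivariant := FreeOp.equivariant

namespace FreeOp

variable {k : Type u} [CommRing k] {M : SMod.{u, v} k}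

/-- The value of an expression in an operad, given the values of the generators. -/
def termValue (Q : PreDGOperad.{u, w} k)
    (φ : ∀ {n : ℕ} {p q : ℤ}, q + 1 = p → M.carrier n p →ₗ[k] Q.carrier n q) :
    ∀ {n : ℕ} {p : ℤ}, Term M n p → Q.carrier n p
  | _, _, .gen h x => φ h x
  | _, _, .one => Q.one
  | _, _, .act σ x => Q.act σ (termValue Q φ x)
  | _, _, .comp h e i x y => Q.comp h e i (termValue Q φ x) (termValue Q φ y)
  | _, _, .zero => 0
  | _, _, .add x y => termValue Q φ x + termValue Q φ y
  | _, _, .smul c x => c • termValue Q φ x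

theorem termValue_rel {Q : PreDGOperad.{u, w} k} (hQ : IsOperad Q)
    (φ : ∀ {n : ℕ} {p q : ℤ}, q + 1 = p → M.carrier n p →ₗ[k] Q.carrier n q)
    (hφ : ∀ {n : ℕ} {p q : ℤ} (h : q + 1 = p) (σ : Perm (Fin n)) (x : M.carrier n p),
      φ h (M.act σ x) = Q.act σ (φ h x))
    {n : ℕ} {p : ℤ} {x y : Term M n p} (h : Rel M x y) :
    termValue Q φ x = termValue Q φ y := by
  induction h with
  | congr_act σ _ ih => simp only [termValue, ih]
  | congr_comp_left h e i y _ ih => simp only [termValue, ih]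
  | congr_comp_right h e i x _ ih => simp only [termValue, ih]
  | congr_add_left y _ ih => simp only [termValue, ih]
  | congr_add_right x _ ih => simp only [termValue, ih]
  | congr_smul c _ ih => simp only [termValue, ih]
  | add_assoc x y z => simp only [termValue, _root_.add_assoc]
  | add_comm x y => simp only [termValue, _root_.add_comm]
  | zero_add x => simp only [termValue, _root_.zero_add]
  | neg_add x => simp [termValue]
  | smul_add c x y => simp only [termValue, _root_.smul_add]
  | add_smul c c' x => simp only [termValue, _root_.add_smul]
  | mul_smul c c' x => simp only [termValue, SemigroupAction.mul_smul]
  | one_smul x => simp only [termValue, _root_.one_smul]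
  | act_add σ x y => simp only [termValue, map_add]
  | act_smul σ c x => simp only [termValue, map_smul]
  | comp_add_left h e i x x' y => simp only [termValue, map_add, LinearMap.add_apply]
  | comp_smul_left h e i c x y => simp only [termValue, map_smul, LinearMap.smul_apply]
  | comp_add_right h e i x y y' => simp only [termValue, map_add]
  | comp_smul_right h e i c x y => simp only [termValue, map_smul]
  | act_one x => simp only [termValue, hQ.act_one]
  | act_mul σ τ x => simp only [termValue, hQ.act_mul]
  | one_comp h e i x => simp only [termValue, hQ.one_comp]
  | comp_one h e i x => simp only [termValue, hQ.comp_one]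
  | assoc_seq h₁ h₂ h₃ h₄ e₁ e₂ e₃ e₄ i j y hy μ ν ξ =>
    simp only [termValue]
    exact hQ.assoc_seq h₁ h₂ h₃ h₄ e₁ e₂ e₃ e₄ i j y hy _ _ _
  | assoc_par h₁ h₂ h₃ h₄ e₁ e₂ e₃ e₄ i j hij y hy x hx μ ν ξ =>
    simp only [termValue]
    exact hQ.assoc_par h₁ h₂ h₃ h₄ e₁ e₂ e₃ e₄ i j hij y hy x hx _ _ _
  | equivariant h e i σ τ ρ hρ μ ν =>
    simp only [termValue]
    exact hQ.equivariant h e i σ τ ρ hρ _ _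
  | gen_add h x y => simp only [termValue, map_add]
  | gen_smul h c x => simp only [termValue, map_smul]
  | gen_act h σ x => simp only [termValue, hφ]

/-- The morphism of operads determined by its values on the generators. -/
def lift (d : ∀ {n : ℕ} {p q : ℤ}, q + 1 = p → FreeOp M n p →ₗ[k] FreeOp M n q)
    {Q : PreDGOperad.{u, w} k} (hQ : IsOperad Q)
    (φ : ∀ {n : ℕ} {p q : ℤ}, q + 1 = p → M.carrier n p →ₗ[k] Q.carrier n q)
    (hφ : ∀ {n : ℕ} {p q : ℤ} (h : q + 1 = p) (σ : Perm (Fin n)) (x : M.carrier n p),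
      φ h (M.act σ x) = Q.act σ (φ h x)) :
    OperadHom (freePreDG M d) Q where
  toFun {_ _} :=
    { toFun := Quot.lift (termValue Q φ) (fun _ _ h => termValue_rel hQ φ hφ h)
      map_add' := by rintro ⟨x⟩ ⟨y⟩; rfl
      map_smul' := by rintro c ⟨x⟩; rfl }
  map_act := by rintro n p σ ⟨x⟩; rfl
  map_one := rfl
  map_comp := by rintro m n r p q s h e i ⟨x⟩ ⟨y⟩; rfl

end FreeOp

/-! ### The cobar construction -/

section Signs

variable (k : Type u) [CommRing k]

theorem ksign_add (a b : ℤ) : ksign k (a + b) = ksign k a * ksign k b := by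
  simp [ksign, Int.negOnePow_add]

theorem ksign_one : ksign k 1 = -1 := by simp [ksign]

theorem ksign_zero : ksign k 0 = 1 := by simp [ksign]

theorem ksign_mul_self (a : ℤ) : ksign k a * ksign k a = 1 := by
  rw [← ksign_add, ← two_mul]
  simp [ksign]

theorem ksign_neg (a : ℤ) : ksign k (-a) = ksign k a := by simp [ksign, Int.negOnePow_neg]

theorem ksign_sub (a b : ℤ) : ksign k (a - b) = ksign k a * ksign k b := by
  rw [sub_eq_add_neg, ksign_add, ksign_neg]

end Signs

namespace Cobar

variable {k : Type u} [CommRing k] (C : PreDGCooperad.{u, v} k)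

/-- `(s⁻¹ ∘_{(1)} s⁻¹) : C ∘_{(1)} C → T(s⁻¹C)`,
`(μ ⊗_i ν)^σ ↦ (-1)^{|μ|} (s⁻¹μ ∘_i s⁻¹ν)^σ`. -/
def infToFree {r : ℕ} {s t : ℤ} (h : t + 2 = s) :
    InfComp C.toSMod r s →ₗ[k] FreeOp C.toSMod r t :=
  Submodule.liftQ _ (Finsupp.lift _ k _ fun x : InfSymbol C.toSMod r s =>
      ksign k x.p • FreeOp.act x.σ (FreeOp.comp x.hm
        (show (x.p - 1) + (x.q - 1) = t by have := x.hp; omega) x.i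
        (FreeOp.gen (by omega) x.μ) (FreeOp.gen (by omega) x.ν))) (by
    rw [Submodule.span_le]
    rintro x hx
    simp only [SetLike.mem_coe, LinearMap.mem_ker]
    have key : ∀ (f : InfSymbol C.toSMod r s → FreeOp C.toSMod r t) (y : InfSymbol C.toSMod r s)
        (c : k), Finsupp.lift _ k _ f (Finsupp.single y c) = c • f y := by
      intro f y c; simp
    cases hx with
    | add_left hm hp i μ μ' ν σ =>
      simp only [map_sub, key, map_add, LinearMap.add_apply, smul_add]; abel
    | smul_left hm hp i c μ ν σ =>
      simp only [map_sub, key, map_smul, LinearMap.smul_apply, one_smul, smul_comm c, sub_self]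
    | add_right hm hp i μ ν ν' σ =>
      simp only [map_sub, key, map_add, smul_add]; abel
    | smul_right hm hp i c μ ν σ =>
      simp only [map_sub, key, map_smul, one_smul, smul_comm c, sub_self]
    | equivariant hm hp i α β ρ hρ μ ν σ =>
      simp only [map_sub, key, one_smul, FreeOp.gen_act, sub_eq_zero]
      rw [FreeOp.equivariant hm _ i α β ρ hρ, FreeOp.act_mul])

theorem infToFree_mk {m n r : ℕ} {p q s t : ℤ} (h : t + 2 = s) (hm : m + n = r + 1)
    (hp : p + q = s) (i : Fin m) (μ : C.carrier m p) (ν : C.carrier n q) (σ : Perm (Fin r)) :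
    infToFree C h (InfComp.mk hm hp i μ ν σ) =
      ksign k p • FreeOp.act σ (FreeOp.comp hm (show (p - 1) + (q - 1) = t by omega) i
        (FreeOp.gen (by omega) μ) (FreeOp.gen (by omega) ν)) := by
  simp [infToFree, InfComp.mk]

theorem infToFree_act {r : ℕ} {s t : ℤ} (h : t + 2 = s) (τ : Perm (Fin r))
    (x : InfComp C.toSMod r s) :
    infToFree C h (InfComp.act τ x) = FreeOp.act τ (infToFree C h x) := by
  induction x using Submodule.Quotient.induction_on with
  | H x =>
    induction x using Finsupp.induction_linear with
    | zero => simp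
    | add f g hf hg => simp only [Submodule.Quotient.mk_add, map_add, hf, hg]
    | single a c =>
      simp [InfComp.act, infToFree, InfComp.symbolAct, Finsupp.mapDomain_single, FreeOp.act_mul]

/-- The value of the differential of the cobar construction on a generator,
`d(s⁻¹x) = d₁(s⁻¹x) - d₂(s⁻¹x)` with `d₁(s⁻¹x) = -s⁻¹(dx)` and
`d₂(s⁻¹x) = (s⁻¹ ∘_{(1)} s⁻¹)(Δ_{(1)}(x))`. -/
def dGen {n : ℕ} {p q r : ℤ} (h : q + 1 = p) (h' : r + 1 = q) :
    C.carrier n p →ₗ[k] FreeOp C.toSMod n r :=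
  -(FreeOp.gen h' ∘ₗ C.d h) - infToFree C (show r + 2 = p by omega) ∘ₗ C.decomp

theorem dGen_act {n : ℕ} {p q r : ℤ} (h : q + 1 = p) (h' : r + 1 = q) (σ : Perm (Fin n))
    (x : C.carrier n p) : dGen C h h' (C.act σ x) = FreeOp.act σ (dGen C h h' x) := by
  simp [dGen, C.d_act, C.decomp_act, FreeOp.gen_act, infToFree_act]

/-- The differential on expressions: the derivation extending `dGen`. -/
def dTerm : ∀ {n : ℕ} {p : ℤ}, Term C.toSMod n p → ∀ (q : ℤ), q + 1 = p → FreeOp C.toSMod n q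
  | _, _, .gen h x, _, hq => dGen C h hq x
  | _, _, .one, _, _ => 0
  | _, _, .act σ x, q, hq => FreeOp.act σ (dTerm x q hq)
  | _, _, .comp (p := p) (q := q) h e i x y, _, hr =>
      FreeOp.comp h (show (p - 1) + q = _ by omega) i (dTerm x (p - 1) (by omega)) (FreeOp.mk y) +
      ksign k p •
        FreeOp.comp h (show p + (q - 1) = _ by omega) i (FreeOp.mk x) (dTerm y (q - 1) (by omega))
  | _, _, .zero, _, _ => 0
  | _, _, .add x y, q, hq => dTerm x q hq + dTerm y q hq
  | _, _, .smul c x, q, hq => c • dTerm x q hq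

theorem dTerm_rel {n : ℕ} {p : ℤ} {x y : Term C.toSMod n p} (h : Rel C.toSMod x y) :
    ∀ (q : ℤ) (hq : q + 1 = p), dTerm C x q hq = dTerm C y q hq := by
  induction h with
  | congr_act σ _ ih => intro q hq; simp only [dTerm, ih]
  | congr_comp_left h e i y hr ih => intro q hq; simp only [dTerm, ih, FreeOp.sound hr]
  | congr_comp_right h e i x hr ih => intro q hq; simp only [dTerm, ih, FreeOp.sound hr]
  | congr_add_left y _ ih => intro q hq; simp only [dTerm, ih]
  | congr_add_right x _ ih => intro q hq; simp only [dTerm, ih]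
  | congr_smul c _ ih => intro q hq; simp only [dTerm, ih]
  | add_assoc x y z => intro q hq; simp only [dTerm, add_assoc]
  | add_comm x y => intro q hq; simp only [dTerm, add_comm]
  | zero_add x => intro q hq; simp only [dTerm, zero_add]
  | neg_add x => intro q hq; simp [dTerm]
  | smul_add c x y => intro q hq; simp only [dTerm, smul_add]
  | add_smul c c' x => intro q hq; simp only [dTerm, add_smul]
  | mul_smul c c' x => intro q hq; simp only [dTerm, mul_smul]
  | one_smul x => intro q hq; simp only [dTerm, one_smul]
  | act_add σ x y => intro q hq; simp only [dTerm, map_add]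
  | act_smul σ c x => intro q hq; simp only [dTerm, map_smul]
  | comp_add_left h e i x x' y =>
    intro q hq
    simp only [dTerm, FreeOp.mk_add, map_add, LinearMap.add_apply, smul_add]
    abel
  | comp_smul_left h e i c x y =>
    intro q hq
    simp only [dTerm, FreeOp.mk_smul, map_smul, LinearMap.smul_apply, smul_add, smul_comm c]
  | comp_add_right h e i x y y' =>
    intro q hq
    simp only [dTerm, FreeOp.mk_add, map_add, smul_add]
    abel
  | comp_smul_right h e i c x y =>
    intro q hq
    simp only [dTerm, FreeOp.mk_smul, map_smul, smul_add, smul_comm c]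
  | act_one x => intro q hq; simp only [dTerm, FreeOp.act_one]
  | act_mul σ τ x => intro q hq; simp only [dTerm, FreeOp.act_mul]
  | @one_comp n p h e i x =>
    intro q hq
    obtain rfl : q = p - 1 := by omega
    simp only [dTerm, map_zero, LinearMap.zero_apply, zero_add, ksign_zero, one_smul]
    exact FreeOp.one_comp h _ i _
  | @comp_one n p h e i x =>
    intro q hq
    obtain rfl : q = p - 1 := by omega
    simp only [dTerm, map_zero, smul_zero, add_zero]
    exact FreeOp.comp_one h _ i _
  | @assoc_seq m n l a b c p q r s t z h₁ h₂ h₃ h₄ e₁ e₂ e₃ e₄ i j y hy μ ν ξ =>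
    intro z' hz
    simp only [dTerm, FreeOp.mk_comp, map_add, map_smul, LinearMap.add_apply,
      LinearMap.smul_apply, smul_add, smul_smul]
    rw [FreeOp.assoc_seq h₁ h₂ h₃ h₄ _ _ e₃ (by omega) i j y hy,
      FreeOp.assoc_seq h₁ h₂ h₃ h₄ _ _ (t := t - 1) (by omega) (by omega) i j y hy,
      FreeOp.assoc_seq h₁ h₂ h₃ h₄ _ _ (t := t - 1) (by omega) (by omega) i j y hy,
      show ksign k s = ksign k p * ksign k q by rw [← e₁, ksign_add], add_assoc]
  | @assoc_par m n l a b c p q r s t z h₁ h₂ h₃ h₄ e₁ e₂ e₃ e₄ i j hij y hy x hx μ ν ξ =>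
    intro z' hz
    simp only [dTerm, FreeOp.mk_comp, map_add, map_smul, LinearMap.add_apply,
      LinearMap.smul_apply, smul_add, smul_smul]
    rw [FreeOp.assoc_par h₁ h₂ h₃ h₄ _ _ (t := t - 1) (by omega) (by omega) i j hij y hy x hx,
      FreeOp.assoc_par h₁ h₂ h₃ h₄ _ _ e₃ (by omega) i j hij y hy x hx,
      FreeOp.assoc_par h₁ h₂ h₃ h₄ _ _ (t := t - 1) (by omega) (by omega) i j hij y hy x hx,
      smul_smul, smul_smul, add_right_comm]
    have hk : ksign k q * ksign k q = 1 := ksign_mul_self k q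
    have hs : ksign k s * ksign k (q * (r - 1)) = ksign k (q * r) * ksign k p := by
      rw [← e₁, ksign_add, mul_sub, mul_one, ksign_sub]
      linear_combination (ksign k p * ksign k (q * r)) * hk
    have ht : ksign k p * ksign k ((q - 1) * r) = ksign k (q * r) * ksign k t := by
      rw [← e₃, ksign_add, sub_mul, one_mul, ksign_sub]
      ring
    rw [hs, ht]
  | @equivariant m n r p q s h e i σ τ ρ hρ μ ν =>
    intro s' hs
    simp only [dTerm, FreeOp.mk_act, map_add, map_smul]
    rw [FreeOp.equivariant h _ i σ τ ρ hρ, FreeOp.equivariant h _ i σ τ ρ hρ]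
  | gen_add h x y => intro q hq; simp only [dTerm, map_add]
  | gen_smul h c x => intro q hq; simp only [dTerm, map_smul]
  | gen_act h σ x => intro q hq; simp only [dTerm, dGen_act]

/-- The differential of the cobar construction. -/
def diff {n : ℕ} {p q : ℤ} (h : q + 1 = p) : FreeOp C.toSMod n p →ₗ[k] FreeOp C.toSMod n q where
  toFun := Quot.lift (fun x => dTerm C x q h) (fun _ _ hr => dTerm_rel C hr q h)
  map_add' := by rintro ⟨x⟩ ⟨y⟩; rfl
  map_smul' := by rintro c ⟨x⟩; rfl

end Cobar

/-- The cobar construction `ΩC = (T(s⁻¹C), d₁ - d₂)`. -/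
def cobar {k : Type u} [CommRing k] (C : PreDGCooperad.{u, v} k) : PreDGOperad.{u, max u v} k :=
  freePreDG C.toSMod (Cobar.diff C)

/-- The generator `s⁻¹x` of the cobar construction. -/
def sInv {k : Type u} [CommRing k] {C : PreDGCooperad.{u, v} k} {n : ℕ} {p q : ℤ}
    (h : q + 1 = p) (x : C.carrier n p) : (cobar C).carrier n q := FreeOp.gen h x

/-- The morphism of operads `Ωf : ΩC → ΩC'` with `Ωf(s⁻¹x) = s⁻¹f(x)`. -/
def cobarMap {k : Type u} [CommRing k] {C : PreDGCooperad.{u, v} k} {C' : PreDGCooperad.{u, w} k}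
    (f : SHom C.toSMod C'.toSMod) : OperadHom (cobar C) (cobar C') :=
  FreeOp.lift (Cobar.diff C) (Q := cobar C') (freePreDG_isOperad _ _)
    (fun h => FreeOp.gen h ∘ₗ f.toFun)
    (fun h σ x => by
      change FreeOp.gen h (f.toFun (C.act σ x)) = FreeOp.act σ (FreeOp.gen h (f.toFun x))
      rw [f.map_act, FreeOp.gen_act])

/-! ### The Koszul dual cooperad of the Lie operad -/

/-- The generator `ℓ_n` of arity `n ≥ 2` and degree `p = n - 1`, when `n ≤ N`: this is inhabited
(by one element) exactly in these cases. -/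
structure KGen (N : ℕ∞) (n : ℕ) (p : ℤ) : Type where
  two_le : 2 ≤ n
  le : (n : ℕ∞) ≤ N
  deg : p + 1 = n

instance (N : ℕ∞) (n : ℕ) (p : ℤ) : Subsingleton (KGen N n p) := ⟨by rintro ⟨⟩ ⟨⟩; rfl⟩

theorem psign_mul (k : Type u) [CommRing k] {n : ℕ} (σ τ : Perm (Fin n)) :
    psign k (σ * τ) = psign k σ * psign k τ := by
  simp [psign]

theorem psign_one (k : Type u) [CommRing k] {n : ℕ} : psign k (1 : Perm (Fin n)) = 1 := by
  simp [psign]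

theorem psign_mul_self (k : Type u) [CommRing k] {n : ℕ} (σ : Perm (Fin n)) :
    psign k σ * psign k σ = 1 := by
  rw [psign, ← Int.cast_mul, ← Units.val_mul, Int.units_mul_self]
  simp

/-- The `𝕊`-module with basis `ℓ_2, ℓ_3, …` (up to `ℓ_N`), on which the symmetric groups act by
the sign. -/
def lieKMod (k : Type u) [CommRing k] (N : ℕ∞) : SMod.{u, u} k where
  carrier n p := KGen N n p →₀ k
  act σ := psign k σ • LinearMap.id
  act_one x := by simp [psign_one]
  act_mul σ τ x := by simp [psign_mul, smul_smul]

/-- The element `ℓ_n` of arity `n` and degree `p = n - 1` (and `0` outside of the range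
`2 ≤ n ≤ N`). -/
def ell (k : Type u) [CommRing k] (N : ℕ∞) (n : ℕ) (p : ℤ) : (lieKMod k N).carrier n p :=
  open Classical in
  if h : 2 ≤ n ∧ (n : ℕ∞) ≤ N ∧ p + 1 = n then Finsupp.single ⟨h.1, h.2.1, h.2.2⟩ 1 else 0

/-- `τ` is an `(i, n - i)`-shuffle. -/
def IsShuffle {n : ℕ} (i : ℕ) (τ : Perm (Fin n)) : Prop :=
  ∀ a b : Fin n, a < b → ((b : ℕ) < i ∨ i ≤ (a : ℕ)) → τ a < τ b

open Classical in
/-- The set `Sh⁻¹(i, n - i)` of unshuffles, the inverses of shuffles. -/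
def unshuffles (n i : ℕ) : Finset (Perm (Fin n)) := Finset.univ.filter fun σ => IsShuffle i σ⁻¹

/-- `∑_{σ ∈ Sh⁻¹(i, j - 1)} (-1)^{|σ|} (ℓ_j ⊗_1 ℓ_i)^σ`, where `i + j = n + 1`. -/
def ellSum (k : Type u) [CommRing k] (N : ℕ∞) {i j n : ℕ} {p : ℤ} (hj : 0 < j)
    (hn : j + i = n + 1) (hp : ((j : ℤ) - 1) + ((i : ℤ) - 1) = p) : InfComp (lieKMod k N) n p :=
  ∑ σ ∈ unshuffles n i, psign k σ •
    InfComp.mk hn hp ⟨0, hj⟩ (ell k N j ((j : ℤ) - 1)) (ell k N i ((i : ℤ) - 1)) σ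

/-- `Δ_{(1)}(ℓ_n) = ∑_{i + j = n + 1} (-1)^{(j-1)(i-1)} ∑_{σ ∈ Sh⁻¹(i, j - 1)} (-1)^{|σ|}
(ℓ_j ⊗_1 ℓ_i)^σ`, where `i, j ≥ 2` since only the coaugmentation coideal is considered. -/
def ellDecomp (k : Type u) [CommRing k] (N : ℕ∞) {n : ℕ} {p : ℤ} (g : KGen N n p) :
    InfComp (lieKMod k N) n p :=
  ∑ i ∈ Finset.range n, if h : 2 ≤ i ∧ i < n then
    ksign k (((n : ℤ) - i) * ((i : ℤ) - 1)) •
      ellSum k N (i := i) (j := n + 1 - i) (by omega) (by omega)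
        (by have := g.deg; omega)
  else 0

theorem strictMono_perm_eq_one {n : ℕ} (ρ : Perm (Fin n)) (h : StrictMono ρ) : ρ = 1 := by
  have h1 : Set.range ρ = Set.range (id : Fin n → Fin n) := by simp [ρ.surjective.range_eq]
  have h2 := (StrictMono.range_inj h strictMono_id).1 h1
  exact Equiv.ext fun a => congrFun h2 a

/-- Permutations preserving the set of the first `i` elements. -/
def Young {n : ℕ} (i : ℕ) (ρ : Perm (Fin n)) : Prop := ∀ a : Fin n, (ρ a : ℕ) < i ↔ (a : ℕ) < i

theorem Young.inv {n i : ℕ} {ρ : Perm (Fin n)} (h : Young i ρ) : Young i ρ⁻¹ := by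
  intro a
  have := h (ρ⁻¹ a)
  simpa using this.symm

theorem Young.mul {n i : ℕ} {ρ ρ' : Perm (Fin n)} (h : Young i ρ) (h' : Young i ρ') :
    Young i (ρ * ρ') := fun a => by rw [Perm.mul_apply, h, h']

theorem unshuffle_unique {n i : ℕ} {u u' ρ : Perm (Fin n)} (hu : u ∈ unshuffles n i)
    (hu' : u' ∈ unshuffles n i) (hρ : Young i ρ) (h : u' = ρ * u) : u' = u := by
  simp only [unshuffles, Finset.mem_filter, Finset.mem_univ, true_and] at hu hu'
  suffices ρ = 1 by simpa [this] using h
  apply strictMono_perm_eq_one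
  intro a b hab
  by_cases hc : (b : ℕ) < i ∨ i ≤ (a : ℕ)
  · have h1 := hu a b hab hc
    by_contra hcon
    have hne : ρ b ≠ ρ a := fun e => hab.ne' (ρ.injective e)
    have hlt : ρ b < ρ a := lt_of_le_of_ne (not_lt.mp hcon) hne
    have h2 := hu' (ρ b) (ρ a) hlt (by
      rcases hc with hc | hc
      · left; rw [hρ]; exact lt_trans hab hc
      · right
        by_contra h3
        have := (hρ b).1 (not_le.mp h3)
        have : (a : ℕ) < b := hab
        omega)
    subst h
    simp only [mul_inv_rev, Perm.mul_apply, Perm.inv_def, Equiv.symm_apply_apply] at h1 h2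
    exact absurd h1 (not_lt.mpr h2.le)
  · push Not at hc
    have h1 := (hρ a).2 hc.2
    have h2 : ¬ (ρ b : ℕ) < i := fun h => absurd ((hρ b).1 h) (not_lt.mpr hc.1)
    show (ρ a : ℕ) < ρ b
    omega

theorem exists_unshuffle {n i : ℕ} (hi : i ≤ n) (σ : Perm (Fin n)) :
    ∃ u ∈ unshuffles n i, ∃ ρ, Young i ρ ∧ u = ρ * σ := by
  classical
  let A : Finset (Fin n) := Finset.univ.filter fun a => (σ a : ℕ) < i
  have hA : A.card = i := by
    have h1 : A = (Finset.univ.filter fun a : Fin n => (a : ℕ) < i).map σ⁻¹.toEmbedding := by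
      ext a
      simp only [A, Finset.mem_filter, Finset.mem_univ, true_and, Finset.mem_map_equiv]
      simp [Equiv.Perm.inv_def]
    rw [h1, Finset.card_map]
    have := Fin.card_filter_val_lt (m := i) (n := n)
    rw [this]
    omega
  have hAc : Aᶜ.card = n - i := by rw [Finset.card_compl, hA, Fintype.card_fin]
  let s : Fin n ≃ Fin n :=
    (finCongr (by omega : n = i + (n - i))).trans
      (finSumFinEquiv.symm.trans (finSumEquivOfFinset hA hAc))
  have hs1 : ∀ a : Fin n, ∀ h : (a : ℕ) < i, s a = A.orderEmbOfFin hA ⟨a, h⟩ := by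
    intro a h
    have : finCongr (by omega : n = i + (n - i)) a = Fin.castAdd (n - i) ⟨a, h⟩ := by
      ext; simp
    simp only [s, Equiv.trans_apply, this, finSumFinEquiv_symm_apply_castAdd]
    simp
  have hs2 : ∀ a : Fin n, ∀ h : i ≤ (a : ℕ),
      s a = Aᶜ.orderEmbOfFin hAc ⟨a - i, by have := a.2; omega⟩ := by
    intro a h
    have : finCongr (by omega : n = i + (n - i)) a =
        Fin.natAdd i ⟨a - i, by have := a.2; omega⟩ := by
      ext; simp; omega
    simp only [s, Equiv.trans_apply, this, finSumFinEquiv_symm_apply_natAdd]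
    simp
  have hmem : ∀ a : Fin n, (σ (s a) : ℕ) < i ↔ (a : ℕ) < i := by
    intro a
    constructor
    · intro h
      by_contra hc
      have h1 := Finset.orderEmbOfFin_mem Aᶜ hAc ⟨a - i, by have := a.2; omega⟩
      rw [← hs2 a (not_lt.mp hc)] at h1
      simp [A] at h1
      omega
    · intro h
      have h1 := Finset.orderEmbOfFin_mem A hA ⟨a, h⟩
      rw [← hs1 a h] at h1
      simpa [A] using h1
  refine ⟨s⁻¹, ?_, s⁻¹ * σ⁻¹, ?_, by group⟩
  · simp only [unshuffles, Finset.mem_filter, Finset.mem_univ, true_and, inv_inv]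
    intro a b hab hc
    have hab' : (a : ℕ) < b := hab
    rcases hc with hc | hc
    · rw [hs1 a (lt_trans hab hc), hs1 b hc]
      simpa using hab
    · rw [hs2 a hc, hs2 b (hc.trans hab'.le)]
      simp only [OrderEmbedding.lt_iff_lt, Fin.mk_lt_mk]
      omega
  · have : Young i (σ * s) := hmem
    have h2 := this.inv
    rwa [mul_inv_rev] at h2

theorem sum_unshuffles_mul {X : Type*} [AddCommMonoid X] {n i : ℕ} (hi : i ≤ n)
    (f : Perm (Fin n) → X) (hf : ∀ ρ σ, Young i ρ → f (ρ * σ) = f σ) (τ : Perm (Fin n)) :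
    ∑ σ ∈ unshuffles n i, f (σ * τ) = ∑ σ ∈ unshuffles n i, f σ := by
  choose N hN R hR hNR using fun σ : Perm (Fin n) => exists_unshuffle hi σ
  refine Finset.sum_bij' (fun σ _ => N (σ * τ)) (fun σ _ => N (σ * τ⁻¹))
    (fun σ _ => hN _) (fun σ _ => hN _) ?_ ?_ ?_
  · intro σ hσ
    apply unshuffle_unique hσ (hN _) ((hR (N (σ * τ) * τ⁻¹)).mul (hR (σ * τ)))
    rw [hNR (N (σ * τ) * τ⁻¹), hNR (σ * τ)]
    group
  · intro σ hσ
    apply unshuffle_unique hσ (hN _) ((hR (N (σ * τ⁻¹) * τ)).mul (hR (σ * τ⁻¹)))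
    rw [hNR (N (σ * τ⁻¹) * τ), hNR (σ * τ⁻¹)]
    group
  · intro σ hσ
    rw [hNR (σ * τ), hf _ _ (hR _)]

/-- A permutation in a Young subgroup is a partial composite. -/
theorem Young.exists_block {i j n : ℕ} (hj : 0 < j) (hn : j + i = n + 1) (k : Type u) [CommRing k]
    {ρ : Perm (Fin n)} (h : Young i ρ) :
    ∃ (α : Perm (Fin j)) (β : Perm (Fin i)), α ⟨0, hj⟩ = ⟨0, hj⟩ ∧
      IsBlockPerm hn ⟨0, hj⟩ α β ρ ∧ psign k ρ = psign k α * psign k β := by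
  obtain ⟨l, rfl⟩ : ∃ l, j = 1 + l := ⟨j - 1, by omega⟩
  obtain rfl : n = i + l := by omega
  let ρ' : Perm (Fin i ⊕ Fin l) := finSumFinEquiv.trans (ρ.trans finSumFinEquiv.symm)
  have hρ' : ∀ x, finSumFinEquiv (ρ' x) = ρ (finSumFinEquiv x) := by intro x; simp [ρ']
  have hmaps : Set.MapsTo ρ' (Set.range Sum.inl) (Set.range Sum.inl) := by
    rintro _ ⟨a, rfl⟩
    have h1 := (h (finSumFinEquiv (Sum.inl a))).2 (by simp)
    rw [← hρ'] at h1
    rcases hx : ρ' (Sum.inl a) with b | b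
    · exact ⟨b, rfl⟩
    · rw [hx] at h1; simp at h1
  obtain ⟨⟨β, γ⟩, hβγ⟩ := Perm.mem_sumCongrHom_range_of_perm_mapsTo_inl hmaps
  have hβ : ∀ a : Fin i, ρ (Fin.castAdd l a) = Fin.castAdd l (β a) := by
    intro a
    have := hρ' (Sum.inl a)
    rw [← hβγ] at this
    simpa using this.symm
  have hγ : ∀ a : Fin l, ρ (Fin.natAdd i a) = Fin.natAdd i (γ a) := by
    intro a
    have := hρ' (Sum.inr a)
    rw [← hβγ] at this
    simpa using this.symm
  let α' : Perm (Fin 1 ⊕ Fin l) := Perm.sumCongr 1 γ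
  let α : Perm (Fin (1 + l)) := finSumFinEquiv.symm.trans (α'.trans finSumFinEquiv)
  have hα0 : α ⟨0, hj⟩ = ⟨0, hj⟩ := by
    have : (⟨0, hj⟩ : Fin (1 + l)) = Fin.castAdd l 0 := by ext; simp
    simp only [α, Equiv.trans_apply, this, finSumFinEquiv_symm_apply_castAdd]
    simp [α']
  have hα1 : ∀ a : Fin l, α (Fin.natAdd 1 a) = Fin.natAdd 1 (γ a) := by
    intro a
    simp only [α, Equiv.trans_apply, finSumFinEquiv_symm_apply_natAdd]
    simp [α']
  refine ⟨α, β, hα0, ⟨?_, ?_⟩, ?_⟩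
  · intro a
    have h1 : ∀ a : Fin i, innerInput hn (⟨0, hj⟩ : Fin (1 + l)) a = Fin.castAdd l a := by
      intro a; ext; simp [innerInput]
    rw [hα0, h1, h1, hβ]
  · intro x hx
    have hx0 : (x : ℕ) ≠ 0 := fun e => hx (Fin.ext e)
    obtain ⟨a, rfl⟩ : ∃ a : Fin l, x = Fin.natAdd 1 a :=
      ⟨⟨x - 1, by have := x.2; omega⟩, by ext; simp; omega⟩
    have h1 : ∀ (a : Fin l) (y : Fin (1 + l)) (hy : y = ⟨0, hj⟩) (z : Fin (1 + l))
        (hz : z = Fin.natAdd 1 a) (h : z ≠ y), outerInput hn y z h = Fin.natAdd i a := by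
      rintro a _ rfl _ rfl h
      ext
      simp only [outerInput]
      rw [dif_neg (by simp)]
      simp
      omega
    rw [h1 a _ rfl _ rfl, h1 (γ a) _ hα0 _ (hα1 a), hγ]
  · have e1 : Perm.sign ρ = Perm.sign ρ' := by
      have : ρ' = (finSumFinEquiv (m := i) (n := l)).permCongr.symm ρ := by
        ext x; simp [ρ', Equiv.permCongr_def]
      rw [this]
      simp
    have e2 : Perm.sign α = Perm.sign α' := by
      have : α = (finSumFinEquiv (m := 1) (n := l)).permCongr α' := by
        ext x; simp [α, Equiv.permCongr_def]
      rw [this]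
      simp
    rw [← hβγ] at e1
    simp only [psign, e1, e2, α']
    simp [mul_comm]

theorem ellSum_act (k : Type u) [CommRing k] (N : ℕ∞) {i j n : ℕ} {p : ℤ} (hj : 0 < j)
    (hn : j + i = n + 1) (hp : ((j : ℤ) - 1) + ((i : ℤ) - 1) = p) (τ : Perm (Fin n)) :
    InfComp.act τ (ellSum k N hj hn hp) = psign k τ • ellSum k N hj hn hp := by
  have key := sum_unshuffles_mul (show i ≤ n by omega) (fun σ : Perm (Fin n) => psign k σ •
    InfComp.mk hn hp ⟨0, hj⟩ (ell k N j ((j : ℤ) - 1)) (ell k N i ((i : ℤ) - 1)) σ) (by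
      intro ρ σ hρ
      obtain ⟨α, β, h0, hb, hs⟩ := hρ.exists_block hj hn k
      have h1 := InfComp.mk_equivariant hn hp ⟨0, hj⟩ α β ρ hb
        (ell k N j ((j : ℤ) - 1)) (ell k N i ((i : ℤ) - 1)) σ
      rw [h0] at h1
      rw [← h1]
      have h2 := InfComp.mk_smul_left hn hp ⟨0, hj⟩ (psign k α) (ell k N j ((j : ℤ) - 1))
        (psign k β • ell k N i ((i : ℤ) - 1)) σ
      have h3 := InfComp.mk_smul_right hn hp ⟨0, hj⟩ (psign k β) (ell k N j ((j : ℤ) - 1))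
        (ell k N i ((i : ℤ) - 1)) σ
      have h4 : InfComp.mk hn hp ⟨0, hj⟩
          ((lieKMod k N).act α (ell k N j ((j : ℤ) - 1)))
          ((lieKMod k N).act β (ell k N i ((i : ℤ) - 1))) σ = psign k α • psign k β •
          InfComp.mk hn hp ⟨0, hj⟩ (ell k N j ((j : ℤ) - 1)) (ell k N i ((i : ℤ) - 1)) σ := by
        rw [← h3, ← h2]; rfl
      rw [h4]
      rw [psign_mul, hs, smul_smul, smul_smul]
      congr 1
      linear_combination psign k σ * psign k β * psign k β * psign_mul_self k α +
        psign k σ * psign_mul_self k β) τ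
  simp only [ellSum, map_sum, map_smul, InfComp.act_mk]
  rw [← key, Finset.smul_sum]
  refine Finset.sum_congr rfl fun σ _ => ?_
  rw [smul_smul, psign_mul, mul_comm (psign k σ), ← mul_assoc, psign_mul_self, one_mul]

theorem ellDecomp_act (k : Type u) [CommRing k] (N : ℕ∞) {n : ℕ} {p : ℤ} (g : KGen N n p)
    (σ : Perm (Fin n)) :
    InfComp.act σ (ellDecomp k N g) = psign k σ • ellDecomp k N g := by
  rw [ellDecomp, map_sum, Finset.smul_sum]
  refine Finset.sum_congr rfl fun i _ => ?_
  split_ifs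
  · rw [map_smul, ellSum_act, smul_comm]
  · rw [map_zero, smul_zero]

theorem lift_ellDecomp_act (k : Type u) [CommRing k] (N : ℕ∞) {n : ℕ} {p : ℤ} (σ : Perm (Fin n))
    (x : KGen N n p →₀ k) :
    Finsupp.lift (InfComp (lieKMod k N) n p) k _ (ellDecomp k N) (psign k σ • x) =
      InfComp.act σ (Finsupp.lift (InfComp (lieKMod k N) n p) k _ (ellDecomp k N) x) := by
  induction x using Finsupp.induction_linear with
  | zero => simp
  | add f g hf hg => rw [smul_add, map_add, map_add, hf, hg, map_add]
  | single g c =>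
    have h : Finsupp.lift (InfComp (lieKMod k N) n p) k _ (ellDecomp k N) (Finsupp.single g c) =
        c • ellDecomp k N g := by simp
    rw [map_smul, h, map_smul, ellDecomp_act, smul_comm]

/-- The Koszul dual cooperad of the Lie operad (more precisely its coaugmentation coideal) in
arities at most `N`. It is a subcooperad of the one with `N = ⊤`. -/
def lieK (k : Type u) [CommRing k] (N : ℕ∞) : PreDGCooperad.{u, u} k where
  toSMod := lieKMod k N
  d _ := 0
  d_act h σ x := by simp
  decomp := Finsupp.lift (InfComp (lieKMod k N) _ _) k _ (ellDecomp k N)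
  decomp_act σ x := lift_ellDecomp_act k N σ x

/-! ### The resolution of the Koszul dual cooperad of the Lie operad -/

/-- The generators `ℓ_n`, `ℓ_{n;i}`, `ℓ_{n;i,j}`, `ℓ_{n;i,j,l}` of the resolution, indexed by arity
and degree. -/
inductive DGen : ℕ → ℤ → Type
  | l2 : DGen 2 1
  | l2_1 : DGen 2 2
  | l2_11 : DGen 2 3
  | l2_111 : DGen 2 4
  | l3 : DGen 3 2
  | l3_1 : DGen 3 3
  | l3_2 : DGen 3 3
  | l3_11 : DGen 3 4
  | l3_12 : DGen 3 4
  | l3_22 : DGen 3 4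
  | l4 : DGen 4 3
  | l4_1 : DGen 4 4
  | l4_2 : DGen 4 4
  | l4_3 : DGen 4 4
  | l5 : DGen 5 4

/-- The free graded `𝕊`-module on the generators, with basis the elements `g^σ`. -/
def lieDMod (k : Type u) [CommRing k] : SMod.{u, u} k where
  carrier n p := (DGen n p × Perm (Fin n)) →₀ k
  act τ := Finsupp.lmapDomain k k fun x => (x.1, x.2 * τ)
  act_one x := by
    simp only [mul_one, Finsupp.lmapDomain_apply]
    exact Finsupp.mapDomain_id
  act_mul σ τ x := by
    simp only [Finsupp.lmapDomain_apply, ← Finsupp.mapDomain_comp]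
    congr 1

/-- The equivariant extension of a map defined on the generators, for a right action `A` of the
symmetric group on the target. -/
def freeExt {k : Type u} [CommRing k] {X : Type*} [AddCommGroup X] [Module k X] {n : ℕ} {p : ℤ}
    (A : Perm (Fin n) → X →ₗ[k] X) (f : DGen n p → X) :
    ((DGen n p × Perm (Fin n)) →₀ k) →ₗ[k] X :=
  Finsupp.lift X k _ fun x => A x.2 (f x.1)

theorem freeExt_act {k : Type u} [CommRing k] {X : Type*} [AddCommGroup X] [Module k X] {n : ℕ}
    {p : ℤ} (A : Perm (Fin n) → X →ₗ[k] X) (hA : ∀ σ τ x, A (σ * τ) x = A τ (A σ x))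
    (f : DGen n p → X) (τ : Perm (Fin n)) (x : (DGen n p × Perm (Fin n)) →₀ k) :
    freeExt A f (Finsupp.mapDomain (fun x => (x.1, x.2 * τ)) x) = A τ (freeExt A f x) := by
  induction x using Finsupp.induction_linear with
  | zero => simp
  | add g h hg hh => rw [Finsupp.mapDomain_add, map_add, map_add, map_add, hg, hh]
  | single y c => simp [freeExt, Finsupp.mapDomain_single, hA]

section Resolution

variable (k : Type u) [CommRing k]

/-- The element `g^σ`. The degree is given up to a proof of equality. -/
def gEl {n : ℕ} {p q : ℤ} (h : p = q) (g : DGen n p) (σ : Perm (Fin n)) :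
    (lieDMod k).carrier n q :=
  Finsupp.single (h ▸ g, σ) 1

/-- The permutation of the inputs `0, …, n - 1` given by a cycle. -/
abbrev cyc {n : ℕ} (l : List (Fin n)) : Perm (Fin n) := l.formPerm

/-- The internal differential on the generators. -/
def bdGen : ∀ {n : ℕ} {p q : ℤ}, q + 1 = p → DGen n p → (lieDMod k).carrier n q
  | _, _, _, _, .l2 => 0
  | _, _, _, h, .l2_1 => -gEl k (by omega) .l2 1 - gEl k (by omega) .l2 (cyc [0, 1])
  | _, _, _, h, .l2_11 => -gEl k (by omega) .l2_1 1 + gEl k (by omega) .l2_1 (cyc [0, 1])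
  | _, _, _, h, .l2_111 => -gEl k (by omega) .l2_11 1 - gEl k (by omega) .l2_11 (cyc [0, 1])
  | _, _, _, _, .l3 => 0
  | _, _, _, h, .l3_1 => -gEl k (by omega) .l3 1 - gEl k (by omega) .l3 (cyc [0, 1])
  | _, _, _, h, .l3_2 => -gEl k (by omega) .l3 1 - gEl k (by omega) .l3 (cyc [1, 2])
  | _, _, _, h, .l3_11 => -gEl k (by omega) .l3_1 1 + gEl k (by omega) .l3_1 (cyc [0, 1])
  | _, _, _, h, .l3_12 =>
      gEl k (by omega) .l3_1 1 - gEl k (by omega) .l3_2 (cyc [0, 1])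
      + gEl k (by omega) .l3_1 (cyc [0, 2, 1]) - gEl k (by omega) .l3_2 1
      + gEl k (by omega) .l3_1 (cyc [1, 2]) - gEl k (by omega) .l3_2 (cyc [0, 1, 2])
  | _, _, _, h, .l3_22 => -gEl k (by omega) .l3_2 1 + gEl k (by omega) .l3_2 (cyc [1, 2])
  | _, _, _, _, .l4 => 0
  | _, _, _, h, .l4_1 => -gEl k (by omega) .l4 1 - gEl k (by omega) .l4 (cyc [0, 1])
  | _, _, _, h, .l4_2 => -gEl k (by omega) .l4 1 - gEl k (by omega) .l4 (cyc [1, 2])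
  | _, _, _, h, .l4_3 => -gEl k (by omega) .l4 1 - gEl k (by omega) .l4 (cyc [2, 3])
  | _, _, _, _, .l5 => 0

/-- The element `(g ⊗_i g')^σ` for generators `g`, `g'`; here `i` is counted from `0`. -/
def tEl {m n r : ℕ} {p q s : ℤ} (g : DGen m p) (i : Fin m) (g' : DGen n q) (σ : Perm (Fin r))
    (hm : m + n = r + 1 := by decide) (hp : p + q = s := by decide) : InfComp (lieDMod k) r s :=
  InfComp.mk hm hp i (gEl k rfl g 1) (gEl k rfl g' 1) σ

/-- The infinitesimal decomposition map on the generators. -/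
def decGen : ∀ {n : ℕ} {p : ℤ}, DGen n p → InfComp (lieDMod k) n p
  | _, _, .l2 => 0
  | _, _, .l2_1 => 0
  | _, _, .l2_11 => 0
  | _, _, .l2_111 => 0
  | _, _, .l3 =>
      -tEl k .l2 0 .l2 1 + tEl k .l2 1 .l2 1 - tEl k .l2 1 .l2 (cyc [0, 1])
  | _, _, .l3_1 => tEl k .l2 0 .l2_1 1
  | _, _, .l3_2 =>
      -tEl k .l2_1 0 .l2 1 - tEl k .l2 1 .l2_1 1 - tEl k .l2_1 1 .l2 (cyc [0, 1])
  | _, _, .l3_11 => -tEl k .l2 0 .l2_11 1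
  | _, _, .l3_12 =>
      -tEl k .l2_1 0 .l2_1 1 - tEl k .l2_1 1 .l2_1 1 - tEl k .l2_1 1 .l2_1 (cyc [0, 1])
      + tEl k .l2_11 1 .l2 (cyc [0, 2, 1])
  | _, _, .l3_22 =>
      -tEl k .l2_11 0 .l2 1 + tEl k .l2 1 .l2_11 1 - tEl k .l2_11 1 .l2 (cyc [0, 1])
  | _, _, .l4 =>
      tEl k .l2 0 .l3 1
      + tEl k .l2 1 .l3 1 - tEl k .l2 1 .l3 (cyc [0, 1]) + tEl k .l2 1 .l3 (cyc [0, 1, 2])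
      + tEl k .l3 0 .l2 1
      - tEl k .l3 1 .l2 1 + tEl k .l3 1 .l2 (cyc [0, 1])
      + tEl k .l3 2 .l2 1 - tEl k .l3 2 .l2 (cyc [1, 2]) + tEl k .l3 2 .l2 (cyc [0, 2, 1])
  | _, _, .l4_1 =>
      -tEl k .l2 0 .l3_1 1 - tEl k .l2 1 .l3_1 (cyc [0, 1, 2])
      + tEl k .l3 0 .l2_1 1 + tEl k .l3_1 2 .l2 1
  | _, _, .l4_2 =>
      -tEl k .l2 0 .l3_2 1 - tEl k .l2 1 .l3_1 1
      + tEl k .l3_1 0 .l2 1 + tEl k .l3_1 1 .l2 (cyc [0, 1])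
      - tEl k .l3 1 .l2_1 1 + tEl k .l3_1 2 .l2 (cyc [0, 2, 1])
  | _, _, .l4_3 =>
      tEl k .l2_1 1 .l3 (cyc [0, 1, 2]) - tEl k .l2 1 .l3_2 1 + tEl k .l2 1 .l3_2 (cyc [0, 1])
      + tEl k .l2_1 0 .l3 1 + tEl k .l3_2 0 .l2 1
      - tEl k .l3_2 2 .l2 (cyc [1, 2]) + tEl k .l3_2 2 .l2 (cyc [0, 2, 1])
      + tEl k .l3 2 .l2_1 1 - tEl k .l3_2 1 .l2 1 + tEl k .l3_2 1 .l2 (cyc [0, 1])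
  | _, _, .l5 =>
      -tEl k .l2 0 .l4 1
      + tEl k .l2 1 .l4 1 - tEl k .l2 1 .l4 (cyc [0, 1]) + tEl k .l2 1 .l4 (cyc [0, 1, 2])
      - tEl k .l2 1 .l4 (cyc [0, 1, 2, 3])
      + tEl k .l3 0 .l3 1
      + tEl k .l3 1 .l3 1 - tEl k .l3 1 .l3 (cyc [0, 1]) + tEl k .l3 1 .l3 (cyc [0, 1, 2])
      + tEl k .l3 2 .l3 1 - tEl k .l3 2 .l3 (cyc [1, 2]) + tEl k .l3 2 .l3 (cyc [1, 2, 3])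
      + tEl k .l3 2 .l3 (cyc [0, 2, 1]) - tEl k .l3 2 .l3 (cyc [0, 2, 3, 1])
      + tEl k .l3 2 .l3 (cyc [0, 2] * cyc [1, 3])
      - tEl k .l4 0 .l2 1
      + tEl k .l4 1 .l2 1 - tEl k .l4 1 .l2 (cyc [0, 1])
      - tEl k .l4 2 .l2 1 + tEl k .l4 2 .l2 (cyc [1, 2]) - tEl k .l4 2 .l2 (cyc [0, 2, 1])
      + tEl k .l4 3 .l2 1 - tEl k .l4 3 .l2 (cyc [2, 3]) + tEl k .l4 3 .l2 (cyc [1, 3, 2])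
      - tEl k .l4 3 .l2 (cyc [0, 3, 2, 1])

/-- The `𝕊`-free resolution, in low degrees, of the Koszul dual cooperad of the Lie operad (more
precisely its coaugmentation coideal). -/
def lieD : PreDGCooperad.{u, u} k where
  toSMod := lieDMod k
  d h := freeExt (fun σ => (lieDMod k).act σ) (bdGen k h)
  d_act _ σ x := freeExt_act _ (lieDMod k).act_mul _ σ x
  decomp := freeExt InfComp.act (decGen k)
  decomp_act σ x := freeExt_act _ InfComp.act_mul _ σ x

/-- The morphism `ψ` on generators: `ℓ_n ↦ ℓ_n`, and the other generators are sent to `0`. -/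
def psiGen (N : ℕ∞) : ∀ {n : ℕ} {p : ℤ}, DGen n p → (lieK k N).carrier n p
  | _, _, .l2 => ell k N 2 1
  | _, _, .l3 => ell k N 3 2
  | _, _, .l4 => ell k N 4 3
  | _, _, .l5 => ell k N 5 4
  | _, _, _ => 0

/-- The morphism `ψ` with values in the Koszul dual cooperad of the Lie operad, cut off at arity
`N`: `ψ(ℓ_n^σ) = (-1)^{|σ|} ℓ_n`. -/
def psi (N : ℕ∞) : SHom (lieD k).toSMod (lieK k N).toSMod where
  toFun := freeExt (fun σ => (lieK k N).act σ) (psiGen k N)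
  map_act σ x := freeExt_act _ (lieK k N).act_mul _ σ x

/-- The inclusion of the part of arity at most `N` of the Koszul dual cooperad of the Lie
operad. -/
def lieKIncl (N : ℕ∞) : SHom (lieK k N).toSMod (lieK k ⊤).toSMod where
  toFun := Finsupp.lmapDomain k k fun g => ⟨g.two_le, le_top, g.deg⟩
  map_act σ x := map_smul (Finsupp.lmapDomain k k _) (psign k σ) x

end Resolution

/-! ### The endomorphism operad of a chain complex -/

/-- A `ℤ`-graded chain complex of `k`-modules, given by its total module with the homogeneous
submodules and the differential. -/
structure DGMod (k : Type u) [CommRing k] where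
  carrier : Type w
  [acg : AddCommGroup carrier]
  [mod : Module k carrier]
  gr : ℤ → Submodule k carrier
  [dec : DirectSum.Decomposition gr]
  d : carrier →ₗ[k] carrier
  d_mem : ∀ p, ∀ x ∈ gr p, d x ∈ gr (p - 1)
  d_d : ∀ x, d (d x) = 0

attribute [instance] DGMod.acg DGMod.mod DGMod.dec

/-- A complex `L_0 ← L_1 ← L_2`. -/
def DGMod.IsThreeTerm {k : Type u} [CommRing k] (V : DGMod.{u, w} k) : Prop :=
  ∀ p, p ≠ 0 → p ≠ 1 → p ≠ 2 → V.gr p = ⊥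

namespace DGMod

variable {k : Type u} [CommRing k] (V : DGMod.{u, w} k)

/-- The linear map which is multiplication by `c p` in degree `p`. -/
def scale (c : ℤ → k) : V.carrier →ₗ[k] V.carrier :=
  DirectSum.toModule k ℤ V.carrier (fun p => c p • (V.gr p).subtype) ∘ₗ
    (DirectSum.decomposeLinearEquiv V.gr).toLinearMap

theorem scale_apply (c : ℤ → k) {p : ℤ} {x : V.carrier} (hx : x ∈ V.gr p) :
    V.scale c x = c p • x := by
  have h : DirectSum.decompose V.gr x = DirectSum.of (fun i => V.gr i) p ⟨x, hx⟩ :=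
    DirectSum.decompose_of_mem V.gr hx
  have h' : DirectSum.decomposeLinearEquiv V.gr x = DirectSum.lof k ℤ (fun i => V.gr i) p ⟨x, hx⟩ := h
  simp only [scale, LinearMap.comp_apply, LinearEquiv.coe_coe]
  rw [h', DirectSum.toModule_lof]
  rfl

theorem scale_mem (c : ℤ → k) {p : ℤ} {x : V.carrier} (hx : x ∈ V.gr p) :
    V.scale c x ∈ V.gr p := by
  rw [V.scale_apply c hx]
  exact Submodule.smul_mem _ _ hx

/-- The projection to the part of odd degree, or to the part of even degree. -/
def parity (odd : Prop) [Decidable odd] : V.carrier →ₗ[k] V.carrier :=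
  V.scale fun p => if (Odd p ↔ odd) then 1 else 0

/-- `x ↦ (-1)^{q |x|} x`. -/
def signMap (q : ℤ) : V.carrier →ₗ[k] V.carrier := V.scale fun p => ksign k (q * p)

/-- The multilinear maps `V^{⊗n} → V` of degree `p`. -/
def multi (n : ℕ) (p : ℤ) :
    Submodule k (MultilinearMap k (fun _ : Fin n => V.carrier) V.carrier) where
  carrier := {f | ∀ (a : Fin n → ℤ) (v : Fin n → V.carrier), (∀ i, v i ∈ V.gr (a i)) →
    f v ∈ V.gr (∑ i, a i + p)}
  add_mem' hf hg a v hv := Submodule.add_mem _ (hf a v hv) (hg a v hv)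
  zero_mem' _ _ _ := Submodule.zero_mem _
  smul_mem' c _ hf a v hv := Submodule.smul_mem _ c (hf a v hv)

/-- The Koszul sign of the permutation `(v_1, …, v_n) ↦ (v_{σ⁻¹(1)}, …, v_{σ⁻¹(n)})` when `v_i` is
of odd degree for `i ∈ S` and of even degree for `i ∉ S`. -/
def koszulSign (k : Type u) [CommRing k] {n : ℕ} (σ : Perm (Fin n)) (S : Finset (Fin n)) : k :=
  ∏ i ∈ S, ∏ j ∈ S, if i < j ∧ σ j < σ i then -1 else 1

/-- `μ^σ(v_1, …, v_n) = ε(σ; v_1, …, v_n) μ(v_{σ⁻¹(1)}, …, v_{σ⁻¹(n)})` for homogeneous `v_i`; see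
`permute_apply`. -/
def permute {n : ℕ} (σ : Perm (Fin n)) :
    MultilinearMap k (fun _ : Fin n => V.carrier) V.carrier →ₗ[k]
      MultilinearMap k (fun _ : Fin n => V.carrier) V.carrier where
  toFun f := ∑ S : Finset (Fin n), koszulSign k σ S •
    (f.domDomCongr σ⁻¹).compLinearMap fun i => V.parity (i ∈ S)
  map_add' f g := by
    rw [← Finset.sum_add_distrib]
    refine Finset.sum_congr rfl fun S _ => ?_
    rw [← smul_add]
    rfl
  map_smul' c f := by
    rw [Finset.smul_sum]
    refine Finset.sum_congr rfl fun S _ => ?_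
    rw [smul_comm]
    rfl

theorem permute_apply {n : ℕ} (σ : Perm (Fin n))
    (f : MultilinearMap k (fun _ : Fin n => V.carrier) V.carrier) (a : Fin n → ℤ)
    (v : Fin n → V.carrier) (hv : ∀ i, v i ∈ V.gr (a i)) :
    V.permute σ f v =
      (∏ i, ∏ j, if i < j ∧ σ j < σ i then ksign k (a i * a j) else 1) •
        f fun i => v (σ⁻¹ i) := by
  classical
  have hpar : ∀ (S : Finset (Fin n)) (i : Fin n),
      V.parity (i ∈ S) (v i) = if (Odd (a i) ↔ i ∈ S) then v i else 0 := by
    intro S i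
    rw [parity, V.scale_apply _ (hv i)]
    split_ifs <;> simp
  simp only [permute, LinearMap.coe_mk, AddHom.coe_mk, sum_apply,
    smul_apply, MultilinearMap.compLinearMap_apply,
    MultilinearMap.domDomCongr_apply, hpar]
  rw [Finset.sum_eq_single (Finset.univ.filter fun i => Odd (a i))]
  · congr 1
    · rw [koszulSign, Finset.prod_filter]
      refine Finset.prod_congr rfl fun i _ => ?_
      split_ifs with hi
      · rw [Finset.prod_filter]
        refine Finset.prod_congr rfl fun j _ => ?_
        by_cases hj : Odd (a j)
        · have : Odd (a i * a j) := hi.mul hj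
          simp [hj, ksign, Int.negOnePow_odd _ this]
        · have : Even (a i * a j) := (Int.not_odd_iff_even.mp hj).mul_left _
          simp [hj, ksign, Int.negOnePow_even _ this]
      · symm
        apply Finset.prod_eq_one
        intro j _
        have : Even (a i * a j) := (Int.not_odd_iff_even.mp hi).mul_right _
        simp [ksign, Int.negOnePow_even _ this]
    · congr 1
      funext i
      simp
  · intro S _ hS
    obtain ⟨i, hi⟩ : ∃ i, ¬ (Odd (a i) ↔ i ∈ S) := by
      by_contra hcon
      push Not at hcon
      exact hS (by ext i; simp [hcon i])
    rw [f.map_coord_zero (σ i) (by simp [hi]), smul_zero]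
  · simp

theorem permute_mem {n : ℕ} {p : ℤ} (σ : Perm (Fin n))
    {f : MultilinearMap k (fun _ : Fin n => V.carrier) V.carrier} (hf : f ∈ V.multi n p) :
    V.permute σ f ∈ V.multi n p := by
  intro a v hv
  rw [V.permute_apply σ f a v hv]
  apply Submodule.smul_mem
  have := hf (fun i => a (σ⁻¹ i)) (fun i => v (σ⁻¹ i)) (fun i => hv _)
  rwa [Equiv.sum_comp σ⁻¹ a] at this

/-- The inputs of `μ` in `μ ∘_i ν`, where `ν` has degree `q`. -/
def insertArg {m n r : ℕ} (h : m + n = r + 1) (i : Fin m) (q : ℤ)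
    (g : MultilinearMap k (fun _ : Fin n => V.carrier) V.carrier) (v : Fin r → V.carrier)
    (x : Fin m) : V.carrier :=
  if hx : x = i then g fun j => v (innerInput h i j)
  else if x < i then V.signMap q (v (outerInput h i x hx))
  else v (outerInput h i x hx)

theorem input_cases {m n r : ℕ} (h : m + n = r + 1) (i : Fin m) (y : Fin r) :
    (∃ j, y = innerInput h i j) ∨ ∃ x, ∃ hx : x ≠ i, y = outerInput h i x hx := by
  have hy := y.2
  have hi := i.2
  by_cases h1 : (y : ℕ) < i
  · right
    refine ⟨⟨y, by omega⟩, fun e => by simp [← e] at h1, ?_⟩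
    ext
    simp [outerInput, Fin.lt_def, h1]
  · by_cases h2 : (y : ℕ) < i + n
    · left
      exact ⟨⟨y - i, by omega⟩, by ext; simp [innerInput]; omega⟩
    · right
      refine ⟨⟨y + 1 - n, by omega⟩, fun e => ?_, ?_⟩
      · have := congrArg Fin.val e
        simp at this
        omega
      · ext
        simp only [outerInput, Fin.lt_def]
        rw [dif_neg (by omega)]
        simp
        omega

theorem innerInput_injective {m n r : ℕ} (h : m + n = r + 1) (i : Fin m) :
    Function.Injective (innerInput h i) := by
  intro j j' e
  have := congrArg Fin.val e
  simp only [innerInput] at this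
  ext
  omega

theorem outerInput_inj {m n r : ℕ} (h : m + n = r + 1) (i x x' : Fin m) (hx : x ≠ i)
    (hx' : x' ≠ i) (e : outerInput h i x hx = outerInput h i x' hx') : x = x' := by
  have := congrArg Fin.val e
  have h1 : (x : ℕ) ≠ i := fun e => hx (Fin.ext e)
  have h2 : (x' : ℕ) ≠ i := fun e => hx' (Fin.ext e)
  simp only [outerInput, Fin.lt_def] at this
  ext
  split_ifs at this <;> simp at this <;> omega

theorem innerInput_ne_outerInput {m n r : ℕ} (h : m + n = r + 1) (i x : Fin m) (hx : x ≠ i)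
    (j : Fin n) : innerInput h i j ≠ outerInput h i x hx := by
  intro e
  have := congrArg Fin.val e
  have h1 : (x : ℕ) ≠ i := fun e => hx (Fin.ext e)
  have h2 := j.2
  simp only [outerInput, innerInput, Fin.lt_def] at this
  split_ifs at this <;> simp at this <;> omega

theorem insertArg_update_inner {m n r : ℕ} (h : m + n = r + 1) (i : Fin m) (q : ℤ)
    (g : MultilinearMap k (fun _ : Fin n => V.carrier) V.carrier) (v : Fin r → V.carrier)
    (j : Fin n) (c : V.carrier) :
    V.insertArg h i q g (Function.update v (innerInput h i j) c) =
      Function.update (V.insertArg h i q g v) i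
        (g (Function.update (fun j => v (innerInput h i j)) j c)) := by
  funext x
  by_cases hx : x = i
  · subst hx
    simp only [insertArg, dif_pos, Function.update_self]
    congr 1
    funext j'
    by_cases hj : j' = j
    · subst hj; simp
    · rw [Function.update_of_ne hj, Function.update_of_ne]
      exact fun e => hj (innerInput_injective h x e)
  · rw [Function.update_of_ne hx]
    have : outerInput h i x hx ≠ innerInput h i j := (innerInput_ne_outerInput h i x hx j).symm
    simp only [insertArg, dif_neg hx, Function.update_of_ne this]

theorem insertArg_update_outer {m n r : ℕ} (h : m + n = r + 1) (i : Fin m) (q : ℤ)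
    (g : MultilinearMap k (fun _ : Fin n => V.carrier) V.carrier) (v : Fin r → V.carrier)
    (x : Fin m) (hx : x ≠ i) (c : V.carrier) :
    V.insertArg h i q g (Function.update v (outerInput h i x hx) c) =
      Function.update (V.insertArg h i q g v) x (if x < i then V.signMap q c else c) := by
  funext y
  by_cases hy : y = i
  · subst hy
    rw [Function.update_of_ne hx.symm]
    simp only [insertArg, dif_pos]
    congr 1
    funext j
    rw [Function.update_of_ne (innerInput_ne_outerInput h y x hx j)]
  · by_cases hyx : y = x
    · subst hyx
      simp [insertArg, hx]
    · rw [Function.update_of_ne hyx]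
      have : outerInput h i y hy ≠ outerInput h i x hx :=
        fun e => hyx (outerInput_inj h i y x hy hx e)
      simp only [insertArg, dif_neg hy, Function.update_of_ne this]

/-- `(μ ∘_i ν)(v_1, …) = (-1)^{|ν|(|v_1| + … + |v_{i-1}|)} μ(v_1, …, v_{i-1}, ν(v_i, …), …)`,
where `ν` has degree `q`. -/
def insertAt {m n r : ℕ} (h : m + n = r + 1) (i : Fin m) (q : ℤ)
    (f : MultilinearMap k (fun _ : Fin m => V.carrier) V.carrier)
    (g : MultilinearMap k (fun _ : Fin n => V.carrier) V.carrier) :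
    MultilinearMap k (fun _ : Fin r => V.carrier) V.carrier :=
  MultilinearMap.mk' (fun v => f (V.insertArg h i q g v))
    (by
      intro v y c c'
      rcases input_cases h i y with ⟨j, rfl⟩ | ⟨x, hx, rfl⟩
      · simp only [insertArg_update_inner, MultilinearMap.map_update_add]
      · simp only [insertArg_update_outer]
        split_ifs <;> simp only [map_add, MultilinearMap.map_update_add])
    (by
      intro v y c c'
      rcases input_cases h i y with ⟨j, rfl⟩ | ⟨x, hx, rfl⟩
      · simp only [insertArg_update_inner, MultilinearMap.map_update_smul]
      · simp only [insertArg_update_outer]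
        split_ifs <;> simp only [map_smul, MultilinearMap.map_update_smul])

theorem insertAt_add_right {m n r : ℕ} (h : m + n = r + 1) (i : Fin m) (q : ℤ)
    (f : MultilinearMap k (fun _ : Fin m => V.carrier) V.carrier)
    (g g' : MultilinearMap k (fun _ : Fin n => V.carrier) V.carrier) :
    V.insertAt h i q f (g + g') = V.insertAt h i q f g + V.insertAt h i q f g' := by
  ext v
  have key : ∀ g₁ g₂ : MultilinearMap k (fun _ : Fin n => V.carrier) V.carrier,
      V.insertArg h i q g₁ v =
        Function.update (V.insertArg h i q g₂ v) i (g₁ fun j => v (innerInput h i j)) := by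
    intro g₁ g₂
    funext x
    by_cases hx : x = i
    · subst hx; simp [insertArg]
    · simp [insertArg, hx]
  change f (V.insertArg h i q (g + g') v) = f (V.insertArg h i q g v) + f (V.insertArg h i q g' v)
  rw [key (g + g') 0, key g 0, key g' 0, add_apply, MultilinearMap.map_update_add]

theorem insertAt_smul_right {m n r : ℕ} (h : m + n = r + 1) (i : Fin m) (q : ℤ) (c : k)
    (f : MultilinearMap k (fun _ : Fin m => V.carrier) V.carrier)
    (g : MultilinearMap k (fun _ : Fin n => V.carrier) V.carrier) :
    V.insertAt h i q f (c • g) = c • V.insertAt h i q f g := by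
  ext v
  have key : ∀ g₁ g₂ : MultilinearMap k (fun _ : Fin n => V.carrier) V.carrier,
      V.insertArg h i q g₁ v =
        Function.update (V.insertArg h i q g₂ v) i (g₁ fun j => v (innerInput h i j)) := by
    intro g₁ g₂
    funext x
    by_cases hx : x = i
    · subst hx; simp [insertArg]
    · simp [insertArg, hx]
  change f (V.insertArg h i q (c • g) v) = c • f (V.insertArg h i q g v)
  rw [key (c • g) 0, key g 0, smul_apply, MultilinearMap.map_update_smul]

theorem sum_inputs {m n r : ℕ} (h : m + n = r + 1) (i : Fin m) (a : Fin r → ℤ) (q : ℤ) :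
    ∑ x : Fin m, (if hx : x = i then ∑ j, a (innerInput h i j) + q else a (outerInput h i x hx)) =
      ∑ y, a y + q := by
  classical
  let e : Fin n ⊕ {x : Fin m // x ≠ i} ≃ Fin r := Equiv.ofBijective
    (Sum.elim (innerInput h i) fun x => outerInput h i x.1 x.2) (by
      constructor
      · rintro (j | x) (j' | x') e
        · exact congrArg _ (innerInput_injective h i e)
        · exact absurd e (innerInput_ne_outerInput h i x'.1 x'.2 j)
        · exact absurd e.symm (innerInput_ne_outerInput h i x.1 x.2 j')
        · exact congrArg _ (Subtype.ext (outerInput_inj h i x.1 x'.1 x.2 x'.2 e))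
      · intro y
        rcases input_cases h i y with ⟨j, rfl⟩ | ⟨x, hx, rfl⟩
        · exact ⟨Sum.inl j, rfl⟩
        · exact ⟨Sum.inr ⟨x, hx⟩, rfl⟩)
  rw [← Equiv.sum_comp e a, Fintype.sum_sum_type, ← Finset.add_sum_erase _ _ (Finset.mem_univ i),
    dif_pos rfl]
  have h1 : ∑ x ∈ Finset.univ.erase i,
      (if hx : x = i then ∑ j, a (innerInput h i j) + q else a (outerInput h i x hx)) =
      ∑ x : {x : Fin m // x ≠ i}, a (outerInput h i x.1 x.2) := by
    rw [← Finset.sum_subtype_of_mem (p := fun x => x ≠ i) _ (by simp)]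
    have : Finset.subtype (fun x => x ≠ i) (Finset.univ.erase i) = Finset.univ := by
      ext x; simp [x.2]
    rw [this]
    refine Finset.sum_congr rfl fun x _ => ?_
    rw [dif_neg x.2]
  rw [h1]
  change _ = ∑ j, a (innerInput h i j) + ∑ x : {x : Fin m // x ≠ i}, a (outerInput h i x.1 x.2) + q
  ring

theorem insertAt_mem {m n r : ℕ} {p q s : ℤ} (h : m + n = r + 1) (e : p + q = s) (i : Fin m)
    {f : MultilinearMap k (fun _ : Fin m => V.carrier) V.carrier}
    {g : MultilinearMap k (fun _ : Fin n => V.carrier) V.carrier}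
    (hf : f ∈ V.multi m p) (hg : g ∈ V.multi n q) : V.insertAt h i q f g ∈ V.multi r s := by
  intro a v hv
  have := hf (fun x => if hx : x = i then ∑ j, a (innerInput h i j) + q
    else a (outerInput h i x hx)) (V.insertArg h i q g v) (by
      intro x
      by_cases hx : x = i
      · simp only [insertArg, dif_pos hx]
        exact hg _ _ fun j => hv _
      · simp only [insertArg, dif_neg hx]
        split_ifs
        · exact V.scale_mem _ (hv _)
        · exact hv _)
  rw [sum_inputs, add_assoc, add_comm q p, e] at this
  exact this

/-- `∂(μ) = d ∘ μ - (-1)^{|μ|} ∑_i μ ∘ (1, …, 1, d, 1, …, 1)` for `μ` of degree `p`, with the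
Koszul sign `(-1)^{|v_1| + … + |v_{i-1}|}` in the `i`-th summand. -/
def bd {n : ℕ} (p : ℤ) : MultilinearMap k (fun _ : Fin n => V.carrier) V.carrier →ₗ[k]
    MultilinearMap k (fun _ : Fin n => V.carrier) V.carrier where
  toFun f := V.d.compMultilinearMap f - ksign k p • ∑ i : Fin n, f.compLinearMap fun x =>
    if x < i then V.signMap 1 else if x = i then V.d else LinearMap.id
  map_add' f g := by
    ext v
    simp only [sub_apply, add_apply, smul_apply,
      sum_apply, LinearMap.compMultilinearMap_apply,
      MultilinearMap.compLinearMap_apply, map_add, Finset.sum_add_distrib, smul_add]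
    abel
  map_smul' c f := by
    ext v
    simp only [sub_apply, smul_apply,
      sum_apply, LinearMap.compMultilinearMap_apply,
      MultilinearMap.compLinearMap_apply, map_smul, ← Finset.smul_sum, smul_sub, RingHom.id_apply,
      smul_comm c]

theorem bd_mem {n : ℕ} {p q : ℤ} (h : q + 1 = p)
    {f : MultilinearMap k (fun _ : Fin n => V.carrier) V.carrier} (hf : f ∈ V.multi n p) :
    V.bd p f ∈ V.multi n q := by
  classical
  intro a v hv
  apply Submodule.sub_mem
  · have := V.d_mem _ _ (hf a v hv)
    rwa [show ∑ i, a i + p - 1 = ∑ i, a i + q by omega] at this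
  · rw [smul_apply, sum_apply]
    apply Submodule.smul_mem
    apply Submodule.sum_mem
    intro i _
    have := hf (Function.update a i (a i - 1)) (fun x =>
      (if x < i then V.signMap 1 else if x = i then V.d else LinearMap.id) (v x)) (by
        intro x
        by_cases hx : x = i
        · subst hx
          simpa using V.d_mem _ _ (hv x)
        · rw [Function.update_of_ne hx]
          by_cases hlt : x < i
          · simp only [hlt, if_true]
            exact V.scale_mem _ (hv x)
          · simpa [hlt, hx] using hv x)
    have hs : ∑ x, Function.update a i (a i - 1) x = ∑ x, a x - 1 := by
      rw [Finset.sum_update_of_mem (Finset.mem_univ i), ← Finset.add_sum_erase _ _ (Finset.mem_univ i),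
        Finset.sdiff_singleton_eq_erase]
      ring
    rw [hs, show ∑ x, a x - 1 + p = ∑ x, a x + q by omega] at this
    exact this

/-- The endomorphism operad of a chain complex. -/
def endOperad : PreDGOperad.{u, w} k where
  carrier n p := V.multi n p
  act σ := (V.permute σ).restrict fun _ hf => V.permute_mem σ hf
  one := ⟨MultilinearMap.ofSubsingleton k V.carrier V.carrier (0 : Fin 1) LinearMap.id, by
    intro a v hv
    simpa using hv 0⟩
  comp {m n r p q s} h e i := LinearMap.mk₂ k
    (fun f g => ⟨V.insertAt h i q f.1 g.1, V.insertAt_mem h e i f.2 g.2⟩)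
    (fun _ _ _ => rfl) (fun _ _ _ => rfl)
    (fun f g g' => Subtype.ext (V.insertAt_add_right h i q f.1 g.1 g'.1))
    (fun c f g => Subtype.ext (V.insertAt_smul_right h i q c f.1 g.1))
  d {n p q} h := (V.bd p).restrict fun _ hf => V.bd_mem h hf

end DGMod

/-! ### Algebras -/

/-- A weak Lie 3-algebra structure on a three-term complex `V` is a structure of algebra over the
cobar construction of the resolution, that is a morphism of dg operads to the endomorphism operad
of `V`. Its structure map `λ_g` is the image of the generator `s⁻¹g`. -/
abbrev WeakLie3Structure {k : Type u} [CommRing k] (V : DGMod.{u, w} k) : Type (max u w) :=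
  DGOperadHom (cobar (lieD k)) V.endOperad

/-- An `L_∞`-algebra structure on `V`: a morphism of dg operads from the cobar construction of the
Koszul dual cooperad of the Lie operad to the endomorphism operad of `V`. On a three-term complex
these are the semi-strict Lie 3-algebra structures. -/
abbrev LInftyStructure {k : Type u} [CommRing k] (V : DGMod.{u, w} k) : Type (max u w) :=
  DGOperadHom (cobar (lieK k ⊤)) V.endOperad

/-- The generator `s⁻¹g`, where `g` is one of the generators of the resolution. -/
def dGenEl (k : Type u) [CommRing k] {n : ℕ} {p q : ℤ} (g : DGen n p) (h : q + 1 = p := by decide) :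
    (cobar (lieD k)).carrier n q :=
  sInv h (gEl k rfl g 1)

/-- The generator `s⁻¹ℓ_n` of degree `q = n - 2`. -/
def kGenEl (k : Type u) [CommRing k] (N : ℕ∞) (n : ℕ) (q : ℤ) : (cobar (lieK k N)).carrier n q :=
  sInv rfl (ell k N n (q + 1))

/-! ### The skew-symmetrization formulas -/

section Formulas

variable {k : Type u} [CommRing k] (P : PreDGOperad.{u, v} k)

/-- The partial composite `μ ∘_i ν`; here `i` is counted from `0`. -/
def pcomp {m n r : ℕ} {p q s : ℤ} (μ : P.carrier m p) (i : Fin m) (ν : P.carrier n q)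
    (h : m + n = r + 1 := by decide) (e : p + q = s := by decide) : P.carrier r s :=
  P.comp h e i μ ν

/-- `1/2 ∑_σ (-1)^{|σ|} λ_2^σ`. -/
def skew2 (l2 : P.carrier 2 0) : P.carrier 2 0 := Ring.inverse (2 : k) • P.alt l2

/-- `1/6 ∑_σ (-1)^{|σ|} λ_3^σ - 1/24 ∑_σ (-1)^{|σ|} (λ_{2;1} ∘_1 λ_2 + λ_{2;1} ∘_2 λ_2)^σ`. -/
def skew3 (l2 : P.carrier 2 0) (l2_1 : P.carrier 2 1) (l3 : P.carrier 3 1) : P.carrier 3 1 :=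
  Ring.inverse (6 : k) • P.alt l3 -
    Ring.inverse (24 : k) • P.alt (pcomp P l2_1 0 l2 + pcomp P l2_1 1 l2)

/-- `1/24 ∑_σ (-1)^{|σ|} λ_4^σ + 1/48 ∑_σ (-1)^{|σ|} (λ_{2;1} ∘_1 λ_3 - λ_{3;1} ∘_1 λ_2
+ λ_{3;2} ∘_2 λ_2 - λ_{2;1} ∘_2 λ_3 - λ_{3;1} ∘_2 λ_2 + λ_{3;2} ∘_3 λ_2)^σ`. -/
def skew4 (l2 : P.carrier 2 0) (l2_1 : P.carrier 2 1) (l3 : P.carrier 3 1)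
    (l3_1 l3_2 : P.carrier 3 2) (l4 : P.carrier 4 2) : P.carrier 4 2 :=
  Ring.inverse (24 : k) • P.alt l4 +
    Ring.inverse (48 : k) • P.alt
      (pcomp P l2_1 0 l3 - pcomp P l3_1 0 l2 + pcomp P l3_2 1 l2
        - pcomp P l2_1 1 l3 - pcomp P l3_1 1 l2 + pcomp P l3_2 2 l2)

end Formulas

end WeakLie

end

open WeakLie

/-! A morphism out of a cobar construction is determined by equivariant values on the generators,
and it commutes with the differentials as soon as it does so there. For ΩLie^¡ and ΩLie^¡_3 this
means antisymmetric operations l_n of degree n - 2 with d l_n = -J_n, where J_n (`jacobiator`) is a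
signed sum over unshuffles of composites of lower operations (`lieK_hom_isDG`). The theorem thus
reduces to identities between operations of arity at most five, together with arguments about
degrees.

The identities are verified by a calculus of formal combinations of trees with labelled inputs. A
word lists the successive graftings that build a tree; the parallel associativity law brings it to a
normal form (`wordAt_sort`). The table `dTable` and the Leibniz rule give a formal differential, and
`d_lcAt` shows that it computes the true one in every operad with a derivation whose chosen elements
obey the table (`IsModel`). The generators of ΩR form a model (`lamVal_isModel`), as do their images
under Ωψ (`ellVal_isModel`) and under a weak Lie 3-algebra structure g. One formal check of d² = 0
therefore serves for ΩR and, in arity at most four, for ΩLie^¡_3; and Ωψ commutes with d because it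
relates two models of the same table.

For Φ, the key is `sum_unshuffles_comp_alt`: since each permutation is uniquely a product of an
element of a Young subgroup and an unshuffle, the sum over unshuffles of a composite of two
alternating sums is an alternating sum of the composites at all inputs. The Jacobi identities in
arity at most four become vanishing statements modulo signed relabelling, with integer coefficients
after scaling by t = 1/48. The correction terms contain generators killed by ψ, and alternating an
antisymmetric operation multiplies it by n!, which gives both equations for Ωψ_3 ∘ Φ and Ωψ ∘ Φ.

In arity five, 6912 J_5 is exhibited as the boundary of an explicit operation of degree three
(`smul_jacobiator_skewFamily_five`). On a complex in degrees 0, 1, 2 all operations of degree at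
least three vanish, so J_5 = 0 because 6912 = 2^8 · 3^3 is invertible. The explicit element is
alternated over four labels only: alternation over all five would multiply the contribution of ℓ_5
by 120 under Ωψ, and 5 need not be invertible. For n ≥ 6, J_n itself has degree at least three, and
the same vanishing gives uniqueness of h.

All this is applied to the endomorphism operad, whose laws are proved on homogeneous elements with
Koszul exponents modulo two; its differential is a commutator with d, hence a derivation
(`hasDerivation_of_commutator`). -/

noncomputable section

namespace WeakLie

open Equiv

/-! ### Derivations on operads and the cobar construction -/

/-- An operad with a derivation of degree `-1`, which need not square to zero. -/
structure HasDerivation {k : Type u} [CommRing k] (P : PreDGOperad.{u, v} k) : Prop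
    extends IsOperad P where
  d_act : ∀ {n : ℕ} {p q : ℤ} (h : q + 1 = p) (σ : Perm (Fin n)) (x : P.carrier n p),
    P.d h (P.act σ x) = P.act σ (P.d h x)
  d_one : ∀ {q : ℤ} (h : q + 1 = 0), P.d h P.one = 0
  d_comp : ∀ {m n r : ℕ} {p q s p' q' s' : ℤ} (h : m + n = r + 1) (e : p + q = s)
    (ep : p' + 1 = p) (eq : q' + 1 = q) (es : s' + 1 = s) (e₁ : p' + q = s') (e₂ : p + q' = s')
    (i : Fin m) (μ : P.carrier m p) (ν : P.carrier n q),
    P.d es (P.comp h e i μ ν) =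
      P.comp h e₁ i (P.d ep μ) ν + ksign k p • P.comp h e₂ i μ (P.d eq ν)

theorem ksign_smul_smul {k : Type u} [CommRing k] {X : Type*} [AddCommGroup X] [Module k X]
    (p : ℤ) (x : X) : ksign k p • ksign k p • x = x := by
  rw [smul_smul, ksign_mul_self, one_smul]

section CobarGeneral

variable {k : Type u} [CommRing k] {C : PreDGCooperad.{u, v} k}

/-- The differential was defined on expressions by the Leibniz rule, so the laws hold by definition
once the degrees are written as p - 1 and q - 1. No cooperad law enters; only d² = 0 depends on
those, which is why derivations are separated from dg operads. -/
theorem cobar_hasDerivation (C : PreDGCooperad.{u, v} k) : HasDerivation (cobar C) where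
  toIsOperad := freePreDG_isOperad _ _
  d_act := by rintro n p q h σ ⟨x⟩; rfl
  d_one _ := rfl
  d_comp := by
    rintro m n r p q s p' q' s' h e ep eq es e₁ e₂ i ⟨μ⟩ ⟨ν⟩
    obtain rfl : p' = p - 1 := by omega
    obtain rfl : q' = q - 1 := by omega
    rfl

theorem sInv_act {n : ℕ} {p q : ℤ} (h : q + 1 = p) (σ : Perm (Fin n)) (x : C.carrier n p) :
    (sInv h (C.act σ x) : (cobar C).carrier n q) = (cobar C).act σ (sInv h x) :=
  FreeOp.gen_act h σ x

/-- Induction on the elements of a cobar construction. -/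
theorem cobar_induction {motive : ∀ {n : ℕ} {p : ℤ}, (cobar C).carrier n p → Prop}
    (gen : ∀ {n : ℕ} {p q : ℤ} (h : q + 1 = p) (x : C.carrier n p), motive (sInv h x))
    (one : motive (cobar C).one)
    (act : ∀ {n : ℕ} {p : ℤ} (σ : Perm (Fin n)) (x : (cobar C).carrier n p),
      motive x → motive ((cobar C).act σ x))
    (comp : ∀ {m n r : ℕ} {p q s : ℤ} (h : m + n = r + 1) (e : p + q = s) (i : Fin m)
      (x : (cobar C).carrier m p) (y : (cobar C).carrier n q),
      motive x → motive y → motive ((cobar C).comp h e i x y))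
    (zero : ∀ {n : ℕ} {p : ℤ}, motive (0 : (cobar C).carrier n p))
    (add : ∀ {n : ℕ} {p : ℤ} (x y : (cobar C).carrier n p), motive x → motive y → motive (x + y))
    (smul : ∀ {n : ℕ} {p : ℤ} (c : k) (x : (cobar C).carrier n p), motive x → motive (c • x))
    {n : ℕ} {p : ℤ} (x : (cobar C).carrier n p) : motive x := by
  suffices H : ∀ {n : ℕ} {p : ℤ} (x : Term C.toSMod n p),
      motive (FreeOp.mk x : (cobar C).carrier n p) by
    obtain ⟨x⟩ := x
    exact H x
  intro n p x
  induction x with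
  | gen h x => exact gen h x
  | one => exact one
  | act σ x ih => exact act σ _ ih
  | comp h e i x y ihx ihy => exact comp h e i _ _ ihx ihy
  | zero => exact zero
  | add x y ihx ihy => exact add _ _ ihx ihy
  | smul c x ih => exact smul c _ ih

/-- The differential of the cobar construction squares to zero if it does so on the generators. -/
theorem cobar_isDGOperad
    (hC : ∀ {n : ℕ} {p q r t : ℤ} (h : q + 1 = p) (h' : r + 1 = q) (h'' : t + 1 = r)
      (x : C.carrier n p), (cobar C).d h'' ((cobar C).d h' (sInv h x)) = 0) :
    IsDGOperad (cobar C) where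
  toIsOperad := freePreDG_isOperad _ _
  d_act := (cobar_hasDerivation C).d_act
  d_one := (cobar_hasDerivation C).d_one
  d_comp := (cobar_hasDerivation C).d_comp
  d_d := by
    have D := cobar_hasDerivation C
    suffices H : ∀ {n : ℕ} {p : ℤ} (x : (cobar C).carrier n p) (q r : ℤ) (h : q + 1 = p)
        (h' : r + 1 = q), (cobar C).d h' ((cobar C).d h x) = 0 by
      intro n p q r h h' x
      exact H x q r h h'
    intro n p x
    induction x using cobar_induction with
    | gen h x => intro q r h1 h2; exact hC h h1 h2 x
    | one => intro q r h1 h2; rw [D.d_one, map_zero]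
    | act σ x ih => intro q r h1 h2; rw [D.d_act, D.d_act, ih, map_zero]
    | @comp m n r p q s h e i x y ihx ihy =>
      intro s' s'' h1 h2
      rw [D.d_comp h e (p' := p - 1) (q' := q - 1) (by omega) (by omega) h1 (by omega) (by omega),
        map_add, map_smul,
        D.d_comp h _ (p' := p - 1 - 1) (q' := q - 1) (by omega) (by omega) h2 (by omega) (by omega),
        D.d_comp h _ (p' := p - 1) (q' := q - 1 - 1) (by omega) (by omega) h2 (by omega)
          (by omega), ihx, ihy]
      simp only [map_zero, LinearMap.zero_apply, zero_add, smul_zero, add_zero]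
      -- The two mixed terms dx ∘ dy carry the signs (-1)^(p-1) and (-1)^p and cancel.
      rw [← add_smul, ksign_sub, ksign_one]
      simp
    | zero => intro q r h1 h2; rw [map_zero, map_zero]
    | add x y ihx ihy => intro q r h1 h2; rw [map_add, map_add, ihx, ihy, add_zero]
    | smul c x ih => intro q r h1 h2; rw [map_smul, map_smul, ih, smul_zero]

/-- A morphism from a cobar construction commutes with the differentials if it does so on the
generators. -/
theorem cobar_hom_isDG {Q : PreDGOperad.{u, w} k} (hQ : HasDerivation Q)
    (f : OperadHom (cobar C) Q)
    (hf : ∀ {n : ℕ} {p q r : ℤ} (h : q + 1 = p) (h' : r + 1 = q) (x : C.carrier n p),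
      f.toFun ((cobar C).d h' (sInv h x)) = Q.d h' (f.toFun (sInv h x))) : f.IsDG := by
  have D := cobar_hasDerivation C
  suffices H : ∀ {n : ℕ} {p : ℤ} (x : (cobar C).carrier n p) (q : ℤ) (h : q + 1 = p),
      f.toFun ((cobar C).d h x) = Q.d h (f.toFun x) by
    intro n p q h x
    exact H x q h
  intro n p x
  induction x using cobar_induction with
  | gen h x => intro q h1; exact hf h h1 x
  | one => intro q h1; rw [D.d_one, f.map_one, hQ.d_one, map_zero]
  | act σ x ih => intro q h1; rw [D.d_act, f.map_act, f.map_act, hQ.d_act, ih]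
  | @comp m n r p q s h e i x y ihx ihy =>
    intro s' h1
    rw [D.d_comp h e (p' := p - 1) (q' := q - 1) (by omega) (by omega) h1 (by omega) (by omega),
      map_add, map_smul, f.map_comp, f.map_comp, f.map_comp,
      hQ.d_comp h e (p' := p - 1) (q' := q - 1) (by omega) (by omega) h1 (by omega) (by omega),
      ihx, ihy]
  | zero => intro q h1; simp only [map_zero]
  | add x y ihx ihy => intro q h1; simp only [map_add, ihx, ihy]
  | smul c x ih => intro q h1; simp only [map_smul, ih]

/-- Morphisms from a cobar construction agree if they agree on the generators. -/
theorem cobar_hom_ext {Q : PreDGOperad.{u, w} k} {f g : OperadHom (cobar C) Q}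
    (hfg : ∀ {n : ℕ} {p q : ℤ} (h : q + 1 = p) (x : C.carrier n p),
      f.toFun (sInv h x) = g.toFun (sInv h x)) {n : ℕ} {p : ℤ} (x : (cobar C).carrier n p) :
    f.toFun x = g.toFun x := by
  induction x using cobar_induction with
  | gen h x => exact hfg h x
  | one => rw [f.map_one, g.map_one]
  | act σ x ih => rw [f.map_act, g.map_act, ih]
  | comp h e i x y ihx ihy => rw [f.map_comp, g.map_comp, ihx, ihy]
  | zero => rw [map_zero, map_zero]
  | add x y ihx ihy => rw [map_add, map_add, ihx, ihy]
  | smul c x ih => rw [map_smul, map_smul, ih]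

end CobarGeneral

/-! ### Words and labelled words -/

/-- The generators `s⁻¹ℓ_*` of the cobar construction of the resolution. -/
inductive Lam
  | a2 | a21 | a211 | a2111 | a3 | a31 | a32 | a311 | a312 | a322 | a4 | a41 | a42 | a43 | a5

namespace Lam

/-- The position of a generator in a fixed enumeration. -/
def idx : Lam → ℕ
  | .a2 => 0
  | .a21 => 1
  | .a211 => 2
  | .a2111 => 3
  | .a3 => 4
  | .a31 => 5
  | .a32 => 6
  | .a311 => 7
  | .a312 => 8
  | .a322 => 9
  | .a4 => 10
  | .a41 => 11
  | .a42 => 12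
  | .a43 => 13
  | .a5 => 14

/-- The arity minus one. -/
def exc : Lam → ℕ
  | .a2 => 1
  | .a21 => 1
  | .a211 => 1
  | .a2111 => 1
  | .a3 => 2
  | .a31 => 2
  | .a32 => 2
  | .a311 => 2
  | .a312 => 2
  | .a322 => 2
  | .a4 => 3
  | .a41 => 3
  | .a42 => 3
  | .a43 => 3
  | .a5 => 4

/-- The degree. -/
def deg : Lam → ℤ
  | .a2 => 0
  | .a21 => 1
  | .a211 => 2
  | .a2111 => 3
  | .a3 => 1
  | .a31 => 2
  | .a32 => 2
  | .a311 => 3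
  | .a312 => 3
  | .a322 => 3
  | .a4 => 2
  | .a41 => 3
  | .a42 => 3
  | .a43 => 3
  | .a5 => 3

/-- Whether the degree is odd. -/
def odd : Lam → Bool
  | .a2 => false
  | .a21 => true
  | .a211 => false
  | .a2111 => true
  | .a3 => true
  | .a31 => false
  | .a32 => false
  | .a311 => true
  | .a312 => true
  | .a322 => true
  | .a4 => false
  | .a41 => true
  | .a42 => true
  | .a43 => true
  | .a5 => true

/-- Equality is read off from the index, which keeps comparisons cheap in the large finite checks.
-/
instance : DecidableEq Lam := fun g h =>
  if e : g.idx = h.idx then isTrue (by cases g <;> cases h <;> first | rfl | cases e)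
  else isFalse fun e' => e (congrArg idx e')

end Lam

/-- A word `(i_r, g_r), …, (i_1, g_1)` stands for `(((1 ∘ g_1) ∘_{i_2} g_2) ⋯) ∘_{i_r} g_r`. -/
abbrev Word := List (ℕ × Lam)

/-- A formal linear combination of words with labelled inputs. -/
abbrev LC := List (ℤ × Word × List ℕ)

/-- The integer `-c` if `b` is true, and `c` otherwise. -/
def flip (b : Bool) (c : ℤ) : ℤ := bif b then -c else c

namespace Word

/-- The arity of a word. -/
def ar : Word → ℕ
  | [] => 1
  | x :: w => ar w + x.2.exc

/-- The degree of a word. -/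
def deg : Word → ℤ
  | [] => 0
  | x :: w => deg w + x.2.deg

/-- Whether the degree of a word is odd. -/
def odd : Word → Bool
  | [] => false
  | x :: w => xor x.2.odd (odd w)

/-- Grafting of a generator in front of a sorted word, with the parity of the sign. -/
def ins (j : ℕ) (h : Lam) : Word → Bool × Word
  | [] => (false, [(j, h)])
  | (i, g) :: w =>
    -- The letter `h` is grafted to the left of `g`, so by the parallel law it may be grafted first;
    -- then `g` sits `h.exc` inputs further to the right, and the exchange costs (-1)^(|g||h|). In
    -- sorted words the positions increase weakly in the order of grafting: this is the preorder
    -- listing of the vertices of a planar tree.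
    bif Nat.blt j i then
      let r := ins j h w
      (xor (g.odd && h.odd) r.1, (i + h.exc, g) :: r.2)
    else (false, (j, h) :: (i, g) :: w)

/-- The sorted form of a word, with the parity of the sign. -/
def sort : Word → Bool × Word
  | [] => (false, [])
  | x :: w =>
    let r := sort w
    let t := ins x.1 x.2 r.2
    (xor r.1 t.1, t.2)

/-- Grafting of `v` at the input `a` of `w`. -/
def graft (a : ℕ) (v w : Word) : Word := v.map (fun x => (a + x.1, x.2)) ++ w

end Word

/-- The labels of a composite. -/
def graftLabels (i : ℕ) (L K : List ℕ) : List ℕ :=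
  -- The entry at position a of a label list is the label of the a-th input. The label `i` is
  -- replaced by the block of shifted inner labels, and larger labels make room for it.
  L.flatMap fun x => bif Nat.beq x i then K.map (i + ·) else bif Nat.blt x i then [x] else [x + K.length - 1]

/-- Renaming of labels. -/
def renameLabels (L K : List ℕ) : List ℕ := K.map fun x => L.getD x 0

namespace LC

/-- Scalar multiplication. -/
def smul (c : ℤ) (x : LC) : LC := x.map fun t => (c * t.1, t.2)

/-- Partial composition. -/
def comp (i : ℕ) (x y : LC) : LC :=
  x.flatMap fun s => y.map fun t =>
    (s.1 * t.1, Word.graft (s.2.2.idxOf i) t.2.1 s.2.1, graftLabels i s.2.2 t.2.2)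

/-- The generator as a linear combination. -/
def gen (g : Lam) : LC := [(1, [(0, g)], List.range (g.exc + 1))]

end LC

/-- The differentials of the generators. -/
def dTable : Lam → LC
  -- The entries already contain the signs of d(s⁻¹x) = -s⁻¹dx - ∑ (-1)^|μ| (s⁻¹μ ∘_i s⁻¹ν)^σ, and σ
  -- is recorded by the values of its inverse; `d_gEl_eq` compares them with the definition of the
  -- resolution.
  | .a2 => []
  | .a21 => [(1, [(0, .a2)], [0, 1]),
      (1, [(0, .a2)], [1, 0])]
  | .a211 => [(1, [(0, .a21)], [0, 1]),
      (-1, [(0, .a21)], [1, 0])]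
  | .a2111 => [(1, [(0, .a211)], [0, 1]),
      (1, [(0, .a211)], [1, 0])]
  | .a3 => [(-1, [(0, .a2), (0, .a2)], [0, 1, 2]),
      (1, [(1, .a2), (0, .a2)], [0, 1, 2]),
      (-1, [(1, .a2), (0, .a2)], [1, 0, 2])]
  | .a31 => [(1, [(0, .a3)], [0, 1, 2]),
      (1, [(0, .a3)], [1, 0, 2]),
      (1, [(0, .a21), (0, .a2)], [0, 1, 2])]
  | .a32 => [(1, [(0, .a3)], [0, 1, 2]),
      (1, [(0, .a3)], [0, 2, 1]),
      (1, [(0, .a2), (0, .a21)], [0, 1, 2]),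
      (-1, [(1, .a21), (0, .a2)], [0, 1, 2]),
      (1, [(1, .a2), (0, .a21)], [1, 0, 2])]
  | .a311 => [(1, [(0, .a31)], [0, 1, 2]),
      (-1, [(0, .a31)], [1, 0, 2]),
      (-1, [(0, .a211), (0, .a2)], [0, 1, 2])]
  | .a312 => [(-1, [(0, .a31)], [0, 1, 2]),
      (1, [(0, .a32)], [1, 0, 2]),
      (-1, [(0, .a31)], [1, 2, 0]),
      (1, [(0, .a32)], [0, 1, 2]),
      (-1, [(0, .a31)], [0, 2, 1]),
      (1, [(0, .a32)], [2, 0, 1]),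
      (1, [(0, .a21), (0, .a21)], [0, 1, 2]),
      (1, [(1, .a21), (0, .a21)], [0, 1, 2]),
      (1, [(1, .a21), (0, .a21)], [1, 0, 2]),
      (1, [(1, .a2), (0, .a211)], [1, 2, 0])]
  | .a322 => [(1, [(0, .a32)], [0, 1, 2]),
      (-1, [(0, .a32)], [0, 2, 1]),
      (-1, [(0, .a2), (0, .a211)], [0, 1, 2]),
      (1, [(1, .a211), (0, .a2)], [0, 1, 2]),
      (-1, [(1, .a2), (0, .a211)], [1, 0, 2])]
  | .a4 => [(1, [(0, .a3), (0, .a2)], [0, 1, 2, 3]),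
      (1, [(1, .a3), (0, .a2)], [0, 1, 2, 3]),
      (-1, [(1, .a3), (0, .a2)], [1, 0, 2, 3]),
      (1, [(1, .a3), (0, .a2)], [2, 0, 1, 3]),
      (-1, [(0, .a2), (0, .a3)], [0, 1, 2, 3]),
      (1, [(1, .a2), (0, .a3)], [0, 1, 2, 3]),
      (-1, [(1, .a2), (0, .a3)], [1, 0, 2, 3]),
      (-1, [(2, .a2), (0, .a3)], [0, 1, 2, 3]),
      (1, [(2, .a2), (0, .a3)], [0, 2, 1, 3]),
      (-1, [(2, .a2), (0, .a3)], [1, 2, 0, 3])]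
  | .a41 => [(1, [(0, .a4)], [0, 1, 2, 3]),
      (1, [(0, .a4)], [1, 0, 2, 3]),
      (-1, [(0, .a31), (0, .a2)], [0, 1, 2, 3]),
      (-1, [(1, .a31), (0, .a2)], [2, 0, 1, 3]),
      (-1, [(0, .a21), (0, .a3)], [0, 1, 2, 3]),
      (1, [(2, .a2), (0, .a31)], [0, 1, 2, 3])]
  | .a42 => [(1, [(0, .a4)], [0, 1, 2, 3]),
      (1, [(0, .a4)], [0, 2, 1, 3]),
      (-1, [(0, .a32), (0, .a2)], [0, 1, 2, 3]),
      (-1, [(1, .a31), (0, .a2)], [0, 1, 2, 3]),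
      (1, [(0, .a2), (0, .a31)], [0, 1, 2, 3]),
      (1, [(1, .a2), (0, .a31)], [1, 0, 2, 3]),
      (1, [(1, .a21), (0, .a3)], [0, 1, 2, 3]),
      (1, [(2, .a2), (0, .a31)], [1, 2, 0, 3])]
  | .a43 => [(1, [(0, .a4)], [0, 1, 2, 3]),
      (1, [(0, .a4)], [0, 1, 3, 2]),
      (-1, [(1, .a3), (0, .a21)], [2, 0, 1, 3]),
      (-1, [(1, .a32), (0, .a2)], [0, 1, 2, 3]),
      (1, [(1, .a32), (0, .a2)], [1, 0, 2, 3]),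
      (-1, [(0, .a3), (0, .a21)], [0, 1, 2, 3]),
      (1, [(0, .a2), (0, .a32)], [0, 1, 2, 3]),
      (-1, [(2, .a2), (0, .a32)], [0, 2, 1, 3]),
      (1, [(2, .a2), (0, .a32)], [1, 2, 0, 3]),
      (-1, [(2, .a21), (0, .a3)], [0, 1, 2, 3]),
      (-1, [(1, .a2), (0, .a32)], [0, 1, 2, 3]),
      (1, [(1, .a2), (0, .a32)], [1, 0, 2, 3])]
  | .a5 => [(-1, [(0, .a4), (0, .a2)], [0, 1, 2, 3, 4]),
      (1, [(1, .a4), (0, .a2)], [0, 1, 2, 3, 4]),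
      (-1, [(1, .a4), (0, .a2)], [1, 0, 2, 3, 4]),
      (1, [(1, .a4), (0, .a2)], [2, 0, 1, 3, 4]),
      (-1, [(1, .a4), (0, .a2)], [3, 0, 1, 2, 4]),
      (-1, [(0, .a3), (0, .a3)], [0, 1, 2, 3, 4]),
      (-1, [(1, .a3), (0, .a3)], [0, 1, 2, 3, 4]),
      (1, [(1, .a3), (0, .a3)], [1, 0, 2, 3, 4]),
      (-1, [(1, .a3), (0, .a3)], [2, 0, 1, 3, 4]),
      (-1, [(2, .a3), (0, .a3)], [0, 1, 2, 3, 4]),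
      (1, [(2, .a3), (0, .a3)], [0, 2, 1, 3, 4]),
      (-1, [(2, .a3), (0, .a3)], [0, 3, 1, 2, 4]),
      (-1, [(2, .a3), (0, .a3)], [1, 2, 0, 3, 4]),
      (1, [(2, .a3), (0, .a3)], [1, 3, 0, 2, 4]),
      (-1, [(2, .a3), (0, .a3)], [2, 3, 0, 1, 4]),
      (-1, [(0, .a2), (0, .a4)], [0, 1, 2, 3, 4]),
      (1, [(1, .a2), (0, .a4)], [0, 1, 2, 3, 4]),
      (-1, [(1, .a2), (0, .a4)], [1, 0, 2, 3, 4]),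
      (-1, [(2, .a2), (0, .a4)], [0, 1, 2, 3, 4]),
      (1, [(2, .a2), (0, .a4)], [0, 2, 1, 3, 4]),
      (-1, [(2, .a2), (0, .a4)], [1, 2, 0, 3, 4]),
      (1, [(3, .a2), (0, .a4)], [0, 1, 2, 3, 4]),
      (-1, [(3, .a2), (0, .a4)], [0, 1, 3, 2, 4]),
      (1, [(3, .a2), (0, .a4)], [0, 2, 3, 1, 4]),
      (-1, [(3, .a2), (0, .a4)], [1, 2, 3, 0, 4])]

namespace LC

/-- The differential of a word. -/
def dWord : Word → LC
  | [] => []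
  | (i, g) :: w =>
    comp i (dWord w) (gen g) ++
      comp i [(flip (Word.odd w) 1, w, List.range (Word.ar w))] (dTable g)

/-- The differential. -/
def d (x : LC) : LC :=
  x.flatMap fun s => (dWord s.2.1).map fun t => (s.1 * t.1, t.2.1, renameLabels s.2.2 t.2.2)

/-- Sorting of the words in a linear combination. -/
def sortWords (x : LC) : LC :=
  x.map fun s => let r := Word.sort s.2.1; (flip r.1 s.1, r.2, s.2.2)

end LC

/-- The parity of the number of entries less than `x`. -/
def oddBelow (x : ℕ) : List ℕ → Bool
  | [] => false
  | y :: L => xor (Nat.blt y x) (oddBelow x L)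

/-- The parity of the number of inversions in a list. -/
def oddInversions : List ℕ → Bool
  | [] => false
  | x :: L => xor (oddBelow x L) (oddInversions L)

/-- The list `L` with the labels less than `j` replaced by `m, m + 1, …`. -/
def canonLabels (j : ℕ) : ℕ → List ℕ → List ℕ
  | _, [] => []
  | m, x :: L => bif Nat.blt x j then m :: canonLabels j (m + 1) L else x :: canonLabels j m L

namespace LC

/-- Normalization of the labels, up to permutations of the labels less than `j`. -/
def altLabels (j : ℕ) (x : LC) : LC := x.map fun s =>
  let L := canonLabels j 0 s.2.2
  (flip (xor (oddInversions s.2.2) (oddInversions L)) s.1, s.2.1, L)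

end LC

/-! ### Collecting terms and testing formal combinations for zero -/

/-- Search trees for collecting terms. -/
inductive Coll
  | nil
  | node (l : Coll) (key : ℕ) (c : ℤ) (w : Word) (L : List ℕ) (r : Coll)

namespace Coll

/-- Insertion of a term. -/
def insert (key : ℕ) (c : ℤ) (w : Word) (L : List ℕ) : Coll → Coll
  | nil => node nil key c w L nil
  | node l key' c' w' L' r =>
    bif Nat.beq key key' then
      -- The key only guides the search. Terms are merged when they really agree, and a collision of
      -- keys is sent to the right, so the zero test is sound without injectivity of `key`.
      if w = w' ∧ L = L' then node l key' (c + c') w' L' r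
      else node l key' c' w' L' (insert key c w L r)
    else bif Nat.blt key key' then node (insert key c w L l) key' c' w' L' r
    else node l key' c' w' L' (insert key c w L r)

/-- Whether all coefficients vanish. -/
def isZero : Coll → Bool
  | nil => true
  | node l _ c _ _ r => l.isZero && (decide (c = 0) && r.isZero)

end Coll

/-- A search key. -/
def key (w : Word) (L : List ℕ) : ℕ :=
  L.foldl (fun a x => 8 * a + x) (w.foldl (fun a x => 128 * a + (16 * x.1 + x.2.idx)) 1)

namespace LC

/-- Collection of the terms. -/
def collect (x : LC) : Coll := x.foldl (fun t s => t.insert (key s.2.1 s.2.2) s.1 s.2.1 s.2.2) .nil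

/-- Whether a linear combination vanishes after sorting of the words. -/
def isZero (x : LC) : Bool := (collect (sortWords x)).isZero

/-- Whether a linear combination vanishes after sorting and alternation of the labels less than
`j`. -/
def isAltZero (j : ℕ) (x : LC) : Bool := (collect (altLabels j (sortWords x))).isZero

end LC

/-! ### Evaluation of words in an operad -/

/-- The sign with the given parity, in the ground ring. -/
def bsign (k : Type u) [CommRing k] (b : Bool) : k := bif b then -1 else 1

section Evaluation

variable {k : Type u} [CommRing k]

theorem bsign_xor (a b : Bool) : bsign k (xor a b) = bsign k a * bsign k b := by
  cases a <;> cases b <;> simp [bsign]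

theorem cast_flip (b : Bool) (c : ℤ) : ((flip b c : ℤ) : k) = bsign k b * c := by
  cases b <;> simp [bsign, flip]

theorem ksign_eq_bsign (n : ℤ) : ksign k n = bsign k (decide (Odd n)) := by
  by_cases h : Odd n
  · simp [ksign, bsign, Int.negOnePow_odd _ h, h]
  · simp [ksign, bsign, Int.negOnePow_even _ (Int.not_odd_iff_even.mp h), h]

theorem Lam.odd_eq (g : Lam) : g.odd = decide (Odd g.deg) := by
  cases g <;> decide

theorem Word.odd_eq (w : Word) : w.odd = decide (Odd w.deg) := by
  induction w with
  | nil => decide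
  | cons x w ih =>
    simp only [Word.odd, Word.deg, ih, Lam.odd_eq]
    by_cases h1 : Odd x.2.deg <;> by_cases h2 : Odd (Word.deg w) <;>
      simp [h1, h2, Int.odd_add, ← Int.not_odd_iff_even]

theorem ksign_deg_mul (g h : Lam) : ksign k (g.deg * h.deg) = bsign k (g.odd && h.odd) := by
  rw [ksign_eq_bsign, Lam.odd_eq, Lam.odd_eq]
  congr 1
  simp [Int.odd_mul]

/-- The grafting positions in a word are inputs. -/
def Word.Ok : Word → Prop
  | [] => True
  | x :: w => x.1 < Word.ar w ∧ Word.Ok w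

instance Word.decidableOk : ∀ w : Word, Decidable w.Ok
  | [] => isTrue trivial
  | _ :: w => @instDecidableAnd _ _ _ (Word.decidableOk w)

variable (P : PreDGOperad.{u, v} k) (val : ∀ g : Lam, P.carrier (g.exc + 1) g.deg)

/-- The value of a word. -/
def wordVal : ∀ w : Word, P.carrier (Word.ar w) (Word.deg w)
  | [] => P.one
  | (i, g) :: w => if h : i < Word.ar w then
      P.comp (m := Word.ar w) (n := g.exc + 1) (by simp only [Word.ar]; omega) rfl ⟨i, h⟩
        (wordVal w) (val g)
    else 0

/-- The value of a word as an element of prescribed arity and degree. -/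
def wordAt (n : ℕ) (p : ℤ) (w : Word) : P.carrier n p :=
  if h : Word.ar w = n ∧ Word.deg w = p then h.2 ▸ h.1 ▸ wordVal P val w else 0

theorem wordAt_self (w : Word) : wordAt P val (Word.ar w) (Word.deg w) w = wordVal P val w := by
  simp [wordAt]

theorem wordAt_nil : wordAt P val 1 0 [] = P.one := wordAt_self P val []

/-- Peels off the last grafting with arity and degree left free, so that the transports in `wordAt`
do not reappear later. -/
theorem wordAt_cons {w : Word} {g : Lam} {m r : ℕ} {p s : ℤ} (hm : Word.ar w = m)
    (hp : Word.deg w = p) (h : m + (g.exc + 1) = r + 1) (e : p + g.deg = s) (i : Fin m) :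
    wordAt P val r s ((i.1, g) :: w) = P.comp h e i (wordAt P val m p w) (val g) := by
  subst hm hp e
  obtain rfl : r = Word.ar w + g.exc := by omega
  rw [wordAt_self]
  refine (wordAt_self P val ((i.1, g) :: w)).trans ?_
  exact dif_pos i.2

variable {P}

theorem wordAt_single (hP : IsOperad P) (g : Lam) {n : ℕ} {p : ℤ} (hn : g.exc + 1 = n)
    (hp : g.deg = p) : wordAt P val n p [(0, g)] = hp ▸ hn ▸ val g := by
  subst hn hp
  refine (wordAt_cons P val (w := []) (m := 1) (p := 0) rfl rfl (by omega) (by omega) 0).trans ?_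
  rw [wordAt_nil, hP.one_comp]

theorem Word.ar_graft (a : ℕ) (v w : Word) : Word.ar (Word.graft a v w) + 1 = ar v + ar w := by
  induction v with
  | nil => simp [graft, ar, Nat.add_comm]
  | cons x v ih =>
    simp only [graft, List.map_cons, List.cons_append, ar] at ih ⊢
    omega

theorem Word.deg_graft (a : ℕ) (v w : Word) : Word.deg (Word.graft a v w) = deg v + deg w := by
  induction v with
  | nil => simp [graft, deg]
  | cons x v ih =>
    simp only [graft, List.map_cons, List.cons_append, deg] at ih ⊢
    omega

theorem Word.ok_graft {a : ℕ} {v w : Word} (hv : v.Ok) (hw : w.Ok) (ha : a < ar w) :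
    (Word.graft a v w).Ok := by
  induction v with
  | nil => exact hw
  | cons x v ih =>
    have h1 := Word.ar_graft a v w
    have h2 := hv.1
    refine ⟨?_, ih hv.2⟩
    change a + x.1 < ar (graft a v w)
    omega

/-- Induction on the inner word: sequential associativity moves its last grafting outside.
Composition of words is thus concatenation with shifted positions, with no sign. -/
theorem comp_wordAt (hP : IsOperad P) {v w : Word} (hv : v.Ok) :
    ∀ {m n r : ℕ} {p q s : ℤ} (_ : Word.ar w = m) (_ : Word.deg w = p) (_ : Word.ar v = n)
      (_ : Word.deg v = q) (h : m + n = r + 1) (e : p + q = s) (i : Fin m),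
      P.comp h e i (wordAt P val m p w) (wordAt P val n q v) =
        wordAt P val r s (Word.graft i v w) := by
  induction v with
  | nil =>
    intro m n r p q s hm hp hn hq h e i
    obtain rfl : n = 1 := hn.symm
    obtain rfl : q = 0 := hq.symm
    obtain rfl : r = m := by omega
    obtain rfl : s = p := by omega
    rw [wordAt_nil, hP.comp_one]
    rfl
  | cons x v ih =>
    obtain ⟨j, g⟩ := x
    intro m n r p q s hm hp hn hq h e i
    have hn' : Word.ar v + (g.exc + 1) = n + 1 := by rw [← hn]; simp only [Word.ar]; omega
    have hq' : Word.deg v + g.deg = q := hq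
    have ha := Word.ar_graft i v w
    have hd := Word.deg_graft i v w
    have h1 := wordAt_cons P val (w := v) rfl rfl hn' hq' ⟨j, hv.1⟩
    rw [h1, ← hP.assoc_seq (a := Word.ar (Word.graft i v w)) (s := Word.deg (Word.graft i v w))
      (by omega) (by omega) hn' h (by omega) (by omega) hq' e i ⟨j, hv.1⟩
      ⟨i + j, by have := hv.1; have := i.2; simp only at *; omega⟩ rfl,
      ih hv.2 hm hp rfl rfl]
    rw [← wordAt_cons P val rfl rfl]
    rfl

/-- Each exchange is one instance of parallel associativity. The validity, arity and degree of the
result are carried along because the next exchange needs them. -/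
theorem wordAt_ins (hP : IsOperad P) (j : ℕ) (h : Lam) (w : Word) :
    ∀ {n : ℕ} {p : ℤ}, Word.Ok ((j, h) :: w) → Word.ar ((j, h) :: w) = n →
      Word.deg ((j, h) :: w) = p →
      wordAt P val n p ((j, h) :: w) =
        bsign k (Word.ins j h w).1 • wordAt P val n p (Word.ins j h w).2 ∧
      (Word.ins j h w).2.Ok ∧ Word.ar (Word.ins j h w).2 = n ∧ Word.deg (Word.ins j h w).2 = p := by
  induction w with
  | nil =>
    intro n p hok hn hp
    exact ⟨by simp [Word.ins, bsign], hok, hn, hp⟩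
  | cons x w ih =>
    obtain ⟨i, g⟩ := x
    intro n p hok hn hp
    by_cases hji : j < i
    · have hb : Nat.blt j i = true := by simpa [Nat.blt_eq] using hji
      have hi : i < Word.ar w := hok.2.1
      obtain ⟨e1, o1, a1, d1⟩ := ih (n := Word.ar w + h.exc) (p := Word.deg w + h.deg)
        ⟨hji.trans hi, hok.2.2⟩ rfl rfl
      simp only [Word.ins, hb, cond_true]
      simp only [Word.ar, Word.deg] at hn hp
      have c1 := wordAt_cons P val (w := (i, g) :: w) (g := h) (r := n) (s := p) rfl rfl
        (by simp only [Word.ar]; omega) (by simp only [Word.deg]; omega) ⟨j, hok.1⟩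
      have c2 := wordAt_cons P val (w := w) (g := g) (r := Word.ar w + g.exc)
        (s := Word.deg w + g.deg) rfl rfl (by omega) rfl ⟨i, hi⟩
      have c3 := wordAt_cons P val (w := (Word.ins j h w).2) (g := g) (r := n) (s := p) a1 d1
        (by omega) (by omega) ⟨i + h.exc, by omega⟩
      have c4 := wordAt_cons P val (w := w) (g := h) (r := Word.ar w + h.exc)
        (s := Word.deg w + h.deg) rfl rfl (by omega) rfl ⟨j, hji.trans hi⟩
      have par := hP.assoc_par (m := Word.ar w) (n := h.exc + 1) (l := g.exc + 1)
        (a := Word.ar w + h.exc) (b := Word.ar w + g.exc) (c := n)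
        (p := Word.deg w) (q := h.deg) (r := g.deg) (s := Word.deg w + h.deg)
        (t := Word.deg w + g.deg) (z := p) (by omega) (by omega) (by omega) (by omega) rfl
        (by omega) rfl (by omega) ⟨j, hji.trans hi⟩ ⟨i, hi⟩ hji ⟨i + h.exc, by omega⟩
        (by simp only; omega) ⟨j, by omega⟩ rfl (wordAt P val _ _ w) (val h) (val g)
      refine ⟨?_, ⟨by rw [a1]; omega, o1⟩, by simp only [Word.ar]; omega,
        by simp only [Word.deg]; omega⟩
      have e2 : bsign k (Word.ins j h w).1 • wordAt P val n p ((i + h.exc, g) ::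
          (Word.ins j h w).2) = ksign k (g.deg * h.deg) • wordAt P val n p
            ((j, h) :: (i, g) :: w) := by
        rw [c3, ← LinearMap.smul_apply, ← map_smul, ← e1, c4, par, mul_comm, c1]
        congr 1
        exact congrArg (fun y => P.comp _ _ _ y (val h)) c2.symm
      rw [bsign_xor, ← ksign_deg_mul, mul_smul, e2, ksign_smul_smul]
    · have hb : Nat.blt j i = false := by
        rw [← Bool.not_eq_true, Nat.blt_eq]
        exact hji
      simp only [Word.ins, hb, cond_false]
      exact ⟨by simp [bsign], hok, hn, hp⟩

theorem wordAt_sort (hP : IsOperad P) (w : Word) : ∀ {n : ℕ} {p : ℤ}, w.Ok → Word.ar w = n →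
    Word.deg w = p →
    wordAt P val n p w = bsign k (Word.sort w).1 • wordAt P val n p (Word.sort w).2 ∧
      (Word.sort w).2.Ok ∧ Word.ar (Word.sort w).2 = n ∧ Word.deg (Word.sort w).2 = p := by
  induction w with
  | nil =>
    intro n p hok hn hp
    exact ⟨by simp [Word.sort, bsign], hok, hn, hp⟩
  | cons x w ih =>
    obtain ⟨i, g⟩ := x
    intro n p hok hn hp
    obtain ⟨e1, o1, a1, d1⟩ := ih hok.2 rfl rfl
    simp only [Word.ar, Word.deg] at hn hp
    obtain ⟨e2, h2⟩ := wordAt_ins val hP i g (Word.sort w).2 (n := n) (p := p)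
      ⟨by rw [a1]; exact hok.1, o1⟩ (by simp only [Word.ar]; omega) (by simp only [Word.deg]; omega)
    refine ⟨?_, h2⟩
    have c1 := wordAt_cons P val (w := w) (g := g) (r := n) (s := p) rfl rfl
      (by omega) hp ⟨i, hok.1⟩
    have c2 := wordAt_cons P val (w := (Word.sort w).2) (g := g) (r := n) (s := p) a1 d1
      (by omega) hp ⟨i, hok.1⟩
    simp only at c1 c2
    simp only [Word.sort, bsign_xor, mul_smul]
    rw [← e2, c2, c1, e1, map_smul, LinearMap.smul_apply]

end Evaluation

/-! ### Labellings and permutations -/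

/-- The permutation `σ` for which `L` is the list of the values of `σ⁻¹`. -/
def perm (n : ℕ) (L : List ℕ) : Perm (Fin n) :=
  -- Since x^σ(v_1, …) involves v_{σ⁻¹(a)} at position a, the list of values of σ⁻¹ is the list of
  -- labels by position. The identity is a default value for lists that are not labellings.
  if h : L.Perm (List.range n) then
    { toFun := fun x => ⟨L.idxOf x.1, by
        have := List.idxOf_lt_length_of_mem (h.mem_iff.2 (List.mem_range.2 x.2))
        simpa [h.length_eq] using this⟩
      invFun := fun a => ⟨L[a.1]'(by simp [h.length_eq]), by
        have := h.mem_iff.1 (List.getElem_mem (l := L) (n := a.1) (by simp [h.length_eq]))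
        exact List.mem_range.1 this⟩
      left_inv := fun x => by simp
      right_inv := fun a => by
        ext
        exact (h.nodup_iff.2 List.nodup_range).idxOf_getElem _ _ }
  else 1

theorem perm_inv_apply {n : ℕ} {L : List ℕ} (h : L.Perm (List.range n)) (a : Fin n) :
    (((perm n L)⁻¹ a : Fin n) : ℕ) = L[a.1]'(by simp [h.length_eq]) := by
  simp only [perm, dif_pos h]
  rfl

theorem perm_apply {n : ℕ} {L : List ℕ} (h : L.Perm (List.range n)) (a : Fin n) :
    ((perm n L a : Fin n) : ℕ) = L.idxOf a.1 := by
  simp only [perm, dif_pos h]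
  rfl

theorem eq_perm {n : ℕ} {L : List ℕ} (h : L.Perm (List.range n)) (σ : Perm (Fin n))
    (hσ : ∀ a : Fin n, ((σ⁻¹ a : Fin n) : ℕ) = L[a.1]'(by simp [h.length_eq])) :
    σ = perm n L := by
  rw [← inv_inj]
  ext a
  rw [hσ, perm_inv_apply h]

theorem perm_range (n : ℕ) : perm n (List.range n) = 1 :=
  (eq_perm (List.Perm.refl _) 1 fun a => by simp).symm

theorem isLabelling_of_forall_mem {n : ℕ} {L : List ℕ} (hL : L.length = n)
    (h : ∀ x < n, x ∈ L) : L.Perm (List.range n) := by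
  have h1 : (List.range n).Subperm L :=
    List.subperm_of_subset List.nodup_range fun x hx => h x (List.mem_range.1 hx)
  exact (h1.perm_of_length_le (by simp [hL])).symm

/-- The order of the factors is reversed because label lists record inverses. -/
theorem renameLabels_perm {n : ℕ} {L K : List ℕ} (hL : L.Perm (List.range n))
    (hK : K.Perm (List.range n)) :
    (renameLabels L K).Perm (List.range n) ∧ perm n (renameLabels L K) = perm n K * perm n L := by
  have hl : L.length = n := by simp [hL.length_eq]
  have h1 : (renameLabels L K).Perm (List.range n) := by
    refine ((hK.map fun x => L.getD x 0).trans (List.Perm.trans ?_ hL))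
    apply List.Perm.of_eq
    apply List.ext_getElem (by simp [hl])
    intro a h1 h2
    rw [List.getElem_map, List.getElem_range, List.getD_eq_getElem _ _ h2]
  refine ⟨h1, (eq_perm h1 _ fun a => ?_).symm⟩
  have hk : K[a.1]'(by simp [hK.length_eq]) < L.length := by
    rw [hl]
    exact List.mem_range.1 (hK.mem_iff.1 (List.getElem_mem _))
  rw [mul_inv_rev, Perm.mul_apply, perm_inv_apply hL]
  simp only [renameLabels, List.getElem_map, List.getD_eq_getElem _ _ hk, perm_inv_apply hK]

theorem graftLabels_split {i : ℕ} {L₁ L₂ : List ℕ} (K : List ℕ)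
    (h₁ : i ∉ L₁) (h₂ : i ∉ L₂) :
    graftLabels i (L₁ ++ i :: L₂) K =
      L₁.map (fun x => if x < i then x else x + K.length - 1) ++
        (K.map (i + ·) ++ L₂.map fun x => if x < i then x else x + K.length - 1) := by
  have key : ∀ L : List ℕ, i ∉ L → (L.flatMap fun x => bif Nat.beq x i then K.map (i + ·)
      else bif Nat.blt x i then [x] else [x + K.length - 1]) =
      L.map fun x => if x < i then x else x + K.length - 1 := by
    intro L hL
    induction L with
    | nil => rfl
    | cons x L ih =>
      simp only [List.mem_cons, not_or] at hL
      have hx : Nat.beq x i = false := by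
        rw [← Bool.not_eq_true, Nat.beq_eq]
        exact fun e => hL.1 e.symm
      rw [List.flatMap_cons, ih hL.2, hx, cond_false, List.map_cons]
      by_cases hlt : x < i
      · have : Nat.blt x i = true := by rw [Nat.blt_eq]; exact hlt
        simp [this, hlt]
      · have : Nat.blt x i = false := by rw [← Bool.not_eq_true, Nat.blt_eq]; exact hlt
        simp [this, hlt]
  rw [graftLabels, List.flatMap_append, List.flatMap_cons, key _ h₁, key _ h₂]
  simp

/-- The label `i` occurs once in `L`, at the position `perm m L i`. Splitting `L` there exhibits the
composite list as two shifted pieces of `L` around the shifted `K`; both clauses are then checked on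
the inverse, inside and outside the middle block. -/
theorem graftLabels_isBlockPerm {m n r : ℕ} (h : m + n = r + 1) {L K : List ℕ}
    (hL : L.Perm (List.range m)) (hK : K.Perm (List.range n)) (i : Fin m) :
    (graftLabels i L K).Perm (List.range r) ∧
      IsBlockPerm h i (perm m L) (perm n K) (perm r (graftLabels i L K)) := by
  have hkl : K.length = n := by simp [hK.length_eq]
  have hll : L.length = m := by simp [hL.length_eq]
  have hnd := hL.nodup_iff.2 List.nodup_range
  obtain ⟨L₁, L₂, hsplit⟩ := List.append_of_mem (hL.mem_iff.2 (List.mem_range.2 i.2))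
  have hnd' := hsplit ▸ hnd
  rw [List.nodup_append] at hnd'
  have h₁ : (i : ℕ) ∉ L₁ := fun hi => hnd'.2.2 _ hi _ (by simp) rfl
  have h₂ : (i : ℕ) ∉ L₂ := (List.nodup_cons.1 hnd'.2.1).1
  have hpos : ((perm m L i : Fin m) : ℕ) = L₁.length := by
    rw [perm_apply hL, hsplit, List.idxOf_append_of_notMem h₁]
    simp
  have hG : graftLabels i L K = _ := (congrArg (graftLabels i · K) hsplit).trans
    (graftLabels_split K h₁ h₂)
  have hlen : L₁.length + 1 + L₂.length = m := by
    rw [← hll, hsplit]; simp; omega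
  have hlab : (graftLabels i L K).Perm (List.range r) := by
    apply isLabelling_of_forall_mem
    · rw [hG]; simp; omega
    · intro x hx
      rw [hG]
      have hmem : ∀ y < m, y ≠ i → y ∈ L₁ ∨ y ∈ L₂ := by
        intro y hy hne
        have := hL.mem_iff.2 (List.mem_range.2 hy)
        rw [hsplit] at this
        simpa [hne] using this
      have hi := i.2
      simp only [List.mem_append, List.mem_map]
      by_cases c1 : x < i
      · rcases hmem x (by omega) (by omega) with hc | hc
        · exact Or.inl ⟨x, hc, by simp [c1]⟩
        · exact Or.inr (Or.inr ⟨x, hc, by simp [c1]⟩)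
      · by_cases c2 : x < i + n
        · refine Or.inr (Or.inl ⟨x - i, hK.mem_iff.2 (List.mem_range.2 (by omega)), by omega⟩)
        · have c3 : ¬ x + 1 - n < i := by omega
          rcases hmem (x + 1 - n) (by omega) (by omega) with hc | hc
          · exact Or.inl ⟨_, hc, by rw [if_neg c3]; omega⟩
          · exact Or.inr (Or.inr ⟨_, hc, by rw [if_neg c3]; omega⟩)
  refine ⟨hlab, ?_, ?_⟩
  · intro j
    rw [← Perm.inv_eq_iff_eq.trans eq_comm]
    ext
    rw [perm_inv_apply hlab]
    simp only [innerInput, hG, hpos]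
    have hj : ((perm n K j : Fin n) : ℕ) < K.length := by rw [hkl]; exact (perm n K j).2
    rw [List.getElem_append_right (by simp), List.getElem_append_left (by simp; omega),
      List.getElem_map]
    have := perm_inv_apply hK (perm n K j)
    rw [Perm.inv_def, Equiv.symm_apply_apply] at this
    simp [this]
  · intro x hx
    rw [← Perm.inv_eq_iff_eq.trans eq_comm]
    ext
    rw [perm_inv_apply hlab]
    have hb : ((perm m L x : Fin m) : ℕ) ≠ L₁.length := by
      rw [← hpos]; exact fun e => hx ((perm m L).injective (Fin.ext e))
    have hxL := perm_inv_apply hL (perm m L x)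
    rw [Perm.inv_def, Equiv.symm_apply_apply, eq_comm, List.getElem_eq_iff] at hxL
    have hxi : (x : ℕ) ≠ i := fun e => hx (Fin.ext e)
    have hxm := (perm m L x).2
    have hout : ((outerInput h i x hx : Fin r) : ℕ) =
        if (x : ℕ) < i then (x : ℕ) else x + K.length - 1 := by
      simp only [outerInput, Fin.lt_def, hkl]
      split_ifs <;> rfl
    rw [List.getElem_eq_iff, hG, hout]
    obtain ⟨b, hbv⟩ : ∃ b, b = ((perm m L x : Fin m) : ℕ) := ⟨_, rfl⟩
    rw [← hbv] at hxL hb hxm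
    rw [hsplit] at hxL
    by_cases c : b < L₁.length
    · have c' : perm m L x < perm m L i := by rw [Fin.lt_def, hpos, ← hbv]; exact c
      rw [List.getElem?_append_left c] at hxL
      have ho : ((outerInput h (perm m L i) (perm m L x) ((perm m L).injective.ne hx) : Fin r) : ℕ)
          = b := by
        simp only [outerInput, dif_pos c', hbv]
      rw [ho, List.getElem?_append_left (by simpa using c), List.getElem?_map, hxL]
      rfl
    · have c' : ¬ perm m L x < perm m L i := by rw [Fin.lt_def, hpos, ← hbv]; exact c
      rw [List.getElem?_append_right (by omega), List.getElem?_cons, if_neg (by omega)] at hxL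
      have ho : ((outerInput h (perm m L i) (perm m L x) ((perm m L).injective.ne hx) : Fin r) : ℕ)
          = b + n - 1 := by
        simp only [outerInput, dif_neg c', hbv]
      rw [ho, List.getElem?_append_right (by simp; omega),
        List.getElem?_append_right (by simp; omega), List.getElem?_map]
      have e : b + n - 1 - (L₁.map fun x => if x < (i : ℕ) then x else x + K.length - 1).length -
          (K.map (i.1 + ·)).length = b - L₁.length - 1 := by
        simp; omega
      rw [e, hxL]
      rfl

/-- Peeling off the head separates the inversions that involve it from those of the tail.
Distinctness of the entries makes "not less" mean "greater". The left side has the shape of the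
product formula for the sign of a permutation. -/
theorem prod_inversions (L : List ℕ) (hL : L.Nodup) :
    ∏ i : Fin L.length, ∏ j ∈ Finset.Ioi i, (if L[i.1] < L[j.1] then (1 : ℤˣ) else -1) =
      bif oddInversions L then -1 else 1 := by
  induction L with
  | nil => rfl
  | cons x L ih =>
    have hnd := List.nodup_cons.1 hL
    have e1 : ∀ M : List ℕ, x ∉ M → ∏ j : Fin M.length, (if x < M[j.1] then (1 : ℤˣ) else -1) =
        bif oddBelow x M then -1 else 1 := by
      intro M hM
      induction M with
      | nil => rfl
      | cons y M ihM =>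
        simp only [List.mem_cons, not_or] at hM
        rw [oddBelow]
        by_cases c : y < x
        · have hb : Nat.blt y x = true := by rw [Nat.blt_eq]; exact c
          refine (Fin.prod_univ_succ _).trans
            ((congrArg₂ (· * ·) (if_neg (not_lt.2 c.le)) (ihM hM.2)).trans ?_)
          rw [hb]
          cases oddBelow x M <;> simp
        · have hb : Nat.blt y x = false := by rw [← Bool.not_eq_true, Nat.blt_eq]; exact c
          refine (Fin.prod_univ_succ _).trans
            ((congrArg₂ (· * ·) (if_pos (lt_of_le_of_ne (not_lt.1 c) hM.1)) (ihM hM.2)).trans ?_)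
          rw [hb]
          cases oddBelow x M <;> simp
    have e2 : ∏ j ∈ Finset.Ioi (0 : Fin (L.length + 1)),
        (if (x :: L)[(0 : Fin (L.length + 1)).1] < (x :: L)[j.1] then (1 : ℤˣ) else -1) =
        bif oddBelow x L then -1 else 1 := by
      rw [← e1 L hnd.1, Fin.Ioi_zero_eq_map, Finset.prod_map]
      rfl
    have e3 : ∀ i : Fin L.length, ∏ j ∈ Finset.Ioi i.succ,
        (if (x :: L)[i.succ.1] < (x :: L)[j.1] then (1 : ℤˣ) else -1) =
        ∏ j ∈ Finset.Ioi i, (if L[i.1] < L[j.1] then (1 : ℤˣ) else -1) := by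
      intro i
      rw [Fin.Ioi_succ, Finset.prod_map]
      rfl
    refine (Fin.prod_univ_succ _).trans ((congrArg₂ (· * ·) e2
      ((Finset.prod_congr rfl fun i _ => e3 i).trans (ih hnd.2))).trans ?_)
    rw [oddInversions]
    cases oddBelow x L <;> cases oddInversions L <;> simp

theorem psign_perm {k : Type u} [CommRing k] {n : ℕ} {L : List ℕ} (h : L.Perm (List.range n)) :
    psign k (perm n L) = bsign k (oddInversions L) := by
  have hn : L.length = n := by simp [h.length_eq]
  subst hn
  -- The list gives the values of the inverse, which has the same sign.
  rw [psign, ← Perm.sign_inv, Perm.sign_eq_prod_prod_Ioi]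
  have := prod_inversions L (h.nodup_iff.2 List.nodup_range)
  have e : ∀ i j : Fin L.length, (if (perm L.length L)⁻¹ i < (perm L.length L)⁻¹ j
      then (1 : ℤˣ) else -1) = if L[i.1] < L[j.1] then (1 : ℤˣ) else -1 := by
    intro i j
    simp only [Fin.lt_def, perm_inv_apply h]
  simp only [e]
  rw [this]
  cases oddInversions L <;> simp [bsign]

/-! ### Evaluation of formal linear combinations -/

/-- A term of a linear combination is a labelled word of arity `n` and degree `p`. -/
def TermOk (n : ℕ) (p : ℤ) (s : ℤ × Word × List ℕ) : Prop :=
  s.2.1.Ok ∧ Word.ar s.2.1 = n ∧ Word.deg s.2.1 = p ∧ s.2.2.Perm (List.range n)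

instance (n : ℕ) (p : ℤ) (s : ℤ × Word × List ℕ) : Decidable (TermOk n p s) :=
  inferInstanceAs (Decidable (_ ∧ _ ∧ _ ∧ _))

/-- All terms of a linear combination have arity `n` and degree `p`. -/
def LC.Ok (n : ℕ) (p : ℤ) (x : LC) : Prop := ∀ s ∈ x, TermOk n p s

instance (n : ℕ) (p : ℤ) (x : LC) : Decidable (LC.Ok n p x) :=
  inferInstanceAs (Decidable (∀ s ∈ x, _))

theorem LC.Ok.append {n : ℕ} {p : ℤ} {x y : LC} (hx : x.Ok n p) (hy : y.Ok n p) :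
    LC.Ok n p (x ++ y) := by
  intro s hs
  rcases List.mem_append.1 hs with h | h
  exacts [hx s h, hy s h]

theorem LC.Ok.smul {n : ℕ} {p : ℤ} {x : LC} (c : ℤ) (hx : x.Ok n p) : (x.smul c).Ok n p := by
  intro s hs
  obtain ⟨t, ht, rfl⟩ := List.mem_map.1 hs
  exact hx t ht

section LCEval

variable {k : Type u} [CommRing k] {P : PreDGOperad.{u, v} k}
  (val : ∀ g : Lam, P.carrier (g.exc + 1) g.deg)

/-- The value of a term. -/
def termAt (n : ℕ) (p : ℤ) (s : ℤ × Word × List ℕ) : P.carrier n p :=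
  (s.1 : k) • P.act (perm n s.2.2) (wordAt P val n p s.2.1)

/-- The value of a linear combination. -/
def lcAt (n : ℕ) (p : ℤ) (x : LC) : P.carrier n p := (x.map (termAt val n p)).sum

theorem lcAt_nil (n : ℕ) (p : ℤ) : lcAt val n p [] = 0 := rfl

theorem lcAt_cons (n : ℕ) (p : ℤ) (s : ℤ × Word × List ℕ) (x : LC) :
    lcAt val n p (s :: x) = termAt val n p s + lcAt val n p x := by
  simp [lcAt]

theorem lcAt_append (n : ℕ) (p : ℤ) (x y : LC) :
    lcAt val n p (x ++ y) = lcAt val n p x + lcAt val n p y := by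
  simp [lcAt]

theorem lcAt_smul (n : ℕ) (p : ℤ) (c : ℤ) (x : LC) :
    lcAt val n p (x.smul c) = (c : k) • lcAt val n p x := by
  induction x with
  | nil => simp [LC.smul, lcAt_nil]
  | cons s x ih =>
    have : LC.smul c (s :: x) = (c * s.1, s.2) :: LC.smul c x := rfl
    rw [this, lcAt_cons, lcAt_cons, ih, smul_add, termAt, termAt, smul_smul]
    push_cast
    rfl

variable {val}

/-- Equivariance merges the two permutations into the block permutation, and the words then compose
by `comp_wordAt`. Grafting takes place where the label `i` sits in the outer list, since this
position is σ(i). -/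
theorem comp_termAt (hP : IsOperad P) {m n r : ℕ} {p q z : ℤ} (h : m + n = r + 1)
    (e : p + q = z) (i : Fin m) {s t : ℤ × Word × List ℕ} (hs : TermOk m p s)
    (ht : TermOk n q t) :
    let u := (s.1 * t.1, Word.graft (s.2.2.idxOf i.1) t.2.1 s.2.1, graftLabels i s.2.2 t.2.2)
    TermOk r z u ∧ P.comp h e i (termAt val m p s) (termAt val n q t) = termAt val r z u := by
  obtain ⟨os, as, ds, ls⟩ := hs
  obtain ⟨ot, at', dt, lt⟩ := ht
  obtain ⟨hl, hb⟩ := graftLabels_isBlockPerm h ls lt i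
  have hi := perm_apply ls i
  have h1 := Word.ar_graft (s.2.2.idxOf i.1) t.2.1 s.2.1
  have h2 := Word.deg_graft (s.2.2.idxOf i.1) t.2.1 s.2.1
  refine ⟨⟨Word.ok_graft ot os (by rw [as, ← hi]; exact (perm m s.2.2 i).2), ?_, ?_, hl⟩, ?_⟩
  · simp only; omega
  · simp only; omega
  · simp only [termAt, map_smul, LinearMap.smul_apply]
    rw [hP.equivariant h e i _ _ _ hb, comp_wordAt val hP ot as ds at' dt, hi, smul_smul]
    push_cast
    rw [mul_comm]

theorem comp_lcAt (hP : IsOperad P) {m n r : ℕ} {p q z : ℤ} (h : m + n = r + 1)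
    (e : p + q = z) (i : Fin m) {x y : LC} (hx : x.Ok m p) (hy : y.Ok n q) :
    (LC.comp i x y).Ok r z ∧
      P.comp h e i (lcAt val m p x) (lcAt val n q y) = lcAt val r z (LC.comp i x y) := by
  induction x with
  | nil => exact ⟨by simp [LC.comp, LC.Ok], by simp [LC.comp, lcAt_nil]⟩
  | cons s x ih =>
    obtain ⟨o1, e1⟩ := ih fun t ht => hx t (by simp [ht])
    have hs := hx s (by simp)
    have : LC.comp i (s :: x) y = (y.map fun t => (s.1 * t.1,
      Word.graft (s.2.2.idxOf i.1) t.2.1 s.2.1, graftLabels i s.2.2 t.2.2)) ++ LC.comp i x y := rfl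
    rw [this, lcAt_append, ← e1, lcAt_cons, map_add, LinearMap.add_apply]
    refine ⟨LC.Ok.append ?_ o1, ?_⟩
    · intro u hu
      obtain ⟨t, ht, rfl⟩ := List.mem_map.1 hu
      exact (comp_termAt (val := val) hP h e i hs (hy t ht)).1
    · congr 1
      clear this e1 o1 ih
      induction y with
      | nil => simp [lcAt_nil]
      | cons t y ihy =>
        rw [lcAt_cons, map_add, List.map_cons, lcAt_cons,
          ihy fun t ht => hy t (by simp [ht]),
          (comp_termAt (val := val) hP h e i hs (hy t (by simp))).2]

theorem gen_ok (g : Lam) : (LC.gen g).Ok (g.exc + 1) g.deg := by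
  intro s hs
  obtain rfl := List.mem_singleton.1 hs
  refine ⟨⟨by simp [Word.ar], trivial⟩, ?_, ?_, List.Perm.refl _⟩
  · simp [Word.ar, Nat.add_comm]
  · simp [Word.deg]

theorem word_ok {w : Word} (hw : w.Ok) (c : ℤ) :
    LC.Ok (Word.ar w) (Word.deg w) [(c, w, List.range (Word.ar w))] := by
  intro s hs
  obtain rfl := List.mem_singleton.1 hs
  exact ⟨hw, rfl, rfl, List.Perm.refl _⟩

theorem lcAt_word (hP : IsOperad P) {n : ℕ} {p : ℤ} (c : ℤ) (w : Word) :
    lcAt val n p [(c, w, List.range n)] = (c : k) • wordAt P val n p w := by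
  simp [lcAt, termAt, perm_range, hP.act_one]

theorem lcAt_gen (hP : IsOperad P) (g : Lam) : lcAt val (g.exc + 1) g.deg (LC.gen g) = val g := by
  rw [LC.gen, lcAt_word hP, wordAt_single val hP g rfl rfl]
  simp

theorem dTable_ok (g : Lam) : (dTable g).Ok (g.exc + 1) (g.deg - 1) := by
  cases g <;> decide +kernel

/-- The values of the generators of arity at most `N` satisfy the formulas for their
differentials. -/
def IsModel (P : PreDGOperad.{u, v} k) (val : ∀ g : Lam, P.carrier (g.exc + 1) g.deg) (N : ℕ) :
    Prop :=
  ∀ g : Lam, g.exc + 1 ≤ N → P.d (show g.deg - 1 + 1 = g.deg by omega) (val g) =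
    lcAt val (g.exc + 1) (g.deg - 1) (dTable g)

theorem Word.one_le_ar (w : Word) : 1 ≤ Word.ar w := by
  induction w with
  | nil => exact le_rfl
  | cons x w ih => exact ih.trans (Nat.le_add_right _ _)

/-- The Leibniz rule along the word. The arity bound passes to each letter and to each initial
subtree because every word has arity at least one, so the model property is needed only up to `N`.
-/
theorem d_wordAt (hP : HasDerivation P) {N : ℕ} (hv : IsModel P val N) (w : Word) (hw : w.Ok)
    (hN : Word.ar w ≤ N) :
    (LC.dWord w).Ok (Word.ar w) (Word.deg w - 1) ∧
      P.d (show Word.deg w - 1 + 1 = Word.deg w by omega)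
        (wordAt P val (Word.ar w) (Word.deg w) w) =
      lcAt val (Word.ar w) (Word.deg w - 1) (LC.dWord w) := by
  induction w with
  | nil =>
    refine ⟨by simp [LC.dWord, LC.Ok], ?_⟩
    change P.d _ (wordAt P val 1 0 []) = 0
    rw [wordAt_nil]
    exact hP.d_one _
  | cons x w ih =>
    obtain ⟨i, g⟩ := x
    have hN' : Word.ar w + g.exc ≤ N := hN
    have hw1 := Word.one_le_ar w
    obtain ⟨o1, e1⟩ := ih hw.2 (by omega)
    have c1 := comp_lcAt (val := val) hP.toIsOperad (r := Word.ar w + g.exc)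
      (z := Word.deg w + g.deg - 1) (by omega) (by omega) ⟨i, hw.1⟩ o1 (gen_ok g)
    have c2 := comp_lcAt (val := val) hP.toIsOperad (r := Word.ar w + g.exc)
      (z := Word.deg w + g.deg - 1) (by omega) (by omega) ⟨i, hw.1⟩
      (word_ok hw.2 (flip (Word.odd w) 1)) (dTable_ok g)
    refine ⟨LC.Ok.append c1.1 c2.1, ?_⟩
    rw [LC.dWord]
    refine Eq.trans ?_ (lcAt_append val (Word.ar w + g.exc) (Word.deg w + g.deg - 1) _ _).symm
    have h0 := wordAt_cons P val (w := w) (g := g) (r := Word.ar w + g.exc)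
      (s := Word.deg w + g.deg) rfl rfl (by omega) rfl ⟨i, hw.1⟩
    change P.d (show Word.deg w + g.deg - 1 + 1 = Word.deg w + g.deg by omega)
      (wordAt P val (Word.ar w + g.exc) (Word.deg w + g.deg) ((i, g) :: w)) = _
    rw [← c1.2, ← c2.2, lcAt_gen hP.toIsOperad, lcAt_word hP.toIsOperad, ← e1, ← hv g (by omega), h0,
      hP.d_comp (p' := Word.deg w - 1) (q' := g.deg - 1) _ _ (by omega) (by omega) _ (by omega)
        (by omega), cast_flip, Word.odd_eq, ← ksign_eq_bsign]
    simp

/-- The transfer principle: the formal differential computes the actual one in every model, so that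
an identity checked once on formal combinations holds in the cobar constructions and in endomorphism
operads alike. -/
theorem d_lcAt (hP : HasDerivation P) {N : ℕ} (hv : IsModel P val N) {n : ℕ} {p q : ℤ}
    (hn : n ≤ N) (h : q + 1 = p) {x : LC} (hx : x.Ok n p) :
    (LC.d x).Ok n q ∧ P.d h (lcAt val n p x) = lcAt val n q (LC.d x) := by
  obtain rfl : q = p - 1 := by omega
  induction x with
  | nil => exact ⟨by simp [LC.d, LC.Ok], by simp [LC.d, lcAt_nil]⟩
  | cons s x ih =>
    obtain ⟨o1, e1⟩ := ih fun t ht => hx t (by simp [ht])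
    obtain ⟨os, as, ds, ls⟩ := hx s (by simp)
    have hd := d_wordAt hP hv s.2.1 os (as ▸ hn)
    have hsplit : LC.d (s :: x) = ((LC.dWord s.2.1).map fun t =>
      (s.1 * t.1, t.2.1, renameLabels s.2.2 t.2.2)) ++ LC.d x := rfl
    rw [hsplit, lcAt_append, ← e1, lcAt_cons, map_add]
    subst as ds
    refine ⟨LC.Ok.append ?_ o1, ?_⟩
    · intro u hu
      obtain ⟨t, ht, rfl⟩ := List.mem_map.1 hu
      obtain ⟨ot, at', dt, lt⟩ := hd.1 t ht
      exact ⟨ot, at', dt, (renameLabels_perm ls lt).1⟩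
    · congr 1
      rw [termAt, map_smul, hP.d_act, hd.2]
      generalize LC.dWord s.2.1 = y at hd ⊢
      have hy := hd.1
      clear hd hsplit e1 o1 ih hx
      induction y with
      | nil => simp [lcAt_nil]
      | cons t y ihy =>
        rw [lcAt_cons, map_add, smul_add, List.map_cons, lcAt_cons,
          ihy fun t ht => hy t (by simp [ht])]
        congr 1
        obtain ⟨ot, at', dt, lt⟩ := hy t (by simp)
        simp only [termAt, map_smul, (renameLabels_perm ls lt).2, hP.act_mul, smul_smul]
        push_cast
        rfl

/-- The value of a search tree. -/
def collAt (val : ∀ g : Lam, P.carrier (g.exc + 1) g.deg) (n : ℕ) (p : ℤ) : Coll → P.carrier n p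
  | .nil => 0
  | .node l _ c w L r => collAt val n p l + termAt val n p (c, w, L) + collAt val n p r

theorem collAt_insert (n : ℕ) (p : ℤ) (key : ℕ) (c : ℤ) (w : Word) (L : List ℕ) (t : Coll) :
    collAt val n p (t.insert key c w L) = collAt val n p t + termAt val n p (c, w, L) := by
  induction t with
  | nil => simp [Coll.insert, collAt]
  | node l key' c' w' L' r ihl ihr =>
    rw [Coll.insert]
    cases Nat.beq key key' with
    | true =>
      rw [cond_true]
      split_ifs with hw
      · obtain ⟨rfl, rfl⟩ := hw
        simp only [collAt, termAt, Int.cast_add, add_smul]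
        abel
      · simp only [collAt, ihr]
        abel
    | false =>
      rw [cond_false]
      cases Nat.blt key key' with
      | true =>
        rw [cond_true]
        simp only [collAt, ihl]
        abel
      | false =>
        rw [cond_false]
        simp only [collAt, ihr]
        abel

theorem collAt_eq_zero (n : ℕ) (p : ℤ) (t : Coll) (ht : t.isZero = true) :
    collAt val n p t = 0 := by
  induction t with
  | nil => rfl
  | node l key c w L r ihl ihr =>
    simp only [Coll.isZero, Bool.and_eq_true, decide_eq_true_eq] at ht
    simp [collAt, ihl ht.1, ihr ht.2.2, ht.2.1, termAt]

theorem collAt_collect (n : ℕ) (p : ℤ) (x : LC) :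
    collAt val n p x.collect = lcAt val n p x := by
  have key : ∀ (x : LC) (t : Coll), collAt val n p
      (x.foldl (fun t s => t.insert (key s.2.1 s.2.2) s.1 s.2.1 s.2.2) t) =
      collAt val n p t + lcAt val n p x := by
    intro x
    induction x with
    | nil => intro t; simp [lcAt_nil]
    | cons s x ih =>
      intro t
      rw [List.foldl_cons, ih, collAt_insert, lcAt_cons, add_assoc]
  rw [LC.collect, key]
  simp [collAt]

theorem lcAt_sortWords (hP : IsOperad P) {n : ℕ} {p : ℤ} {x : LC} (hx : x.Ok n p) :
    x.sortWords.Ok n p ∧ lcAt val n p x = lcAt val n p x.sortWords := by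
  induction x with
  | nil => exact ⟨hx, rfl⟩
  | cons s x ih =>
    obtain ⟨o1, e1⟩ := ih fun t ht => hx t (by simp [ht])
    obtain ⟨os, as, ds, ls⟩ := hx s (by simp)
    obtain ⟨e2, o2, a2, d2⟩ := wordAt_sort val hP s.2.1 os as ds
    have : LC.sortWords (s :: x) =
      (flip (Word.sort s.2.1).1 s.1, (Word.sort s.2.1).2, s.2.2) :: LC.sortWords x := rfl
    rw [this]
    constructor
    · intro t ht
      rcases List.mem_cons.1 ht with rfl | ht
      · exact ⟨o2, a2, d2, ls⟩
      · exact o1 t ht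
    · rw [lcAt_cons, lcAt_cons, ← e1, termAt, termAt, e2, cast_flip, map_smul, smul_smul]
      simp only [mul_comm]

/-- A linear combination which vanishes after sorting has value zero. -/
theorem lcAt_eq_zero (hP : IsOperad P) {n : ℕ} {p : ℤ} {x : LC} (hx : x.Ok n p)
    (h : x.isZero = true) : lcAt val n p x = 0 := by
  rw [(lcAt_sortWords hP hx).2, ← collAt_collect]
  exact collAt_eq_zero n p _ h

/-! ### Alternation over the permutations of the first labels -/

/-- `∑ (-1)^{|σ|} x^σ` over the permutations `σ` which fix the inputs `j, j + 1, …`. -/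
def altBelow (P : PreDGOperad.{u, v} k) (j : ℕ) {n : ℕ} {p : ℤ} :
    P.carrier n p →ₗ[k] P.carrier n p :=
  ∑ σ : {σ : Perm (Fin n) // ∀ a : Fin n, j ≤ a → σ a = a}, psign k σ.1 • P.act σ.1

/-- Left multiplication by `τ` permutes the subgroup over which the sum runs. -/
theorem altBelow_act (hP : IsOperad P) {j n : ℕ} {p : ℤ} (τ : Perm (Fin n))
    (hτ : ∀ a : Fin n, j ≤ a → τ a = a) (x : P.carrier n p) :
    altBelow P j (P.act τ x) = psign k τ • altBelow P j x := by
  have hτ' : ∀ a : Fin n, j ≤ a → τ⁻¹ a = a := fun a ha => by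
    rw [Perm.inv_eq_iff_eq, hτ a ha]
  let e : {σ : Perm (Fin n) // ∀ a : Fin n, j ≤ a → σ a = a} ≃
      {σ : Perm (Fin n) // ∀ a : Fin n, j ≤ a → σ a = a} :=
    { toFun := fun σ => ⟨τ * σ.1, fun a ha => by rw [Perm.mul_apply, σ.2 a ha, hτ a ha]⟩
      invFun := fun σ => ⟨τ⁻¹ * σ.1, fun a ha => by rw [Perm.mul_apply, σ.2 a ha, hτ' a ha]⟩
      left_inv := fun σ => by simp
      right_inv := fun σ => by simp }
  simp only [altBelow, LinearMap.sum_apply, LinearMap.smul_apply, Finset.smul_sum]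
  rw [← Equiv.sum_comp e fun σ => psign k τ • psign k σ.1 • P.act σ.1 x]
  refine Finset.sum_congr rfl fun σ _ => ?_
  change _ = psign k τ • psign k (τ * σ.1) • P.act (τ * σ.1) x
  rw [hP.act_mul, psign_mul, smul_smul, ← mul_assoc, psign_mul_self, one_mul]

theorem altBelow_eq_alt {n : ℕ} {p : ℤ} (x : P.carrier n p) : altBelow P n x = P.alt x := by
  simp only [altBelow, LinearMap.sum_apply, LinearMap.smul_apply, PreDGOperad.alt]
  exact Equiv.sum_comp (Equiv.subtypeUnivEquiv fun σ a ha => absurd a.2 (not_lt.2 ha))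
    fun σ => psign k σ • P.act σ x

/-- Only the number of small labels and the collection of large ones matter, and these agree for all
labellings of n inputs; hence the canonical form of a labelling is again a labelling. -/
theorem canonLabels_perm (j : ℕ) (L : List ℕ) : ∀ m : ℕ, (canonLabels j m L).Perm
    (List.range' m (L.countP (· < j)) ++ L.filter fun x => ! decide (x < j)) := by
  induction L with
  | nil => intro m; exact List.Perm.refl _
  | cons x L ih =>
    intro m
    rw [canonLabels]
    by_cases h : x < j
    · have hb : Nat.blt x j = true := by rw [Nat.blt_eq]; exact h
      rw [hb, cond_true, List.countP_cons_of_pos (by simpa using h), List.range'_succ,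
        List.filter_cons_of_neg (by simpa using h)]
      exact (ih (m + 1)).cons m
    · have hb : Nat.blt x j = false := by rw [← Bool.not_eq_true, Nat.blt_eq]; exact h
      rw [hb, cond_false, List.countP_cons_of_neg (by simpa using h),
        List.filter_cons_of_pos (by simpa using h)]
      exact ((ih m).cons x).trans List.perm_middle.symm

theorem canonLabels_getElem (j : ℕ) (L : List ℕ) : ∀ (m a x : ℕ), L[a]? = some x → j ≤ x →
    (canonLabels j m L)[a]? = some x := by
  induction L with
  | nil => intro m a x h; simp at h
  | cons y L ih =>
    intro m a x h hx
    rw [canonLabels]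
    cases a with
    | zero =>
      obtain rfl : y = x := by simpa using h
      have hb : Nat.blt y j = false := by rw [← Bool.not_eq_true, Nat.blt_eq]; exact not_lt.2 hx
      simp [hb]
    | succ a =>
      have h' : L[a]? = some x := by simpa using h
      cases Nat.blt y j <;> simp [ih _ a x h' hx]

/-- A labelling and its canonical form `C` have the labels from `j` on at the same positions, so
(perm C)⁻¹ · perm L fixes those labels. It lies in the subgroup of the alternation, which absorbs it
at the cost of its sign. -/
theorem altBelow_act_perm (hP : IsOperad P) {j n : ℕ} {p : ℤ}
    (hj : canonLabels j 0 (List.range n) = List.range n) {L : List ℕ}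
    (hL : L.Perm (List.range n)) (x : P.carrier n p) :
    (canonLabels j 0 L).Perm (List.range n) ∧
    altBelow P j (P.act (perm n L) x) =
      bsign k (xor (oddInversions L) (oddInversions (canonLabels j 0 L))) •
        altBelow P j (P.act (perm n (canonLabels j 0 L)) x) := by
  have hC : (canonLabels j 0 L).Perm (List.range n) := by
    refine (canonLabels_perm j L 0).trans ?_
    rw [hL.countP_eq]
    refine ((List.Perm.refl _).append (hL.filter _)).trans ?_
    refine (canonLabels_perm j (List.range n) 0).symm.trans ?_
    rw [hj]
  refine ⟨hC, ?_⟩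
  generalize hCdef : canonLabels j 0 L = C at hC
  have hτ : ∀ a : Fin n, j ≤ a → ((perm n C)⁻¹ * perm n L) a = a := by
    intro a ha
    rw [Perm.mul_apply]
    ext
    rw [perm_inv_apply hC, List.getElem_eq_iff, ← hCdef]
    apply canonLabels_getElem j L 0 _ _ _ ha
    rw [← List.getElem_eq_iff (h := by simp [hL.length_eq]), ← perm_inv_apply hL]
    simp
  have e : perm n L = perm n C * ((perm n C)⁻¹ * perm n L) := by group
  have hs : psign k ((perm n C)⁻¹ * perm n L) = bsign k (xor (oddInversions L) (oddInversions C)) := by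
    rw [bsign_xor, ← psign_perm hL, ← psign_perm hC, psign_mul, mul_comm]
    simp [psign]
  conv_lhs => rw [e, hP.act_mul, altBelow_act hP _ hτ, hs]

theorem altBelow_altLabels (hP : IsOperad P) {j n : ℕ} {p : ℤ}
    (hj : canonLabels j 0 (List.range n) = List.range n) {x : LC} (hx : x.Ok n p) :
    altBelow P j (lcAt val n p x) = altBelow P j (lcAt val n p (x.altLabels j)) := by
  induction x with
  | nil => rfl
  | cons s x ih =>
    obtain ⟨os, as, ds, ls⟩ := hx s (by simp)
    have : LC.altLabels j (s :: x) = (flip (xor (oddInversions s.2.2)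
      (oddInversions (canonLabels j 0 s.2.2))) s.1, s.2.1, canonLabels j 0 s.2.2) ::
        LC.altLabels j x := rfl
    rw [this, lcAt_cons, lcAt_cons, map_add, map_add, ih fun t ht => hx t (by simp [ht])]
    congr 1
    simp only [termAt, map_smul]
    rw [(altBelow_act_perm hP hj ls _).2, smul_smul, cast_flip, mul_comm]

/-- A linear combination which vanishes after alternation of the labels less than `j`. -/
theorem altBelow_lcAt_eq_zero (hP : IsOperad P) {j n : ℕ} {p : ℤ}
    (hj : canonLabels j 0 (List.range n) = List.range n) {x : LC} (hx : x.Ok n p)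
    (h : x.isAltZero j = true) : altBelow P j (lcAt val n p x) = 0 := by
  rw [(lcAt_sortWords hP hx).2, altBelow_altLabels hP hj (lcAt_sortWords (val := val) hP hx).1,
    ← collAt_collect, collAt_eq_zero n p _ h, map_zero]

end LCEval

/-! ### The cobar construction of the resolution -/

/-- The corresponding generator of the resolution. -/
def Lam.toDGen : ∀ g : Lam, DGen (g.exc + 1) (g.deg + 1)
  | .a2 => .l2
  | .a21 => .l2_1
  | .a211 => .l2_11
  | .a2111 => .l2_111
  | .a3 => .l3
  | .a31 => .l3_1
  | .a32 => .l3_2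
  | .a311 => .l3_11
  | .a312 => .l3_12
  | .a322 => .l3_22
  | .a4 => .l4
  | .a41 => .l4_1
  | .a42 => .l4_2
  | .a43 => .l4_3
  | .a5 => .l5

/-- The corresponding generator of the cobar construction. -/
def DGen.toLam : ∀ {n : ℕ} {p : ℤ}, DGen n p → Lam
  | _, _, .l2 => .a2
  | _, _, .l2_1 => .a21
  | _, _, .l2_11 => .a211
  | _, _, .l2_111 => .a2111
  | _, _, .l3 => .a3
  | _, _, .l3_1 => .a31
  | _, _, .l3_2 => .a32
  | _, _, .l3_11 => .a311
  | _, _, .l3_12 => .a312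
  | _, _, .l3_22 => .a322
  | _, _, .l4 => .a4
  | _, _, .l4_1 => .a41
  | _, _, .l4_2 => .a42
  | _, _, .l4_3 => .a43
  | _, _, .l5 => .a5

theorem DGen.exc_toLam {n : ℕ} {p : ℤ} (g : DGen n p) : g.toLam.exc + 1 = n := by
  cases g <;> rfl

theorem DGen.deg_toLam {n : ℕ} {p : ℤ} (g : DGen n p) : g.toLam.deg + 1 = p := by
  cases g <;> rfl

section ResolutionModel

variable (k : Type u) [CommRing k]

/-- The generators of the cobar construction of the resolution. -/
def lamVal (g : Lam) : (cobar (lieD k)).carrier (g.exc + 1) g.deg :=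
  sInv rfl (gEl k rfl g.toDGen 1)

/-- The value of a word in the cobar construction of the resolution. -/
abbrev wordR (n : ℕ) (p : ℤ) (w : Word) : (cobar (lieD k)).carrier n p :=
  wordAt (cobar (lieD k)) (lamVal k) n p w

/-- The map `x ↦ s⁻¹x`. -/
def sInvR {n : ℕ} {p q : ℤ} (h : q + 1 = p) :
    (lieDMod k).carrier n p →ₗ[k] (cobar (lieD k)).carrier n q := FreeOp.gen h

/-- The map `(μ ⊗_i ν)^σ ↦ (-1)^{|μ|} (s⁻¹μ ∘_i s⁻¹ν)^σ`. -/
def infR {r : ℕ} {s t : ℤ} (h : t + 2 = s) :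
    InfComp (lieDMod k) r s →ₗ[k] (cobar (lieD k)).carrier r t := Cobar.infToFree (lieD k) h

theorem gEl_act {n : ℕ} {p q : ℤ} (h : p = q) (g : DGen n p) (σ : Perm (Fin n)) :
    gEl k h g σ = (lieDMod k).act σ (gEl k h g 1) := by
  change _ = Finsupp.mapDomain _ _
  simp [gEl, Finsupp.mapDomain_single]

theorem sInvR_act {n : ℕ} {p q : ℤ} (h : q + 1 = p) (σ : Perm (Fin n))
    (x : (lieDMod k).carrier n p) :
    sInvR k h ((lieDMod k).act σ x) = (cobar (lieD k)).act σ (sInvR k h x) :=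
  FreeOp.gen_act h σ x

theorem sInvR_toDGen (g : Lam) {q q' : ℤ} (e : g.deg + 1 = q') (h : q + 1 = q') :
    sInvR k h (gEl k e g.toDGen 1) = wordR k (g.exc + 1) q [(0, g)] := by
  subst e
  obtain rfl : q = g.deg := by omega
  exact (wordAt_single (lamVal k) (cobar_hasDerivation _).toIsOperad g rfl rfl).symm

theorem sInvR_gEl {n : ℕ} {p q q' : ℤ} (g : DGen n p) (e : p = q') (h : q + 1 = q')
    (σ : Perm (Fin n)) :
    sInvR k h (gEl k e g σ) = (cobar (lieD k)).act σ (wordR k n q [(0, g.toLam)]) := by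
  rw [gEl_act, sInvR_act]
  congr 1
  cases g
  · exact sInvR_toDGen k .a2 e h
  · exact sInvR_toDGen k .a21 e h
  · exact sInvR_toDGen k .a211 e h
  · exact sInvR_toDGen k .a2111 e h
  · exact sInvR_toDGen k .a3 e h
  · exact sInvR_toDGen k .a31 e h
  · exact sInvR_toDGen k .a32 e h
  · exact sInvR_toDGen k .a311 e h
  · exact sInvR_toDGen k .a312 e h
  · exact sInvR_toDGen k .a322 e h
  · exact sInvR_toDGen k .a4 e h
  · exact sInvR_toDGen k .a41 e h
  · exact sInvR_toDGen k .a42 e h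
  · exact sInvR_toDGen k .a43 e h
  · exact sInvR_toDGen k .a5 e h

/-- Here the degree of the undesuspended outer generator determines the sign, in accordance with the
convention for `infToFree`. -/
theorem infR_tEl {m n r : ℕ} {p q s t : ℤ} (g : DGen m p) (g' : DGen n q) (i : Fin m)
    (σ : Perm (Fin r)) (hm : m + n = r + 1) (hp : p + q = s) (h : t + 2 = s) :
    infR k h (tEl k g i g' σ hm hp) =
      ksign k p • (cobar (lieD k)).act σ (wordR k r t [(i.1, g'.toLam), (0, g.toLam)]) := by
  have H := (cobar_hasDerivation (lieD k)).toIsOperad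
  have h1 := g.exc_toLam
  have h2 := g.deg_toLam
  have h3 := g'.exc_toLam
  have h4 := g'.deg_toLam
  have key : (cobar (lieD k)).comp hm (show (p - 1) + (q - 1) = t by omega) i
      (sInvR k (by omega) (gEl k rfl g 1)) (sInvR k (by omega) (gEl k rfl g' 1)) =
      wordR k r t [(i.1, g'.toLam), (0, g.toLam)] := by
    rw [sInvR_gEl, sInvR_gEl, H.act_one, H.act_one]
    refine (comp_wordAt (lamVal k) H (by simp [Word.Ok, Word.ar])
      (by simp [Word.ar]; omega) (by simp [Word.deg]; omega) (by simp [Word.ar]; omega)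
      (by simp [Word.deg]; omega) hm _ i).trans ?_
    simp [Word.graft]
  rw [← key]
  exact Cobar.infToFree_mk (lieD k) h hm hp i _ _ σ

theorem cobar_d_gEl {n : ℕ} {p q r : ℤ} (h : q + 1 = p) (h' : r + 1 = q) (g : DGen n p) :
    (cobar (lieD k)).d h' (sInvR k h (gEl k rfl g 1)) =
      -sInvR k h' (bdGen k h g) - infR k (show r + 2 = p by omega) (decGen k g) := by
  have e1 : freeExt (fun σ => (lieDMod k).act σ) (bdGen k h) (gEl k rfl g 1) = bdGen k h g := by
    simp only [freeExt, Finsupp.lift_apply, gEl]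
    rw [Finsupp.sum_single_index (by simp), one_smul]
    exact (lieDMod k).act_one _
  have e2 : freeExt InfComp.act (decGen k) (gEl k rfl g 1) = InfComp.act 1 (decGen k g) := by
    simp only [freeExt, Finsupp.lift_apply, gEl]
    rw [Finsupp.sum_single_index (by simp), one_smul]
  have e3 : infR k (show r + 2 = p by omega) (InfComp.act 1 (decGen k g)) =
      infR k (show r + 2 = p by omega) (decGen k g) :=
    (Cobar.infToFree_act (lieD k) _ 1 _).trans (FreeOp.act_one _)
  rw [← e3, ← e2]
  conv_rhs => rw [← e1]
  rfl

theorem perm_eq_cyc_two :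
    perm 2 [1, 0] = cyc [0, 1] := by
  decide +kernel

/-- Because lists record inverses, the cycle 0 → 1 → 2 → 0 corresponds to `[2, 0, 1]`. -/
theorem perm_eq_cyc_three :
    perm 3 [1, 0, 2] = cyc [0, 1] ∧
    perm 3 [0, 2, 1] = cyc [1, 2] ∧
    perm 3 [2, 0, 1] = cyc [0, 1, 2] ∧
    perm 3 [1, 2, 0] = cyc [0, 2, 1] := by
  decide +kernel

theorem perm_eq_cyc_four :
    perm 4 [1, 0, 2, 3] = cyc [0, 1] ∧
    perm 4 [0, 2, 1, 3] = cyc [1, 2] ∧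
    perm 4 [0, 1, 3, 2] = cyc [2, 3] ∧
    perm 4 [2, 0, 1, 3] = cyc [0, 1, 2] ∧
    perm 4 [1, 2, 0, 3] = cyc [0, 2, 1] := by
  decide +kernel

theorem perm_eq_cyc_five :
    perm 5 [1, 0, 2, 3, 4] = cyc [0, 1] ∧
    perm 5 [0, 2, 1, 3, 4] = cyc [1, 2] ∧
    perm 5 [0, 1, 3, 2, 4] = cyc [2, 3] ∧
    perm 5 [2, 0, 1, 3, 4] = cyc [0, 1, 2] ∧
    perm 5 [1, 2, 0, 3, 4] = cyc [0, 2, 1] ∧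
    perm 5 [0, 3, 1, 2, 4] = cyc [1, 2, 3] ∧
    perm 5 [0, 2, 3, 1, 4] = cyc [1, 3, 2] ∧
    perm 5 [3, 0, 1, 2, 4] = cyc [0, 1, 2, 3] ∧
    perm 5 [1, 3, 0, 2, 4] = cyc [0, 2, 3, 1] ∧
    perm 5 [1, 2, 3, 0, 4] = cyc [0, 3, 2, 1] ∧
    perm 5 [2, 3, 0, 1, 4] = cyc [0, 2] * cyc [1, 3] := by
  decide +kernel



/-- This ties the table to the given differential and decomposition map: after translating cycles
into label lists and evaluating the signs (-1)^|μ|, both sides are the same sum. -/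
theorem d_gEl_eq {n : ℕ} {p q r : ℤ} (h : q + 1 = p) (h' : r + 1 = q) (g : DGen n p) :
    -sInvR k h' (bdGen k h g) - infR k (show r + 2 = p by omega) (decGen k g) =
      lcAt (lamVal k) n r (dTable g.toLam) := by
  have H := (cobar_hasDerivation (lieD k)).toIsOperad
  obtain ⟨p1, p2, p3, p4⟩ := perm_eq_cyc_three
  obtain ⟨q1, q2, q3, q4, q5⟩ := perm_eq_cyc_four
  obtain ⟨r1, r2, r3, r4, r5, r6, r7, r8, r9, r10, r11⟩ := perm_eq_cyc_five
  have s2 : perm 2 [0, 1] = 1 := perm_range 2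
  have s3 : perm 3 [0, 1, 2] = 1 := perm_range 3
  have s4 : perm 4 [0, 1, 2, 3] = 1 := perm_range 4
  have s5 : perm 5 [0, 1, 2, 3, 4] = 1 := perm_range 5
  have k2 : ksign k 2 = 1 := by simp [ksign]
  have k3 : ksign k 3 = -1 := by simp [ksign, Int.negOnePow_odd 3 (by decide)]
  have v3 : ((3 : Fin 4) : ℕ) = 3 := rfl
  cases g <;>
  simp only [bdGen,
    decGen, map_add, map_sub, map_neg, map_zero, sInvR_gEl, infR_tEl, DGen.toLam, dTable,
    lcAt_cons, lcAt_nil, termAt, perm_eq_cyc_two, p1, p2, p3, p4, q1, q2, q3, q4, q5, r1, r2, r3,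
    r4, r5, r6, r7, r8, r9, r10, r11, s2, s3, s4, s5, ksign_one, k2, k3, H.act_one, Int.cast_one,
    Int.cast_neg, one_smul, neg_smul, neg_neg, add_zero, sub_zero, neg_zero, wordR,
    Fin.val_zero, Fin.val_one, Fin.val_two, v3] <;>
  abel

theorem lamVal_isModel : IsModel (cobar (lieD k)) (lamVal k) 5 := by
  intro g _
  refine (cobar_d_gEl k rfl (show g.deg - 1 + 1 = g.deg by omega) g.toDGen).trans ?_
  rw [d_gEl_eq]
  cases g <;> rfl

/-- The cooperad laws of the resolution, in the form of d² = 0 on the fifteen generators. Sorting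
the words is enough for all terms to cancel; no relabelling is needed. -/
theorem isZero_d_d_gen (g : Lam) : (LC.d (LC.d (LC.gen g))).isZero = true := by
  cases g <;> decide +kernel

theorem IsModel.d_d {k : Type u} [CommRing k] {P : PreDGOperad.{u, v} k}
    {val : ∀ g : Lam, P.carrier (g.exc + 1) g.deg} (hP : HasDerivation P) {N : ℕ}
    (hv : IsModel P val N) (g : Lam) (hg : g.exc + 1 ≤ N) {q r : ℤ} (h : q + 1 = g.deg)
    (h' : r + 1 = q) : P.d h' (P.d h (val g)) = 0 := by
  rw [← lcAt_gen (val := val) hP.toIsOperad g]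
  have h1 := d_lcAt hP hv hg h (gen_ok g)
  have h2 := d_lcAt hP hv hg h' h1.1
  rw [h1.2, h2.2]
  exact lcAt_eq_zero hP.toIsOperad h2.1 (isZero_d_d_gen g)

theorem Lam.exc_lt (g : Lam) : g.exc + 1 ≤ 5 := by
  cases g <;> decide

/-- The elements of the resolution are linear combinations of the elements `g^σ`. -/
theorem lieDMod_induction {n : ℕ} {p : ℤ} {motive : (lieDMod k).carrier n p → Prop}
    (zero : motive 0) (add : ∀ x y, motive x → motive y → motive (x + y))
    (smul : ∀ (c : k) x, motive x → motive (c • x))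
    (gen : ∀ (g : DGen n p) (σ : Perm (Fin n)), motive ((lieDMod k).act σ (gEl k rfl g 1)))
    (x : (lieDMod k).carrier n p) : motive x := by
  refine Finsupp.induction_linear x zero (fun x y => add x y) ?_
  rintro ⟨g, σ⟩ c
  have := smul c _ (gen g σ)
  rw [← gEl_act] at this
  have e : c • gEl k rfl g σ = Finsupp.single (g, σ) c :=
    (Finsupp.smul_single c (g, σ) (1 : k)).trans (by rw [smul_eq_mul, mul_one])
  exact e ▸ this

theorem cobar_lieD_isDGOperad : IsDGOperad (cobar (lieD k)) := by
  have D := cobar_hasDerivation (lieD k)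
  refine cobar_isDGOperad ?_
  intro n p q r t h h' h'' x
  change (cobar (lieD k)).d h'' ((cobar (lieD k)).d h' (sInvR k h x)) = 0
  induction x using lieDMod_induction with
  | zero => simp only [map_zero]
  | add x y hx hy => simp only [map_add, hx, hy, add_zero]
  | smul c x hx => simp only [map_smul, hx, smul_zero]
  | gen g σ =>
    rw [sInvR_act, D.d_act, D.d_act]
    -- By equivariance only the generators themselves matter, and these obey the table.
    have key : ∀ (g : Lam) {q : ℤ} (h : q + 1 = g.deg + 1) (h' : r + 1 = q),
        (cobar (lieD k)).d h'' ((cobar (lieD k)).d h' (sInvR k h (gEl k rfl g.toDGen 1))) = 0 := by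
      intro g q h h'
      obtain rfl : q = g.deg := by omega
      exact (lamVal_isModel k).d_d D g g.exc_lt h' h''
    have : (cobar (lieD k)).d h'' ((cobar (lieD k)).d h' (sInvR k h (gEl k rfl g 1))) = 0 := by
      cases g
      · exact key .a2 h h'
      · exact key .a21 h h'
      · exact key .a211 h h'
      · exact key .a2111 h h'
      · exact key .a3 h h'
      · exact key .a31 h h'
      · exact key .a32 h h'
      · exact key .a311 h h'
      · exact key .a312 h h'
      · exact key .a322 h h'
      · exact key .a4 h h'
      · exact key .a41 h h'
      · exact key .a42 h h'
      · exact key .a43 h h'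
      · exact key .a5 h h'
    rw [this, map_zero]

end ResolutionModel

/-! ### Alternating sums and unshuffles -/

section Alternation

instance {n i : ℕ} (ρ : Perm (Fin n)) : Decidable (Young i ρ) :=
  inferInstanceAs (Decidable (∀ a : Fin n, (ρ a : ℕ) < i ↔ (a : ℕ) < i))

theorem exists_eq_perm {n : ℕ} (σ : Perm (Fin n)) :
    ∃ L : List ℕ, L.Perm (List.range n) ∧ σ = perm n L := by
  have h : (List.ofFn fun a => ((σ⁻¹ a : Fin n) : ℕ)).Perm (List.range n) := by
    refine isLabelling_of_forall_mem (by simp) fun x hx => ?_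
    rw [List.mem_ofFn]
    exact ⟨σ ⟨x, hx⟩, by simp⟩
  exact ⟨_, h, eq_perm h σ fun a => by simp⟩

/-- Unshuffles represent the cosets of the Young subgroup: every permutation is uniquely ρu with ρ
preserving the first `i` places and u an unshuffle. -/
theorem sum_perm_eq_sum_unshuffles {X : Type*} [AddCommMonoid X] {n i : ℕ} (hi : i ≤ n)
    (f : Perm (Fin n) → X) :
    ∑ σ, f σ = ∑ u ∈ unshuffles n i, ∑ ρ : {ρ : Perm (Fin n) // Young i ρ}, f (ρ.1 * u) := by
  classical
  choose N hN R hR hNR using fun σ : Perm (Fin n) => exists_unshuffle hi σ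
  rw [← Finset.sum_product']
  symm
  refine Finset.sum_bij' (fun x _ => x.2.1 * x.1) (fun σ _ => (N σ, ⟨(R σ)⁻¹, (hR σ).inv⟩))
    (fun _ _ => Finset.mem_univ _) (fun σ _ => by simp [hN σ]) ?_ ?_ (fun _ _ => rfl)
  · rintro ⟨u, ρ, hρ⟩ hx
    have hu : u ∈ unshuffles n i := (Finset.mem_product.1 hx).1
    have h1 : N (ρ * u) = u := unshuffle_unique hu (hN _) ((hR (ρ * u)).mul hρ)
      (by rw [hNR (ρ * u), mul_assoc])
    have h2 := hNR (ρ * u)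
    rw [h1] at h2
    refine Prod.ext h1 (Subtype.ext ?_)
    change (R (ρ * u))⁻¹ = ρ
    rw [inv_eq_iff_mul_eq_one]
    have h3 : R (ρ * u) * ρ * u = 1 * u := by rw [mul_assoc, ← h2, one_mul]
    exact mul_right_cancel h3
  · intro σ _
    change (R σ)⁻¹ * N σ = σ
    rw [hNR σ, inv_mul_cancel_left]

theorem exists_blockPerm {m n r : ℕ} (h : m + n = r + 1) (i : Fin m) (σ : Perm (Fin m))
    (τ : Perm (Fin n)) : ∃ ρ, IsBlockPerm h i σ τ ρ := by
  obtain ⟨L, hL, rfl⟩ := exists_eq_perm σ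
  obtain ⟨K, hK, rfl⟩ := exists_eq_perm τ
  exact ⟨_, (graftLabels_isBlockPerm h hL hK i).2⟩

theorem IsBlockPerm.unique {m n r : ℕ} {h : m + n = r + 1} {i : Fin m} {σ : Perm (Fin m)}
    {τ : Perm (Fin n)} {ρ ρ' : Perm (Fin r)} (hρ : IsBlockPerm h i σ τ ρ)
    (hρ' : IsBlockPerm h i σ τ ρ') : ρ = ρ' := by
  ext1 y
  rcases DGMod.input_cases h i y with ⟨j, rfl⟩ | ⟨x, hx, rfl⟩
  · rw [hρ.1, hρ'.1]
  · rw [hρ.2, hρ'.2]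

/-- Once the image of `i` is known, the inner block recovers τ and the other inputs recover σ. This
identifies any presentation as a block permutation with the one supplied by `Young.exists_block`. -/
theorem IsBlockPerm.injective {m n r : ℕ} {h : m + n = r + 1} {i : Fin m} {σ σ' : Perm (Fin m)}
    {τ τ' : Perm (Fin n)} {ρ : Perm (Fin r)} (hρ : IsBlockPerm h i σ τ ρ)
    (hρ' : IsBlockPerm h i σ' τ' ρ) (hi : σ i = σ' i) : σ = σ' ∧ τ = τ' := by
  constructor
  · ext1 x
    by_cases hx : x = i
    · rw [hx, hi]
    · have h1 := hρ.2 x hx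
      have h2 := hρ'.2 x hx
      have h3 := h1.symm.trans h2
      have key : ∀ (y : Fin m) (hy : y = σ i) (h4 : σ' x ≠ y),
          outerInput h (σ i) (σ x) (σ.injective.ne hx) = outerInput h y (σ' x) h4 →
          σ x = σ' x := by
        rintro y rfl h4 e
        exact DGMod.outerInput_inj h _ _ _ _ _ e
      exact key _ hi.symm _ h3
  · ext1 x
    have h3 := (hρ.1 x).symm.trans (hρ'.1 x)
    rw [hi] at h3
    exact DGMod.innerInput_injective h _ h3

theorem IsBlockPerm.young {i j n : ℕ} (hj : 0 < j) (hn : j + i = n + 1) {α : Perm (Fin j)}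
    {β : Perm (Fin i)} {ρ : Perm (Fin n)} (hα : α ⟨0, hj⟩ = ⟨0, hj⟩)
    (hρ : IsBlockPerm hn ⟨0, hj⟩ α β ρ) : Young i ρ := by
  intro y
  rcases DGMod.input_cases hn ⟨0, hj⟩ y with ⟨b, rfl⟩ | ⟨x, hx, rfl⟩
  · rw [hρ.1, hα]
    simp [innerInput]
  · rw [hρ.2]
    have key : ∀ (z y : Fin j) (hy : y = ⟨0, hj⟩) (h : z ≠ y),
        ¬ (outerInput hn y z h : ℕ) < i := by
      rintro z y rfl h
      have : (z : ℕ) ≠ 0 := fun e => h (Fin.ext e)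
      simp only [outerInput]
      rw [dif_neg (by simp [Fin.lt_def])]
      simp only
      omega
    simp only [key _ _ hα, key _ _ rfl]

theorem IsBlockPerm.psign_eq {i j n : ℕ} (hj : 0 < j) (hn : j + i = n + 1) (k : Type u)
    [CommRing k] {α : Perm (Fin j)} {β : Perm (Fin i)} {ρ : Perm (Fin n)}
    (hα : α ⟨0, hj⟩ = ⟨0, hj⟩) (hρ : IsBlockPerm hn ⟨0, hj⟩ α β ρ) :
    psign k ρ = psign k α * psign k β := by
  obtain ⟨α', β', h0, hb, hs⟩ := (hρ.young hj hn hα).exists_block hj hn k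
  obtain ⟨rfl, rfl⟩ := hρ.injective hb (hα.trans h0.symm)
  exact hs

/-- Sums over a Young subgroup. -/
theorem sum_young {X : Type*} [AddCommMonoid X] {i j n : ℕ} (hj : 0 < j) (hn : j + i = n + 1)
    (f : Perm (Fin n) → X) (F : Perm (Fin j) → Perm (Fin i) → X)
    (hF : ∀ α β ρ, α ⟨0, hj⟩ = ⟨0, hj⟩ → IsBlockPerm hn ⟨0, hj⟩ α β ρ → F α β = f ρ) :
    ∑ ρ : {ρ : Perm (Fin n) // Young i ρ}, f ρ.1 =
      ∑ α : {α : Perm (Fin j) // α ⟨0, hj⟩ = ⟨0, hj⟩}, ∑ β, F α.1 β := by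
  classical
  choose B hB using fun α β => exists_blockPerm hn (⟨0, hj⟩ : Fin j) α β
  -- The ring occurs only in the clause on signs, which is discarded, so any ring will do.
  choose A A' hA hAA _ using fun ρ : {ρ : Perm (Fin n) // Young i ρ} =>
    ρ.2.exists_block hj hn ℤ
  rw [← Finset.sum_product']
  refine Finset.sum_bij' (fun ρ _ => (⟨A ρ, hA ρ⟩, A' ρ))
    (fun x _ => ⟨B x.1.1 x.2, (hB x.1.1 x.2).young hj hn x.1.2⟩)
    (fun _ _ => by simp) (fun _ _ => Finset.mem_univ _) ?_ ?_ ?_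
  · intro ρ _
    exact Subtype.ext ((hB _ _).unique (hAA ρ))
  · rintro ⟨⟨α, hα⟩, β⟩ _
    obtain ⟨h1, h2⟩ := (hAA ⟨B α β, (hB α β).young hj hn hα⟩).injective (hB α β)
      ((hA _).trans hα.symm)
    exact Prod.ext (Subtype.ext h1) h2
  · intro ρ _
    exact (hF _ _ _ (hA ρ) (hAA ρ)).symm

theorem cycleRange_inv_apply {j : ℕ} (a x : Fin j) : (((Fin.cycleRange a)⁻¹ x : Fin j) : ℕ) =
    if (x : ℕ) = 0 then (a : ℕ) else if (x : ℕ) ≤ a then (x : ℕ) - 1 else x := by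
  obtain ⟨y, rfl⟩ := (Fin.cycleRange a).surjective x
  rw [← Perm.mul_apply, inv_mul_cancel, Perm.one_apply]
  obtain ⟨j, rfl⟩ : ∃ l, j = l + 1 := ⟨j - 1, by have := a.2; omega⟩
  rcases lt_trichotomy y a with h | h | h
  · rw [Fin.cycleRange_of_lt h]
    have h1 : (y : ℕ) < a := h
    have h2 : ((y + 1 : Fin (j + 1)) : ℕ) = y + 1 := Fin.val_add_one_of_lt (lt_of_lt_of_le h (Fin.le_last a))
    rw [h2, if_neg (by omega), if_pos (by omega)]
    omega
  · subst h
    simp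
  · rw [Fin.cycleRange_of_gt h]
    have h1 : (a : ℕ) < y := h
    rw [if_neg (by omega), if_neg (by omega)]

/-- The inverse cycle rotates the inputs 0, …, m, and its t-th power rotates them by t steps. This
realizes the movement of a whole block as a power of one cycle. -/
theorem cycleRange_inv_pow_apply {n : ℕ} (m x : Fin n) (t : ℕ) (ht : t ≤ m + 1) :
    ((((Fin.cycleRange m)⁻¹ ^ t) x : Fin n) : ℕ) =
    if (x : ℕ) < t then (x : ℕ) + (m + 1) - t else if (x : ℕ) ≤ m then (x : ℕ) - t else x := by
  induction t with
  | zero => simp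
  | succ t ih =>
    rw [pow_succ', Perm.mul_apply, cycleRange_inv_apply, ih (by omega)]
    have := m.2
    split_ifs <;> omega

/-- The sign of moving an operation with `i` inputs past `a` inputs. -/
theorem exists_blockPerm_cycle {i j n : ℕ} (hj : 0 < j) (hn : j + i = n + 1) (hi : 0 < i)
    (k : Type u) [CommRing k] (a : Fin j) :
    ∃ ρ, IsBlockPerm hn ⟨0, hj⟩ (Fin.cycleRange a)⁻¹ 1 ρ ∧
      psign k (Fin.cycleRange a)⁻¹ * psign k ρ = ksign k (((i : ℤ) - 1) * (a : ℕ)) := by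
  have ha := a.2
  have h0 : (Fin.cycleRange a)⁻¹ ⟨0, hj⟩ = a := by
    ext
    rw [cycleRange_inv_apply]
    simp
  -- Moving a block of `i` inputs past `a` inputs is a rotation by `i` steps of the first `a + i`
  -- inputs.
  let m : Fin n := ⟨a + i - 1, by omega⟩
  refine ⟨(Fin.cycleRange m)⁻¹ ^ i, ⟨?_, ?_⟩, ?_⟩
  · intro b
    ext
    rw [cycleRange_inv_pow_apply m _ i (by simp only [m]; omega), h0]
    have := b.2
    simp only [innerInput, m, Perm.one_apply, zero_add]
    rw [if_pos b.2]
    omega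
  · intro x hx
    have hx0 : (x : ℕ) ≠ 0 := fun e => hx (Fin.ext e)
    have hx1 := cycleRange_inv_apply a x
    rw [if_neg hx0] at hx1
    have key : ∀ (z y : Fin j) (_ : y = a) (h : z ≠ y), (outerInput hn y z h : ℕ) =
        if (z : ℕ) < a then (z : ℕ) else z + i - 1 := by
      rintro z y rfl h
      simp only [outerInput, Fin.lt_def]
      split_ifs <;> rfl
    have key0 : (outerInput hn ⟨0, hj⟩ x hx : ℕ) = x + i - 1 := by
      simp only [outerInput, Fin.lt_def]
      rw [dif_neg (by simp)]
    ext
    rw [cycleRange_inv_pow_apply m _ i (by simp only [m]; omega), key _ _ h0, key0, hx1]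
    have := x.2
    simp only [m]
    split_ifs <;> omega
  · have e : Perm.sign (Fin.cycleRange a)⁻¹ * Perm.sign ((Fin.cycleRange m)⁻¹ ^ i) =
        (((i : ℤ) - 1) * (a : ℕ)).negOnePow := by
      obtain ⟨i, rfl⟩ : ∃ l, i = l + 1 := ⟨i - 1, by omega⟩
      rw [map_pow, Perm.sign_inv, Perm.sign_inv, Fin.sign_cycleRange, Fin.sign_cycleRange,
        ← pow_mul, ← pow_add]
      have h1 : (((i + 1 : ℕ) : ℤ) - 1) * (a : ℕ) = ((i * a : ℕ) : ℤ) := by push_cast; ring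
      rw [h1, Int.negOnePow_def, zpow_natCast]
      -- With `i` now denoting the arity minus one, the exponents of the two signs add up to i·a and
      -- the even number 2a + i(i + 1).
      have h2 : (a : ℕ) + m * (i + 1) = i * a + (2 * a + i * (i + 1)) := by
        simp only [m]
        have : (a : ℕ) + (i + 1) - 1 = a + i := by omega
        rw [this]
        ring
      rw [h2, pow_add, pow_add, pow_mul (-1) 2, (Nat.even_mul_succ_self i).neg_one_pow]
      simp
    simp only [psign, ksign, ← e]
    push_cast
    rfl

/-- Decomposition into cosets of the stabilizer of `z`, indexed by the image of `z`, with
representatives `c a`. -/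
theorem sum_perm_eq_sum_fix {X : Type*} [AddCommMonoid X] {j : ℕ} (z : Fin j)
    (c : Fin j → Perm (Fin j)) (hc : ∀ a, c a z = a) (f : Perm (Fin j) → X) :
    ∑ α, f α = ∑ a : Fin j, ∑ α : {α : Perm (Fin j) // α z = z}, f (c a * α.1) := by
  rw [← Finset.sum_product']
  symm
  refine Finset.sum_bij' (fun x _ => c x.1 * x.2.1)
    (fun α _ => (α z, ⟨(c (α z))⁻¹ * α, ?_⟩))
    (fun _ _ => Finset.mem_univ _) (fun _ _ => by simp) ?_ ?_ (fun _ _ => rfl)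
  · rw [Perm.mul_apply, Perm.inv_eq_iff_eq, hc]
  · rintro ⟨a, α, hα⟩ _
    have h1 : (c a * α) z = a := by rw [Perm.mul_apply, hα, hc]
    refine Prod.ext h1 (Subtype.ext ?_)
    simp only [h1, inv_mul_cancel_left]
  · intro α _
    simp

variable {k : Type u} [CommRing k] {P : PreDGOperad.{u, v} k}

theorem alt_act (hP : IsOperad P) {n : ℕ} {p : ℤ} (τ : Perm (Fin n)) (x : P.carrier n p) :
    P.alt (P.act τ x) = psign k τ • P.alt x := by
  rw [← altBelow_eq_alt, ← altBelow_eq_alt]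
  exact altBelow_act hP τ (fun a ha => absurd a.2 (not_lt.2 ha)) x

theorem act_alt (hP : IsOperad P) {n : ℕ} {p : ℤ} (τ : Perm (Fin n)) (x : P.carrier n p) :
    P.act τ (P.alt x) = psign k τ • P.alt x := by
  simp only [PreDGOperad.alt, map_sum, map_smul, Finset.smul_sum, ← hP.act_mul]
  rw [← Equiv.sum_comp (Equiv.mulRight τ) fun σ => psign k τ • psign k σ • P.act σ x]
  refine Finset.sum_congr rfl fun σ _ => ?_
  simp only [Equiv.coe_mulRight, psign_mul]
  rw [smul_smul, mul_comm (psign k σ), ← mul_assoc, psign_mul_self, one_mul]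

/-- The sum over unshuffles of a composite of alternating sums. -/
theorem sum_unshuffles_comp_alt (hP : IsOperad P) {i j n : ℕ} {p q s : ℤ} (hj : 0 < j)
    (hi : 0 < i) (hn : j + i = n + 1) (e : p + q = s) (x : P.carrier j p) (y : P.carrier i q) :
    ∑ σ ∈ unshuffles n i, psign k σ • P.act σ (P.comp hn e ⟨0, hj⟩ (P.alt x) (P.alt y)) =
      ∑ a : Fin j, ksign k (((i : ℤ) - 1) * (a : ℕ)) • P.alt (P.comp hn e a x y) := by
  have h0 : ∀ a : Fin j, (Fin.cycleRange a)⁻¹ ⟨0, hj⟩ = a := by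
    intro a
    ext
    rw [cycleRange_inv_apply]
    simp
  -- Sort the permutations of `x` by the image `a` of the first input. Those that fix the first
  -- input, together with the permutations of `y`, form exactly the Young subgroup.
  have h1 : P.comp hn e ⟨0, hj⟩ (P.alt x) (P.alt y) =
      ∑ a : Fin j, psign k (Fin.cycleRange a)⁻¹ • ∑ ρ : {ρ : Perm (Fin n) // Young i ρ},
        psign k ρ.1 • P.act ρ.1 (P.comp hn e ⟨0, hj⟩ (P.act (Fin.cycleRange a)⁻¹ x) y) := by
    conv_lhs => rw [PreDGOperad.alt, sum_perm_eq_sum_fix ⟨0, hj⟩ _ h0, map_sum, LinearMap.sum_apply]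
    refine Finset.sum_congr rfl fun a _ => ?_
    rw [sum_young hj hn
      (fun ρ => psign k ρ • P.act ρ (P.comp hn e ⟨0, hj⟩ (P.act (Fin.cycleRange a)⁻¹ x) y))
      (fun α β => (psign k α * psign k β) • P.comp hn e ⟨0, hj⟩
        (P.act α (P.act (Fin.cycleRange a)⁻¹ x)) (P.act β y))
      (fun α β ρ hα hρ => by
        rw [hP.equivariant hn e _ α β ρ hρ, hα, hρ.psign_eq hj hn k hα])]
    rw [Finset.smul_sum, map_sum, LinearMap.sum_apply]
    refine Finset.sum_congr rfl fun α _ => ?_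
    rw [PreDGOperad.alt, map_sum, Finset.smul_sum]
    refine Finset.sum_congr rfl fun β _ => ?_
    rw [hP.act_mul, psign_mul, map_smul, map_smul, LinearMap.smul_apply, smul_smul, smul_smul]
    congr 1
    ring
  -- The sum over the Young subgroup and the sum over unshuffles combine to the full alternating
  -- sum.
  have h2 : ∀ z : P.carrier n s, ∑ σ ∈ unshuffles n i, psign k σ • P.act σ
      (∑ ρ : {ρ : Perm (Fin n) // Young i ρ}, psign k ρ.1 • P.act ρ.1 z) = P.alt z := by
    intro z
    rw [PreDGOperad.alt, sum_perm_eq_sum_unshuffles (show i ≤ n by omega)]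
    refine Finset.sum_congr rfl fun σ _ => ?_
    rw [map_sum, Finset.smul_sum]
    refine Finset.sum_congr rfl fun ρ _ => ?_
    rw [map_smul, ← hP.act_mul, smul_smul, psign_mul, mul_comm]
  simp only [h1, map_sum, map_smul, Finset.smul_sum (f := fun a : Fin j => _)]
  rw [Finset.sum_comm]
  refine Finset.sum_congr rfl fun a _ => ?_
  -- Moving the inner operation from the first input to the input `a` produces the asserted sign.
  obtain ⟨ρ, hρ, hs⟩ := exists_blockPerm_cycle hj hn hi k a
  have h3 := hP.equivariant hn e _ _ _ _ hρ x y
  rw [h0, hP.act_one] at h3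
  have h4 := h2 (P.comp hn e ⟨0, hj⟩ (P.act (Fin.cycleRange a)⁻¹ x) y)
  rw [← hs, mul_smul, ← alt_act hP, ← h3, ← h4, Finset.smul_sum]
  refine Finset.sum_congr rfl fun σ _ => ?_
  rw [smul_comm]
  simp only [map_sum, map_smul]

end Alternation

/-! ### Morphisms from the cobar construction of the Koszul dual cooperad -/

section LieK

variable {k : Type u} [CommRing k]

/-- The composites of antisymmetric operations at the other inputs are determined by those at the
first input. -/
theorem act_comp_of_antisymm {P : PreDGOperad.{u, v} k} (hP : IsOperad P) {i j n : ℕ}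
    {p q s : ℤ} (hj : 0 < j) (hi : 0 < i) (hn : j + i = n + 1) (e : p + q = s)
    {x : P.carrier j p} {y : P.carrier i q} (hx : ∀ α, P.act α x = psign k α • x)
    (hy : ∀ β, P.act β y = psign k β • y) (a : Fin j) (σ σ' : Perm (Fin n))
    (h : ∀ b : Fin i, (σ' (σ⁻¹ (innerInput hn a b)) : ℕ) < i) :
    P.act σ (P.comp hn e a x y) =
      (ksign k (((i : ℤ) - 1) * (a : ℕ)) * (psign k σ * psign k σ')) •
        P.act σ' (P.comp hn e ⟨0, hj⟩ x y) := by
  have h0 : (Fin.cycleRange a)⁻¹ ⟨0, hj⟩ = a := by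
    ext
    rw [cycleRange_inv_apply]
    simp
  obtain ⟨ρ, hρ, hs⟩ := exists_blockPerm_cycle hj hn hi k a
  have h1 := hP.equivariant hn e _ _ _ _ hρ x y
  rw [h0, hP.act_one, hx, map_smul, LinearMap.smul_apply] at h1
  -- The permutation ρ carries the first `i` inputs to the block at `a`, and by hypothesis σ'σ⁻¹
  -- carries this block back into the first `i` inputs.
  have hY : Young i (σ' * σ⁻¹ * ρ) := by
    have m1 : Set.MapsTo (σ' * σ⁻¹ * ρ) {y : Fin n | (y : ℕ) < i} {y : Fin n | (y : ℕ) < i} := by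
      intro y hy
      have hy' : (y : ℕ) < i := hy
      have : y = innerInput hn ⟨0, hj⟩ ⟨y, hy'⟩ := by ext; simp [innerInput]
      rw [this]
      change ((σ' (σ⁻¹ (ρ _)) : Fin n) : ℕ) < i
      rw [hρ.1, h0]
      exact h _
    -- On a finite set, a permutation that maps a subset into itself has an inverse that does so
    -- too.
    have m2 := Perm.perm_symm_mapsTo_of_mapsTo (σ' * σ⁻¹ * ρ) m1
    intro y
    refine ⟨fun hy => ?_, fun hy => m1 hy⟩
    have : (((σ' * σ⁻¹ * ρ)⁻¹ ((σ' * σ⁻¹ * ρ) y) : Fin n) : ℕ) < i := m2 hy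
    rwa [← Perm.mul_apply, inv_mul_cancel, Perm.one_apply] at this
  obtain ⟨α, β, hα, hb, hsb⟩ := hY.exists_block hj hn k
  have h2 := hP.equivariant hn e _ _ _ _ hb x y
  rw [hα, hx, hy, map_smul, map_smul, LinearMap.smul_apply, smul_smul, mul_comm, ← hsb] at h2
  -- The first factor acts on x ∘_1 y by its sign, by antisymmetry; the second one moves the graft
  -- to the input `a`.
  have h3 : σ' = (σ' * σ⁻¹ * ρ) * (ρ⁻¹ * σ) := by group
  have h4 : P.act σ' (P.comp hn e ⟨0, hj⟩ x y) = (psign k (σ' * σ⁻¹ * ρ) *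
      psign k (Fin.cycleRange a)⁻¹) • P.act σ (P.comp hn e a x y) := by
    conv_lhs => rw [h3, hP.act_mul, ← h2, map_smul]
    have h5 : P.comp hn e ⟨0, hj⟩ x y =
        psign k (Fin.cycleRange a)⁻¹ • P.act ρ (P.comp hn e a x y) := by
      rw [← h1, smul_smul, psign_mul_self, one_smul]
    rw [h5, map_smul, ← hP.act_mul, mul_inv_cancel_left, smul_smul]
  have hi' : psign k σ⁻¹ = psign k σ := by simp [psign]
  rw [h4, smul_smul, psign_mul, psign_mul, hi', ← hs]
  have e1 := psign_mul_self k σ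
  have e2 := psign_mul_self k σ'
  have e3 := psign_mul_self k ρ
  have e4 := psign_mul_self k (Fin.cycleRange a)⁻¹
  have : psign k (Fin.cycleRange a)⁻¹ * psign k ρ * (psign k σ * psign k σ') *
      (psign k σ' * psign k σ * psign k ρ * psign k (Fin.cycleRange a)⁻¹) = 1 := by
    calc _ = (psign k σ * psign k σ) * (psign k σ' * psign k σ') * (psign k ρ * psign k ρ) *
        (psign k (Fin.cycleRange a)⁻¹ * psign k (Fin.cycleRange a)⁻¹) := by ring
      _ = 1 := by rw [e1, e2, e3, e4]; ring
  rw [this, one_smul]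

/-- The quadratic part of the differential of `s⁻¹ℓ_n`, up to sign, for given values `w` of the
generators: the left hand side of the generalized Jacobi identity. -/
def jacobiator (P : PreDGOperad.{u, v} k) (w : ∀ (n : ℕ) (q : ℤ), P.carrier n q) (n : ℕ) {r : ℤ}
    (hr : r + 3 = n) : P.carrier n r :=
  ∑ i ∈ Finset.range n, if h : 2 ≤ i ∧ i < n then
    (ksign k (((n : ℤ) - i) * ((i : ℤ) - 1)) * ksign k ((n : ℤ) - i)) •
      ∑ σ ∈ unshuffles n i, psign k σ • P.act σ
        (P.comp (show (n + 1 - i) + i = n + 1 by omega)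
          (show ((n : ℤ) - i - 1) + ((i : ℤ) - 2) = r by omega) ⟨0, by omega⟩
          (w (n + 1 - i) _) (w i _))
  else 0

theorem map_jacobiator {P : PreDGOperad.{u, v} k} {Q : PreDGOperad.{u, w} k} (f : OperadHom P Q)
    (w : ∀ (n : ℕ) (q : ℤ), P.carrier n q) (n : ℕ) {r : ℤ} (hr : r + 3 = n) :
    f.toFun (jacobiator P w n hr) = jacobiator Q (fun n q => f.toFun (w n q)) n hr := by
  rw [jacobiator, jacobiator, map_sum]
  refine Finset.sum_congr rfl fun i _ => ?_
  split_ifs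
  · simp only [map_smul, map_sum, f.map_act, f.map_comp]
  · rw [map_zero]

/-- Only arities strictly between 1 and `n`, in the degrees m - 2, contribute. Values of a family
elsewhere are irrelevant, so families may be extended by zero. -/
theorem jacobiator_congr {P : PreDGOperad.{u, v} k} {w w' : ∀ (n : ℕ) (q : ℤ), P.carrier n q}
    (n : ℕ) {r : ℤ} (hr : r + 3 = n)
    (h : ∀ (m : ℕ) (q : ℤ), 2 ≤ m → m < n → q + 2 = m → w m q = w' m q) :
    jacobiator P w n hr = jacobiator P w' n hr := by
  refine Finset.sum_congr rfl fun i _ => ?_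
  split_ifs with hi
  · rw [h (n + 1 - i) _ (by omega) (by omega) (by omega), h i _ hi.1 hi.2 (by omega)]
  · rfl

theorem sInv_ell (N : ℕ∞) (n : ℕ) {p q : ℤ} (h : q + 1 = p) :
    sInv (C := lieK k N) h (ell k N n p) = kGenEl k N n q := by
  subst h
  rfl

theorem act_kGenEl (N : ℕ∞) (n : ℕ) (q : ℤ) (σ : Perm (Fin n)) :
    (cobar (lieK k N)).act σ (kGenEl k N n q) = psign k σ • kGenEl k N n q :=
  (sInv_act (C := lieK k N) rfl σ (ell k N n (q + 1))).symm.trans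
    (map_smul (FreeOp.gen (M := (lieK k N).toSMod) rfl) (psign k σ) (ell k N n (q + 1)))

theorem ell_of (N : ℕ∞) {n : ℕ} {p : ℤ} (g : KGen N n p) : ell k N n p = Finsupp.single g 1 := by
  exact dif_pos ⟨g.two_le, g.le, g.deg⟩

/-- The map `(μ ⊗_i ν)^σ ↦ (-1)^{|μ|} (s⁻¹μ ∘_i s⁻¹ν)^σ`. -/
def infK (N : ℕ∞) {r : ℕ} {s t : ℤ} (h : t + 2 = s) :
    InfComp (lieKMod k N) r s →ₗ[k] (cobar (lieK k N)).carrier r t :=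
  Cobar.infToFree (lieK k N) h

theorem infK_ell (N : ℕ∞) {i j n : ℕ} {p q s t p' q' : ℤ} (h : t + 2 = s) (hn : j + i = n + 1)
    (hp : p + q = s) (hp' : p' + 1 = p) (hq' : q' + 1 = q) (a : Fin j) (σ : Perm (Fin n)) :
    infK N h (InfComp.mk hn hp a (ell k N j p) (ell k N i q) σ) =
      ksign k p • (cobar (lieK k N)).act σ ((cobar (lieK k N)).comp hn
        (show p' + q' = t by omega) a (kGenEl k N j p') (kGenEl k N i q')) := by
  obtain rfl : p' = p - 1 := by omega
  obtain rfl : q' = q - 1 := by omega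
  rw [← sInv_ell N j (show p - 1 + 1 = p by omega), ← sInv_ell N i (show q - 1 + 1 = q by omega)]
  exact Cobar.infToFree_mk (lieK k N) h hn hp a _ _ σ

/-- The internal differential is zero, so only the decomposition remains. Besides the sign in the
cooperad, each composite receives (-1)^|ℓ_j| with |ℓ_j| = n - i. -/
theorem cobar_d_kGenEl (N : ℕ∞) {n : ℕ} {q r : ℤ} (h' : r + 1 = q) (h2 : 2 ≤ n)
    (hN : (n : ℕ∞) ≤ N) (hr : r + 3 = n) :
    (cobar (lieK k N)).d h' (kGenEl k N n q) =
      -jacobiator (cobar (lieK k N)) (kGenEl k N) n hr := by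
  have hq : q + 1 + 1 = n := by omega
  have e1 : (cobar (lieK k N)).d h' (kGenEl k N n q) =
      -infK N (show r + 2 = q + 1 by omega) (ellDecomp k N ⟨h2, hN, hq⟩) := by
    have e2 : Finsupp.lift (InfComp (lieKMod k N) n (q + 1)) k _ (ellDecomp k N)
        (ell k N n (q + 1)) = ellDecomp k N ⟨h2, hN, hq⟩ := by
      rw [ell_of N ⟨h2, hN, hq⟩]
      simp
    rw [← e2]
    have e3 : (cobar (lieK k N)).d h' (kGenEl k N n q) = -(0 : (cobar (lieK k N)).carrier n r) -
      infK N (show r + 2 = q + 1 by omega) (Finsupp.lift (InfComp (lieKMod k N) n (q + 1)) k _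
        (ellDecomp k N) (ell k N n (q + 1))) := by
      have e4 := map_zero (FreeOp.gen (M := (lieK k N).toSMod) (n := n) h')
      exact congrArg (fun z : (cobar (lieK k N)).carrier n r => -z - infK N
        (show r + 2 = q + 1 by omega) (Finsupp.lift (InfComp (lieKMod k N) n (q + 1)) k _
        (ellDecomp k N) (ell k N n (q + 1)))) e4
    rw [e3, neg_zero, zero_sub]
  rw [e1, ellDecomp, jacobiator, map_sum]
  congr 1
  refine Finset.sum_congr rfl fun i _ => ?_
  split_ifs with hi
  · rw [map_smul, ellSum, map_sum, mul_smul, Finset.smul_sum (r := ksign k ((n : ℤ) - i))]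
    congr 1
    refine Finset.sum_congr rfl fun σ _ => ?_
    rw [map_smul, infK_ell N (p' := (n : ℤ) - i - 1) (q' := (i : ℤ) - 2) _ _ _ (by omega)
      (by omega), smul_comm]
    congr 2
    omega
  · rw [map_zero]

/-- The morphism with prescribed antisymmetric values on the generators `s⁻¹ℓ_n`. -/
def lieKLift (N : ℕ∞) {Q : PreDGOperad.{u, v} k} (hQ : IsOperad Q)
    (w : ∀ (n : ℕ) (q : ℤ), Q.carrier n q)
    (hw : ∀ (n : ℕ) (q : ℤ) (σ : Perm (Fin n)), Q.act σ (w n q) = psign k σ • w n q) :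
    OperadHom (cobar (lieK k N)) Q :=
  FreeOp.lift (M := lieKMod k N) (Cobar.diff (lieK k N)) hQ
    (fun {n _ q} _ => Finsupp.lift (Q.carrier n q) k _ fun _ => w n q)
    (fun {n p q} _ σ x => by
      have key : ∀ x : KGen N n p →₀ k,
          Finsupp.lift (Q.carrier n q) k _ (fun _ => w n q) (psign k σ • x) =
            Q.act σ (Finsupp.lift (Q.carrier n q) k _ (fun _ => w n q) x) := by
        intro x
        rw [map_smul]
        induction x using Finsupp.induction_linear with
        | zero => simp only [map_zero, smul_zero]
        | add x y hx hy => simp only [map_add, smul_add, hx, hy]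
        | single g c =>
          have : Finsupp.lift (Q.carrier n q) k _ (fun _ => w n q) (Finsupp.single g c) =
            c • w n q := by simp
          rw [this, map_smul, hw, smul_comm]
      exact key x)

variable {Q : PreDGOperad.{u, v} k} {w : ∀ (n : ℕ) (q : ℤ), Q.carrier n q}

theorem lieKLift_kGenEl (N : ℕ∞) (hQ : IsOperad Q)
    (hw : ∀ (n : ℕ) (q : ℤ) (σ : Perm (Fin n)), Q.act σ (w n q) = psign k σ • w n q)
    {n : ℕ} {q : ℤ} (h2 : 2 ≤ n) (hN : (n : ℕ∞) ≤ N) (hq : q + 2 = n) :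
    (lieKLift N hQ w hw).toFun (kGenEl k N n q) = w n q := by
  have e : Finsupp.lift (Q.carrier n q) k _ (fun _ => w n q) (ell k N n (q + 1)) = w n q := by
    rw [ell_of N ⟨h2, hN, by omega⟩]
    simp
  exact e

/-- The elements of the Koszul dual cooperad are multiples of the generators. -/
theorem lieKMod_eq_smul (N : ℕ∞) {n : ℕ} {p : ℤ} (x : (lieKMod k N).carrier n p) :
    ∃ c : k, x = c • ell k N n p ∧ (¬ (2 ≤ n ∧ (n : ℕ∞) ≤ N ∧ p + 1 = n) → c = 0) := by
  change KGen N n p →₀ k at x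
  by_cases h : 2 ≤ n ∧ (n : ℕ∞) ≤ N ∧ p + 1 = n
  · refine ⟨x ⟨h.1, h.2.1, h.2.2⟩, ?_, fun h' => absurd h h'⟩
    rw [ell_of N ⟨h.1, h.2.1, h.2.2⟩]
    change x = x _ • (Finsupp.single _ 1 : KGen N n p →₀ k)
    ext g
    obtain rfl := Subsingleton.elim ⟨h.1, h.2.1, h.2.2⟩ g
    simp
  · refine ⟨0, ?_, fun _ => rfl⟩
    rw [zero_smul]
    exact Finsupp.ext fun g => absurd ⟨g.two_le, g.le, g.deg⟩ h

/-- The generators of the cobar construction are multiples of the `s⁻¹ℓ_n`. -/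
theorem sInv_lieK_eq_smul (N : ℕ∞) {n : ℕ} {p q : ℤ} (h : q + 1 = p)
    (x : (lieK k N).carrier n p) : ∃ c : k, sInv (C := lieK k N) h x = c • kGenEl k N n q ∧
      (¬ (2 ≤ n ∧ (n : ℕ∞) ≤ N ∧ q + 2 = n) → c = 0) := by
  obtain ⟨c, hc, h0⟩ := lieKMod_eq_smul N x
  refine ⟨c, ?_, fun h' => h0 fun h'' => h' ⟨h''.1, h''.2.1, by omega⟩⟩
  rw [← sInv_ell N n h]
  exact (congrArg (fun y => sInv (C := lieK k N) h y) hc).trans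
    (map_smul (FreeOp.gen (M := (lieK k N).toSMod) h) c _)

/-- Morphisms from the cobar construction agree if they agree on the generators `s⁻¹ℓ_n`. -/
theorem lieK_hom_ext (N : ℕ∞) {f g : OperadHom (cobar (lieK k N)) Q}
    (hfg : ∀ (n : ℕ) (q : ℤ), 2 ≤ n → (n : ℕ∞) ≤ N → q + 2 = n →
      f.toFun (kGenEl k N n q) = g.toFun (kGenEl k N n q))
    {n : ℕ} {p : ℤ} (x : (cobar (lieK k N)).carrier n p) : f.toFun x = g.toFun x := by
  refine cobar_hom_ext (fun {n p q} h x => ?_) x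
  obtain ⟨c, hc, h0⟩ := sInv_lieK_eq_smul N h x
  rw [hc, map_smul, map_smul]
  by_cases h' : 2 ≤ n ∧ (n : ℕ∞) ≤ N ∧ q + 2 = n
  · rw [hfg n q h'.1 h'.2.1 h'.2.2]
  · rw [h0 h', zero_smul, zero_smul]

/-- A morphism to a dg operad is a solution of the generalized Jacobi identities. In the truncated
case they are required only up to arity `N`. -/
theorem lieK_hom_isDG (N : ℕ∞) (hQ : HasDerivation Q) (f : OperadHom (cobar (lieK k N)) Q)
    (hf : ∀ (n : ℕ) (q r : ℤ) (h : r + 1 = q) (hr : r + 3 = n), 2 ≤ n → (n : ℕ∞) ≤ N →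
      Q.d h (f.toFun (kGenEl k N n q)) =
        -jacobiator Q (fun n q => f.toFun (kGenEl k N n q)) n hr) : f.IsDG := by
  refine cobar_hom_isDG hQ f fun {n p q r} h h' x => ?_
  obtain ⟨c, hc, h0⟩ := sInv_lieK_eq_smul N h x
  rw [hc]
  simp only [map_smul]
  by_cases hn : 2 ≤ n ∧ (n : ℕ∞) ≤ N ∧ q + 2 = n
  · rw [hf n q r h' (by omega) hn.1 hn.2.1, cobar_d_kGenEl N h' hn.1 hn.2.1 (by omega), map_neg,
      map_jacobiator]
  · rw [h0 hn, zero_smul, zero_smul]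

end LieK

/-! ### The cobar construction of the Koszul dual cooperad as a model -/

/-- The generators `s⁻¹ℓ_n`. -/
def Lam.isEll : Lam → Bool
  | .a2 => true
  | .a3 => true
  | .a4 => true
  | .a5 => true
  | _ => false

/-- The set `s`, followed by its complement in `0, …, n - 1`. -/
def shuffleLabels (n : ℕ) (s : List ℕ) : List ℕ := s ++ (List.range n).filter fun x => !s.elem x

/-- The inverses of the unshuffles, as lists of values. -/
def shuffleList (n i : ℕ) : List (List ℕ) :=
  ((List.range n).sublistsLen i).map (shuffleLabels n)

namespace LC

/-- The normal form of a term for antisymmetric values of the generators `s⁻¹ℓ_n`, when the other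
generators have the value zero. -/
def skewTerm : ℤ × Word × List ℕ → LC
  | (c, [(i, g)], L) =>
    bif g.isEll then [(flip (oddInversions L) c, [(i, g)], List.range L.length)] else []
  | (c, [(a, g'), (i, g)], L) =>
    bif g.isEll && g'.isEll then
      -- The canonical representative is the unshuffle that lists the labels of the inner operation
      -- in increasing order, followed by the remaining labels in increasing order.
      let L' := shuffleLabels L.length
        ((List.range L.length).filter ((L.drop a).take (g'.exc + 1)).elem)
      -- The conditions of `act_comp_of_antisymm` are tested instead of proved. If they failed the
      -- term would be left as it is, so soundness does not depend on them.
      if L'.Perm (List.range L.length) ∧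
          ∀ b < g'.exc + 1, L'.idxOf (L.getD (a + b) 0) < g'.exc + 1 then
        [(flip (xor (decide (g'.exc % 2 = 1) && decide (a % 2 = 1))
          (xor (oddInversions L) (oddInversions L'))) c, [(0, g'), (i, g)], L')]
      else [(c, [(a, g'), (i, g)], L)]
    else []
  | s => [s]

/-- The normal form of a linear combination for antisymmetric values of the generators `s⁻¹ℓ_n`,
when the other generators have the value zero. -/
def skew (x : LC) : LC := x.flatMap skewTerm

/-- The sum over unshuffles of `g ∘_1 g'`. -/
def unshuffled (n : ℕ) (g g' : Lam) : LC := (shuffleList n (g'.exc + 1)).map fun L =>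
  (flip (oddInversions L) 1, [(0, g'), (0, g)], L)

end LC

/-- The differential of the generators of the cobar construction of the Koszul dual cooperad. -/
def ellTable : Lam → LC
  | .a3 => LC.smul (-1) (LC.unshuffled 3 .a2 .a2)
  | .a4 => LC.smul (-1) (LC.unshuffled 4 .a3 .a2) ++ LC.unshuffled 4 .a2 .a3
  | .a5 => LC.smul (-1) (LC.unshuffled 5 .a4 .a2) ++ (LC.smul (-1) (LC.unshuffled 5 .a3 .a3) ++
      LC.smul (-1) (LC.unshuffled 5 .a2 .a4))
  | _ => []

/-- The formal content of the compatibility of Ωψ with d: setting the generators other than ℓ_n to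
zero and imposing antisymmetry turns the table of the resolution into the Jacobi expressions. For
the other generators everything cancels. -/
theorem isZero_skew_dTable (g : Lam) :
    (LC.skew (dTable g) ++ LC.smul (-1) (ellTable g)).isZero = true := by
  cases g <;> decide +kernel

theorem ellTable_ok (g : Lam) : (ellTable g).Ok (g.exc + 1) (g.deg - 1) := by
  cases g <;> decide +kernel

section Skew

variable {k : Type u} [CommRing k] {P : PreDGOperad.{u, v} k}
  {val : ∀ g : Lam, P.carrier (g.exc + 1) g.deg}

theorem wordAt_pair (hP : IsOperad P) {g g' : Lam} {r : ℕ} {s : ℤ}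
    (h : g.exc + 1 + (g'.exc + 1) = r + 1) (e : g.deg + g'.deg = s) (a : Fin (g.exc + 1)) :
    wordAt P val r s [(a.1, g'), (0, g)] = P.comp h e a (val g) (val g') := by
  rw [wordAt_cons P val (m := g.exc + 1) (p := g.deg) (by simp [Word.ar, Nat.add_comm])
    (by simp [Word.deg]) h e a, wordAt_single val hP g rfl rfl]

theorem decide_odd_mul (m a : ℕ) :
    decide (Odd ((m : ℤ) * (a : ℤ))) = (decide (m % 2 = 1) && decide (a % 2 = 1)) := by
  rw [Bool.eq_iff_iff]
  simp only [decide_eq_true_eq, Bool.and_eq_true, ← Nat.odd_iff, ← Nat.odd_mul]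
  exact_mod_cast Iff.rfl

/-- One letter is reduced by antisymmetry, two letters by `act_comp_of_antisymm`. Longer words are
left alone; they do not occur in the table. -/
theorem lcAt_skewTerm (hP : IsOperad P) (h0 : ∀ g : Lam, g.isEll = false → val g = 0)
    (hs : ∀ (g : Lam) (σ : Perm (Fin (g.exc + 1))), P.act σ (val g) = psign k σ • val g)
    {n : ℕ} {p : ℤ} {s : ℤ × Word × List ℕ} (ok : TermOk n p s) :
    (LC.skewTerm s).Ok n p ∧ lcAt val n p (LC.skewTerm s) = termAt val n p s := by
  have trivialCase : ∀ s : ℤ × Word × List ℕ, TermOk n p s →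
      LC.Ok n p [s] ∧ lcAt val n p [s] = termAt val n p s := by
    intro s hs
    refine ⟨fun t ht => ?_, by rw [lcAt_cons, lcAt_nil, add_zero]⟩
    rw [List.mem_singleton.1 ht]
    exact hs
  rcases s with ⟨c, w, L⟩
  rcases w with _ | ⟨⟨a, g'⟩, _ | ⟨⟨i, g⟩, _ | ⟨x, w⟩⟩⟩
  · exact trivialCase _ ok
  · obtain ⟨o, ha, hd, hL⟩ := ok
    simp only at ha hd hL
    have hlen : L.length = n := by simp [hL.length_eq]
    obtain rfl : a = 0 := by simpa [Word.Ok, Word.ar] using o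
    obtain rfl : g'.exc + 1 = n := by simpa [Word.ar, Nat.add_comm] using ha
    obtain rfl : g'.deg = p := by simpa [Word.deg] using hd
    have hw : wordAt P val (g'.exc + 1) g'.deg [(0, g')] = val g' := wordAt_single val hP g' rfl rfl
    rw [LC.skewTerm]
    cases hg : g'.isEll with
    | false =>
      rw [cond_false, lcAt_nil, termAt, hw, h0 g' hg, map_zero, smul_zero]
      exact ⟨fun t ht => absurd ht (by simp), rfl⟩
    | true =>
      rw [cond_true, hlen]
      refine ⟨fun t ht => ?_, ?_⟩
      · rw [List.mem_singleton.1 ht]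
        exact ⟨o, ha, hd, List.Perm.refl _⟩
      · rw [lcAt_cons, lcAt_nil, add_zero, termAt, termAt, hw, perm_range, hP.act_one, hs,
          psign_perm hL, cast_flip, smul_smul]
        simp only [mul_comm]
  · have ok' := ok
    obtain ⟨o, ha, hd, hL⟩ := ok
    simp only at ha hd hL
    have hlen : L.length = n := by simp [hL.length_eq]
    obtain rfl : i = 0 := by simpa [Word.Ok, Word.ar] using o.2
    have ha' : a < g.exc + 1 := by simpa [Word.Ok, Word.ar, Nat.add_comm] using o.1
    have hn : g.exc + 1 + (g'.exc + 1) = n + 1 := by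
      simp only [Word.ar] at ha
      omega
    have hp : g.deg + g'.deg = p := by
      simp only [Word.deg] at hd
      omega
    have hw : ∀ b : Fin (g.exc + 1), wordAt P val n p [(b.1, g'), (0, g)] =
      P.comp hn hp b (val g) (val g') := fun b => wordAt_pair hP hn hp b
    rw [LC.skewTerm]
    cases hg : g.isEll && g'.isEll with
    | false =>
      have hz : P.comp hn hp ⟨a, ha'⟩ (val g) (val g') = 0 := by
        rcases Bool.and_eq_false_iff.1 hg with h | h
        · rw [h0 g h, map_zero, LinearMap.zero_apply]
        · rw [h0 g' h, map_zero]
      rw [cond_false, lcAt_nil, termAt, hw ⟨a, ha'⟩, hz, map_zero, smul_zero]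
      exact ⟨fun t ht => absurd ht (by simp), rfl⟩
    | true =>
      rw [cond_true, hlen]
      generalize shuffleLabels n ((List.range n).filter
        ((L.drop a).take (g'.exc + 1)).elem) = L'
      simp only
      split_ifs with hc
      · obtain ⟨hL', hb⟩ := hc
        -- The tested condition on positions says that σ'σ⁻¹ sends the inner block to the first
        -- places.
        have key := act_comp_of_antisymm hP (Nat.succ_pos g.exc) (Nat.succ_pos g'.exc) hn hp
          (hs g) (hs g') ⟨a, ha'⟩ (perm n L) (perm n L') (fun b => by
            rw [perm_apply hL', perm_inv_apply hL]
            have := hb b b.2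
            rwa [List.getD_eq_getElem _ _ (by have := b.2; omega)] at this)
        refine ⟨fun t ht => ?_, ?_⟩
        · rw [List.mem_singleton.1 ht]
          refine ⟨⟨?_, o.2⟩, ?_, ?_, hL'⟩
          · exact lt_of_le_of_lt (Nat.zero_le _) o.1
          · exact ha
          · exact hd
        · rw [lcAt_cons, lcAt_nil, add_zero, termAt, termAt, hw ⟨a, ha'⟩,
            hw ⟨0, Nat.succ_pos _⟩, key, cast_flip, psign_perm hL, psign_perm hL', bsign_xor,
            bsign_xor, ksign_eq_bsign, smul_smul]
          have e1 : (((g'.exc + 1 : ℕ) : ℤ) - 1) * ((a : ℕ) : ℤ) = (g'.exc : ℤ) * (a : ℤ) := by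
            push_cast
            ring
          simp only [e1, decide_odd_mul]
          congr 1
          ring
      · exact trivialCase _ ok'
  · exact trivialCase _ ok

theorem lcAt_skew (hP : IsOperad P) (h0 : ∀ g : Lam, g.isEll = false → val g = 0)
    (hs : ∀ (g : Lam) (σ : Perm (Fin (g.exc + 1))), P.act σ (val g) = psign k σ • val g)
    {n : ℕ} {p : ℤ} {x : LC} (ok : x.Ok n p) :
    x.skew.Ok n p ∧ lcAt val n p x.skew = lcAt val n p x := by
  induction x with
  | nil => exact ⟨ok, rfl⟩
  | cons s x ih =>
    obtain ⟨o1, e1⟩ := ih fun t ht => ok t (by simp [ht])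
    obtain ⟨o2, e2⟩ := lcAt_skewTerm hP h0 hs (ok s (by simp))
    have : LC.skew (s :: x) = LC.skewTerm s ++ LC.skew x := rfl
    rw [this, lcAt_append, lcAt_cons, e1, e2]
    exact ⟨o2.append o1, rfl⟩

theorem lcAt_dTable_eq_ellTable (hP : IsOperad P) (h0 : ∀ g : Lam, g.isEll = false → val g = 0)
    (hs : ∀ (g : Lam) (σ : Perm (Fin (g.exc + 1))), P.act σ (val g) = psign k σ • val g)
    (g : Lam) : lcAt val (g.exc + 1) (g.deg - 1) (dTable g) =
      lcAt val (g.exc + 1) (g.deg - 1) (ellTable g) := by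
  obtain ⟨o, e⟩ := lcAt_skew hP h0 hs (dTable_ok g)
  have := lcAt_eq_zero (val := val) hP (o.append ((ellTable_ok g).smul (-1))) (isZero_skew_dTable g)
  rw [lcAt_append, lcAt_smul, e] at this
  simpa [sub_eq_zero, ← sub_eq_add_neg] using this

instance {n : ℕ} (i : ℕ) (τ : Perm (Fin n)) : Decidable (IsShuffle i τ) :=
  inferInstanceAs (Decidable (∀ a b : Fin n, a < b → ((b : ℕ) < i ∨ i ≤ (a : ℕ)) → τ a < τ b))

/-- The list of unshuffles is correct. -/
def ShuffleListOk (n i : ℕ) : Prop :=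
  (∀ σ : Perm (Fin n), IsShuffle i σ⁻¹ ↔ σ ∈ (shuffleList n i).map (perm n)) ∧
    ((shuffleList n i).map (perm n)).Nodup ∧ ∀ L ∈ shuffleList n i, L.Perm (List.range n)

instance (n i : ℕ) : Decidable (ShuffleListOk n i) :=
  inferInstanceAs (Decidable (_ ∧ _ ∧ _))

theorem sum_unshuffles_comp (hP : IsOperad P) {g g' : Lam} {n : ℕ} {p : ℤ}
    (hok : ShuffleListOk n (g'.exc + 1)) (hn : g.exc + 1 + (g'.exc + 1) = n + 1)
    (e : g.deg + g'.deg = p) :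
    ∑ σ ∈ unshuffles n (g'.exc + 1), psign k σ • P.act σ
      (P.comp hn e ⟨0, Nat.succ_pos _⟩ (val g) (val g')) =
      lcAt val n p (LC.unshuffled n g g') := by
  obtain ⟨h1, h2, h3⟩ := hok
  have h4 : unshuffles n (g'.exc + 1) = ((shuffleList n (g'.exc + 1)).map (perm n)).toFinset := by
    ext σ
    simp only [unshuffles, Finset.mem_filter, Finset.mem_univ, true_and, List.mem_toFinset]
    exact h1 σ
  rw [h4, List.sum_toFinset _ h2, lcAt, LC.unshuffled, List.map_map, List.map_map]
  congr 1
  refine List.map_congr_left fun L hL => ?_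
  simp only [Function.comp_apply, termAt]
  rw [wordAt_pair hP hn e ⟨0, Nat.succ_pos _⟩, psign_perm (h3 L hL), cast_flip]
  simp

theorem shuffleListOk :
    ShuffleListOk 3 2 ∧ ShuffleListOk 4 2 ∧ ShuffleListOk 4 3 ∧ ShuffleListOk 5 2 ∧
      ShuffleListOk 5 3 ∧ ShuffleListOk 5 4 := by
  decide +kernel

end Skew

/-! ### Jacobi expressions in low arity and the images of the generators under Ωψ -/

section EllModel

variable {k : Type u} [CommRing k]

theorem ksign_even {n : ℤ} (h : Even n) : ksign k n = 1 := by
  simp [ksign, Int.negOnePow_even n h]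

theorem ksign_odd {n : ℤ} (h : Odd n) : ksign k n = -1 := by
  simp [ksign, Int.negOnePow_odd n h]

/-- The sum over unshuffles of `x ∘_1 y`. -/
def unshuffleSum (P : PreDGOperad.{u, v} k) {i j n : ℕ} {p q s : ℤ} (x : P.carrier j p)
    (y : P.carrier i q) (hj : 0 < j) (hn : j + i = n + 1) (e : p + q = s) : P.carrier n s :=
  ∑ σ ∈ unshuffles n i, psign k σ • P.act σ (P.comp hn e ⟨0, hj⟩ x y)

section Jacobiator

variable (P : PreDGOperad.{u, v} k) (w : ∀ (n : ℕ) (q : ℤ), P.carrier n q)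

theorem jacobiator_two : jacobiator P w 2 (r := -1) rfl = 0 := by
  rw [jacobiator, Finset.sum_eq_zero]
  intro i _
  exact dif_neg (by omega)

theorem jacobiator_three : jacobiator P w 3 (r := 0) rfl =
    unshuffleSum P (n := 3) (s := 0) (w 2 0) (w 2 0) two_pos rfl rfl := by
  have s : ksign k ((((3 : ℕ) : ℤ) - (2 : ℕ)) * (((2 : ℕ) : ℤ) - 1)) *
      ksign k (((3 : ℕ) : ℤ) - (2 : ℕ)) = 1 := by
    rw [← ksign_add]
    exact ksign_even (by decide)
  rw [jacobiator, Finset.sum_range_succ, Finset.sum_range_succ, Finset.sum_range_succ,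
    Finset.sum_range_zero, dif_neg (by omega), dif_neg (by omega), dif_pos (by omega), s,
    one_smul, zero_add, zero_add, zero_add]
  rfl

theorem jacobiator_four : jacobiator P w 4 (r := 1) rfl =
    unshuffleSum P (n := 4) (s := 1) (w 3 1) (w 2 0) three_pos rfl rfl -
      unshuffleSum P (n := 4) (s := 1) (w 2 0) (w 3 1) two_pos rfl rfl := by
  have s2 : ksign k ((((4 : ℕ) : ℤ) - (2 : ℕ)) * (((2 : ℕ) : ℤ) - 1)) *
      ksign k (((4 : ℕ) : ℤ) - (2 : ℕ)) = 1 := by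
    rw [← ksign_add]
    exact ksign_even (by decide)
  have s3 : ksign k ((((4 : ℕ) : ℤ) - (3 : ℕ)) * (((3 : ℕ) : ℤ) - 1)) *
      ksign k (((4 : ℕ) : ℤ) - (3 : ℕ)) = -1 := by
    rw [← ksign_add]
    exact ksign_odd (by decide)
  rw [jacobiator, Finset.sum_range_succ, Finset.sum_range_succ, Finset.sum_range_succ,
    Finset.sum_range_succ, Finset.sum_range_zero, dif_neg (by omega), dif_neg (by omega),
    dif_pos (by omega), dif_pos (by omega), s2, s3,
    one_smul, zero_add, zero_add, zero_add, neg_one_smul, ← sub_eq_add_neg]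
  rfl

theorem jacobiator_five : jacobiator P w 5 (r := 2) rfl =
    unshuffleSum P (n := 5) (s := 2) (w 4 2) (w 2 0) four_pos rfl rfl +
      unshuffleSum P (n := 5) (s := 2) (w 3 1) (w 3 1) three_pos rfl rfl +
      unshuffleSum P (n := 5) (s := 2) (w 2 0) (w 4 2) two_pos rfl rfl := by
  have s2 : ksign k ((((5 : ℕ) : ℤ) - (2 : ℕ)) * (((2 : ℕ) : ℤ) - 1)) *
      ksign k (((5 : ℕ) : ℤ) - (2 : ℕ)) = 1 := by
    rw [← ksign_add]
    exact ksign_even (by decide)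
  have s3 : ksign k ((((5 : ℕ) : ℤ) - (3 : ℕ)) * (((3 : ℕ) : ℤ) - 1)) *
      ksign k (((5 : ℕ) : ℤ) - (3 : ℕ)) = 1 := by
    rw [← ksign_add]
    exact ksign_even (by decide)
  have s4 : ksign k ((((5 : ℕ) : ℤ) - (4 : ℕ)) * (((4 : ℕ) : ℤ) - 1)) *
      ksign k (((5 : ℕ) : ℤ) - (4 : ℕ)) = 1 := by
    rw [← ksign_add]
    exact ksign_even (by decide)
  rw [jacobiator, Finset.sum_range_succ, Finset.sum_range_succ, Finset.sum_range_succ,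
    Finset.sum_range_succ, Finset.sum_range_succ, Finset.sum_range_zero, dif_neg (by omega),
    dif_neg (by omega), dif_pos (by omega), dif_pos (by omega), dif_pos (by omega), s2, s3, s4,
    one_smul, one_smul, one_smul, zero_add, zero_add, zero_add]
  rfl

end Jacobiator

variable (k)

/-- The images of the generators under `Ωψ`. -/
def ellVal (N : ℕ∞) (g : Lam) : (cobar (lieK k N)).carrier (g.exc + 1) g.deg :=
  sInv (C := lieK k N) rfl (psiGen k N g.toDGen)

variable {k}

theorem ellVal_eq_zero (N : ℕ∞) (g : Lam) (hg : g.isEll = false) : ellVal k N g = 0 := by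
  have h0 : ∀ {n : ℕ} {p q : ℤ} (h : q + 1 = p), sInv (C := lieK k N) (n := n) h 0 = 0 :=
    fun h => map_zero (FreeOp.gen (M := (lieK k N).toSMod) h)
  cases g <;> first | exact absurd hg (by decide) | exact h0 _

theorem ellVal_antisymm (N : ℕ∞) (g : Lam) (σ : Perm (Fin (g.exc + 1))) :
    (cobar (lieK k N)).act σ (ellVal k N g) = psign k σ • ellVal k N g :=
  (sInv_act (C := lieK k N) rfl σ _).symm.trans
    (map_smul (FreeOp.gen (M := (lieK k N).toSMod) rfl) (psign k σ) _)

/-- For the generators other than ℓ_n both the value and the reduced table vanish. For ℓ_n the table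
reduces to the sum over unshuffles that defines the differential. The bound on `M` is essential to
this argument, since ℓ_n is sent to zero when n exceeds `N`. -/
theorem ellVal_isModel {N : ℕ∞} {M : ℕ} (hM : (M : ℕ∞) ≤ N) :
    IsModel (cobar (lieK k N)) (ellVal k N) M := by
  have H := (cobar_hasDerivation (lieK k N)).toIsOperad
  obtain ⟨o32, o42, o43, o52, o53, o54⟩ := shuffleListOk
  intro g hg
  have hgN : ((g.exc + 1 : ℕ) : ℕ∞) ≤ N := le_trans (by exact_mod_cast hg) hM
  rw [lcAt_dTable_eq_ellTable H (ellVal_eq_zero N) (ellVal_antisymm N)]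
  cases hE : g.isEll with
  | false =>
    rw [ellVal_eq_zero N g hE, map_zero]
    cases g <;> first | exact absurd hE (by decide) | rfl
  | true =>
    cases g <;> try exact absurd hE (by decide)
    · have : (cobar (lieK k N)).d (show (-1 : ℤ) + 1 = 0 by rfl) (kGenEl k N 2 0) =
          lcAt (ellVal k N) 2 (-1) (ellTable .a2) := by
        rw [cobar_d_kGenEl N _ le_rfl hgN rfl, jacobiator_two, neg_zero]
        rfl
      exact this
    · have : (cobar (lieK k N)).d (show (0 : ℤ) + 1 = 1 by rfl) (kGenEl k N 3 1) =
          lcAt (ellVal k N) 3 0 (ellTable .a3) := by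
        have u2 : unshuffleSum (cobar (lieK k N)) (n := 3) (s := 0) (kGenEl k N 2 0)
            (kGenEl k N 2 0) two_pos rfl rfl =
            lcAt (ellVal k N) 3 0 (LC.unshuffled 3 .a2 .a2) :=
          sum_unshuffles_comp (val := ellVal k N) H (g := .a2) (g' := .a2) (n := 3) (p := 0) o32 rfl rfl
        rw [cobar_d_kGenEl (n := 3) (r := 0) N _ (by decide) hgN rfl, jacobiator_three, ellTable,
          lcAt_smul, u2]
        simp only [Int.cast_neg, Int.cast_one, neg_one_smul]
      exact this
    · have : (cobar (lieK k N)).d (show (1 : ℤ) + 1 = 2 by rfl) (kGenEl k N 4 2) =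
          lcAt (ellVal k N) 4 1 (ellTable .a4) := by
        have u3 : unshuffleSum (cobar (lieK k N)) (n := 4) (s := 1) (kGenEl k N 3 1)
            (kGenEl k N 2 0) three_pos rfl rfl =
            lcAt (ellVal k N) 4 1 (LC.unshuffled 4 .a3 .a2) :=
          sum_unshuffles_comp (val := ellVal k N) H (g := .a3) (g' := .a2) (n := 4) (p := 1) o42 rfl rfl
        have u2 : unshuffleSum (cobar (lieK k N)) (n := 4) (s := 1) (kGenEl k N 2 0)
            (kGenEl k N 3 1) two_pos rfl rfl =
            lcAt (ellVal k N) 4 1 (LC.unshuffled 4 .a2 .a3) :=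
          sum_unshuffles_comp (val := ellVal k N) H (g := .a2) (g' := .a3) (n := 4) (p := 1) o43 rfl rfl
        rw [cobar_d_kGenEl (n := 4) (r := 1) N _ (by decide) hgN rfl, jacobiator_four, ellTable,
          lcAt_append, lcAt_smul, u3, u2]
        simp only [Int.cast_neg, Int.cast_one, neg_one_smul]
        abel
      exact this
    · have : (cobar (lieK k N)).d (show (2 : ℤ) + 1 = 3 by rfl) (kGenEl k N 5 3) =
          lcAt (ellVal k N) 5 2 (ellTable .a5) := by
        have u4 : unshuffleSum (cobar (lieK k N)) (n := 5) (s := 2) (kGenEl k N 4 2)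
            (kGenEl k N 2 0) four_pos rfl rfl =
            lcAt (ellVal k N) 5 2 (LC.unshuffled 5 .a4 .a2) :=
          sum_unshuffles_comp (val := ellVal k N) H (g := .a4) (g' := .a2) (n := 5) (p := 2) o52 rfl rfl
        have u3 : unshuffleSum (cobar (lieK k N)) (n := 5) (s := 2) (kGenEl k N 3 1)
            (kGenEl k N 3 1) three_pos rfl rfl =
            lcAt (ellVal k N) 5 2 (LC.unshuffled 5 .a3 .a3) :=
          sum_unshuffles_comp (val := ellVal k N) H (g := .a3) (g' := .a3) (n := 5) (p := 2) o53 rfl rfl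
        have u2 : unshuffleSum (cobar (lieK k N)) (n := 5) (s := 2) (kGenEl k N 2 0)
            (kGenEl k N 4 2) two_pos rfl rfl =
            lcAt (ellVal k N) 5 2 (LC.unshuffled 5 .a2 .a4) :=
          sum_unshuffles_comp (val := ellVal k N) H (g := .a2) (g' := .a4) (n := 5) (p := 2) o54 rfl rfl
        rw [cobar_d_kGenEl (n := 5) (r := 2) N _ (by decide) hgN rfl, jacobiator_five, ellTable,
          lcAt_append, lcAt_append, lcAt_smul, lcAt_smul, lcAt_smul, u4, u3, u2]
        simp only [Int.cast_neg, Int.cast_one, neg_one_smul]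
        abel
      exact this

theorem map_wordAt {P : PreDGOperad.{u, v} k} {Q : PreDGOperad.{u, w} k} (f : OperadHom P Q)
    (val : ∀ g : Lam, P.carrier (g.exc + 1) g.deg) (n : ℕ) (p : ℤ) (w : Word) :
    f.toFun (wordAt P val n p w) = wordAt Q (fun g => f.toFun (val g)) n p w := by
  have key : ∀ w : Word, f.toFun (wordVal P val w) = wordVal Q (fun g => f.toFun (val g)) w := by
    intro w
    induction w with
    | nil => exact f.map_one
    | cons x w ih =>
      obtain ⟨i, g⟩ := x
      by_cases h : i < Word.ar w
      · refine (congrArg f.toFun (dif_pos h)).trans (Eq.trans ?_ (dif_pos h).symm)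
        refine (f.map_comp _ _ _ _ _).trans ?_
        rw [ih]
        rfl
      · refine (congrArg f.toFun (dif_neg h)).trans (Eq.trans ?_ (dif_neg h).symm)
        exact map_zero _
  rw [wordAt, wordAt]
  split_ifs with h
  · obtain ⟨rfl, rfl⟩ := h
    exact key w
  · rw [map_zero]

theorem map_lcAt {P : PreDGOperad.{u, v} k} {Q : PreDGOperad.{u, w} k} (f : OperadHom P Q)
    (val : ∀ g : Lam, P.carrier (g.exc + 1) g.deg) (n : ℕ) (p : ℤ) (x : LC) :
    f.toFun (lcAt val n p x) = lcAt (fun g => f.toFun (val g)) n p x := by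
  induction x with
  | nil => exact map_zero _
  | cons s x ih =>
    rw [lcAt_cons, lcAt_cons, map_add, ih, termAt, termAt, map_smul, f.map_act, map_wordAt]

theorem cobarMap_psi_lamVal (N : ℕ∞) (g : Lam) :
    (cobarMap (C := lieD k) (C' := lieK k N) (psi k N)).toFun (lamVal k g) = ellVal k N g := by
  have : freeExt (fun σ => (lieK k N).act σ) (psiGen k N) (gEl k rfl g.toDGen 1) =
      psiGen k N g.toDGen := by
    simp only [freeExt, Finsupp.lift_apply, gEl]
    rw [Finsupp.sum_single_index (by simp), one_smul]
    exact (lieK k N).act_one _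
  exact congrArg (sInv (C := lieK k N) rfl) this

/-- The generators of ΩR and their images satisfy the same table, and a morphism of operads commutes
with the evaluation of formal combinations. -/
theorem cobarMap_psi_isDG :
    (cobarMap (C := lieD k) (C' := lieK k ⊤) (psi k ⊤)).IsDG := by
  have D := cobar_hasDerivation (lieD k)
  have D' := cobar_hasDerivation (lieK k ⊤)
  set f := cobarMap (C := lieD k) (C' := lieK k ⊤) (psi k ⊤) with hf
  have key : ∀ (g : Lam) {q r : ℤ} (h : q + 1 = g.deg + 1) (h' : r + 1 = q),
      f.toFun ((cobar (lieD k)).d h' (sInvR k h (gEl k rfl g.toDGen 1))) =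
        (cobar (lieK k ⊤)).d h' (f.toFun (sInvR k h (gEl k rfl g.toDGen 1))) := by
    intro g q r h h'
    obtain rfl : q = g.deg := by omega
    obtain rfl : r = g.deg - 1 := by omega
    change f.toFun ((cobar (lieD k)).d h' (lamVal k g)) =
        (cobar (lieK k ⊤)).d h' (f.toFun (lamVal k g))
    rw [lamVal_isModel k g g.exc_lt, cobarMap_psi_lamVal,
      ellVal_isModel (M := 5) le_top g g.exc_lt, map_lcAt]
    simp only [hf, cobarMap_psi_lamVal]
  intro n₀ p₀ q₀ h₀ x₀
  refine cobar_hom_isDG D' f ?_ h₀ x₀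
  intro n p q r h h' x
  change f.toFun ((cobar (lieD k)).d h' (sInvR k h x)) =
    (cobar (lieK k ⊤)).d h' (f.toFun (sInvR k h x))
  induction x using lieDMod_induction with
  | zero => simp only [map_zero]
  | add x y hx hy => simp only [map_add, hx, hy]
  | smul c x hx => simp only [map_smul, hx]
  | gen g σ =>
    rw [sInvR_act, D.d_act, f.map_act, f.map_act, D'.d_act]
    congr 1
    cases g
    · exact key .a2 h h'
    · exact key .a21 h h'
    · exact key .a211 h h'
    · exact key .a2111 h h'
    · exact key .a3 h h'
    · exact key .a31 h h'
    · exact key .a32 h h'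
    · exact key .a311 h h'
    · exact key .a312 h h'
    · exact key .a322 h h'
    · exact key .a4 h h'
    · exact key .a41 h h'
    · exact key .a42 h h'
    · exact key .a43 h h'
    · exact key .a5 h h'

/-- No separate coassociativity computation is needed: the ℓ_n form a model in arity at most four,
so the formal identity d² = 0 for the resolution specializes to them. -/
theorem cobar_lieK_four_isDGOperad : IsDGOperad (cobar (lieK k 4)) := by
  have D := cobar_hasDerivation (lieK k 4)
  have M : IsModel (cobar (lieK k 4)) (ellVal k 4) 4 := ellVal_isModel (by exact_mod_cast le_rfl)
  refine cobar_isDGOperad ?_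
  intro n p q r t h h' h'' x
  obtain ⟨c, hc, h0⟩ := sInv_lieK_eq_smul 4 h x
  rw [hc]
  simp only [map_smul]
  by_cases hn : 2 ≤ n ∧ (n : ℕ∞) ≤ 4 ∧ q + 2 = n
  · have hn4 : n ≤ 4 := by exact_mod_cast hn.2.1
    have h2 := hn.1
    have : (cobar (lieK k 4)).d h'' ((cobar (lieK k 4)).d h' (kGenEl k 4 n q)) = 0 := by
      obtain ⟨-, -, hq⟩ := hn
      clear hc h0
      interval_cases n
      · obtain rfl : q = 0 := by omega
        exact M.d_d D .a2 (by decide) h' h''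
      · obtain rfl : q = 1 := by omega
        exact M.d_d D .a3 (by decide) h' h''
      · obtain rfl : q = 2 := by omega
        exact M.d_d D .a4 (by decide) h' h''
    rw [this, smul_zero]
  · rw [h0 hn, zero_smul]

end EllModel

/-! ### The skew-symmetrized structure maps -/

namespace LC

/-- `∑_a ± x ∘_a y`, which describes the sum over unshuffles of composites of alternating sums. -/
def graftSum (j i : ℕ) (x y : LC) : LC :=
  -- The exponent (i - 1)a of `sum_unshuffles_comp_alt` is written as (i + 1)a, which has the same
  -- parity and avoids subtraction.
  (List.range j).flatMap fun a => smul (flip (Nat.beq ((i + 1) * a % 2) 1) 1) (comp a x y)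

/-- `λ_2`, as a linear combination. -/
def skewTwo : LC := [(1, [(0, .a2)], List.range 2)]

/-- `24` times the formula for `l_3`, without alternation. -/
def skewThree : LC := [(4, [(0, .a3)], List.range 3), (-1, [(0, .a2), (0, .a21)], List.range 3),
  (-1, [(1, .a2), (0, .a21)], List.range 3)]

/-- `48` times the formula for `l_4`, without alternation. -/
def skewFour : LC := [(2, [(0, .a4)], List.range 4), (1, [(0, .a3), (0, .a21)], List.range 4),
  (-1, [(0, .a2), (0, .a31)], List.range 4), (1, [(1, .a2), (0, .a32)], List.range 4),
  (-1, [(1, .a3), (0, .a21)], List.range 4), (-1, [(1, .a2), (0, .a31)], List.range 4),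
  (1, [(2, .a2), (0, .a32)], List.range 4)]

theorem skewTwo_ok : skewTwo.Ok 2 0 := by decide +kernel

theorem skewThree_ok : skewThree.Ok 3 1 := by decide +kernel

theorem skewFour_ok : skewFour.Ok 4 2 := by decide +kernel

end LC

section SkewFamily

variable {k : Type u} [CommRing k] {P : PreDGOperad.{u, v} k}
  {val : ∀ g : Lam, P.carrier (g.exc + 1) g.deg}

theorem lcAt_flatMap {ι : Type*} (n : ℕ) (p : ℤ) (L : List ι) (f : ι → LC) :
    lcAt val n p (L.flatMap f) = (L.map fun a => lcAt val n p (f a)).sum := by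
  induction L with
  | nil => rfl
  | cons a L ih => rw [List.flatMap_cons, lcAt_append, ih, List.map_cons, List.sum_cons]

theorem sum_range_map {X : Type*} [AddCommMonoid X] (n : ℕ) (f : ℕ → X) :
    ((List.range n).map f).sum = ∑ a : Fin n, f a := by
  rw [← Finset.sum_range]
  rfl

theorem alt_smul (c : k) {n : ℕ} {p : ℤ} (x : P.carrier n p) : P.alt (c • x) = c • P.alt x := by
  simp only [← altBelow_eq_alt, map_smul]

theorem alt_add {n : ℕ} {p : ℤ} (x y : P.carrier n p) : P.alt (x + y) = P.alt x + P.alt y := by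
  simp only [← altBelow_eq_alt, map_add]

theorem alt_sub {n : ℕ} {p : ℤ} (x y : P.carrier n p) : P.alt (x - y) = P.alt x - P.alt y := by
  simp only [← altBelow_eq_alt, map_sub]

theorem d_altBelow (hP : HasDerivation P) (j : ℕ) {n : ℕ} {p q : ℤ} (h : q + 1 = p)
    (x : P.carrier n p) : P.d h (altBelow P j x) = altBelow P j (P.d h x) := by
  simp only [altBelow, LinearMap.sum_apply, LinearMap.smul_apply, map_sum, map_smul, hP.d_act]

theorem graftSum_ok (hP : IsOperad P) {i j n : ℕ} {p q s : ℤ} (hn : j + i = n + 1)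
    (e : p + q = s) {x y : LC} (hx : x.Ok j p) (hy : y.Ok i q) :
    (LC.graftSum j i x y).Ok n s := by
  intro t ht
  obtain ⟨a, ha, ht⟩ := List.mem_flatMap.1 ht
  -- Well-formedness does not depend on the values of the generators, so zero values serve.
  exact (comp_lcAt (P := P) (val := fun _ => 0) hP hn e ⟨a, List.mem_range.1 ha⟩ hx hy).1.smul _ t ht

/-- This turns each summand of a Jacobi expression in alternating sums into the alternation of a
single formal combination, to which the zero test applies. -/
theorem unshuffleSum_alt (hP : IsOperad P) {i j n : ℕ} {p q s : ℤ} (hj : 0 < j) (hi : 0 < i)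
    (hn : j + i = n + 1) (e : p + q = s) (c c' : k) {x y : LC} (hx : x.Ok j p) (hy : y.Ok i q) :
    unshuffleSum P (c • P.alt (lcAt val j p x)) (c' • P.alt (lcAt val i q y)) hj hn e =
      (c * c') • P.alt (lcAt val n s (LC.graftSum j i x y)) := by
  have h1 := sum_unshuffles_comp_alt hP hj hi hn e (lcAt val j p x) (lcAt val i q y)
  have h2 : unshuffleSum P (c • P.alt (lcAt val j p x)) (c' • P.alt (lcAt val i q y)) hj hn e =
      (c * c') • ∑ σ ∈ unshuffles n i, psign k σ • P.act σ
        (P.comp hn e ⟨0, hj⟩ (P.alt (lcAt val j p x)) (P.alt (lcAt val i q y))) := by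
    rw [unshuffleSum, Finset.smul_sum]
    refine Finset.sum_congr rfl fun σ _ => ?_
    simp only [map_smul, LinearMap.smul_apply]
    rw [smul_smul c' c, smul_comm, mul_comm]
  rw [h2, h1, LC.graftSum, lcAt_flatMap, sum_range_map]
  congr 1
  simp only [← altBelow_eq_alt]
  rw [map_sum]
  refine Finset.sum_congr rfl fun a _ => ?_
  rw [(comp_lcAt hP hn e a hx hy).2, lcAt_smul, map_smul, cast_flip, ksign_eq_bsign]
  congr 1
  have : decide (Odd (((i : ℤ) - 1) * (a : ℕ))) = Nat.beq ((i + 1) * a % 2) 1 := by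
    rw [Bool.eq_iff_iff, decide_eq_true_iff, Nat.beq_eq, ← Nat.odd_iff,
      ← Int.odd_coe_nat]
    push_cast
    simp only [Int.odd_mul, Int.odd_sub, Int.odd_add]
  rw [this]
  simp

/-- The family with the values `x`, `y`, `z` in the arities `2`, `3`, `4`. -/
def family (x : P.carrier 2 0) (y : P.carrier 3 1) (z : P.carrier 4 2) :
    ∀ (n : ℕ) (q : ℤ), P.carrier n q
  | 2, 0 => x
  | 3, 1 => y
  | 4, 2 => z
  | _, _ => 0

theorem family_antisymm {x : P.carrier 2 0} {y : P.carrier 3 1} {z : P.carrier 4 2}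
    (hx : ∀ σ, P.act σ x = psign k σ • x) (hy : ∀ σ, P.act σ y = psign k σ • y)
    (hz : ∀ σ, P.act σ z = psign k σ • z) (n : ℕ) (q : ℤ) (σ : Perm (Fin n)) :
    P.act σ (family x y z n q) = psign k σ • family x y z n q := by
  unfold family
  split
  · exact hx σ
  · exact hy σ
  · exact hz σ
  · rw [map_zero, smul_zero]

theorem inverse_eq_of_mul {a b : k} (h : a * b = 1) : Ring.inverse a = b := by
  have hu : IsUnit a := IsUnit.of_mul_eq_one b h
  calc Ring.inverse a = Ring.inverse a * (a * b) := by rw [h, mul_one]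
    _ = b := by rw [← mul_assoc, Ring.inverse_mul_cancel a hu, one_mul]

variable {t : k}

/-- All coefficients are expressed through t = 1/48: 1/2 = 24t, 1/6 = 8t and 1/24 = 2t. This leaves
integral combinations for the formal computation. -/
theorem skew2_eq (hP : IsOperad P) (ht : 48 * t = 1) {l2 : P.carrier 2 0} (h2 : val .a2 = l2) :
    skew2 P l2 = (24 * t) • P.alt (lcAt val 2 0 LC.skewTwo) := by
  have h : lcAt val 2 0 LC.skewTwo = l2 := (lcAt_gen hP .a2).trans h2
  rw [skew2, h, inverse_eq_of_mul (b := 24 * t) (by linear_combination ht)]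

theorem skew3_eq (hP : IsOperad P) (ht : 48 * t = 1) {l2 : P.carrier 2 0} {l2_1 : P.carrier 2 1}
    {l3 : P.carrier 3 1} (h2 : val .a2 = l2) (h2_1 : val .a21 = l2_1) (h3 : val .a3 = l3) :
    skew3 P l2 l2_1 l3 = (2 * t) • P.alt (lcAt val 3 1 LC.skewThree) := by
  have w3 : wordAt P val 3 1 [(0, .a3)] = l3 := (wordAt_single val hP .a3 rfl rfl).trans h3
  have p0 : wordAt P val 3 1 [(0, .a2), (0, .a21)] = pcomp P l2_1 0 l2 := by
    rw [← h2_1, ← h2]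
    exact wordAt_pair hP (g := .a21) (g' := .a2) rfl rfl 0
  have p1 : wordAt P val 3 1 [(1, .a2), (0, .a21)] = pcomp P l2_1 1 l2 := by
    rw [← h2_1, ← h2]
    exact wordAt_pair hP (g := .a21) (g' := .a2) rfl rfl 1
  have h : lcAt val 3 1 LC.skewThree = (4 : k) • l3 -
      (pcomp P l2_1 0 l2 + pcomp P l2_1 1 l2) := by
    simp only [LC.skewThree, lcAt_cons, lcAt_nil, termAt, perm_range, hP.act_one, w3, p0, p1]
    push_cast
    simp only [neg_one_smul]
    abel
  rw [skew3, h, alt_sub, alt_smul, smul_sub, smul_smul,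
    inverse_eq_of_mul (b := 2 * t * 4) (by linear_combination ht),
    inverse_eq_of_mul (a := 24) (b := 2 * t) (by linear_combination ht)]

theorem skew4_eq (hP : IsOperad P) (ht : 48 * t = 1) {l2 : P.carrier 2 0} {l2_1 : P.carrier 2 1}
    {l3 : P.carrier 3 1} {l3_1 l3_2 : P.carrier 3 2} {l4 : P.carrier 4 2} (h2 : val .a2 = l2)
    (h2_1 : val .a21 = l2_1) (h3 : val .a3 = l3) (h3_1 : val .a31 = l3_1)
    (h3_2 : val .a32 = l3_2) (h4 : val .a4 = l4) :
    skew4 P l2 l2_1 l3 l3_1 l3_2 l4 =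
      t • P.alt (lcAt val 4 2 LC.skewFour) := by
  have w4 : wordAt P val 4 2 [(0, .a4)] = l4 := (wordAt_single val hP .a4 rfl rfl).trans h4
  have p0 : wordAt P val 4 2 [(0, .a3), (0, .a21)] = pcomp P l2_1 0 l3 := by
    rw [← h2_1, ← h3]
    exact wordAt_pair hP (g := .a21) (g' := .a3) rfl rfl 0
  have p1 : wordAt P val 4 2 [(1, .a3), (0, .a21)] = pcomp P l2_1 1 l3 := by
    rw [← h2_1, ← h3]
    exact wordAt_pair hP (g := .a21) (g' := .a3) rfl rfl 1
  have q0 : wordAt P val 4 2 [(0, .a2), (0, .a31)] = pcomp P l3_1 0 l2 := by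
    rw [← h3_1, ← h2]
    exact wordAt_pair hP (g := .a31) (g' := .a2) rfl rfl 0
  have q1 : wordAt P val 4 2 [(1, .a2), (0, .a31)] = pcomp P l3_1 1 l2 := by
    rw [← h3_1, ← h2]
    exact wordAt_pair hP (g := .a31) (g' := .a2) rfl rfl 1
  have r1 : wordAt P val 4 2 [(1, .a2), (0, .a32)] = pcomp P l3_2 1 l2 := by
    rw [← h3_2, ← h2]
    exact wordAt_pair hP (g := .a32) (g' := .a2) rfl rfl 1
  have r2 : wordAt P val 4 2 [(2, .a2), (0, .a32)] = pcomp P l3_2 2 l2 := by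
    rw [← h3_2, ← h2]
    exact wordAt_pair hP (g := .a32) (g' := .a2) rfl rfl 2
  have h : lcAt val 4 2 LC.skewFour = (2 : k) • l4 +
      (pcomp P l2_1 0 l3 - pcomp P l3_1 0 l2
        + pcomp P l3_2 1 l2 - pcomp P l2_1 1 l3
        - pcomp P l3_1 1 l2 + pcomp P l3_2 2 l2) := by
    simp only [LC.skewFour, lcAt_cons, lcAt_nil, termAt, perm_range, hP.act_one, w4, p0, p1, q0,
      q1, r1, r2]
    push_cast
    simp only [neg_one_smul, one_smul]
    abel
  rw [skew4, h, alt_add (_ • _), alt_smul, smul_add, smul_smul,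
    inverse_eq_of_mul (b := t * 2) (by linear_combination ht),
    inverse_eq_of_mul (a := 48) (b := t) (by linear_combination ht)]

variable (P val t)

/-- The skew-symmetrized structure maps, where `t = 1/48`. -/
def skewFamily : ∀ (n : ℕ) (q : ℤ), P.carrier n q :=
  family ((24 * t) • P.alt (lcAt val 2 0 LC.skewTwo)) ((2 * t) • P.alt (lcAt val 3 1 LC.skewThree))
    (t • P.alt (lcAt val 4 2 LC.skewFour))

theorem skewFamily_two :
    skewFamily P val t 2 0 = (24 * t) • P.alt (lcAt val 2 0 LC.skewTwo) := rfl

theorem skewFamily_three :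
    skewFamily P val t 3 1 = (2 * t) • P.alt (lcAt val 3 1 LC.skewThree) := rfl

theorem skewFamily_four : skewFamily P val t 4 2 = t • P.alt (lcAt val 4 2 LC.skewFour) := rfl

variable {P val t}

theorem skewFamily_antisymm (hP : IsOperad P) (n : ℕ) (q : ℤ) (σ : Perm (Fin n)) :
    P.act σ (skewFamily P val t n q) = psign k σ • skewFamily P val t n q := by
  refine family_antisymm ?_ ?_ ?_ n q σ <;>
  · intro σ
    rw [map_smul, act_alt hP, smul_comm]

theorem d_skewFamily_two (hP : HasDerivation P) {N : ℕ} (hv : IsModel P val N) (hN : 2 ≤ N) :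
    P.d (show (-1 : ℤ) + 1 = 0 from rfl) (skewFamily P val t 2 0) = 0 := by
  have h := (d_lcAt hP hv hN (show (-1 : ℤ) + 1 = 0 from rfl) LC.skewTwo_ok).2
  rw [skewFamily_two, map_smul, ← altBelow_eq_alt, d_altBelow hP, h,
    lcAt_eq_zero hP.toIsOperad (d_lcAt hP hv hN (show (-1 : ℤ) + 1 = 0 from rfl) LC.skewTwo_ok).1
      (by decide +kernel), map_zero, smul_zero]

theorem d_skewFamily_three (hP : HasDerivation P) {N : ℕ} (hv : IsModel P val N) (hN : 3 ≤ N)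
    (ht : 48 * t = 1) :
    P.d (show (0 : ℤ) + 1 = 1 from rfl) (skewFamily P val t 3 1) =
      -jacobiator P (skewFamily P val t) 3 (r := 0) rfl := by
  have H := hP.toIsOperad
  obtain ⟨ho, hd⟩ := d_lcAt hP hv hN (show (0 : ℤ) + 1 = 1 from rfl) LC.skewThree_ok
  have og := graftSum_ok (P := P) H (i := 2) (j := 2) (n := 3) (p := 0) (q := 0) (s := 0) rfl rfl
    LC.skewTwo_ok LC.skewTwo_ok
  -- Here `j = 3` is the full alternation. The factor 6 is (24t)²/(2t), the ratio of the
  -- coefficients of J_3 and of l_3.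
  have hz := altBelow_lcAt_eq_zero (val := val) H (j := 3) (by decide +kernel)
    (ho.append (og.smul 6)) (by decide +kernel)
  rw [lcAt_append, lcAt_smul, map_add, map_smul] at hz
  rw [eq_neg_iff_add_eq_zero, jacobiator_three, skewFamily_three, skewFamily_two,
    unshuffleSum_alt H (n := 3) (s := 0) two_pos two_pos rfl rfl _ _ LC.skewTwo_ok LC.skewTwo_ok,
    map_smul, ← altBelow_eq_alt, ← altBelow_eq_alt, d_altBelow hP, hd]
  have e : 24 * t * (24 * t) = 2 * t * ((6 : ℤ) : k) := by
    push_cast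
    linear_combination 12 * t * ht
  rw [e, mul_smul (2 * t), ← smul_add, hz, smul_zero]

theorem d_skewFamily_four (hP : HasDerivation P) {N : ℕ} (hv : IsModel P val N) (hN : 4 ≤ N)
    (ht : 48 * t = 1) :
    P.d (show (1 : ℤ) + 1 = 2 from rfl) (skewFamily P val t 4 2) =
      -jacobiator P (skewFamily P val t) 4 (r := 1) rfl := by
  have H := hP.toIsOperad
  obtain ⟨ho, hd⟩ := d_lcAt hP hv hN (show (1 : ℤ) + 1 = 2 from rfl) LC.skewFour_ok
  have og := graftSum_ok (P := P) H (i := 2) (j := 3) (n := 4) (p := 1) (q := 0) (s := 1) rfl rfl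
    LC.skewThree_ok LC.skewTwo_ok
  have og' := graftSum_ok (P := P) H (i := 3) (j := 2) (n := 4) (p := 0) (q := 1) (s := 1) rfl rfl
    LC.skewTwo_ok LC.skewThree_ok
  -- Both composites in J_4 have the coefficient 24t · 2t = t, the same as l_4, so no further
  -- scaling is needed.
  have hz := altBelow_lcAt_eq_zero (val := val) H (j := 4) (by decide +kernel)
    (ho.append (og.append (og'.smul (-1)))) (by decide +kernel)
  rw [lcAt_append, lcAt_append, lcAt_smul, map_add, map_add, map_smul] at hz
  rw [eq_neg_iff_add_eq_zero, jacobiator_four, skewFamily_four, skewFamily_three, skewFamily_two,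
    unshuffleSum_alt H (n := 4) (s := 1) three_pos two_pos rfl rfl _ _ LC.skewThree_ok LC.skewTwo_ok,
    unshuffleSum_alt H (n := 4) (s := 1) two_pos three_pos rfl rfl _ _ LC.skewTwo_ok LC.skewThree_ok,
    map_smul, ← altBelow_eq_alt, ← altBelow_eq_alt, ← altBelow_eq_alt, d_altBelow hP, hd]
  have e : 24 * t * (2 * t) = t := by linear_combination t * ht
  rw [mul_comm (2 * t), e, ← smul_sub, ← smul_add, sub_eq_add_neg, ← neg_one_smul k]
  push_cast at hz
  rw [hz, smul_zero]

/-- The generalized Jacobi identities in arity at most four. -/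
theorem d_skewFamily (hP : HasDerivation P) {N : ℕ} (hv : IsModel P val N) (hN : 4 ≤ N)
    (ht : 48 * t = 1) {n : ℕ} {q r : ℤ} (h : r + 1 = q) (hr : r + 3 = n) (h2 : 2 ≤ n)
    (h4 : n ≤ 4) : P.d h (skewFamily P val t n q) = -jacobiator P (skewFamily P val t) n hr := by
  interval_cases n
  · obtain rfl : r = -1 := by omega
    obtain rfl : q = 0 := by omega
    rw [d_skewFamily_two hP hv (by omega), jacobiator_two, neg_zero]
  · obtain rfl : r = 0 := by omega
    obtain rfl : q = 1 := by omega
    exact d_skewFamily_three hP hv (by omega) ht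
  · obtain rfl : r = 1 := by omega
    obtain rfl : q = 2 := by omega
    exact d_skewFamily_four hP hv hN ht

end SkewFamily

/-! ### The Jacobi identity in arity five, up to a boundary -/

namespace LC

/-- The labels `0, …, n - 1` with `n` inserted at the position `p`. -/
def insertLabel (n p : ℕ) : List ℕ := (List.range n).insertIdx p n

/-- The alternating sum of the renamings by `insertLabel n p`. -/
def spread (n : ℕ) (x : LC) : LC := (List.range (n + 1)).flatMap fun p => x.map fun s =>
  (flip (oddInversions (insertLabel n p)) s.1, s.2.1, renameLabels (insertLabel n p) s.2.2)

/-- `6912` times the left hand side of the Jacobi identity in arity five, before alternation. -/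
def jacobiFive : LC :=
  smul 72 (graftSum 4 2 skewFour skewTwo) ++ smul 12 (graftSum 3 3 skewThree skewThree) ++
    smul 72 (graftSum 2 4 skewTwo skewFour)

/-- An element with boundary `-jacobiFive` up to alternation. -/
def jacobiHomotopy : LC := [
  -- This labelling is odd and the alternation has 24 terms, so under Ωψ this term gives 288 · 24 =
  -- 6912 times the generator s⁻¹ℓ_5, as it should since d(s⁻¹ℓ_5) = -J_5. Alternation over all five
  -- labels would instead give multiples of 120.
  (-288, [(0, .a5)], [0, 4, 1, 2, 3]),
  (-56, [(0, .a41), (0, .a2)], [4, 0, 1, 2, 3]),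
  (56, [(1, .a41), (0, .a2)], [0, 4, 1, 2, 3]),
  (-168, [(0, .a42), (0, .a2)], [0, 4, 1, 2, 3]),
  (-344, [(1, .a42), (0, .a2)], [0, 1, 4, 2, 3]),
  (-64, [(1, .a42), (0, .a2)], [0, 1, 2, 4, 3]),
  (88, [(0, .a43), (0, .a2)], [0, 1, 4, 2, 3]),
  (32, [(0, .a43), (0, .a2)], [0, 1, 2, 4, 3]),
  (72, [(1, .a43), (0, .a2)], [0, 1, 2, 4, 3]),
  (96, [(1, .a43), (0, .a2)], [0, 1, 2, 3, 4]),
  (-44, [(0, .a4), (0, .a21)], [4, 0, 1, 2, 3]),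
  (40, [(0, .a4), (0, .a21)], [0, 4, 1, 2, 3]),
  (-48, [(0, .a4), (0, .a21)], [0, 1, 4, 2, 3]),
  (16, [(0, .a4), (0, .a21)], [0, 1, 2, 4, 3]),
  (-76, [(0, .a4), (0, .a21)], [0, 1, 2, 3, 4]),
  (-68, [(1, .a4), (0, .a21)], [4, 0, 1, 2, 3]),
  (44, [(1, .a4), (0, .a21)], [0, 4, 1, 2, 3]),
  (-40, [(1, .a4), (0, .a21)], [0, 1, 4, 2, 3]),
  (48, [(1, .a4), (0, .a21)], [0, 1, 2, 4, 3]),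
  (-8, [(1, .a4), (0, .a21)], [0, 1, 2, 3, 4]),
  (56, [(1, .a31), (0, .a3)], [0, 4, 1, 2, 3]),
  (-200, [(2, .a31), (0, .a3)], [0, 1, 4, 2, 3]),
  (-32, [(2, .a31), (0, .a3)], [0, 1, 2, 4, 3]),
  (168, [(0, .a32), (0, .a3)], [0, 4, 1, 2, 3]),
  (-176, [(1, .a32), (0, .a3)], [0, 1, 4, 2, 3]),
  (-64, [(1, .a32), (0, .a3)], [0, 1, 2, 4, 3]),
  (72, [(2, .a32), (0, .a3)], [0, 1, 2, 4, 3]),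
  (96, [(2, .a32), (0, .a3)], [0, 1, 2, 3, 4]),
  (-68, [(0, .a3), (0, .a31)], [4, 0, 1, 2, 3]),
  (64, [(0, .a3), (0, .a31)], [0, 4, 1, 2, 3]),
  (16, [(0, .a3), (0, .a31)], [0, 1, 4, 2, 3]),
  (96, [(0, .a3), (0, .a31)], [0, 1, 2, 4, 3]),
  (-68, [(0, .a3), (0, .a31)], [0, 1, 2, 3, 4]),
  (152, [(1, .a3), (0, .a31)], [4, 0, 1, 2, 3]),
  (-124, [(1, .a3), (0, .a31)], [0, 4, 1, 2, 3]),
  (8, [(1, .a3), (0, .a31)], [0, 1, 4, 2, 3]),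
  (-40, [(1, .a3), (0, .a31)], [0, 1, 2, 4, 3]),
  (68, [(1, .a3), (0, .a31)], [0, 1, 2, 3, 4]),
  (200, [(2, .a3), (0, .a31)], [4, 0, 1, 2, 3]),
  (32, [(2, .a3), (0, .a31)], [0, 4, 1, 2, 3]),
  (-24, [(0, .a3), (0, .a32)], [0, 1, 2, 4, 3]),
  (-32, [(0, .a3), (0, .a32)], [0, 1, 2, 3, 4]),
  (-76, [(1, .a3), (0, .a32)], [4, 0, 1, 2, 3]),
  (76, [(1, .a3), (0, .a32)], [0, 4, 1, 2, 3]),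
  (-80, [(1, .a3), (0, .a32)], [0, 1, 4, 2, 3]),
  (-176, [(1, .a3), (0, .a32)], [0, 1, 2, 3, 4]),
  (76, [(2, .a3), (0, .a32)], [4, 0, 1, 2, 3]),
  (-152, [(2, .a3), (0, .a32)], [0, 4, 1, 2, 3]),
  (76, [(2, .a3), (0, .a32)], [0, 1, 4, 2, 3]),
  (-80, [(2, .a3), (0, .a32)], [0, 1, 2, 4, 3]),
  (-24, [(2, .a3), (0, .a32)], [0, 1, 2, 3, 4]),
  (-56, [(0, .a21), (0, .a4)], [4, 0, 1, 2, 3]),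
  (168, [(1, .a21), (0, .a4)], [0, 4, 1, 2, 3]),
  (88, [(2, .a21), (0, .a4)], [0, 1, 4, 2, 3]),
  (32, [(2, .a21), (0, .a4)], [0, 1, 2, 4, 3]),
  (24, [(3, .a21), (0, .a4)], [0, 1, 2, 4, 3]),
  (32, [(3, .a21), (0, .a4)], [0, 1, 2, 3, 4]),
  (-44, [(0, .a2), (0, .a41)], [4, 0, 1, 2, 3]),
  (-128, [(0, .a2), (0, .a41)], [0, 4, 1, 2, 3]),
  (-48, [(0, .a2), (0, .a41)], [0, 1, 4, 2, 3]),
  (40, [(0, .a2), (0, .a41)], [0, 1, 2, 4, 3]),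
  (-44, [(0, .a2), (0, .a41)], [0, 1, 2, 3, 4]),
  (-216, [(1, .a2), (0, .a41)], [4, 0, 1, 2, 3]),
  (44, [(1, .a2), (0, .a41)], [0, 4, 1, 2, 3]),
  (-40, [(1, .a2), (0, .a41)], [0, 1, 4, 2, 3]),
  (40, [(1, .a2), (0, .a41)], [0, 1, 2, 4, 3]),
  (-44, [(1, .a2), (0, .a41)], [0, 1, 2, 3, 4]),
  (112, [(2, .a2), (0, .a41)], [4, 0, 1, 2, 3]),
  (-56, [(3, .a2), (0, .a41)], [4, 0, 1, 2, 3]),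
  (88, [(0, .a2), (0, .a42)], [0, 1, 4, 2, 3]),
  (32, [(0, .a2), (0, .a42)], [0, 1, 2, 4, 3]),
  (60, [(1, .a2), (0, .a42)], [4, 0, 1, 2, 3]),
  (-56, [(1, .a2), (0, .a42)], [0, 4, 1, 2, 3]),
  (-112, [(1, .a2), (0, .a42)], [0, 1, 4, 2, 3]),
  (-112, [(1, .a2), (0, .a42)], [0, 1, 2, 4, 3]),
  (60, [(1, .a2), (0, .a42)], [0, 1, 2, 3, 4]),
  (60, [(2, .a2), (0, .a42)], [4, 0, 1, 2, 3]),
  (-224, [(2, .a2), (0, .a42)], [0, 4, 1, 2, 3]),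
  (56, [(2, .a2), (0, .a42)], [0, 1, 4, 2, 3]),
  (60, [(2, .a2), (0, .a42)], [0, 1, 2, 3, 4]),
  (344, [(3, .a2), (0, .a42)], [0, 4, 1, 2, 3]),
  (64, [(3, .a2), (0, .a42)], [0, 1, 4, 2, 3]),
  (-24, [(0, .a2), (0, .a43)], [0, 1, 2, 4, 3]),
  (-32, [(0, .a2), (0, .a43)], [0, 1, 2, 3, 4]),
  (48, [(1, .a2), (0, .a43)], [0, 1, 2, 4, 3]),
  (64, [(1, .a2), (0, .a43)], [0, 1, 2, 3, 4]),
  (-44, [(2, .a2), (0, .a43)], [4, 0, 1, 2, 3]),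
  (40, [(2, .a2), (0, .a43)], [0, 4, 1, 2, 3]),
  (-44, [(2, .a2), (0, .a43)], [0, 1, 4, 2, 3]),
  (-32, [(2, .a2), (0, .a43)], [0, 1, 2, 4, 3]),
  (-144, [(2, .a2), (0, .a43)], [0, 1, 2, 3, 4]),
  (-44, [(3, .a2), (0, .a43)], [4, 0, 1, 2, 3]),
  (40, [(3, .a2), (0, .a43)], [0, 4, 1, 2, 3]),
  (-120, [(3, .a2), (0, .a43)], [0, 1, 4, 2, 3]),
  (44, [(3, .a2), (0, .a43)], [0, 1, 2, 4, 3]),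
  (56, [(3, .a2), (0, .a43)], [0, 1, 2, 3, 4]),
  (-56, [(1, .a31), (0, .a21), (0, .a2)], [0, 4, 1, 2, 3]),
  (8, [(0, .a3), (0, .a21), (0, .a21)], [0, 4, 1, 2, 3]),
  (4, [(0, .a3), (0, .a21), (0, .a21)], [0, 1, 2, 4, 3]),
  (-3, [(0, .a3), (0, .a21), (0, .a21)], [0, 1, 2, 3, 4]),
  (4, [(1, .a3), (0, .a21), (0, .a21)], [4, 0, 1, 2, 3]),
  (-4, [(1, .a3), (0, .a21), (0, .a21)], [0, 4, 1, 2, 3]),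
  (1, [(1, .a3), (0, .a21), (0, .a21)], [0, 1, 2, 3, 4]),
  (-1, [(1, .a3), (1, .a21), (0, .a21)], [4, 0, 1, 2, 3]),
  (4, [(1, .a3), (1, .a21), (0, .a21)], [0, 4, 1, 2, 3]),
  (-4, [(1, .a3), (1, .a21), (0, .a21)], [0, 1, 2, 3, 4]),
  (3, [(2, .a3), (1, .a21), (0, .a21)], [4, 0, 1, 2, 3]),
  (-4, [(2, .a3), (1, .a21), (0, .a21)], [0, 4, 1, 2, 3]),
  (-8, [(2, .a3), (1, .a21), (0, .a21)], [0, 1, 2, 4, 3]),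
  (12, [(0, .a2), (0, .a31), (0, .a21)], [4, 0, 1, 2, 3]),
  (-14, [(0, .a2), (0, .a31), (0, .a21)], [0, 4, 1, 2, 3]),
  (12, [(0, .a2), (0, .a31), (0, .a21)], [0, 1, 4, 2, 3]),
  (-12, [(0, .a2), (0, .a31), (0, .a21)], [0, 1, 2, 4, 3]),
  (15, [(0, .a2), (0, .a31), (0, .a21)], [0, 1, 2, 3, 4]),
  (12, [(1, .a2), (0, .a31), (0, .a21)], [4, 0, 1, 2, 3]),
  (-16, [(1, .a2), (0, .a31), (0, .a21)], [0, 4, 1, 2, 3]),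
  (18, [(1, .a2), (0, .a31), (0, .a21)], [0, 1, 4, 2, 3]),
  (-20, [(1, .a2), (0, .a31), (0, .a21)], [0, 1, 2, 4, 3]),
  (13, [(1, .a2), (0, .a31), (0, .a21)], [0, 1, 2, 3, 4]),
  (13, [(1, .a2), (1, .a31), (0, .a21)], [4, 0, 1, 2, 3]),
  (-16, [(1, .a2), (1, .a31), (0, .a21)], [0, 4, 1, 2, 3]),
  (18, [(1, .a2), (1, .a31), (0, .a21)], [0, 1, 4, 2, 3]),
  (-12, [(1, .a2), (1, .a31), (0, .a21)], [0, 1, 2, 4, 3]),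
  (20, [(1, .a2), (1, .a31), (0, .a21)], [0, 1, 2, 3, 4]),
  (15, [(2, .a2), (1, .a31), (0, .a21)], [4, 0, 1, 2, 3]),
  (-12, [(2, .a2), (1, .a31), (0, .a21)], [0, 4, 1, 2, 3]),
  (12, [(2, .a2), (1, .a31), (0, .a21)], [0, 1, 4, 2, 3]),
  (-14, [(2, .a2), (1, .a31), (0, .a21)], [0, 1, 2, 4, 3]),
  (12, [(2, .a2), (1, .a31), (0, .a21)], [0, 1, 2, 3, 4]),
  (-8, [(1, .a2), (0, .a32), (0, .a21)], [4, 0, 1, 2, 3]),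
  (8, [(1, .a2), (0, .a32), (0, .a21)], [0, 4, 1, 2, 3]),
  (-8, [(1, .a2), (0, .a32), (0, .a21)], [0, 1, 4, 2, 3]),
  (12, [(1, .a2), (0, .a32), (0, .a21)], [0, 1, 2, 4, 3]),
  (-9, [(1, .a2), (0, .a32), (0, .a21)], [0, 1, 2, 3, 4]),
  (-4, [(2, .a2), (0, .a32), (0, .a21)], [4, 0, 1, 2, 3]),
  (12, [(2, .a2), (0, .a32), (0, .a21)], [0, 4, 1, 2, 3]),
  (-8, [(2, .a2), (0, .a32), (0, .a21)], [0, 1, 4, 2, 3]),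
  (-3, [(2, .a2), (0, .a32), (0, .a21)], [0, 1, 2, 3, 4]),
  (-3, [(2, .a2), (1, .a32), (0, .a21)], [4, 0, 1, 2, 3]),
  (4, [(2, .a2), (1, .a32), (0, .a21)], [0, 4, 1, 2, 3]),
  (-8, [(2, .a2), (1, .a32), (0, .a21)], [0, 1, 4, 2, 3]),
  (-12, [(2, .a2), (1, .a32), (0, .a21)], [0, 1, 2, 3, 4]),
  (-9, [(3, .a2), (1, .a32), (0, .a21)], [4, 0, 1, 2, 3]),
  (8, [(3, .a2), (1, .a32), (0, .a21)], [0, 4, 1, 2, 3]),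
  (-12, [(3, .a2), (1, .a32), (0, .a21)], [0, 1, 4, 2, 3]),
  (8, [(3, .a2), (1, .a32), (0, .a21)], [0, 1, 2, 4, 3]),
  (-8, [(3, .a2), (1, .a32), (0, .a21)], [0, 1, 2, 3, 4]),
  (-56, [(1, .a21), (1, .a2), (0, .a31)], [0, 4, 1, 2, 3]),
  (4, [(0, .a2), (0, .a21), (0, .a31)], [4, 0, 1, 2, 3]),
  (-2, [(0, .a2), (0, .a21), (0, .a31)], [0, 4, 1, 2, 3]),
  (4, [(0, .a2), (0, .a21), (0, .a31)], [0, 1, 2, 3, 4]),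
  (6, [(1, .a2), (0, .a21), (0, .a31)], [0, 1, 4, 2, 3]),
  (-8, [(1, .a2), (0, .a21), (0, .a31)], [0, 1, 2, 4, 3]),
  (-8, [(1, .a2), (1, .a21), (0, .a31)], [4, 0, 1, 2, 3]),
  (-6, [(1, .a2), (1, .a21), (0, .a31)], [0, 1, 4, 2, 3]),
  (-4, [(2, .a2), (1, .a21), (0, .a31)], [0, 1, 4, 2, 3]),
  (2, [(2, .a2), (1, .a21), (0, .a31)], [0, 1, 2, 4, 3]),
  (-4, [(2, .a2), (1, .a21), (0, .a31)], [0, 1, 2, 3, 4]),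
  (-4, [(1, .a2), (1, .a21), (0, .a32)], [4, 0, 1, 2, 3]),
  (4, [(1, .a2), (1, .a21), (0, .a32)], [0, 4, 1, 2, 3]),
  (-2, [(1, .a2), (1, .a21), (0, .a32)], [0, 1, 4, 2, 3]),
  (6, [(2, .a2), (1, .a21), (0, .a32)], [0, 1, 2, 4, 3]),
  (-8, [(2, .a2), (1, .a21), (0, .a32)], [0, 1, 2, 3, 4]),
  (-8, [(2, .a2), (2, .a21), (0, .a32)], [0, 4, 1, 2, 3]),
  (-6, [(2, .a2), (2, .a21), (0, .a32)], [0, 1, 2, 4, 3]),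
  (4, [(3, .a2), (2, .a21), (0, .a32)], [4, 0, 1, 2, 3]),
  (-4, [(3, .a2), (2, .a21), (0, .a32)], [0, 1, 2, 4, 3]),
  (2, [(3, .a2), (2, .a21), (0, .a32)], [0, 1, 2, 3, 4]),
  (20, [(2, .a2), (0, .a2), (0, .a312)], [0, 4, 1, 2, 3]),
  (-12, [(2, .a2), (0, .a2), (0, .a312)], [0, 1, 4, 2, 3]),
  (12, [(2, .a2), (0, .a2), (0, .a312)], [0, 1, 2, 4, 3]),
  (-6, [(2, .a2), (0, .a2), (0, .a312)], [0, 1, 2, 3, 4]),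
  (-16, [(3, .a2), (0, .a2), (0, .a312)], [4, 0, 1, 2, 3]),
  (-12, [(3, .a2), (0, .a2), (0, .a312)], [0, 1, 4, 2, 3]),
  (16, [(3, .a2), (0, .a2), (0, .a312)], [0, 1, 2, 4, 3]),
  (-6, [(3, .a2), (1, .a2), (0, .a312)], [4, 0, 1, 2, 3]),
  (12, [(3, .a2), (1, .a2), (0, .a312)], [0, 4, 1, 2, 3]),
  (-12, [(3, .a2), (1, .a2), (0, .a312)], [0, 1, 4, 2, 3]),
  (-20, [(3, .a2), (1, .a2), (0, .a312)], [0, 1, 2, 3, 4]),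
  (2, [(0, .a2), (0, .a21), (0, .a21), (0, .a21)], [0, 4, 1, 2, 3]),
  (-4, [(0, .a2), (0, .a21), (0, .a21), (0, .a21)], [0, 1, 2, 4, 3]),
  (-3, [(0, .a2), (0, .a21), (0, .a21), (0, .a21)], [0, 1, 2, 3, 4]),
  (-6, [(1, .a2), (0, .a21), (0, .a21), (0, .a21)], [0, 1, 4, 2, 3]),
  (8, [(1, .a2), (0, .a21), (0, .a21), (0, .a21)], [0, 1, 2, 4, 3]),
  (4, [(1, .a2), (1, .a21), (0, .a21), (0, .a21)], [4, 0, 1, 2, 3]),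
  (4, [(2, .a2), (1, .a21), (0, .a21), (0, .a21)], [0, 1, 4, 2, 3]),
  (1, [(2, .a2), (1, .a21), (0, .a21), (0, .a21)], [0, 1, 2, 3, 4]),
  (-1, [(1, .a2), (1, .a21), (1, .a21), (0, .a21)], [4, 0, 1, 2, 3]),
  (4, [(1, .a2), (1, .a21), (1, .a21), (0, .a21)], [0, 4, 1, 2, 3]),
  (-4, [(1, .a2), (1, .a21), (1, .a21), (0, .a21)], [0, 1, 2, 3, 4]),
  (-4, [(2, .a2), (2, .a21), (1, .a21), (0, .a21)], [0, 4, 1, 2, 3]),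
  (-6, [(2, .a2), (2, .a21), (1, .a21), (0, .a21)], [0, 1, 2, 4, 3]),
  (3, [(3, .a2), (2, .a21), (1, .a21), (0, .a21)], [4, 0, 1, 2, 3]),
  (2, [(3, .a2), (2, .a21), (1, .a21), (0, .a21)], [0, 1, 2, 3, 4]),
  (-12, [(2, .a2), (2, .a21), (0, .a2), (0, .a211)], [0, 4, 1, 2, 3]),
  (-14, [(2, .a2), (2, .a21), (0, .a2), (0, .a211)], [0, 1, 2, 4, 3]),
  (12, [(3, .a2), (2, .a21), (0, .a2), (0, .a211)], [4, 0, 1, 2, 3]),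
  (6, [(3, .a2), (2, .a21), (0, .a2), (0, .a211)], [0, 1, 4, 2, 3]),
  (6, [(3, .a2), (2, .a21), (0, .a2), (0, .a211)], [0, 1, 2, 3, 4]),
  (6, [(3, .a2), (1, .a2), (1, .a21), (0, .a211)], [4, 0, 1, 2, 3]),
  (-12, [(3, .a2), (1, .a2), (1, .a21), (0, .a211)], [0, 4, 1, 2, 3]),
  (-4, [(3, .a2), (1, .a2), (1, .a21), (0, .a211)], [0, 1, 2, 4, 3])]

set_option maxRecDepth 100000 in
theorem jacobiHomotopy_ok : jacobiHomotopy.Ok 5 3 := by decide +kernel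

-- The central computation. The full alternation of the Jacobi expression is spread over the five
-- positions of the last label, so that both summands are compared modulo permutations of the first
-- four labels only.
set_option maxRecDepth 100000 in
theorem d_jacobiHomotopy : isAltZero 4 (d jacobiHomotopy ++ spread 4 jacobiFive) = true := by
  decide +kernel

end LC

section JacobiFive

variable {k : Type u} [CommRing k] {P : PreDGOperad.{u, v} k}
  {val : ∀ g : Lam, P.carrier (g.exc + 1) g.deg}

theorem insertLabel_perm {n p : ℕ} (hp : p ≤ n) :
    (LC.insertLabel n p).Perm (List.range (n + 1)) := by
  rw [List.range_succ]
  refine (List.perm_insertIdx n (List.range n) (by simpa using hp)).trans ?_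
  exact (List.perm_append_singleton n (List.range n)).symm

theorem perm_insertLabel {n p : ℕ} (hp : p ≤ n) :
    ((perm (n + 1) (LC.insertLabel n p) (Fin.last n) : Fin (n + 1)) : ℕ) = p := by
  have h := insertLabel_perm hp
  have : Fin.last n = (perm (n + 1) (LC.insertLabel n p))⁻¹ ⟨p, by omega⟩ := by
    ext
    rw [perm_inv_apply h]
    simp [LC.insertLabel, List.getElem_insertIdx_self]
  rw [this]
  simp

theorem lcAt_renameLabels (hP : IsOperad P) {n : ℕ} {p : ℤ} {L : List ℕ} (hL : L.Perm (List.range n))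
    (b : Bool) {x : LC} (hx : x.Ok n p) :
    LC.Ok n p (x.map fun s => (flip b s.1, s.2.1, renameLabels L s.2.2)) ∧
    lcAt val n p (x.map fun s => (flip b s.1, s.2.1, renameLabels L s.2.2)) =
      bsign k b • P.act (perm n L) (lcAt val n p x) := by
  induction x with
  | nil => exact ⟨by simp [LC.Ok], by simp [lcAt_nil]⟩
  | cons s x ih =>
    obtain ⟨o, e⟩ := ih fun t ht => hx t (by simp [ht])
    obtain ⟨os, as, ds, ls⟩ := hx s (by simp)
    obtain ⟨h1, h2⟩ := renameLabels_perm hL ls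
    refine ⟨?_, ?_⟩
    · intro t ht
      rcases List.mem_cons.1 ht with rfl | ht
      · exact ⟨os, as, ds, h1⟩
      · exact o t ht
    · rw [List.map_cons, lcAt_cons, lcAt_cons, e, map_add, smul_add]
      congr 1
      simp only [termAt, map_smul]
      rw [h2, hP.act_mul, cast_flip, mul_smul]

theorem spread_ok (hP : IsOperad P) {n : ℕ} {p : ℤ} {x : LC} (hx : x.Ok (n + 1) p) :
    (LC.spread n x).Ok (n + 1) p := by
  intro t ht
  obtain ⟨a, ha, ht⟩ := List.mem_flatMap.1 ht
  exact (lcAt_renameLabels (P := P) (val := fun _ => 0) hP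
    (insertLabel_perm (Nat.lt_succ_iff.1 (List.mem_range.1 ha))) _ hx).1 t ht

/-- Permutations of n + 1 inputs are sorted by the image of the last one. The inserted labels are
the coset representatives, and the stabilizer of the last input is the group of the partial
alternation. -/
theorem alt_lcAt_eq_spread (hP : IsOperad P) {n : ℕ} {p : ℤ} {x : LC} (hx : x.Ok (n + 1) p) :
    P.alt (lcAt val (n + 1) p x) = altBelow P n (lcAt val (n + 1) p (LC.spread n x)) := by
  rw [LC.spread, lcAt_flatMap, sum_range_map, PreDGOperad.alt, map_sum,
    sum_perm_eq_sum_fix (Fin.last n) (fun a => perm (n + 1) (LC.insertLabel n a))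
      (fun a => Fin.ext (perm_insertLabel (Nat.lt_succ_iff.1 a.2)))]
  refine Finset.sum_congr rfl fun a _ => ?_
  have ha := insertLabel_perm (Nat.lt_succ_iff.1 a.2)
  rw [(lcAt_renameLabels hP ha _ hx).2, map_smul, ← psign_perm ha]
  simp only [altBelow, LinearMap.sum_apply, LinearMap.smul_apply, Finset.smul_sum]
  refine Fintype.sum_equiv (Equiv.subtypeEquivRight fun σ => ⟨fun h b hb => ?_, fun h =>
    h (Fin.last n) le_rfl⟩) _ _ fun σ => ?_
  · obtain rfl : b = Fin.last n := Fin.ext (le_antisymm (Nat.lt_succ_iff.1 b.2) hb)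
    exact h
  · rw [psign_mul, mul_smul, hP.act_mul]
    rfl

variable {t : k}

/-- The left hand side of the Jacobi identity in arity five is a boundary, up to a factor. -/
theorem smul_jacobiator_skewFamily_five (hP : HasDerivation P) (hv : IsModel P val 5)
    (ht : 48 * t = 1) :
    (6912 : k) • jacobiator P (skewFamily P val t) 5 (r := 2) rfl =
      -P.d (show (2 : ℤ) + 1 = 3 from rfl) (altBelow P 4 (lcAt val 5 3 LC.jacobiHomotopy)) := by
  have H := hP.toIsOperad
  obtain ⟨ho, hd⟩ := d_lcAt hP hv le_rfl (show (2 : ℤ) + 1 = 3 from rfl) LC.jacobiHomotopy_ok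
  have o42 := graftSum_ok (P := P) H (i := 2) (j := 4) (n := 5) (p := 2) (q := 0) (s := 2) rfl rfl
    LC.skewFour_ok LC.skewTwo_ok
  have o33 := graftSum_ok (P := P) H (i := 3) (j := 3) (n := 5) (p := 1) (q := 1) (s := 2) rfl rfl
    LC.skewThree_ok LC.skewThree_ok
  have o24 := graftSum_ok (P := P) H (i := 4) (j := 2) (n := 5) (p := 0) (q := 2) (s := 2) rfl rfl
    LC.skewTwo_ok LC.skewFour_ok
  have oj : LC.jacobiFive.Ok 5 2 := ((o42.smul 72).append (o33.smul 12)).append (o24.smul 72)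
  have os := spread_ok (P := P) H oj
  have hz := altBelow_lcAt_eq_zero (val := val) H (j := 4) (by decide +kernel)
    (ho.append os) LC.d_jacobiHomotopy
  rw [lcAt_append, map_add, ← alt_lcAt_eq_spread H oj] at hz
  rw [d_altBelow hP, hd, eq_neg_iff_add_eq_zero, add_comm, ← hz, jacobiator_five,
    skewFamily_four, skewFamily_three, skewFamily_two,
    unshuffleSum_alt H (n := 5) (s := 2) four_pos two_pos rfl rfl _ _ LC.skewFour_ok LC.skewTwo_ok,
    unshuffleSum_alt H (n := 5) (s := 2) three_pos three_pos rfl rfl _ _ LC.skewThree_ok LC.skewThree_ok,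
    unshuffleSum_alt H (n := 5) (s := 2) two_pos four_pos rfl rfl _ _ LC.skewTwo_ok LC.skewFour_ok]
  congr 1
  rw [LC.jacobiFive, lcAt_append, lcAt_append, lcAt_smul, lcAt_smul, lcAt_smul, alt_add, alt_add,
    alt_smul, alt_smul, alt_smul, smul_add, smul_add, smul_smul, smul_smul, smul_smul]
  -- Since 6912 = 3 · 48², the coefficients 24t² and 4t² of the summands of J_5 become the integers
  -- 72 and 12.
  have ht2 : 2304 * (t * t) = 1 := by linear_combination (48 * t + 1) * ht
  have e1 : 6912 * (t * (24 * t)) = (((72 : ℤ)) : k) := by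
    push_cast
    linear_combination 72 * ht2
  have e2 : 6912 * (2 * t * (2 * t)) = (((12 : ℤ)) : k) := by
    push_cast
    linear_combination 12 * ht2
  rw [e1, e2, mul_comm (24 * t), e1]

end JacobiFive

/-! ### The morphism from the cobar construction of the truncated Koszul dual cooperad -/

/-- The identity morphism. -/
def OperadHom.id {k : Type u} [CommRing k] (P : PreDGOperad.{u, v} k) : OperadHom P P where
  toFun := LinearMap.id
  map_act _ _ := rfl
  map_one := rfl
  map_comp _ _ _ _ _ := rfl

/-- The composite of two morphisms. -/
def OperadHom.trans {k : Type u} [CommRing k] {P : PreDGOperad.{u, v} k}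
    {Q : PreDGOperad.{u, w} k} {R : PreDGOperad k} (f : OperadHom P Q) (g : OperadHom Q R) :
    OperadHom P R where
  toFun := g.toFun ∘ₗ f.toFun
  map_act σ x := by simp only [LinearMap.comp_apply, f.map_act, g.map_act]
  map_one := by simp only [LinearMap.comp_apply, f.map_one, g.map_one]
  map_comp h e i μ ν := by simp only [LinearMap.comp_apply, f.map_comp, g.map_comp]

section Symmetrization

variable {k : Type u} [CommRing k]

theorem map_alt {P : PreDGOperad.{u, v} k} {Q : PreDGOperad.{u, w} k} (f : OperadHom P Q) {n : ℕ}
    {p : ℤ} (x : P.carrier n p) : f.toFun (P.alt x) = Q.alt (f.toFun x) := by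
  simp only [PreDGOperad.alt, map_sum, map_smul, f.map_act]

theorem map_family {P : PreDGOperad.{u, v} k} {Q : PreDGOperad.{u, w} k} (f : OperadHom P Q)
    (x : P.carrier 2 0) (y : P.carrier 3 1) (z : P.carrier 4 2) (n : ℕ) (q : ℤ) :
    f.toFun (family x y z n q) = family (f.toFun x) (f.toFun y) (f.toFun z) n q := by
  unfold family
  split <;> first | rfl | exact map_zero _

/-- The formulas use only operadic operations, so they are natural for morphisms of operads. This is
how they pass to Ωψ and to the structure maps of a weak Lie 3-algebra. -/
theorem map_skewFamily {P : PreDGOperad.{u, v} k} {Q : PreDGOperad.{u, w} k} (f : OperadHom P Q)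
    (val : ∀ g : Lam, P.carrier (g.exc + 1) g.deg) (t : k) (n : ℕ) (q : ℤ) :
    f.toFun (skewFamily P val t n q) = skewFamily Q (fun g => f.toFun (val g)) t n q := by
  rw [skewFamily, map_family]
  simp only [map_smul, map_alt, map_lcAt]
  rfl

theorem alt_of_antisymm {P : PreDGOperad.{u, v} k} {n : ℕ} {p : ℤ} {x : P.carrier n p}
    (hx : ∀ σ, P.act σ x = psign k σ • x) : P.alt x = (n.factorial : k) • x := by
  simp only [PreDGOperad.alt, hx, smul_smul, psign_mul_self, one_smul, Finset.sum_const,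
    Finset.card_univ, Fintype.card_perm, Fintype.card_fin, Nat.cast_smul_eq_nsmul]

/-- Skew-symmetrization does not change an `L_∞`-structure. -/
theorem skewFamily_ellVal (N : ℕ∞) {t : k} (ht : 48 * t = 1) {n : ℕ} {q : ℤ} (h2 : 2 ≤ n)
    (h4 : n ≤ 4) (hq : q + 2 = n) :
    skewFamily (cobar (lieK k N)) (ellVal k N) t n q = kGenEl k N n q := by
  have H := (cobar_hasDerivation (lieK k N)).toIsOperad
  have e21 : ellVal k N .a21 = 0 := ellVal_eq_zero N .a21 rfl
  have e31 : ellVal k N .a31 = 0 := ellVal_eq_zero N .a31 rfl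
  have e32 : ellVal k N .a32 = 0 := ellVal_eq_zero N .a32 rfl
  interval_cases n
  · obtain rfl : q = 0 := by omega
    have := skew2_eq (val := ellVal k N) H ht (l2 := kGenEl k N 2 0) rfl
    rw [skewFamily_two, ← this, skew2, alt_of_antisymm (act_kGenEl N 2 0), smul_smul,
      inverse_eq_of_mul (b := 24 * t) (by linear_combination ht)]
    simp only [Nat.factorial]
    push_cast
    rw [show 24 * t * 2 = 1 by linear_combination ht, one_smul]
  · obtain rfl : q = 1 := by omega
    have := skew3_eq (val := ellVal k N) H ht (l2 := kGenEl k N 2 0) (l2_1 := 0)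
      (l3 := kGenEl k N 3 1) rfl e21 rfl
    rw [skewFamily_three, ← this, skew3, alt_of_antisymm (act_kGenEl N 3 1), smul_smul,
      inverse_eq_of_mul (b := 8 * t) (by linear_combination ht)]
    -- Every correction term contains the value of ℓ_{2;1}, which is zero here; what remains is 1/6
    -- of the 3! equal summands.
    simp only [Nat.factorial, pcomp, map_zero, LinearMap.zero_apply, add_zero]
    rw [← altBelow_eq_alt, map_zero, smul_zero, sub_zero]
    push_cast
    rw [show 8 * t * 6 = 1 by linear_combination ht, one_smul]
  · obtain rfl : q = 2 := by omega
    have := skew4_eq (val := ellVal k N) H ht (l2 := kGenEl k N 2 0) (l2_1 := 0)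
      (l3 := kGenEl k N 3 1) (l3_1 := 0) (l3_2 := 0) (l4 := kGenEl k N 4 2) rfl e21 rfl e31 e32 rfl
    rw [skewFamily_four, ← this, skew4, alt_of_antisymm (act_kGenEl N 4 2), smul_smul,
      inverse_eq_of_mul (b := 2 * t) (by linear_combination ht)]
    simp only [Nat.factorial, pcomp, map_zero, LinearMap.zero_apply, add_zero, sub_zero]
    rw [← altBelow_eq_alt, map_zero, smul_zero, add_zero]
    push_cast
    rw [show 2 * t * 24 = 1 by linear_combination ht, one_smul]

theorem le_four_of_cast {n : ℕ} (h : (n : ℕ∞) ≤ 4) : n ≤ 4 := by exact_mod_cast h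

/-- The skew-symmetrization morphism, where `t = 1/48`. -/
def skewHom {t : k} (ht : 48 * t = 1) : DGOperadHom (cobar (lieK k 4)) (cobar (lieD k)) where
  toOperadHom := lieKLift 4 (cobar_hasDerivation (lieD k)).toIsOperad
    (skewFamily (cobar (lieD k)) (lamVal k) t)
    (skewFamily_antisymm (cobar_hasDerivation (lieD k)).toIsOperad)
  isDG := by
    have H := cobar_hasDerivation (lieD k)
    intro n₀ p₀ q₀ h₀ x₀
    refine lieK_hom_isDG 4 H _ (fun n q r h hr h2 h4 => ?_) h₀ x₀
    have h4' := le_four_of_cast h4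
    rw [lieKLift_kGenEl 4 H.toIsOperad _ h2 h4 (by omega),
      d_skewFamily H (lamVal_isModel k) (by decide) ht h hr h2 h4']
    congr 1
    -- In arity at most four only the prescribed values of smaller arity enter. The truncated
    -- cooperad has no generator in arity five, so no Jacobi identity is required there.
    refine jacobiator_congr n hr fun m q hm hmn hq => ?_
    exact (lieKLift_kGenEl 4 H.toIsOperad _ hm (by exact_mod_cast (by omega : m ≤ 4)) hq).symm

theorem skewHom_kGenEl {t : k} (ht : 48 * t = 1) {n : ℕ} {q : ℤ} (h2 : 2 ≤ n) (h4 : n ≤ 4)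
    (hq : q + 2 = n) :
    (skewHom ht).toFun (kGenEl k 4 n q) = skewFamily (cobar (lieD k)) (lamVal k) t n q :=
  lieKLift_kGenEl 4 (cobar_hasDerivation (lieD k)).toIsOperad
    (skewFamily_antisymm (cobar_hasDerivation (lieD k)).toIsOperad) h2 (by exact_mod_cast h4) hq

/-- By naturality the image is the skew-symmetrization of the antisymmetric family, which is
unchanged. Leaving `N` free covers ψ_3 (`N = 4`) and ψ (`N = ⊤`) together. -/
theorem cobarMap_psi_skewHom_kGenEl (N : ℕ∞) {t : k} (ht : 48 * t = 1) {n : ℕ} {q : ℤ}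
    (h2 : 2 ≤ n) (h4 : n ≤ 4) (hq : q + 2 = n) :
    (cobarMap (C := lieD k) (C' := lieK k N) (psi k N)).toFun
      ((skewHom ht).toFun (kGenEl k 4 n q)) = kGenEl k N n q := by
  rw [skewHom_kGenEl ht h2 h4 hq, map_skewFamily]
  simp only [cobarMap_psi_lamVal]
  exact skewFamily_ellVal N ht h2 h4 hq

theorem cobarMap_lieKIncl_kGenEl (N : ℕ∞) {n : ℕ} {q : ℤ} (h2 : 2 ≤ n) (hN : (n : ℕ∞) ≤ N)
    (hq : q + 2 = n) : (cobarMap (C := lieK k N) (C' := lieK k ⊤) (lieKIncl k N)).toFun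
      (kGenEl k N n q) = kGenEl k ⊤ n q := by
  have : Finsupp.lmapDomain k k (fun g : KGen N n (q + 1) => (⟨g.two_le, le_top, g.deg⟩ :
      KGen ⊤ n (q + 1))) (ell k N n (q + 1)) = ell k ⊤ n (q + 1) := by
    rw [ell_of N ⟨h2, hN, by omega⟩, ell_of ⊤ ⟨h2, le_top, by omega⟩]
    exact Finsupp.mapDomain_single
  exact congrArg (sInv (C := lieK k ⊤) rfl) this

theorem cobarMap_psi_four_skewHom {t : k} (ht : 48 * t = 1) {n : ℕ} {p : ℤ}
    (x : (cobar (lieK k 4)).carrier n p) :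
    (cobarMap (C := lieD k) (C' := lieK k 4) (psi k 4)).toFun ((skewHom ht).toFun x) = x :=
  lieK_hom_ext 4 (f := (skewHom ht).toOperadHom.trans
    (cobarMap (C := lieD k) (C' := lieK k 4) (psi k 4))) (g := OperadHom.id _)
    (fun _ _ h2 h4 hq => cobarMap_psi_skewHom_kGenEl 4 ht h2 (le_four_of_cast h4) hq) x

theorem cobarMap_psi_top_skewHom {t : k} (ht : 48 * t = 1) {n : ℕ} {p : ℤ}
    (x : (cobar (lieK k 4)).carrier n p) :
    (cobarMap (C := lieD k) (C' := lieK k ⊤) (psi k ⊤)).toFun ((skewHom ht).toFun x) =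
      (cobarMap (C := lieK k 4) (C' := lieK k ⊤) (lieKIncl k 4)).toFun x :=
  lieK_hom_ext 4 (f := (skewHom ht).toOperadHom.trans
    (cobarMap (C := lieD k) (C' := lieK k ⊤) (psi k ⊤))) (g := cobarMap (lieKIncl k 4))
    (fun _ _ h2 h4 hq => (cobarMap_psi_skewHom_kGenEl ⊤ ht h2 (le_four_of_cast h4) hq).trans
      (cobarMap_lieKIncl_kGenEl 4 h2 h4 hq).symm) x

end Symmetrization

/-! ### Koszul signs -/

/-- The sign `(-1)^x` for an exponent modulo two. -/
def zsign (k : Type u) [CommRing k] (x : ZMod 2) : k := if x = 0 then 1 else -1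

section Signs

variable {k : Type u} [CommRing k]

theorem zsign_add (x y : ZMod 2) : zsign k (x + y) = zsign k x * zsign k y := by
  have : ∀ x y : ZMod 2, ((x = 0 ∧ y = 0) ∨ (x = 0 ∧ y = 1)) ∨ ((x = 1 ∧ y = 0) ∨ (x = 1 ∧ y = 1)) := by
    decide
  have h1 : (1 : ZMod 2) + 1 = 0 := by decide
  rcases this x y with (⟨rfl, rfl⟩ | ⟨rfl, rfl⟩) | (⟨rfl, rfl⟩ | ⟨rfl, rfl⟩) <;> simp [zsign, h1]

theorem zsign_zero : zsign k 0 = 1 := if_pos rfl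

/-- Exponents in `ZMod 2` let sign identities be proved by additive computations. -/
theorem ksign_eq_zsign (n : ℤ) : ksign k n = zsign k n := by
  by_cases h : Odd n
  · have h0 : (n : ZMod 2) ≠ 0 := by
      rw [Ne, ZMod.intCast_zmod_eq_zero_iff_dvd]
      intro h'
      exact (Int.not_even_iff_odd.2 h) (even_iff_two_dvd.2 (by exact_mod_cast h'))
    rw [ksign_odd h, zsign, if_neg h0]
  · have h' := Int.not_odd_iff_even.1 h
    have h0 : (n : ZMod 2) = 0 := by
      rw [ZMod.intCast_zmod_eq_zero_iff_dvd]
      exact_mod_cast even_iff_two_dvd.1 h'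
    rw [ksign_even h', zsign, if_pos h0]

theorem zsign_sum {ι : Type*} (s : Finset ι) (f : ι → ZMod 2) :
    ∏ i ∈ s, zsign k (f i) = zsign k (∑ i ∈ s, f i) := by
  classical
  induction s using Finset.induction_on with
  | empty => simp [zsign_zero]
  | insert i s hi ih => rw [Finset.prod_insert hi, Finset.sum_insert hi, ih, zsign_add]

end Signs

/-- The exponent of the Koszul sign for the passage from the order given by `p` to the order given
by `q`, for elements of degrees `a`. -/
def inversionSum {ι : Type*} [Fintype ι] (p q : ι → ℕ) (a : ι → ZMod 2) : ZMod 2 :=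
  ∑ i, ∑ j, if p i < p j ∧ q j < q i then a i * a j else 0

/-- For a symmetric summand, the sum over unordered pairs does not depend on the total order used to
list each pair once. -/
theorem sum_pairs_eq {ι : Type*} [Fintype ι] {p q : ι → ℕ} (hp : Function.Injective p)
    (hq : Function.Injective q) {F : ι → ι → ZMod 2} (hF : ∀ i j, F i j = F j i) :
    (∑ i, ∑ j, if q i < q j then F i j else 0) = ∑ i, ∑ j, if p i < p j then F i j else 0 := by
  have h1 : ∀ i j, (if q i < q j then F i j else 0) =
      (if p i < p j ∧ q i < q j then F i j else 0) +
        if p j < p i ∧ q i < q j then F j i else 0 := by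
    intro i j
    by_cases hij : i = j
    · subst hij; simp
    · rcases lt_or_gt_of_ne (hp.ne hij) with h | h
      · simp [h, not_lt_of_gt h]
      · simp [h, not_lt_of_gt h, hF i j]
  have h2 : ∀ i j, (if p i < p j then F i j else 0) =
      (if p i < p j ∧ q i < q j then F i j else 0) +
        if p i < p j ∧ q j < q i then F i j else 0 := by
    intro i j
    by_cases hij : i = j
    · subst hij; simp
    · rcases lt_or_gt_of_ne (hq.ne hij) with h | h
      · simp [h, not_lt_of_gt h]
      · simp [h, not_lt_of_gt h]
  simp only [h1, h2, Finset.sum_add_distrib]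
  congr 1
  exact Finset.sum_comm

/-- A pair is reversed between `p` and `r` exactly when it is reversed in one, but not both, of the
two steps; reversals in both cancel modulo two. The second step is first rewritten as a sum over
pairs ordered by `p`. -/
theorem inversionSum_trans {ι : Type*} [Fintype ι] {p q r : ι → ℕ} (hp : Function.Injective p)
    (hq : Function.Injective q) (hr : Function.Injective r) (a : ι → ZMod 2) :
    inversionSum p r a = inversionSum p q a + inversionSum q r a := by
  let F : ι → ι → ZMod 2 := fun i j =>
    if (q i < q j ∧ r j < r i) ∨ (q j < q i ∧ r i < r j) then a i * a j else 0
  have hF : ∀ i j, F i j = F j i := by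
    intro i j
    simp only [F, mul_comm (a i), or_comm]
  have h1 : inversionSum q r a = ∑ i, ∑ j, if q i < q j then F i j else 0 := by
    refine Finset.sum_congr rfl fun i _ => Finset.sum_congr rfl fun j _ => ?_
    by_cases h : q i < q j
    · simp [F, h, not_lt_of_gt h]
    · simp [h]
  rw [h1, sum_pairs_eq hp hq hF]
  simp only [inversionSum, ← Finset.sum_add_distrib]
  refine Finset.sum_congr rfl fun i _ => Finset.sum_congr rfl fun j _ => ?_
  by_cases hij : i = j
  · subst hij; simp
  · by_cases h0 : p i < p j
    · rcases lt_or_gt_of_ne (hq.ne hij) with h | h <;> rcases lt_or_gt_of_ne (hr.ne hij) with h' | h' <;>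
        simp [F, h0, h, h', not_lt_of_gt h, not_lt_of_gt h', CharTwo.add_self_eq_zero]
    · simp [h0]

/-- The exponent of the Koszul sign of a permutation. -/
def koszulExp {n : ℕ} (σ : Perm (Fin n)) (a : Fin n → ZMod 2) : ZMod 2 :=
  inversionSum (fun i : Fin n => (i : ℕ)) (fun i => (σ i : ℕ)) a

theorem koszulExp_eq {n : ℕ} (σ : Perm (Fin n)) (a : Fin n → ZMod 2) :
    koszulExp σ a = ∑ i, ∑ j, if i < j ∧ σ j < σ i then a i * a j else 0 := rfl

/-- The cocycle property of the Koszul sign, from the three orders given by 1, τ and στ. -/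
theorem koszulExp_mul {n : ℕ} (σ τ : Perm (Fin n)) (a : Fin n → ZMod 2) :
    koszulExp (σ * τ) a = koszulExp τ a + koszulExp σ fun i => a (τ⁻¹ i) := by
  have hi : ∀ ρ : Perm (Fin n), Function.Injective fun i => (ρ i : ℕ) :=
    fun ρ => Fin.val_injective.comp ρ.injective
  have h := inversionSum_trans (hi 1) (hi τ) (hi (σ * τ)) a
  refine h.trans (congrArg _ ?_)
  symm
  rw [koszulExp_eq, inversionSum, ← Equiv.sum_comp τ]
  refine Finset.sum_congr rfl fun i _ => ?_
  rw [← Equiv.sum_comp τ]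
  simp

/-! ### Koszul signs of block permutations -/

section BlockSigns

variable {m n r : ℕ} (h : m + n = r + 1) (i : Fin m)

theorem innerInput_lt_innerInput (j j' : Fin n) :
    innerInput h i j < innerInput h i j' ↔ j < j' := by
  simp only [innerInput, Fin.lt_def]
  omega

theorem innerInput_lt_outerInput (j : Fin n) (x : Fin m) (hx : x ≠ i) :
    innerInput h i j < outerInput h i x hx ↔ i < x := by
  have h1 : (x : ℕ) ≠ i := fun e => hx (Fin.ext e)
  have := j.2
  simp only [innerInput, outerInput, Fin.lt_def]
  split_ifs <;> simp only <;> omega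

theorem outerInput_lt_innerInput (j : Fin n) (x : Fin m) (hx : x ≠ i) :
    outerInput h i x hx < innerInput h i j ↔ x < i := by
  have h1 : (x : ℕ) ≠ i := fun e => hx (Fin.ext e)
  have := j.2
  simp only [innerInput, outerInput, Fin.lt_def]
  split_ifs <;> simp only <;> omega

theorem outerInput_lt_outerInput (x x' : Fin m) (hx : x ≠ i) (hx' : x' ≠ i) :
    outerInput h i x hx < outerInput h i x' hx' ↔ x < x' := by
  have h1 : (x : ℕ) ≠ i := fun e => hx (Fin.ext e)
  have h2 : (x' : ℕ) ≠ i := fun e => hx' (Fin.ext e)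
  simp only [outerInput, Fin.lt_def]
  split_ifs <;> simp only <;> omega

/-- The inputs of a composite are those of the inner operation and those of the outer operation
other than `i`. -/
def inputEquiv : Fin n ⊕ {x : Fin m // x ≠ i} ≃ Fin r := Equiv.ofBijective
  (Sum.elim (innerInput h i) fun x => outerInput h i x.1 x.2) (by
    constructor
    · rintro (j | x) (j' | x') e
      · exact congrArg _ (DGMod.innerInput_injective h i e)
      · exact absurd e (DGMod.innerInput_ne_outerInput h i x'.1 x'.2 j)
      · exact absurd e.symm (DGMod.innerInput_ne_outerInput h i x.1 x.2 j')
      · exact congrArg _ (Subtype.ext (DGMod.outerInput_inj h i x.1 x'.1 x.2 x'.2 e))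
    · intro y
      rcases DGMod.input_cases h i y with ⟨j, rfl⟩ | ⟨x, hx, rfl⟩
      · exact ⟨Sum.inl j, rfl⟩
      · exact ⟨Sum.inr ⟨x, hx⟩, rfl⟩)

theorem sum_inputs_split {X : Type*} [AddCommMonoid X] (F : Fin r → X) :
    ∑ y, F y = ∑ j, F (innerInput h i j) +
      ∑ x : {x : Fin m // x ≠ i}, F (outerInput h i x.1 x.2) := by
  rw [← Equiv.sum_comp (inputEquiv h i), Fintype.sum_sum_type]
  rfl

theorem sum_eq_add_ne {X : Type*} [AddCommMonoid X] {m : ℕ} (i : Fin m) (F : Fin m → X) :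
    ∑ x, F x = F i + ∑ x : {x : Fin m // x ≠ i}, F x.1 :=
  Fintype.sum_eq_add_sum_subtype_ne F i

variable {h i}

/-- The Koszul signs of both sides of the equivariance law in an endomorphism operad. -/
theorem koszulExp_block {σ : Perm (Fin m)} {τ : Perm (Fin n)} {ρ : Perm (Fin r)}
    (hρ : IsBlockPerm h i σ τ ρ) (a : Fin r → ZMod 2) (q : ZMod 2) (b : Fin m → ZMod 2)
    (hi : b i = ∑ j, a (innerInput h i j) + q)
    (hb : ∀ x (hx : x ≠ i), b x = a (outerInput h i x hx)) :
    koszulExp σ b + (koszulExp τ (fun j => a (innerInput h i j)) +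
        ∑ x, if x < i then q * b x else 0) =
      koszulExp ρ a + ∑ x, if σ x < σ i then q * b x else 0 := by
  have hb' : ∀ x : {x : Fin m // x ≠ i}, b x.1 = a (outerInput h i x.1 x.2) := fun x => hb x.1 x.2
  set A := ∑ j, a (innerInput h i j) with hA
  -- The pairs of outer inputs are divided into those that involve the slot `i`, where the degree is
  -- A + q, and the others. The same division for ρ replaces the slot by the inputs of the inner
  -- operation, of total degree A.
  have e1 : koszulExp σ b = ∑ x : {x : Fin m // x ≠ i},
      (if i < x.1 ∧ σ x.1 < σ i then (A + q) * b x.1 else 0) +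
      (∑ x : {x : Fin m // x ≠ i}, (if x.1 < i ∧ σ i < σ x.1 then b x.1 * (A + q) else 0) +
      ∑ x : {x : Fin m // x ≠ i}, ∑ x' : {x : Fin m // x ≠ i},
        if x.1 < x'.1 ∧ σ x'.1 < σ x.1 then b x.1 * b x'.1 else 0) := by
    rw [koszulExp_eq, sum_eq_add_ne i]
    simp only [sum_eq_add_ne i (fun j => ite (_ < j ∧ _) _ _), lt_irrefl, false_and, if_false,
      zero_add, hi, Finset.sum_add_distrib]
  have e2 : koszulExp ρ a = (koszulExp τ (fun j => a (innerInput h i j)) +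
      ∑ x : {x : Fin m // x ≠ i}, (if i < x.1 ∧ σ x.1 < σ i then A * b x.1 else 0)) +
      (∑ x : {x : Fin m // x ≠ i}, (if x.1 < i ∧ σ i < σ x.1 then b x.1 * A else 0) +
      ∑ x : {x : Fin m // x ≠ i}, ∑ x' : {x : Fin m // x ≠ i},
        if x.1 < x'.1 ∧ σ x'.1 < σ x.1 then b x.1 * b x'.1 else 0) := by
    rw [koszulExp_eq, sum_inputs_split h i]
    simp only [sum_inputs_split h i (fun j => ite (_ < j ∧ _) _ _), hρ.1, hρ.2,
      innerInput_lt_innerInput, innerInput_lt_outerInput, outerInput_lt_innerInput,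
      outerInput_lt_outerInput, Finset.sum_add_distrib, ← hb']
    congr 2
    · rw [Finset.sum_comm]
      refine Finset.sum_congr rfl fun x _ => ?_
      split_ifs
      · rw [hA, Finset.sum_mul]
      · simp
    · refine Finset.sum_congr rfl fun x _ => ?_
      split_ifs
      · rw [hA, Finset.mul_sum]
      · simp
  rw [e1, e2, sum_eq_add_ne i fun x => if x < i then q * b x else 0,
    sum_eq_add_ne i fun x => if σ x < σ i then q * b x else 0]
  simp only [lt_irrefl, if_false, zero_add]
  -- The degree q of the inner operation passes x on exactly one side of the permutation, or on both
  -- or neither, according to whether σ reverses the order of x and i.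
  have e3 : ∀ x : {x : Fin m // x ≠ i}, (if σ x.1 < σ i then q * b x.1 else 0) =
      (if i < x.1 ∧ σ x.1 < σ i then q * b x.1 else 0) +
      (if x.1 < i ∧ σ i < σ x.1 then b x.1 * q else 0) + if x.1 < i then q * b x.1 else 0 := by
    intro x
    rcases lt_or_gt_of_ne x.2 with h | h <;>
      rcases lt_or_gt_of_ne (σ.injective.ne x.2) with h' | h' <;>
      simp [h, h', not_lt_of_gt h, not_lt_of_gt h', mul_comm q, CharTwo.add_self_eq_zero]
  have e4 : ∀ x : {x : Fin m // x ≠ i}, (if i < x.1 ∧ σ x.1 < σ i then (A + q) * b x.1 else 0) =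
      (if i < x.1 ∧ σ x.1 < σ i then A * b x.1 else 0) +
      if i < x.1 ∧ σ x.1 < σ i then q * b x.1 else 0 := by
    intro x
    split_ifs
    · ring
    · simp
  have e5 : ∀ x : {x : Fin m // x ≠ i}, (if x.1 < i ∧ σ i < σ x.1 then b x.1 * (A + q) else 0) =
      (if x.1 < i ∧ σ i < σ x.1 then b x.1 * A else 0) +
      if x.1 < i ∧ σ i < σ x.1 then b x.1 * q else 0 := by
    intro x
    split_ifs
    · ring
    · simp
  simp only [e3, e4, e5, Finset.sum_add_distrib]
  ring

end BlockSigns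

/-! ### The endomorphism operad is an operad -/

namespace DGMod

variable {k : Type u} [CommRing k] (V : DGMod.{u, w} k)

/-- Multilinear maps which agree on homogeneous elements are equal. -/
theorem multilinear_ext {n : ℕ} {f g : MultilinearMap k (fun _ : Fin n => V.carrier) V.carrier}
    (h : ∀ (a : Fin n → ℤ) (v : Fin n → V.carrier), (∀ i, v i ∈ V.gr (a i)) → f v = g v) :
    f = g := by
  -- The set `S` contains the inputs not yet known to be homogeneous; they are decomposed one at a
  -- time.
  have key : ∀ (S : Finset (Fin n)) (v : Fin n → V.carrier),
      (∀ i, i ∉ S → ∃ a, v i ∈ V.gr a) → f v = g v := by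
    intro S
    induction S using Finset.induction_on with
    | empty =>
      intro v hv
      choose a ha using fun i => hv i (by simp)
      exact h a v ha
    | insert i S hi ih =>
      intro v hv
      have : ∀ x, f (Function.update v i x) = g (Function.update v i x) := by
        intro x
        induction x using DirectSum.Decomposition.inductionOn V.gr with
        | zero => rw [f.map_update_zero, g.map_update_zero]
        | @homogeneous a x =>
          refine ih _ fun j hj => ?_
          by_cases hji : j = i
          · subst hji
            exact ⟨a, by simp⟩
          · rw [Function.update_of_ne hji]
            exact hv j (by simp [hji, hj])
        | add x y hx hy => rw [f.map_update_add, g.map_update_add, hx, hy]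
      simpa using this (v i)
  ext v
  exact key Finset.univ v (by simp)

theorem linear_ext {f g : V.carrier →ₗ[k] V.carrier} (h : ∀ a, ∀ x ∈ V.gr a, f x = g x) :
    f = g := by
  ext x
  induction x using DirectSum.Decomposition.inductionOn V.gr with
  | zero => simp
  | @homogeneous a x => exact h a x x.2
  | add x y hx hy => simp [hx, hy]

theorem signMap_apply (q : ℤ) {a : ℤ} {x : V.carrier} (hx : x ∈ V.gr a) :
    V.signMap q x = zsign k ((q : ZMod 2) * a) • x := by
  rw [signMap, V.scale_apply _ hx, ksign_eq_zsign]
  push_cast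
  rfl

theorem signMap_add (q r : ℤ) (x : V.carrier) :
    V.signMap (q + r) x = V.signMap q (V.signMap r x) := by
  have : V.signMap (q + r) = V.signMap q ∘ₗ V.signMap r := by
    refine V.linear_ext fun a x hx => ?_
    rw [LinearMap.comp_apply, V.signMap_apply _ hx, V.signMap_apply r hx, map_smul,
      V.signMap_apply q hx, smul_smul, ← zsign_add]
    push_cast
    ring_nf
  rw [this]
  rfl

theorem signMap_zero (x : V.carrier) : V.signMap 0 x = x := by
  have : V.signMap 0 = LinearMap.id := by
    refine V.linear_ext fun a x hx => ?_
    rw [V.signMap_apply _ hx]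
    simp [zsign_zero]
  rw [this]
  rfl

theorem signMap_neg_one : V.signMap (-1) = V.signMap 1 := by
  refine V.linear_ext fun a x hx => ?_
  rw [V.signMap_apply _ hx, V.signMap_apply _ hx]
  have : ((-1 : ℤ) : ZMod 2) = ((1 : ℤ) : ZMod 2) := by decide
  rw [this]

/-- Passing a sign operator through a multilinear map. -/
theorem signMap_multi (r : ℤ) {n : ℕ} {q : ℤ}
    {f : MultilinearMap k (fun _ : Fin n => V.carrier) V.carrier} (hf : f ∈ V.multi n q)
    (v : Fin n → V.carrier) :
    f (fun j => V.signMap r (v j)) = ksign k (q * r) • V.signMap r (f v) := by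
  have : f.compLinearMap (fun _ => V.signMap r) =
      ksign k (q * r) • (V.signMap r).compMultilinearMap f := by
    refine V.multilinear_ext fun a v hv => ?_
    simp only [MultilinearMap.compLinearMap_apply, smul_apply,
      LinearMap.compMultilinearMap_apply]
    simp only [fun j => V.signMap_apply r (hv j)]
    rw [f.map_smul_univ, zsign_sum, V.signMap_apply r (hf a v hv), smul_smul, ksign_eq_zsign,
      ← zsign_add]
    congr 2
    push_cast
    rw [mul_add, ← Finset.mul_sum]
    have h2 : (2 : ZMod 2) = 0 := by decide
    -- The output degree contributes a second qr, which cancels the first modulo two.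
    linear_combination -(q : ZMod 2) * r * h2
  exact congrArg (fun g => g v) this

theorem permute_apply_zsign {n : ℕ} (σ : Perm (Fin n))
    (f : MultilinearMap k (fun _ : Fin n => V.carrier) V.carrier) {a : Fin n → ℤ}
    {v : Fin n → V.carrier} (hv : ∀ i, v i ∈ V.gr (a i)) :
    V.permute σ f v = zsign k (koszulExp σ fun i => (a i : ZMod 2)) • f fun i => v (σ⁻¹ i) := by
  rw [V.permute_apply σ f a v hv, koszulExp_eq, ← zsign_sum]
  congr 1
  refine Finset.prod_congr rfl fun i _ => ?_
  rw [← zsign_sum]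
  refine Finset.prod_congr rfl fun j _ => ?_
  split_ifs
  · rw [ksign_eq_zsign]
    push_cast
    rfl
  · rw [zsign_zero]

theorem permute_mul {n : ℕ} (σ τ : Perm (Fin n))
    (f : MultilinearMap k (fun _ : Fin n => V.carrier) V.carrier) :
    V.permute (σ * τ) f = V.permute τ (V.permute σ f) := by
  refine V.multilinear_ext fun a v hv => ?_
  rw [V.permute_apply_zsign _ _ hv, V.permute_apply_zsign _ _ hv,
    V.permute_apply_zsign σ f (a := fun i => a (τ⁻¹ i)) (fun i => hv _), smul_smul, ← zsign_add,
    koszulExp_mul]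
  rfl

theorem permute_one {n : ℕ} (f : MultilinearMap k (fun _ : Fin n => V.carrier) V.carrier) :
    V.permute 1 f = f := by
  refine V.multilinear_ext fun a v hv => ?_
  have : koszulExp (1 : Perm (Fin n)) (fun i => (a i : ZMod 2)) = 0 := by
    rw [koszulExp_eq]
    refine Finset.sum_eq_zero fun i _ => Finset.sum_eq_zero fun j _ => if_neg ?_
    simp only [Perm.one_apply, not_and, not_lt]
    exact fun h => h.le
  rw [V.permute_apply_zsign _ _ hv, this, zsign_zero, one_smul]
  rfl

theorem insertArg_self {m n r : ℕ} (h : m + n = r + 1) (i : Fin m) (q : ℤ)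
    (g : MultilinearMap k (fun _ : Fin n => V.carrier) V.carrier) (v : Fin r → V.carrier) :
    V.insertArg h i q g v i = g fun j => v (innerInput h i j) := dif_pos rfl

theorem insertArg_lt {m n r : ℕ} (h : m + n = r + 1) (i : Fin m) (q : ℤ)
    (g : MultilinearMap k (fun _ : Fin n => V.carrier) V.carrier) (v : Fin r → V.carrier)
    {x : Fin m} (hx : x < i) :
    V.insertArg h i q g v x = V.signMap q (v (outerInput h i x hx.ne)) := by
  rw [insertArg, dif_neg hx.ne, if_pos hx]

theorem insertArg_gt {m n r : ℕ} (h : m + n = r + 1) (i : Fin m) (q : ℤ)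
    (g : MultilinearMap k (fun _ : Fin n => V.carrier) V.carrier) (v : Fin r → V.carrier)
    {x : Fin m} (hx : i < x) :
    V.insertArg h i q g v x = v (outerInput h i x hx.ne') := by
  rw [insertArg, dif_neg hx.ne', if_neg (not_lt_of_gt hx)]

theorem insertAt_apply {m n r : ℕ} (h : m + n = r + 1) (i : Fin m) (q : ℤ)
    (f : MultilinearMap k (fun _ : Fin m => V.carrier) V.carrier)
    (g : MultilinearMap k (fun _ : Fin n => V.carrier) V.carrier) (v : Fin r → V.carrier) :
    V.insertAt h i q f g v = f (V.insertArg h i q g v) := rfl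

/-- On homogeneous inputs both sides are signed values of `f` on the same reordered arguments `w`.
The signs come from the two permutations and from moving `g` past the inputs on its left; their
agreement is `koszulExp_block`. -/
theorem insertAt_permute {m n r : ℕ} (h : m + n = r + 1) (i : Fin m) {q : ℤ}
    {σ : Perm (Fin m)} {τ : Perm (Fin n)} {ρ : Perm (Fin r)} (hρ : IsBlockPerm h i σ τ ρ)
    {f : MultilinearMap k (fun _ : Fin m => V.carrier) V.carrier}
    {g : MultilinearMap k (fun _ : Fin n => V.carrier) V.carrier} (hg : g ∈ V.multi n q) :
    V.insertAt h i q (V.permute σ f) (V.permute τ g) =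
      V.permute ρ (V.insertAt h (σ i) q f g) := by
  refine V.multilinear_ext fun a v hv => ?_
  -- The degrees of the arguments of the outer operation: the slot `i` receives the output degree of
  -- `g`.
  let b : Fin m → ℤ := fun x => if hx : x = i then ∑ j, a (innerInput h i j) + q
    else a (outerInput h i x hx)
  have hbi : b i = ∑ j, a (innerInput h i j) + q := dif_pos rfl
  have hbo : ∀ x (hx : x ≠ i), b x = a (outerInput h i x hx) := fun x hx => dif_neg hx
  have hb : ∀ x, V.insertArg h i q (V.permute τ g) v x ∈ V.gr (b x) := by
    intro x
    rcases lt_trichotomy x i with hx | rfl | hx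
    · rw [V.insertArg_lt _ _ _ _ _ hx, hbo x hx.ne]
      exact V.scale_mem _ (hv _)
    · rw [V.insertArg_self, hbi]
      exact V.permute_mem τ hg _ _ fun j => hv _
    · rw [V.insertArg_gt _ _ _ _ _ hx, hbo x hx.ne']
      exact hv _
  rw [V.insertAt_apply, V.permute_apply_zsign σ f hb, V.permute_apply_zsign ρ _ hv,
    V.insertAt_apply]
  have hin : ∀ j, v (ρ⁻¹ (innerInput h (σ i) j)) = v (innerInput h i (τ⁻¹ j)) := by
    intro j
    congr 1
    rw [Perm.inv_eq_iff_eq, hρ.1]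
    simp
  have hout : ∀ x (hx : x ≠ i), ρ⁻¹ (outerInput h (σ i) (σ x) (σ.injective.ne hx)) =
      outerInput h i x hx := by
    intro x hx
    rw [Perm.inv_eq_iff_eq, hρ.2]
  have hσ : ∀ x, σ⁻¹ (σ x) = x := fun x => by simp
  let w : Fin m → V.carrier := fun x => if hx : x = i then g fun j => v (innerInput h i (τ⁻¹ j))
    else v (outerInput h i x hx)
  have hwi : w i = g fun j => v (innerInput h i (τ⁻¹ j)) := dif_pos rfl
  have hwo : ∀ x (hx : x ≠ i), w x = v (outerInput h i x hx) := fun x hx => dif_neg hx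
  have hL : (fun y => V.insertArg h i q (V.permute τ g) v (σ⁻¹ y)) = fun y =>
      zsign k (if σ⁻¹ y = i then koszulExp τ (fun j => (a (innerInput h i j) : ZMod 2))
        else if σ⁻¹ y < i then (q : ZMod 2) * b (σ⁻¹ y) else 0) • w (σ⁻¹ y) := by
    funext y
    generalize σ⁻¹ y = x
    rcases lt_trichotomy x i with hx | rfl | hx
    · rw [V.insertArg_lt _ _ _ _ _ hx, if_neg hx.ne, if_pos hx, hwo x hx.ne, hbo x hx.ne,
        V.signMap_apply _ (hv _)]
    · rw [V.insertArg_self, if_pos rfl, hwi,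
        V.permute_apply_zsign τ g (a := fun j => a (innerInput h x j)) fun j => hv _]
    · rw [V.insertArg_gt _ _ _ _ _ hx, if_neg hx.ne', if_neg (not_lt_of_gt hx), hwo x hx.ne',
        zsign_zero, one_smul]
  have hR : V.insertArg h (σ i) q g (fun y => v (ρ⁻¹ y)) = fun y =>
      zsign k (if σ (σ⁻¹ y) < σ i then (q : ZMod 2) * b (σ⁻¹ y) else 0) • w (σ⁻¹ y) := by
    funext y
    obtain ⟨x, rfl⟩ := σ.surjective y
    rw [hσ]
    by_cases hxi : x = i
    · subst hxi
      rw [V.insertArg_self, if_neg (lt_irrefl _), zsign_zero, one_smul, hwi]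
      simp only [hin]
    · rw [hwo x hxi, hbo x hxi]
      rcases lt_or_gt_of_ne (σ.injective.ne hxi) with hx | hx
      · rw [V.insertArg_lt _ _ _ _ _ hx, if_pos hx, hout x hxi, V.signMap_apply _ (hv _)]
      · rw [V.insertArg_gt _ _ _ _ _ hx, if_neg (not_lt_of_gt hx), hout x hxi, zsign_zero,
          one_smul]
  rw [hL, hR, f.map_smul_univ, f.map_smul_univ, zsign_sum, zsign_sum, smul_smul, smul_smul,
    ← zsign_add, ← zsign_add]
  congr 2
  rw [← Equiv.sum_comp σ, ← Equiv.sum_comp σ (fun y => if σ (σ⁻¹ y) < σ i then _ else _)]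
  simp only [hσ]
  have key := koszulExp_block hρ (fun y => (a y : ZMod 2)) q (fun x => (b x : ZMod 2))
    (by rw [hbi]; push_cast; rfl) (fun x hx => by rw [hbo x hx])
  rw [← key, sum_eq_add_ne i, sum_eq_add_ne i fun x => if x < i then _ else _]
  simp only [lt_irrefl, if_false, if_true, zero_add]
  congr 2
  refine Finset.sum_congr rfl fun x _ => ?_
  rw [if_neg x.2]

end DGMod

section InputValues

variable {m n r : ℕ} (h : m + n = r + 1) (i : Fin m)

theorem outerInput_val_lt {x : Fin m} (hx : x ≠ i) (hlt : x < i) :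
    (outerInput h i x hx : ℕ) = x := by
  rw [outerInput, dif_pos hlt]

theorem outerInput_val_gt {x : Fin m} (hx : x ≠ i) (hlt : i < x) :
    (outerInput h i x hx : ℕ) = x + n - 1 := by
  rw [outerInput, dif_neg (not_lt_of_gt hlt)]

theorem innerInput_val (j : Fin n) : (innerInput h i j : ℕ) = i + j := rfl

end InputValues

namespace DGMod

variable {k : Type u} [CommRing k] (V : DGMod.{u, w} k)

theorem insertArg_of_val_eq {m n r : ℕ} (h : m + n = r + 1) (i : Fin m) (q : ℤ)
    (g : MultilinearMap k (fun _ : Fin n => V.carrier) V.carrier) (v : Fin r → V.carrier)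
    {x : Fin m} (hx : (x : ℕ) = i) :
    V.insertArg h i q g v x = g fun j => v (innerInput h i j) := by
  obtain rfl := Fin.ext hx
  exact V.insertArg_self h x q g v

/-- Inputs to the left of `i` are passed by both `g` and ξ, hence by total degree q + r; inputs of
`g` to the left of `j` are passed by ξ only. All other arguments agree without sign. -/
theorem insertAt_insertAt_seq {m n l a b c : ℕ} {q r t : ℤ}
    (h₁ : m + n = a + 1) (h₂ : a + l = c + 1) (h₃ : n + l = b + 1) (h₄ : m + b = c + 1)
    (e₃ : q + r = t) (i : Fin m) (j : Fin n) (y : Fin a) (hy : (y : ℕ) = i + j)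
    (f : MultilinearMap k (fun _ : Fin m => V.carrier) V.carrier)
    (g : MultilinearMap k (fun _ : Fin n => V.carrier) V.carrier)
    (ξ : MultilinearMap k (fun _ : Fin l => V.carrier) V.carrier) :
    V.insertAt h₂ y r (V.insertAt h₁ i q f g) ξ =
      V.insertAt h₄ i t f (V.insertAt h₃ j r g ξ) := by
  ext v
  rw [V.insertAt_apply, V.insertAt_apply, V.insertAt_apply]
  congr 1
  funext x
  have hj := j.2
  rcases lt_trichotomy x i with hx | rfl | hx
  · have hx' : (x : ℕ) < i := hx
    have e1 := outerInput_val_lt h₁ i hx.ne hx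
    have h1 : outerInput h₁ i x hx.ne < y := Fin.lt_def.2 (by omega)
    rw [V.insertArg_lt _ _ _ _ _ hx, V.insertArg_lt _ _ _ _ _ hx, V.insertArg_lt _ _ _ _ _ h1,
      ← e₃, signMap_add]
    congr 3
    ext
    rw [outerInput_val_lt h₂ y h1.ne h1, outerInput_val_lt h₄ i hx.ne hx, e1]
  · rw [V.insertArg_self, V.insertArg_self, V.insertAt_apply]
    congr 1
    funext j'
    have e1 := innerInput_val h₁ x j'
    rcases lt_trichotomy j' j with hx | rfl | hx
    · have hx' : (j' : ℕ) < j := hx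
      have h1 : innerInput h₁ x j' < y := Fin.lt_def.2 (by omega)
      rw [V.insertArg_lt _ _ _ _ _ h1, V.insertArg_lt _ _ _ _ _ hx]
      congr 2
      ext
      rw [outerInput_val_lt h₂ y h1.ne h1, innerInput_val, innerInput_val,
        outerInput_val_lt h₃ j hx.ne hx]
    · rw [V.insertArg_of_val_eq _ _ _ _ _ (x := innerInput h₁ x j') (by omega), V.insertArg_self]
      congr 1
      funext l'
      congr 1
      ext
      simp only [innerInput_val]
      omega
    · have hx' : (j : ℕ) < j' := hx
      have h1 : y < innerInput h₁ x j' := Fin.lt_def.2 (by omega)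
      rw [V.insertArg_gt _ _ _ _ _ h1, V.insertArg_gt _ _ _ _ _ hx]
      congr 1
      ext
      rw [outerInput_val_gt h₂ y h1.ne' h1, innerInput_val, innerInput_val,
        outerInput_val_gt h₃ j hx.ne' hx]
      omega
  · have hx' : (i : ℕ) < x := hx
    have e1 := outerInput_val_gt h₁ i hx.ne' hx
    have h1 : y < outerInput h₁ i x hx.ne' := Fin.lt_def.2 (by omega)
    rw [V.insertArg_gt _ _ _ _ _ hx, V.insertArg_gt _ _ _ _ _ hx, V.insertArg_gt _ _ _ _ _ h1]
    congr 1
    ext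
    rw [outerInput_val_gt h₂ y h1.ne' h1, outerInput_val_gt h₄ i hx.ne' hx, e1]
    omega

/-- The arguments of `f` differ only in slot `i`: on one side the sign operator for ξ is applied to
the inputs of `g`, on the other side to its output. By `signMap_multi` the difference is (-1)^(qr).
-/
theorem insertAt_insertAt_par {m n l a b c : ℕ} {q r : ℤ}
    (h₁ : m + n = a + 1) (h₂ : a + l = c + 1) (h₃ : m + l = b + 1) (h₄ : b + n = c + 1)
    (i j : Fin m) (hij : i < j) (y : Fin a) (hy : (y : ℕ) + 1 = j + n) (x : Fin b)
    (hx : (x : ℕ) = i)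
    (f : MultilinearMap k (fun _ : Fin m => V.carrier) V.carrier)
    {g : MultilinearMap k (fun _ : Fin n => V.carrier) V.carrier} (hg : g ∈ V.multi n q)
    (ξ : MultilinearMap k (fun _ : Fin l => V.carrier) V.carrier) :
    V.insertAt h₂ y r (V.insertAt h₁ i q f g) ξ =
      ksign k (q * r) • V.insertAt h₄ x q (V.insertAt h₃ j r f ξ) g := by
  ext v
  rw [smul_apply, V.insertAt_apply, V.insertAt_apply, V.insertAt_apply, V.insertAt_apply]
  have hij' : (i : ℕ) < j := hij
  have key : V.insertArg h₁ i q g (V.insertArg h₂ y r ξ v) =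
      Function.update (V.insertArg h₃ j r ξ (V.insertArg h₄ x q g v)) i
        (ksign k (q * r) • V.insertArg h₃ j r ξ (V.insertArg h₄ x q g v) i) := by
    funext z
    by_cases hzi : z = i
    · subst hzi
      rw [Function.update_self, V.insertArg_self, V.insertArg_lt _ _ _ _ _ hij,
        V.insertArg_of_val_eq _ _ _ _ _ (by rw [outerInput_val_lt h₃ j hij.ne hij, hx]),
        ← V.signMap_multi r hg]
      congr 1
      funext j'
      have hj' := j'.2
      have e1 := innerInput_val h₁ z j'
      have h1 : innerInput h₁ z j' < y := Fin.lt_def.2 (by omega)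
      rw [V.insertArg_lt _ _ _ _ _ h1]
      congr 2
      ext
      rw [outerInput_val_lt h₂ y h1.ne h1, innerInput_val, innerInput_val, hx]
    · rw [Function.update_of_ne hzi]
      rcases lt_or_gt_of_ne hzi with hz | hz
      · have hz' : (z : ℕ) < i := hz
        have hzj : z < j := hz.trans hij
        have e1 := outerInput_val_lt h₁ i hz.ne hz
        have e2 := outerInput_val_lt h₃ j hzj.ne hzj
        have h1 : outerInput h₁ i z hz.ne < y := Fin.lt_def.2 (by omega)
        have h2 : outerInput h₃ j z hzj.ne < x := Fin.lt_def.2 (by omega)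
        rw [V.insertArg_lt _ _ _ _ _ hz, V.insertArg_lt _ _ _ _ _ h1, V.insertArg_lt _ _ _ _ _ hzj,
          V.insertArg_lt _ _ _ _ _ h2, ← signMap_add, ← signMap_add, add_comm]
        congr 2
        ext
        rw [outerInput_val_lt h₂ y h1.ne h1, outerInput_val_lt h₄ x h2.ne h2, e1, e2]
      · have hz' : (i : ℕ) < z := hz
        have e1 := outerInput_val_gt h₁ i hz.ne' hz
        rw [V.insertArg_gt _ _ _ _ _ hz]
        rcases lt_trichotomy z j with hzj | rfl | hzj
        · have hzj' : (z : ℕ) < j := hzj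
          have e2 := outerInput_val_lt h₃ j hzj.ne hzj
          have h1 : outerInput h₁ i z hz.ne' < y := Fin.lt_def.2 (by omega)
          have h2 : x < outerInput h₃ j z hzj.ne := Fin.lt_def.2 (by omega)
          rw [V.insertArg_lt _ _ _ _ _ h1, V.insertArg_lt _ _ _ _ _ hzj,
            V.insertArg_gt _ _ _ _ _ h2]
          congr 2
          ext
          rw [outerInput_val_lt h₂ y h1.ne h1, outerInput_val_gt h₄ x h2.ne' h2, e1, e2]
        · rw [V.insertArg_of_val_eq _ _ _ _ _ (by omega), V.insertArg_self]
          congr 1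
          funext l'
          have e2 := innerInput_val h₃ z l'
          have h2 : x < innerInput h₃ z l' := Fin.lt_def.2 (by omega)
          rw [V.insertArg_gt _ _ _ _ _ h2]
          congr 1
          ext
          rw [outerInput_val_gt h₄ x h2.ne' h2, innerInput_val, innerInput_val]
          omega
        · have hzj' : (j : ℕ) < z := hzj
          have e2 := outerInput_val_gt h₃ j hzj.ne' hzj
          have h1 : y < outerInput h₁ i z hz.ne' := Fin.lt_def.2 (by omega)
          have h2 : x < outerInput h₃ j z hzj.ne' := Fin.lt_def.2 (by omega)
          rw [V.insertArg_gt _ _ _ _ _ h1, V.insertArg_gt _ _ _ _ _ hzj,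
            V.insertArg_gt _ _ _ _ _ h2]
          congr 1
          ext
          rw [outerInput_val_gt h₂ y h1.ne' h1, outerInput_val_gt h₄ x h2.ne' h2, e1, e2]
          omega
  rw [key, f.map_update_smul, Function.update_eq_self]

theorem endOperad_isOperad : IsOperad V.endOperad where
  act_one x := Subtype.ext (V.permute_one x.1)
  act_mul σ τ x := Subtype.ext (V.permute_mul σ τ x.1)
  one_comp {n p} h h' i x := by
    refine Subtype.ext (MultilinearMap.ext fun v => ?_)
    obtain rfl : i = 0 := Subsingleton.elim _ _
    change V.insertArg h 0 p x.1 v 0 = x.1 v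
    rw [V.insertArg_self]
    congr 1
    funext j
    congr 1
    ext
    simp [innerInput]
  comp_one {n p} h h' i x := by
    refine Subtype.ext (MultilinearMap.ext fun v => ?_)
    change x.1 (V.insertArg h i 0 _ v) = x.1 v
    congr 1
    funext y
    rcases lt_trichotomy y i with hy | rfl | hy
    · rw [V.insertArg_lt _ _ _ _ _ hy, signMap_zero]
      congr 1
      ext
      rw [outerInput_val_lt h i hy.ne hy]
    · rw [V.insertArg_self]
      change v (innerInput h y 0) = v y
      congr 1
    · rw [V.insertArg_gt _ _ _ _ _ hy]
      congr 1
      ext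
      rw [outerInput_val_gt h i hy.ne' hy]
      omega
  assoc_seq h₁ h₂ h₃ h₄ e₁ e₂ e₃ e₄ i j y hy μ ν ξ :=
    Subtype.ext (V.insertAt_insertAt_seq h₁ h₂ h₃ h₄ e₃ i j y hy μ.1 ν.1 ξ.1)
  assoc_par h₁ h₂ h₃ h₄ e₁ e₂ e₃ e₄ i j hij y hy x hx μ ν ξ :=
    Subtype.ext (V.insertAt_insertAt_par h₁ h₂ h₃ h₄ i j hij y hy x hx μ.1 ν.2 ξ.1)
  equivariant h e i σ τ ρ hρ μ ν := Subtype.ext (V.insertAt_permute h i hρ ν.2)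

end DGMod

/-! ### The differential of the endomorphism operad -/

theorem innerInput_unary {n : ℕ} (h : n + 1 = n + 1) (i : Fin n) (j : Fin 1) :
    innerInput h i j = i := by
  ext
  simp [innerInput_val]

theorem outerInput_unary {n : ℕ} (h : n + 1 = n + 1) (i x : Fin n) (hx : x ≠ i) :
    outerInput h i x hx = x := by
  ext
  rcases lt_or_gt_of_ne hx with h' | h'
  · rw [outerInput_val_lt h i hx h']
  · rw [outerInput_val_gt h i hx h']
    omega

/-! ### Commutators with a unary operation -/

section Commutator

variable {k : Type u} [CommRing k] {P : PreDGOperad.{u, v} k}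

/-- The commutator with a unary operation of degree `-1` is a derivation. -/
theorem hasDerivation_of_commutator (hP : IsOperad P) (δ : P.carrier 1 (-1))
    (hd : ∀ {n : ℕ} {p q : ℤ} (h : q + 1 = p) (x : P.carrier n p),
      P.d h x = P.comp (show 1 + n = n + 1 by omega) (show -1 + p = q by omega) 0 δ x -
        ksign k p • ∑ i, P.comp (show n + 1 = n + 1 from rfl) (show p + -1 = q by omega) i x δ) :
    HasDerivation P where
  toIsOperad := hP
  d_act {n p q} h σ x := by
    have b1 : IsBlockPerm (show 1 + n = n + 1 by omega) 0 1 σ σ := by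
      have hin : ∀ j : Fin n, innerInput (show 1 + n = n + 1 by omega) (0 : Fin 1) j = j := by
        intro j
        ext
        simp [innerInput_val]
      refine ⟨fun j => ?_, fun x hx => absurd (Subsingleton.elim _ _) hx⟩
      rw [Perm.one_apply, hin, hin]
    have b2 : ∀ i, IsBlockPerm (show n + 1 = n + 1 from rfl) i σ 1 σ := fun i =>
      ⟨fun j => by rw [innerInput_unary, innerInput_unary],
        fun x hx => by rw [outerInput_unary, outerInput_unary]⟩
    have e1 := hP.equivariant _ (show -1 + p = q by omega) 0 1 σ σ b1 δ x
    rw [hP.act_one] at e1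
    have e2 := fun i => hP.equivariant _ (show p + -1 = q by omega) i σ 1 σ (b2 i) x δ
    simp only [hP.act_one] at e2
    rw [hd, hd, e1, map_sub, map_smul, map_sum]
    simp only [e2]
    rw [Equiv.sum_comp σ fun i => P.act σ (P.comp _ _ i x δ)]
    rfl
  d_one {q} h := by
    obtain rfl : q = -1 := by omega
    rw [hd, hP.comp_one, ksign_zero, one_smul, Fin.sum_univ_one,
      hP.one_comp (show 1 + 1 = 1 + 1 from rfl) (show (0 : ℤ) + -1 = -1 by omega), sub_self]
  d_comp {m n r p q s p' q' s'} h e ep eq es e₁ e₂ i μ ν := by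
    have a1 := hP.assoc_seq (show 1 + m = m + 1 by omega) h h (show 1 + r = r + 1 by omega)
      (show -1 + p = p' by omega) e₁ e (show -1 + s = s' by omega) 0 i i (by simp) δ μ ν
    -- The sum over all inputs of μ ∘_i ν splits: δ at an input of ν contributes to ∂ν, and δ at
    -- another input of μ contributes to ∂μ with the sign of passing ν.
    have a2 : ∀ j, P.comp (show r + 1 = r + 1 from rfl) (show s + -1 = s' by omega)
        (innerInput h i j) (P.comp h e i μ ν) δ = P.comp h e₂ i μ
          (P.comp (show n + 1 = n + 1 from rfl) (show q + -1 = q' by omega) j ν δ) := fun j =>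
      hP.assoc_seq h rfl rfl h e (by omega) (by omega) e₂ i j _ rfl μ ν δ
    have a3 : ∀ x : {x : Fin m // x ≠ i},
        P.comp (show r + 1 = r + 1 from rfl) (show s + -1 = s' by omega)
          (outerInput h i x.1 x.2) (P.comp h e i μ ν) δ = ksign k q • P.comp h e₁ i
          (P.comp (show m + 1 = m + 1 from rfl) (show p + -1 = p' by omega) x.1 μ δ) ν := by
      rintro ⟨x, hx⟩
      rcases lt_or_gt_of_ne hx with h' | h'
      · have := hP.assoc_par (show m + 1 = m + 1 from rfl) h h (show r + 1 = r + 1 from rfl)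
          (show p + -1 = p' by omega) e₁ e (show s + -1 = s' by omega) x i h' i rfl
          (outerInput h i x hx) (outerInput_val_lt h i hx h') μ δ ν
        rw [this, neg_one_mul, ksign_neg, ksign_smul_smul]
      · have := hP.assoc_par h (show r + 1 = r + 1 from rfl) (show m + 1 = m + 1 from rfl) h e
          (show s + -1 = s' by omega) (show p + -1 = p' by omega) e₁ i x h' (outerInput h i x hx)
          (by rw [outerInput_val_gt h i hx h']; have := x.2; omega) i rfl μ ν δ
        rw [this, mul_neg_one, ksign_neg]
    -- The term with δ between μ and ν occurs in ∂μ ∘ ν and in (-1)^|μ| μ ∘ ∂ν with opposite signs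
    -- and cancels.
    have a4 := hP.assoc_seq (show m + 1 = m + 1 from rfl) h (show 1 + n = n + 1 by omega) h
      (show p + -1 = p' by omega) e₁ (show -1 + q = q' by omega) e₂ i 0 i (by simp) μ δ ν
    rw [hd es, hd ep, hd eq, ← a1, sum_inputs_split h i]
    simp only [a2, a3]
    rw [sum_eq_add_ne i fun x => P.comp _ _ x μ δ]
    simp only [map_sub, map_smul, map_add, map_sum, LinearMap.sub_apply, LinearMap.smul_apply,
      LinearMap.add_apply, LinearMap.sum_apply, a4]
    have hs : ksign k s = ksign k p * ksign k q := by rw [← e, ksign_add]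
    rw [← Finset.smul_sum, hs]
    simp only [smul_sub, smul_add, smul_smul]
    rw [mul_assoc (ksign k p), ksign_mul_self, mul_one]
    abel

end Commutator

namespace DGMod

variable {k : Type u} [CommRing k] (V : DGMod.{u, w} k)

/-- The differential of `V` as a unary operation. -/
def dUnary : V.endOperad.carrier 1 (-1) :=
  ⟨MultilinearMap.ofSubsingleton k V.carrier V.carrier (0 : Fin 1) V.d, by
    intro a v hv
    simpa [← sub_eq_add_neg] using V.d_mem _ _ (hv 0)⟩

/-- The differential is the commutator with the differential of `V` as a unary operation; the sign
for passing an operation of degree -1 is the same as for degree 1. -/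
theorem endOperad_hasDerivation : HasDerivation V.endOperad := by
  refine hasDerivation_of_commutator V.endOperad_isOperad V.dUnary fun {n p q} h x => ?_
  refine Subtype.ext (MultilinearMap.ext fun v => ?_)
  have e1 : ∀ (h' : 1 + n = n + 1) , V.insertArg h' 0 p x.1 v 0 = x.1 v := by
    intro h'
    rw [V.insertArg_self]
    congr 1
    funext j
    congr 1
    ext
    simp [innerInput_val]
  have e2 : ∀ i, V.insertArg (show n + 1 = n + 1 from rfl) i (-1) V.dUnary.1 v =
      fun y => (if y < i then V.signMap 1 else if y = i then V.d else LinearMap.id) (v y) := by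
    intro i
    funext y
    rcases lt_trichotomy y i with hy | rfl | hy
    · rw [V.insertArg_lt _ _ _ _ _ hy, if_pos hy, signMap_neg_one, outerInput_unary]
    · rw [V.insertArg_self, if_neg (lt_irrefl _), if_pos rfl]
      change V.d (v (innerInput _ y 0)) = _
      rw [innerInput_unary]
    · rw [V.insertArg_gt _ _ _ _ _ hy, if_neg (not_lt_of_gt hy), if_neg hy.ne', outerInput_unary]
      rfl
  have gen : ∀ (F : Fin n → V.multi n q) (c : k),
      ((c • ∑ i, F i : V.multi n q) : MultilinearMap k (fun _ : Fin n => V.carrier) V.carrier) v =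
        c • ∑ i, (F i).1 v := by
    intro F c
    rw [Submodule.coe_smul, Submodule.coe_sum, smul_apply, sum_apply]
  have e3 := gen (fun i => V.endOperad.comp rfl (show p + -1 = q by omega) i x V.dUnary) (ksign k p)
  refine Eq.trans ?_ (congrArg₂ (fun y z => V.d y - z) (e1 (by omega)).symm e3.symm)
  change _ = V.d (x.1 v) - ksign k p • ∑ i : Fin n, x.1 (V.insertArg rfl i (-1) V.dUnary.1 v)
  simp only [e2]
  change (V.d.compMultilinearMap x.1 - ksign k p • ∑ i : Fin n, x.1.compLinearMap fun y =>
    if y < i then V.signMap 1 else if y = i then V.d else LinearMap.id) v = _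
  rw [sub_apply, smul_apply, sum_apply]
  rfl

/-- On a three-term complex there are no operations of degree at least three. -/
theorem endOperad_eq_zero (hV : V.IsThreeTerm) {n : ℕ} {p : ℤ} (hp : 3 ≤ p)
    (x : V.endOperad.carrier n p) : x = 0 := by
  refine Subtype.ext (V.multilinear_ext fun a v hv => ?_)
  change x.1 v = 0
  -- Inputs of nonnegative degree give an output of degree at least three, which vanishes; an input
  -- of negative degree is itself zero.
  by_cases ha : ∀ i, 0 ≤ a i
  · have h := x.2 a v hv
    have hs : 0 ≤ ∑ i, a i := Finset.sum_nonneg fun i _ => ha i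
    rw [hV _ (by omega) (by omega) (by omega)] at h
    exact (Submodule.mem_bot k).1 h
  · push Not at ha
    obtain ⟨i, hi⟩ := ha
    have h := hv i
    rw [hV _ (by omega) (by omega) (by omega)] at h
    exact x.1.map_coord_zero i ((Submodule.mem_bot k).1 h)

end DGMod

/-! ### Skew-symmetrization of weak Lie 3-algebras -/

theorem DGOperadHom.ext {k : Type u} [CommRing k] {P : PreDGOperad.{u, v} k}
    {Q : PreDGOperad.{u, w} k} {f g : DGOperadHom P Q}
    (h : ∀ {n : ℕ} {p : ℤ} (x : P.carrier n p), f.toFun x = g.toFun x) : f = g := by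
  obtain ⟨⟨f, _, _, _⟩, _⟩ := f
  obtain ⟨⟨g, _, _, _⟩, _⟩ := g
  have : @f = @g := by
    funext n p
    exact LinearMap.ext fun x => h x
  subst this
  rfl

section WeakLie3

variable {k : Type u} [CommRing k] {V : DGMod.{u, w} k}

theorem WeakLie3Structure.isModel (g : WeakLie3Structure V) :
    IsModel V.endOperad (fun a => g.toFun (lamVal k a)) 5 := by
  intro a ha
  rw [← g.isDG, lamVal_isModel k a ha, map_lcAt]

/-- The operation whose boundary is -6912 J_5 has degree three and so vanishes on a three-term
complex; 6912 is then cancelled. -/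
theorem jacobiator_skewFamily_five (hV : V.IsThreeTerm) {t : k} (ht : 48 * t = 1)
    {val : ∀ a : Lam, V.endOperad.carrier (a.exc + 1) a.deg} (hv : IsModel V.endOperad val 5) :
    jacobiator V.endOperad (skewFamily V.endOperad val t) 5 (r := 2) rfl = 0 := by
  have h := smul_jacobiator_skewFamily_five V.endOperad_hasDerivation hv ht
  rw [V.endOperad_eq_zero hV le_rfl (altBelow _ 4 _), map_zero, neg_zero] at h
  -- The inverse of 6912, because 48³ = 16 · 6912.
  have e : t * t * (16 * t) * 6912 = 1 := by
    linear_combination (2304 * t * t + 48 * t + 1) * ht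
  have := congrArg (fun y => (t * t * (16 * t)) • y) h
  simpa only [smul_smul, e, one_smul, smul_zero] using this

/-- The `L_∞`-algebra obtained from a weak Lie 3-algebra by skew-symmetrization, where
`t = 1/48`. -/
def WeakLie3Structure.skew (hV : V.IsThreeTerm) {t : k} (ht : 48 * t = 1)
    (g : WeakLie3Structure V) : LInftyStructure V where
  toOperadHom := lieKLift ⊤ V.endOperad_isOperad
    (skewFamily V.endOperad (fun a => g.toFun (lamVal k a)) t)
    (skewFamily_antisymm V.endOperad_isOperad)
  isDG := by
    intro n₀ p₀ q₀ h₀ x₀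
    refine lieK_hom_isDG ⊤ V.endOperad_hasDerivation _ (fun n q r h hr h2 _ => ?_) h₀ x₀
    have hc := jacobiator_congr (P := V.endOperad) n hr fun m q hm _ hq =>
      lieKLift_kGenEl ⊤ V.endOperad_isOperad (skewFamily_antisymm (t := t)
        (val := fun a => g.toFun (lamVal k a)) V.endOperad_isOperad) hm le_top hq
    rw [hc, lieKLift_kGenEl ⊤ V.endOperad_isOperad _ h2 le_top (by omega)]
    -- Below five the identities hold in every model. At five, l_5 = 0 for reasons of degree and J_5
    -- = 0 by the explicit boundary. Above five, both sides have degree n - 3 ≥ 3.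
    rcases lt_trichotomy n 5 with hn | rfl | hn
    · exact d_skewFamily V.endOperad_hasDerivation g.isModel (by decide) ht h hr h2 (by omega)
    · obtain rfl : r = 2 := by omega
      rw [jacobiator_skewFamily_five hV ht g.isModel, neg_zero,
        V.endOperad_eq_zero hV (by omega) (skewFamily _ _ t 5 q), map_zero]
    · rw [V.endOperad_eq_zero hV (by omega) (V.endOperad.d h _),
        V.endOperad_eq_zero hV (by omega) (jacobiator _ _ n hr), neg_zero]

theorem WeakLie3Structure.skew_kGenEl (hV : V.IsThreeTerm) {t : k} (ht : 48 * t = 1)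
    (g : WeakLie3Structure V) {n : ℕ} {q : ℤ} (h2 : 2 ≤ n) (hq : q + 2 = n) :
    (g.skew hV ht).toFun (kGenEl k ⊤ n q) =
      skewFamily V.endOperad (fun a => g.toFun (lamVal k a)) t n q :=
  lieKLift_kGenEl ⊤ V.endOperad_isOperad (skewFamily_antisymm V.endOperad_isOperad) h2 le_top hq

theorem WeakLie3Structure.skew_cobarMap (hV : V.IsThreeTerm) {t : k} (ht : 48 * t = 1)
    (g : WeakLie3Structure V) {n : ℕ} {p : ℤ} (x : (cobar (lieK k 4)).carrier n p) :
    (g.skew hV ht).toFun ((cobarMap (C := lieK k 4) (C' := lieK k ⊤) (lieKIncl k 4)).toFun x) =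
      g.toFun ((skewHom ht).toFun x) := by
  refine lieK_hom_ext 4 (f := OperadHom.trans (cobarMap (lieKIncl k 4)) (g.skew hV ht).toOperadHom)
    (g := (skewHom ht).toOperadHom.trans g.toOperadHom) (fun n q h2 h4 hq => ?_) x
  change (g.skew hV ht).toFun ((cobarMap (lieKIncl k 4)).toFun (kGenEl k 4 n q)) =
    g.toFun ((skewHom ht).toFun (kGenEl k 4 n q))
  rw [skewHom_kGenEl ht h2 (le_four_of_cast h4) hq, map_skewFamily]
  exact (congrArg (g.skew hV ht).toFun (cobarMap_lieKIncl_kGenEl 4 h2 h4 hq)).trans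
    (g.skew_kGenEl hV ht h2 hq)

/-- In arity at least five the structure maps have degree at least three and vanish, so three values
determine everything. -/
theorem LInftyStructure.ext_of_isThreeTerm (hV : V.IsThreeTerm) {f g : LInftyStructure V}
    (h2 : f.toFun (kGenEl k ⊤ 2 0) = g.toFun (kGenEl k ⊤ 2 0))
    (h3 : f.toFun (kGenEl k ⊤ 3 1) = g.toFun (kGenEl k ⊤ 3 1))
    (h4 : f.toFun (kGenEl k ⊤ 4 2) = g.toFun (kGenEl k ⊤ 4 2)) : f = g := by
  refine DGOperadHom.ext fun x => lieK_hom_ext ⊤ (fun n q hn _ hq => ?_) x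
  by_cases h5 : 5 ≤ n
  · rw [V.endOperad_eq_zero hV (by omega) (f.toFun _), V.endOperad_eq_zero hV (by omega) (g.toFun _)]
  · interval_cases n
    · obtain rfl : q = 0 := by omega
      exact h2
    · obtain rfl : q = 1 := by omega
      exact h3
    · obtain rfl : q = 2 := by omega
      exact h4

end WeakLie3

end WeakLie

end

theorem mainTheorem2 {k : Type u} [CommRing k] (h2 : IsUnit (2 : k)) (h3 : IsUnit (3 : k)) :
    IsDGOperad (cobar (lieD k)) ∧ IsDGOperad (cobar (lieK k 4)) ∧
    (cobarMap (C := lieD k) (C' := lieK k ⊤) (psi k ⊤)).IsDG ∧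
    ∃ Φ : DGOperadHom (cobar (lieK k 4)) (cobar (lieD k)),
      (∀ {n : ℕ} {p : ℤ} (x : (cobar (lieK k 4)).carrier n p),
        (cobarMap (C := lieD k) (C' := lieK k 4) (psi k 4)).toFun (Φ.toFun x) = x) ∧
      (∀ {n : ℕ} {p : ℤ} (x : (cobar (lieK k 4)).carrier n p),
        (cobarMap (C := lieD k) (C' := lieK k ⊤) (psi k ⊤)).toFun (Φ.toFun x) =
          (cobarMap (C := lieK k 4) (C' := lieK k ⊤) (lieKIncl k 4)).toFun x) ∧
      Φ.toFun (kGenEl k 4 2 0) = skew2 (cobar (lieD k)) (dGenEl k .l2) ∧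
      Φ.toFun (kGenEl k 4 3 1) =
        skew3 (cobar (lieD k)) (dGenEl k .l2) (dGenEl k .l2_1) (dGenEl k .l3) ∧
      Φ.toFun (kGenEl k 4 4 2) =
        skew4 (cobar (lieD k)) (dGenEl k .l2) (dGenEl k .l2_1) (dGenEl k .l3)
          (dGenEl k .l3_1) (dGenEl k .l3_2) (dGenEl k .l4) ∧
      ∀ V : DGMod.{u, w} k, V.IsThreeTerm → ∀ g : WeakLie3Structure V,
        ∃! h : LInftyStructure V,
          (∀ {n : ℕ} {p : ℤ} (x : (cobar (lieK k 4)).carrier n p),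
            h.toFun ((cobarMap (C := lieK k 4) (C' := lieK k ⊤) (lieKIncl k 4)).toFun x) =
              g.toFun (Φ.toFun x)) ∧
          h.toFun (kGenEl k ⊤ 2 0) = skew2 V.endOperad (g.toFun (dGenEl k .l2)) ∧
          h.toFun (kGenEl k ⊤ 3 1) =
            skew3 V.endOperad (g.toFun (dGenEl k .l2)) (g.toFun (dGenEl k .l2_1))
              (g.toFun (dGenEl k .l3)) ∧
          h.toFun (kGenEl k ⊤ 4 2) =
            skew4 V.endOperad (g.toFun (dGenEl k .l2)) (g.toFun (dGenEl k .l2_1))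
              (g.toFun (dGenEl k .l3)) (g.toFun (dGenEl k .l3_1)) (g.toFun (dGenEl k .l3_2))
              (g.toFun (dGenEl k .l4)) := by
  -- An inverse of 48 = 2^4 · 3.
  obtain ⟨t, ht'⟩ := isUnit_iff_exists_inv.1 ((h2.pow 4).mul h3)
  have ht : 48 * t = 1 := by linear_combination ht'
  have H := (cobar_hasDerivation (lieD k)).toIsOperad
  refine ⟨cobar_lieD_isDGOperad k, cobar_lieK_four_isDGOperad, cobarMap_psi_isDG, skewHom ht,
    fun x => cobarMap_psi_four_skewHom ht x, fun x => cobarMap_psi_top_skewHom ht x, ?_, ?_, ?_,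
    fun V hV g => ?_⟩
  · exact (skewHom_kGenEl ht le_rfl (by decide) rfl).trans
      (skew2_eq (val := lamVal k) H ht rfl).symm
  · exact (skewHom_kGenEl ht (by decide) (by decide) rfl).trans
      (skew3_eq (val := lamVal k) H ht rfl rfl rfl).symm
  · exact (skewHom_kGenEl ht (by decide) le_rfl rfl).trans
      (skew4_eq (val := lamVal k) H ht rfl rfl rfl rfl rfl rfl).symm
  · have E := V.endOperad_isOperad
    have e2 := (g.skew_kGenEl hV ht (n := 2) (q := 0) (by decide) rfl).trans
      (skew2_eq (val := fun a => g.toFun (lamVal k a)) E ht (l2 := g.toFun (dGenEl k .l2)) rfl).symm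
    have e3 := (g.skew_kGenEl hV ht (n := 3) (q := 1) (by decide) rfl).trans
      (skew3_eq (val := fun a => g.toFun (lamVal k a)) E ht (l2 := g.toFun (dGenEl k .l2))
        (l2_1 := g.toFun (dGenEl k .l2_1)) (l3 := g.toFun (dGenEl k .l3)) rfl rfl rfl).symm
    have e4 := (g.skew_kGenEl hV ht (n := 4) (q := 2) (by decide) rfl).trans
      (skew4_eq (val := fun a => g.toFun (lamVal k a)) E ht (l2 := g.toFun (dGenEl k .l2))
        (l2_1 := g.toFun (dGenEl k .l2_1)) (l3 := g.toFun (dGenEl k .l3))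
        (l3_1 := g.toFun (dGenEl k .l3_1)) (l3_2 := g.toFun (dGenEl k .l3_2))
        (l4 := g.toFun (dGenEl k .l4)) rfl rfl rfl rfl rfl rfl).symm
    refine ⟨g.skew hV ht, ⟨fun x => g.skew_cobarMap hV ht x, e2, e3, e4⟩, ?_⟩
    -- Uniqueness follows already from the formulas for l_2, l_3 and l_4.
    rintro h ⟨-, h2', h3', h4'⟩
    exact LInftyStructure.ext_of_isThreeTerm hV (h2'.trans e2.symm) (h3'.trans e3.symm)
      (h4'.trans e4.symm)
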